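/- **Setting.** Let $X$ be a connected non-compact smooth Riemannian manifold with Riemannian volume $\nu$. Let $M$ be a connected smooth manifold on which a Lie group $G$ (second countable) acts smoothly and transitively, $(g,m)\mapsto gm$. Let $\mathfrak g=T_eG$, with a fixed Euclidean norm. Let $\lambda\neq 0$ be a locally finite measure on $M$, quasi-invariant under $G$, with densities $p(g,m)=\frac{d(g^*\lambda)}{d\lambda}(m)$, where $g^*\lambda$ is the image of $\lambda$ under $g$, and with $p$ continuously differentiable on $G\times M$. Let $q:X\times M\to\mathbb R$ be measurable with $q>0$ $\nu\otimes\lambda$-a.e., and let $\sigma(dx,dm)=q(x,m)\,\nu(dx)\lambda(dm)$ with $\sigma(K\times M)<\infty$ for all compact $K\subset X$. Let $\pi$ be the marked Poisson measure with Lévy measure $\sigma$ on the space $\Omega$ of marked configurations, i.e. of the sets $\omega\subset X\times M$ whose points have pairwise distinct and locally finite projections to $X$: its restriction to each relatively compact open $\Lambda\subset X$ is $e^{-\sigma(\Lambda\times M)}\sum_n\frac1{n!}\sigma^{\otimes n}$ on unordered $n$-tuples of points of $\Lambda\times M$. Write $\langle f,\omega\rangle=\sum_{z\in\omega}f(z)$.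 Let $\mathfrak a=V_0(X)\times C_0^\infty(X;\mathfrak g)$ be the set of pairs of a smooth compactly supported vector field on $X$ and a smooth compactly supported $\mathfrak g$-valued function on $X$. For $(v,u)\in\mathfrak a$ let $\psi_t^v$ be the flow of $v$, and let $a_t(x,m)=(\psi^v_t(x),\exp(tu(\psi^v_t(x)))\,m)$. Put $\nabla_{(v,u)}\varphi(z)=\frac{d}{dt}\varphi(a_t z)|_{t=0}$ for functions $\varphi$ on $X\times M$ and $(\nabla^\Omega_{(v,u)}F)(\omega)=\frac{d}{dt}F(a_t\omega)|_{t=0}$ for functions $F$ on $\Omega$. Let $\mathfrak D$ be the set of smooth $\varphi:X\times M\to\mathbb R$ supported in $K\times M$ for some compact $K\subset X$ and bounded together with all iterated derivatives $\nabla_{a_1}\cdots\nabla_{a_n}\varphi$, $a_j\in\mathfrak a$. A cylinder function is $F(\omega)=g(\langle\varphi_1,\omega\rangle,\dots,\langle\varphi_N,\omega\rangle)$ with $\varphi_j\in\mathfrak D$ and $g:\mathbb R^N\to\mathbb C$ smooth and bounded with all its derivatives; $\mathcal F$ is the set of these. For functions on $X\times M$ let $\nabla^X$ be the gradient in $x$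 and let $\widetilde\nabla^M\varphi(x,m)$ be the differential of $g\mapsto\varphi(x,gm)$ at $g=e$. Assume that $\sqrt q$ lies in the local Sobolev space: over each $K\times M$, $K\subset X$ compact, it coincides, together with its gradient, with an element of the closure of $\{\varphi\in\mathfrak D:\|\varphi\|_{1,2}<\infty\}$ for $\|\varphi\|_{1,2}^2=\int(|\nabla^X\varphi|^2+|\widetilde\nabla^M\varphi|^2+|\varphi|^2)\,d\nu\,d\lambda$. Assume also that $\int_{K\times M}|\nabla^Gp(e,m)|\,d\sigma<\infty$ for all compact $K\subset X$. With $\nabla q/q:=2\nabla\sqrt q/\sqrt q$ put $$\beta_{(v,u)}=\Big\langle\tfrac{\nabla^Xq}{q},v\Big\rangle+\operatorname{div}v+\Big\langle\tfrac{\widetilde\nabla^Mq}{q},u\Big\rangle-\langle\nabla^Gp(e,\cdot),u\rangle,\qquad B_{(v,u)}(\omega)=\langle\beta_{(v,u)},\omega\rangle,$$ $$R(v,u)=\tfrac1i\nabla^\Omega_{(v,u)}+\tfrac1{2i}B_{(v,u)},\qquad J(v)=R(v,0),\qquad I(u)=R(0,u).$$ Let $[(v_1,u_1),(v_2,u_2)]=([v_1,v_2],\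 \nabla_{v_1}u_2-\nabla_{v_2}u_1+[u_1,u_2])$, where $[v_1,v_2]$ is the bracket of vector fields, $\nabla_vu$ is the derivative of $u$ in the direction $v$, and $[u_1,u_2](x)=[u_1(x),u_2(x)]$ with the bracket of $\mathfrak g$ given by right-invariant vector fields on $G$. **Proposition.** 1. With this bracket $\mathfrak a$ is a real Lie algebra, and $\nabla_{[a,b]}=\nabla_a\nabla_b-\nabla_b\nabla_a$ on $\mathfrak D$ for $a,b\in\mathfrak a$. 2. For $a\in\mathfrak a$ and $F\in\mathcal F$ the derivative $\nabla_a^\Omega F$ exists at every $\omega$, $R(a)F\in L^1(\pi)$, $R(a)$ is symmetric on $\mathcal F$ (that is, $\int R(a)F\,\overline{F'}\,d\pi=\int F\,\overline{R(a)F'}\,d\pi$ for $F,F'\in\mathcal F$, with integrable integrands), and $R(a)F$ is linear in $a$. 3. On $\mathcal F$, for all $a,b\in\mathfrak a$, $v,v_1,v_2\in V_0(X)$, $u,u_1,u_2\in C_0^\infty(X;\mathfrak g)$, $$[R(a),R(b)]=-i\,R([a,b]),$$ $$[J(v_1),J(v_2)]=-iJ([v_1,v_2]),\qquad [I(u_1),I(u_2)]=-iI([u_1,u_2]),\qquad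 [J(v),I(u)]=-iI(\nabla_vu).$$ Thus $a\mapsto iR(a)$ is a representation of the Lie algebra $\mathfrak a$. Here $[A_1,A_2]=C$ on $\mathcal F$, for symmetric $A_1,A_2$, means the following. For all $F,F'\in\mathcal F$, $$\int\big(A_2F\,\overline{A_1F'}-A_1F\,\overline{A_2F'}\big)\,d\pi=\int CF\,\overline{F'}\,d\pi,$$ with integrable integrands on both sides. Moreover, whenever $A_1(A_2F)$ and $A_2(A_1F)$ exist in the weak sense, their difference equals $CF$ $\pi$-a.e.; here $\Psi=A\Phi$ in the weak sense means that, for all $F'\in\mathcal F$, $\Psi\overline{F'}$ and $\Phi\,\overline{AF'}$ are $\pi$-integrable and $\int\Psi\overline{F'}\,d\pi=\int\Phi\,\overline{AF'}\,d\pi$. 4. If $q>0$ everywhere, $q$ and $p$ are of class $C^2$, and $\beta$ is formed with the classical gradient of $\sqrt q$, then for all $a,b\in\mathfrak a$ and $F\in\mathcal F$ the derivatives in $R(a)R(b)F$ and $R(b)R(a)F$ exist, and $R(a)R(b)F-R(b)R(a)F=-i\,R([a,b])F$ at every $\omega\in\Omega$. -/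

import Mathlib

open scoped Manifold ContDiff Bundle ENNReal Topology ComplexConjugate
open MeasureTheory Set Bundle

noncomputable section

namespace MarkedPoisson

/-- The model space `ℝⁿ` with its Euclidean norm. -/
abbrev Eu (n : ℕ) := EuclideanSpace ℝ (Fin n)

section Manifold

variable {d : ℕ} {X : Type*} [TopologicalSpace X] [ChartedSpace (Eu d) X]

/-! ### Riemannian volume and divergence -/

/-- `∂ᵢ` at the point of `X` with coordinates `y` in the chart around `x₀`. -/
def coordVec (x₀ : X) (y : Eu d) (i : Fin d) :
    TangentSpace (𝓡 d) ((chartAt (Eu d) x₀).symm y) :=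
  mfderiv (𝓡 d) (𝓡 d) (chartAt (Eu d) x₀).symm y (EuclideanSpace.single i (1 : ℝ) : Eu d)

variable [RiemannianBundle (fun x : X => TangentSpace (𝓡 d) x)]

/-- `√(det gᵢⱼ)` at the coordinates `y` in the chart around `x₀`. -/
def volDensity (x₀ : X) (y : Eu d) : ℝ :=
  Real.sqrt (Matrix.det (Matrix.of fun i j : Fin d =>
    inner ℝ (coordVec x₀ y i) (coordVec x₀ y j)))

/-- The measure `√(det gᵢⱼ) dy` of the chart around `x₀`, transported to `X`. -/
def chartVol [MeasurableSpace X] (x₀ : X) : Measure X :=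
  ((volume.restrict (chartAt (Eu d) x₀).target).withDensity
    (fun y => ENNReal.ofReal (volDensity x₀ y))).map (chartAt (Eu d) x₀).symm

/-- The volume of a set that lies in the domain of one chart, and `∞` for any other set. -/
def preVol [MeasurableSpace X] (t : Set X) : ℝ≥0∞ :=
  ⨅ (x₀ : X) (_ : t ⊆ (chartAt (Eu d) x₀).source), chartVol (d := d) x₀ t

theorem le_caratheodory_preVol [MeasurableSpace X] :
    ‹MeasurableSpace X› ≤
      (OuterMeasure.boundedBy (preVol (d := d) (X := X))).caratheodory := by
  intro s hs
  refine OuterMeasure.boundedBy_caratheodory fun t => ?_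
  refine le_iInf₂ fun x₀ hx₀ => ?_
  rw [← measure_inter_add_sdiff t hs]
  exact add_le_add (iInf₂_le x₀ (inter_subset_left.trans hx₀))
    (iInf₂_le x₀ (sdiff_subset.trans hx₀))

/-- The Riemannian volume: the measure that is `√(det gᵢⱼ) dy` in every chart. -/
def riemannianVolume (d : ℕ) (X : Type*) [TopologicalSpace X] [ChartedSpace (Eu d) X]
    [RiemannianBundle (fun x : X => TangentSpace (𝓡 d) x)] [MeasurableSpace X] : Measure X :=
  (OuterMeasure.boundedBy (preVol (d := d) (X := X))).toMeasure le_caratheodory_preVol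

/-- The divergence with respect to the Riemannian volume, in the chart around `x`:
`div v = (1/√g) ∑ᵢ ∂ᵢ(√g vⁱ)`. -/
def divergence (v : (x : X) → TangentSpace (𝓡 d) x) (x : X) : ℝ :=
  (∑ i : Fin d, fderiv ℝ (fun y : Eu d => volDensity x y *
      (show Eu d from mfderiv (𝓡 d) (𝓡 d) (chartAt (Eu d) x) ((chartAt (Eu d) x).symm y)
        (v ((chartAt (Eu d) x).symm y))) i)
      (chartAt (Eu d) x x) (EuclideanSpace.single i (1 : ℝ))) /
    volDensity x (chartAt (Eu d) x x)

end Manifold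

section Flows

variable {d l : ℕ} {X : Type*} [TopologicalSpace X] [ChartedSpace (Eu d) X]
  {G : Type*} [TopologicalSpace G] [ChartedSpace (Eu l) G] [Group G]

open Classical in
/-- The flow `ψₜᵛ(x)` of a vector field; the global integral curve through `x` exists and is unique
when `v` is smooth with compact support. -/
def flow (v : (x : X) → TangentSpace (𝓡 d) x) (t : ℝ) (x : X) : X :=
  if h : ∃ γ : ℝ → X, γ 0 = x ∧ IsMIntegralCurve γ v then h.choose t else x

open Classical in
/-- The exponential map of the Lie group `G`: the value at time `1` of the one-parameter subgroup
with initial velocity `w`. It always exists. -/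
def lieExp (w : GroupLieAlgebra (𝓡 l) G) : G :=
  if h : ∃ γ : ℝ → G, γ 0 = 1 ∧ IsMIntegralCurve γ (mulInvariantVectorField w)
  then h.choose 1 else 1

/-- The right-invariant vector field on `G` with value `w` at the unit element. -/
def rightInvariantField (w : GroupLieAlgebra (𝓡 l) G) (g : G) : TangentSpace (𝓡 l) g :=
  mfderiv (𝓡 l) (𝓡 l) (fun h : G => h * g) 1 w

/-- The bracket of `𝔤 = T_e G` given by right-invariant vector fields. -/
def rightBracket (w₁ w₂ : GroupLieAlgebra (𝓡 l) G) : GroupLieAlgebra (𝓡 l) G :=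
  VectorField.mlieBracket (𝓡 l) (rightInvariantField w₁) (rightInvariantField w₂) (1 : G)

/-! ### The Lie algebra `𝔞 = V₀(X) × C₀^∞(X; 𝔤)` -/

/-- Pairs of a vector field on `X` and a `𝔤`-valued function on `X`. -/
abbrev FieldPair (d l : ℕ) (X G : Type*) [TopologicalSpace X] [ChartedSpace (Eu d) X]
    [TopologicalSpace G] [ChartedSpace (Eu l) G] [Group G] :=
  ((x : X) → TangentSpace (𝓡 d) x) × (X → GroupLieAlgebra (𝓡 l) G)

/-- `(v, u) ∈ 𝔞`: both components are smooth and have compact support. -/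
structure IsCurrent [IsManifold (𝓡 d) ∞ X] (a : FieldPair d l X G) : Prop where
  smooth_fst : ContMDiff (𝓡 d) (𝓡 d).tangent ∞
    (fun x => (⟨x, a.1 x⟩ : TangentBundle (𝓡 d) X))
  compact_fst : IsCompact (closure {x | a.1 x ≠ 0})
  smooth_snd : ContMDiff (𝓡 d) 𝓘(ℝ, Eu l) ∞ (fun x => (show Eu l from a.2 x))
  compact_snd : IsCompact (closure {x | a.2 x ≠ 0})

/-- The derivative `∇ᵥ u` of a `𝔤`-valued function `u` in the direction `v`. -/
def fieldDeriv (v : (x : X) → TangentSpace (𝓡 d) x) (u : X → GroupLieAlgebra (𝓡 l) G) :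
    X → GroupLieAlgebra (𝓡 l) G :=
  fun x => (show Eu l from
    mfderiv (𝓡 d) 𝓘(ℝ, Eu l) (fun x' => (show Eu l from u x')) x (v x))

/-- `[(v₁,u₁),(v₂,u₂)] = ([v₁,v₂], ∇_{v₁}u₂ - ∇_{v₂}u₁ + [u₁,u₂])`. -/
def bracket (a b : FieldPair d l X G) : FieldPair d l X G :=
  (VectorField.mlieBracket (𝓡 d) a.1 b.1,
    fun x => fieldDeriv a.1 b.2 x - fieldDeriv b.1 a.2 x + rightBracket (a.2 x) (b.2 x))

end Flows

section Conf

variable {d k l : ℕ} {X : Type*} [TopologicalSpace X] [ChartedSpace (Eu d) X]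
  {M : Type*} [TopologicalSpace M] [ChartedSpace (Eu k) M]
  {G : Type*} [TopologicalSpace G] [ChartedSpace (Eu l) G] [Group G] [MulAction G M]

/-! ### Marked configurations -/

/-- `ζ ⊆ X × M` is a marked configuration: distinct points of `ζ` have distinct positions, and the
set of positions is locally finite. -/
def IsConf (ζ : Set (X × M)) : Prop :=
  InjOn Prod.fst ζ ∧ ∀ K : Set X, IsCompact K → (Prod.fst '' ζ ∩ K).Finite

/-- The marked configuration space. -/
def Conf (X M : Type*) [TopologicalSpace X] : Type _ := {ζ : Set (X × M) // IsConf ζ}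

/-- The σ-algebra generated by the counting functions `ζ ↦ #(ζ ∩ B)`, where `B` runs through the
Borel sets whose projection to `X` is relatively compact. -/
instance [MeasurableSpace X] [MeasurableSpace M] : MeasurableSpace (Conf X M) :=
  MeasurableSpace.generateFrom {S | ∃ (B : Set (X × M)) (n : ℕ), MeasurableSet B ∧
    (∃ K : Set X, IsCompact K ∧ B ⊆ K ×ˢ univ) ∧ S = {ζ : Conf X M | (ζ.1 ∩ B).ncard = n}}

/-- `⟨f, ζ⟩ = ∑_{(x,m) ∈ ζ} f(x,m)`. -/
def pairing (f : X × M → ℝ) (ζ : Conf X M) : ℝ := ∑ᶠ z ∈ ζ.1, f z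

open Classical in
/-- The image of a configuration under a map of `X × M`. The second alternative never occurs for
the transformations `(ψₜᵛ, ηₜᵘ)` with `(v,u) ∈ 𝔞`. -/
def Conf.image (f : X × M → X × M) (ζ : Conf X M) : Conf X M :=
  if h : IsConf (f '' ζ.1) then ⟨f '' ζ.1, h⟩ else ζ

/-- The restriction `ζ ∩ (Λ × M)`. -/
def Conf.restrict (Λ : Set X) (ζ : Conf X M) : Conf X M :=
  ⟨ζ.1 ∩ Λ ×ˢ univ, ζ.2.1.mono inter_subset_left, fun K hK =>
    (ζ.2.2 K hK).subset (inter_subset_inter_left _ (image_mono inter_subset_left))⟩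

open Classical in
/-- `(z₁,…,zₙ) ↦ {z₁,…,zₙ}` for marked points with pairwise distinct positions; the other tuples,
which form a null set, are sent to the empty configuration. -/
def Conf.ofTuple {n : ℕ} (z : Fin n → X × M) : Conf X M :=
  if h : Function.Injective (fun i => (z i).1) then
    ⟨range z, by
      refine ⟨?_, fun K _ => ((finite_range z).image _).inter_of_left K⟩
      rintro _ ⟨i, rfl⟩ _ ⟨j, rfl⟩ hij
      exact congrArg z (h hij)⟩
  else ⟨∅, by simp [IsConf]⟩

/-- `P` is the marked Poisson measure with Lévy measure `σ`: the probability measure whose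
restriction to every relatively compact open `Λ ⊆ X` is
`e^{-σ(Λ×M)} ∑ₙ (1/n!) σ^{⊗n}` on unordered `n`-tuples of points of `Λ × M`. -/
def IsMarkedPoisson [MeasurableSpace X] [MeasurableSpace M] (σ : Measure (X × M))
    (P : Measure (Conf X M)) : Prop :=
  IsProbabilityMeasure P ∧
  ∀ Λ : Set X, IsOpen Λ → IsCompact (closure Λ) →
    P.map (Conf.restrict Λ) =
      ENNReal.ofReal (Real.exp (-(σ (Λ ×ˢ univ)).toReal)) •
        Measure.sum (fun n : ℕ => ((n.factorial : ℝ≥0∞)⁻¹) •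
          (Measure.pi (fun _ : Fin n => σ.restrict (Λ ×ˢ univ))).map Conf.ofTuple)

/-! ### Directional derivatives -/

/-- The transformation `(x, m) ↦ (ψₜᵛ(x), ηₜᵘ(ψₜᵛ(x)) m)` of `X × M`, where
`ηₜᵘ(x) = exp(t u(x))`. -/
def currentMap (a : FieldPair d l X G) (t : ℝ) (z : X × M) : X × M :=
  (flow a.1 t z.1, lieExp (t • a.2 (flow a.1 t z.1)) • z.2)

/-- The directional derivative `∇_{(v,u)}` of a function on `X × M`. -/
def pointDeriv (a : FieldPair d l X G) (φ : X × M → ℝ) (z : X × M) : ℝ :=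
  deriv (fun t : ℝ => φ (currentMap a t z)) 0

/-- The directional derivative `∇^Ω_{(v,u)}` of a function on the marked configuration space. -/
def confDeriv (a : FieldPair d l X G) (F : Conf X M → ℂ) (ζ : Conf X M) : ℂ :=
  deriv (fun t : ℝ => F (ζ.image (currentMap a t))) 0

/-- The class `𝔇`: smooth functions on `X × M` with support in `K × M` for a compact `K ⊆ X` that
are bounded together with all their iterated directional derivatives along `𝔞`. -/
structure IsTest (d k l : ℕ) (X M G : Type*) [TopologicalSpace X] [ChartedSpace (Eu d) X]
    [TopologicalSpace M] [ChartedSpace (Eu k) M]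
    [TopologicalSpace G] [ChartedSpace (Eu l) G] [Group G] [MulAction G M]
    [IsManifold (𝓡 d) ∞ X] (φ : X × M → ℝ) : Prop where
  smooth : ContMDiff ((𝓡 d).prod (𝓡 k)) 𝓘(ℝ, ℝ) ∞ φ
  support : ∃ K : Set X, IsCompact K ∧ ∀ z, φ z ≠ 0 → z.1 ∈ K
  bounded : ∀ L : List (FieldPair d l X G), (∀ a ∈ L, IsCurrent a) →
    ∃ C : ℝ, ∀ z, |L.foldr pointDeriv φ z| ≤ C

/-- Smooth cylinder functions `F(ζ) = g(⟨φ₁,ζ⟩,…,⟨φ_N,ζ⟩)` with `φⱼ ∈ 𝔇` and `g` smooth and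
bounded with all its derivatives. They are complex-valued, since the operators below are complex. -/
def IsCylinder (d k l : ℕ) (X M G : Type*) [TopologicalSpace X] [ChartedSpace (Eu d) X]
    [TopologicalSpace M] [ChartedSpace (Eu k) M]
    [TopologicalSpace G] [ChartedSpace (Eu l) G] [Group G] [MulAction G M]
    [IsManifold (𝓡 d) ∞ X] (F : Conf X M → ℂ) : Prop :=
  ∃ (N : ℕ) (g : (Fin N → ℝ) → ℂ) (φ : Fin N → X × M → ℝ),
    ContDiff ℝ ∞ g ∧ (∀ n : ℕ, ∃ C : ℝ, ∀ r, ‖iteratedFDeriv ℝ n g r‖ ≤ C) ∧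
    (∀ j, IsTest d k l X M G (φ j)) ∧ ∀ ζ, F ζ = g (fun j => pairing (φ j) ζ)

/-! ### The local Sobolev space and the logarithmic derivative -/

/-- A (pointwise) cotangent field on `X × M` in the `X`-direction: a candidate for `∇^X f`, with
`∇^X_v f = ⟨∇^X f, v⟩`. -/
abbrev XField (d : ℕ) (X M : Type*) [TopologicalSpace X] [ChartedSpace (Eu d) X] :=
  (z : X × M) → (TangentSpace (𝓡 d) z.1 →L[ℝ] ℝ)

/-- The differential of `φ` in the variable `x`. -/
def gradX (d : ℕ) {X M : Type*} [TopologicalSpace X] [ChartedSpace (Eu d) X]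
    (φ : X × M → ℝ) : XField d X M := fun z =>
  (show TangentSpace (𝓡 d) z.1 →L[ℝ] ℝ from
    mfderiv (𝓡 d) 𝓘(ℝ, ℝ) (fun x => φ (x, z.2)) z.1)

/-- The differential at `g = e` of a function on `G`, as a functional on `𝔤`; the Euclidean norm
of the model space of `G` is the norm on `𝔤`. -/
def diffAtOne (l : ℕ) {G : Type*} [TopologicalSpace G] [ChartedSpace (Eu l) G] [Group G]
    (f : G → ℝ) : Eu l →L[ℝ] ℝ :=
  (show Eu l →L[ℝ] ℝ from mfderiv (𝓡 l) 𝓘(ℝ, ℝ) f (1 : G))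

/-- The gradient `∇̃^M φ(x,m)`: the differential of `g ↦ φ(x, g m)` at `g = e`. -/
def gradM (l : ℕ) (G : Type*) [TopologicalSpace G] [ChartedSpace (Eu l) G] [Group G] [MulAction G M]
    (φ : X × M → ℝ) : X × M → (Eu l →L[ℝ] ℝ) := fun z =>
  diffAtOne l (fun g : G => φ (z.1, g • z.2))

variable [RiemannianBundle (fun x : X => TangentSpace (𝓡 d) x)]

/-- The squared Sobolev norm `∫ |DX|² + |DM|² + |f|²` of a function with its gradient. -/
def sobolevEnergy [MeasurableSpace X] [MeasurableSpace M] (μ : Measure (X × M))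
    (f : X × M → ℝ) (DX : XField d X M) (DM : X × M → (Eu l →L[ℝ] ℝ)) : ℝ≥0∞ :=
  ∫⁻ z, (‖DX z‖ₑ ^ 2 + ‖DM z‖ₑ ^ 2 + ‖f z‖ₑ ^ 2) ∂μ

/-- `f ∈ H^{1,2}(X × M)` with `∇f = (DX, DM)`: the pair is a limit, in the Sobolev norm with respect
to `μ = ν ⊗ λ`, of functions in `𝔇` of finite Sobolev norm and their gradients. -/
def HasSobolevGrad (k : ℕ) (G : Type*) [TopologicalSpace G] [ChartedSpace (Eu l) G] [Group G]
    [MulAction G M] [ChartedSpace (Eu k) M] [IsManifold (𝓡 d) ∞ X]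
    [MeasurableSpace X] [MeasurableSpace M] (μ : Measure (X × M))
    (f : X × M → ℝ) (DX : XField d X M) (DM : X × M → (Eu l →L[ℝ] ℝ)) : Prop :=
  AEMeasurable f μ ∧
  (∀ a : FieldPair d l X G, IsCurrent a → AEMeasurable (fun z => DX z (a.1 z.1)) μ) ∧
  AEMeasurable DM μ ∧
  ∃ φ : ℕ → X × M → ℝ,
    (∀ n, IsTest d k l X M G (φ n) ∧ sobolevEnergy μ (φ n) (gradX d (φ n)) (gradM l G (φ n)) < ⊤) ∧
    Filter.Tendsto (fun n => sobolevEnergy μ (φ n - f) (fun z => gradX d (φ n) z - DX z)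
      (fun z => gradM l G (φ n) z - DM z)) Filter.atTop (𝓝 0)

/-- `f ∈ H₀^{1,2}(X × M)` (the local Sobolev space) with `∇f = (DX, DM)`: over every compact
`K ⊆ X` it coincides with an element of `H^{1,2}(X × M)`. -/
def HasLocalSobolevGrad (k : ℕ) (G : Type*) [TopologicalSpace G] [ChartedSpace (Eu l) G] [Group G]
    [MulAction G M] [ChartedSpace (Eu k) M] [IsManifold (𝓡 d) ∞ X]
    [MeasurableSpace X] [MeasurableSpace M] (μ : Measure (X × M))
    (f : X × M → ℝ) (DX : XField d X M) (DM : X × M → (Eu l →L[ℝ] ℝ)) : Prop :=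
  ∀ K : Set X, IsCompact K → ∃ f' DX' DM', HasSobolevGrad k G μ f' DX' DM' ∧
    ∀ᵐ z ∂μ, z.1 ∈ K → f z = f' z ∧ DX z = DX' z ∧ DM z = DM' z

/-- The logarithmic derivative `β_{(v,u)}` of the measure `q(x,m) ν(dx) λ(dm)`:
`⟨∇^X q / q, v⟩ + div v + ⟨∇̃^M q / q, u⟩ - ⟨∇^G p(e,·), u⟩`. Here `(DX, DM)` is the gradient of
`√q`, so that `∇q / q = 2 ∇√q / √q`, and `p(g,m)` is the density of the image of `λ` under `g`
with respect to `λ`. -/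
def logDeriv (q : X × M → ℝ) (DX : XField d X M) (DM : X × M → (Eu l →L[ℝ] ℝ))
    (p : G → M → ℝ) (a : FieldPair d l X G) (z : X × M) : ℝ :=
  2 * DX z (a.1 z.1) / Real.sqrt (q z) + divergence a.1 z.1 +
    2 * DM z (a.2 z.1) / Real.sqrt (q z) - diffAtOne l (fun g => p g z.2) (a.2 z.1)

end Conf

section Operators

variable {d k l : ℕ} {X : Type*} [TopologicalSpace X] [ChartedSpace (Eu d) X]
  {M : Type*} [TopologicalSpace M] [ChartedSpace (Eu k) M]
  {G : Type*} [TopologicalSpace G] [ChartedSpace (Eu l) G] [Group G] [MulAction G M]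

/-! ### The operators `R(v,u)` and their commutators

In this section `β` is the logarithmic derivative, as a function of `(v,u)`. -/

/-- `R(v,u) = (1/i) ∇^Ω_{(v,u)} + (1/2i) B_{(v,u)}` with `B_{(v,u)}(ζ) = ⟨β_{(v,u)}, ζ⟩`. -/
def opR (β : FieldPair d l X G → X × M → ℝ) (a : FieldPair d l X G)
    (F : Conf X M → ℂ) (ζ : Conf X M) : ℂ :=
  (1 / Complex.I) * confDeriv a F ζ + (1 / (2 * Complex.I)) * (pairing (β a) ζ : ℂ) * F ζ

/-- `J(v) = R(v,0)`. -/
def opJ (β : FieldPair d l X G → X × M → ℝ) (v : (x : X) → TangentSpace (𝓡 d) x) :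
    (Conf X M → ℂ) → Conf X M → ℂ :=
  opR β (v, 0)

/-- `I(u) = R(0,u)`. -/
def opI (β : FieldPair d l X G → X × M → ℝ) (u : X → GroupLieAlgebra (𝓡 l) G) :
    (Conf X M → ℂ) → Conf X M → ℂ :=
  opR β (0, u)

variable [IsManifold (𝓡 d) ∞ X] [MeasurableSpace X] [MeasurableSpace M]

/-- `Ψ = A Φ` in the weak sense, for an operator `A` that is symmetric on the cylinder functions:
`∫ Ψ F̄ dP = ∫ Φ (A F)‾ dP` for all cylinder functions `F`, with integrable integrands. -/
def WeakApply (d k l : ℕ) {X M : Type*} (G : Type*) [TopologicalSpace X] [ChartedSpace (Eu d) X]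
    [TopologicalSpace M] [ChartedSpace (Eu k) M]
    [TopologicalSpace G] [ChartedSpace (Eu l) G] [Group G] [MulAction G M]
    [IsManifold (𝓡 d) ∞ X] [MeasurableSpace X] [MeasurableSpace M]
    (P : Measure (Conf X M)) (A : (Conf X M → ℂ) → Conf X M → ℂ) (Φ Ψ : Conf X M → ℂ) : Prop :=
  ∀ F, IsCylinder d k l X M G F →
    Integrable (fun ζ => Ψ ζ * conj (F ζ)) P ∧ Integrable (fun ζ => Φ ζ * conj (A F ζ)) P ∧
    ∫ ζ, Ψ ζ * conj (F ζ) ∂P = ∫ ζ, Φ ζ * conj (A F ζ) ∂P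

/-- `[A₁, A₂] = C` on the cylinder functions, for symmetric operators `A₁`, `A₂`. The functions
`Aⱼ F` need not be cylinder functions, so `A₁ A₂ F` is understood through duality:
`⟨A₂ F, A₁ F'⟩ - ⟨A₁ F, A₂ F'⟩ = ⟨C F, F'⟩` for all cylinder functions `F`, `F'`; and whenever
`A₁ (A₂ F)` and `A₂ (A₁ F)` exist as functions in the weak sense, their difference is `C F`. -/
def IsCommutator (d k l : ℕ) {X M : Type*} (G : Type*) [TopologicalSpace X] [ChartedSpace (Eu d) X]
    [TopologicalSpace M] [ChartedSpace (Eu k) M]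
    [TopologicalSpace G] [ChartedSpace (Eu l) G] [Group G] [MulAction G M]
    [IsManifold (𝓡 d) ∞ X] [MeasurableSpace X] [MeasurableSpace M]
    (P : Measure (Conf X M)) (A₁ A₂ C : (Conf X M → ℂ) → Conf X M → ℂ) : Prop :=
  (∀ F F', IsCylinder d k l X M G F → IsCylinder d k l X M G F' →
    Integrable (fun ζ => A₂ F ζ * conj (A₁ F' ζ) - A₁ F ζ * conj (A₂ F' ζ)) P ∧
    Integrable (fun ζ => C F ζ * conj (F' ζ)) P ∧
    ∫ ζ, (A₂ F ζ * conj (A₁ F' ζ) - A₁ F ζ * conj (A₂ F' ζ)) ∂P =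
      ∫ ζ, C F ζ * conj (F' ζ) ∂P) ∧
  (∀ F Ψ₁₂ Ψ₂₁, IsCylinder d k l X M G F →
    WeakApply d k l G P A₁ (A₂ F) Ψ₁₂ → WeakApply d k l G P A₂ (A₁ F) Ψ₂₁ →
    (fun ζ => Ψ₁₂ ζ - Ψ₂₁ ζ) =ᵐ[P] C F)

/-- `[R(a₁), R(a₂)] = C` on the cylinder functions in the pointwise sense: for every cylinder
function `F` and every configuration the directional derivatives in `R(a₁) R(a₂) F` and
`R(a₂) R(a₁) F` exist, and the difference is `C F`. -/
def IsPointwiseCommutator (β : FieldPair d l X G → X × M → ℝ) (a₁ a₂ : FieldPair d l X G)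
    (C : (Conf X M → ℂ) → Conf X M → ℂ) : Prop :=
  ∀ F, IsCylinder d k l X M G F → ∀ ζ : Conf X M,
    DifferentiableAt ℝ (fun t : ℝ => opR β a₂ F (ζ.image (currentMap a₁ t))) 0 ∧
    DifferentiableAt ℝ (fun t : ℝ => opR β a₁ F (ζ.image (currentMap a₂ t))) 0 ∧
    opR β a₁ (opR β a₂ F) ζ - opR β a₂ (opR β a₁ F) ζ = C F ζ

end Operators

end MarkedPoisson

end

set_option linter.unusedSectionVars false

open scoped Manifold ContDiff Bundle ENNReal Topology ComplexConjugate
open MeasureTheory Set Bundle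

noncomputable section

namespace MarkedPoisson

/-! ### Lower smoothness classes of the manifolds -/

section Regularity

variable {d l : ℕ} {X : Type*} [TopologicalSpace X] [ChartedSpace (Eu d) X] [IsManifold (𝓡 d) ∞ X]
  {G : Type*} [TopologicalSpace G] [ChartedSpace (Eu l) G] [Group G] [LieGroup (𝓡 l) ∞ G]

/-! Everything rests on one integration by parts: if `H` is a smooth function of finitely many
pairings `⟨φⱼ, ω⟩` with `φⱼ ∈ 𝔇`, of polynomial growth with all derivatives, then `∫ (∇^Ω_a H + B_a
H) dπ = 0` (`LevyDensity.integral_confDeriv_add`). For `H = F F̄'` this is the symmetry of `R(a)`.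

For the commutator, `B_b` need not be differentiable, so `R(a) R(b) F` is never formed. Instead,
`∇^Ω` respects the bracket of `𝔞` on these functions (`IsTemperateCylinder.confDeriv_bracket`), and
`⟨R(b)F, R(a)F'⟩ - ⟨R(a)F, R(b)F'⟩ + i ⟨R([a,b])F, F'⟩` is half the sum of three vanishing integrals
of the above type: along `a` with `H = ∇_bF F̄' - F ∇_bF̄'`, along `b` with `H = F ∇_aF̄' - ∇_aF
F̄'`, and along `[a,b]` with `H = F F̄'` (`LevyDensity.form_commutator`). The products `B_a B_b`
cancel, so `B_a` is only ever multiplied by functions of polynomial growth. The statement about weak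
applications follows because cylinder functions determine integrable functions
(`ae_eq_zero_of_integral_cylinder`).

The integration by parts is first proved for one point of `X × M`
(`LevyDensity.integral_pointDeriv_add`). In the position it is the divergence theorem; in the mark
it comes from differentiating `∫ h(exp(tw)m) dλ = ∫ h p(exp(tw),·) dλ` at `t = 0`. Functions in `𝔇`
are not compactly supported in the mark, so cutoffs are inserted whose derivatives along `G` are
bounded and tend to `0` (`exists_mark_cutoffs`). The density enters as the square of `√q`: the
identity for `f φₙ²` with `φₙ ∈ 𝔇` passes to the limit `φₙ → √q` in the local Sobolev space
(`LevyDensity.integral_cutoff`). On `Ω`, the restriction of `π` to a window `Λ × M` is a series over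
`n`-tuples; the product rule and Fubini reduce the `n`-point integral to the one-point identity in
each variable (`LevyDensity.integral_pi_eq_zero`), and the weights `1/n!` absorb polynomial growth
in the number of points.

The bracket identity on `X × M` (`grad_bracket`) holds because the mixed second derivatives cancel:
the `X`-directions leave the bracket of vector fields, the dependence of `u` on `x` leaves the terms
`∇_v u`, and along the orbit map `g ↦ f(x, gm)` the action is differentiated by right-invariant
fields, which leaves the bracket of `𝔤`.

For regular densities the pointwise relation amounts to the cocycle identity `β_[a,b] = ∇_a β_b -
∇_b β_a`. Tested against smooth functions it is a combination of five one-point integrations by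
parts; both sides are continuous and `σ` charges open sets, so it holds everywhere
(`LevyDensity.logDeriv_bracket`). -/

theorem isManifold_one_of_infty : IsManifold (𝓡 d) 1 X :=
  IsManifold.of_le (n := ∞) (by norm_cast)

theorem isManifold_two_of_infty : IsManifold (𝓡 d) 2 X :=
  IsManifold.of_le (n := ∞) (by norm_cast)

theorem isManifold_three_of_infty : IsManifold (𝓡 d) 3 X :=
  IsManifold.of_le (n := ∞) (by norm_cast)

theorem isManifold_minSmoothness_two : IsManifold (𝓡 d) (minSmoothness ℝ 2) X := by
  simpa only [minSmoothness_of_isRCLikeNormedField] using isManifold_two_of_infty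

theorem isManifold_minSmoothness_three : IsManifold (𝓡 d) (minSmoothness ℝ 3) X := by
  simp only [minSmoothness_of_isRCLikeNormedField]; exact isManifold_three_of_infty

theorem lieGroup_minSmoothness_three : LieGroup (𝓡 l) (minSmoothness ℝ 3) G :=
  LieGroup.of_le (n := ∞) (by simp; norm_cast)

end Regularity

attribute [local instance] isManifold_one_of_infty isManifold_two_of_infty isManifold_three_of_infty
  isManifold_minSmoothness_two isManifold_minSmoothness_three
  lieGroup_minSmoothness_three

/-! ### Differentials, vector fields and brackets in charts -/

section ChartCalculus

theorem hasDerivAt_of_hasFDerivAt_comp_smulRight {E F : Type*} [NormedAddCommGroup E]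
    [NormedSpace ℝ E] [NormedAddCommGroup F] [NormedSpace ℝ F] {f : ℝ → F} {L : E →L[ℝ] F} {ξ : E}
    {t : ℝ} (h : HasFDerivAt f (L.comp ((1 : ℝ →L[ℝ] ℝ).smulRight ξ)) t) :
    HasDerivAt f (L ξ) t := by
  simpa using h.hasDerivAt

theorem smulRight_one_apply_eq_comp_smulRight {E F : Type*} [NormedAddCommGroup E]
    [NormedSpace ℝ E] [NormedAddCommGroup F] [NormedSpace ℝ F] (L : E →L[ℝ] F) (η : E) :
    (1 : ℝ →L[ℝ] ℝ).smulRight (L η) = L.comp ((1 : ℝ →L[ℝ] ℝ).smulRight η) := by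
  ext1; simp

theorem smulRight_one_apply_eq_comp_toSpanSingleton {E F : Type*} [NormedAddCommGroup E]
    [NormedSpace ℝ E] [NormedAddCommGroup F] [NormedSpace ℝ F] (L : E →L[ℝ] F) (η : E) :
    (1 : ℝ →L[ℝ] ℝ).smulRight (L η) = L.comp (ContinuousLinearMap.toSpanSingleton ℝ η) := by
  ext1; simp

variable {d : ℕ} {X : Type*} [TopologicalSpace X] [ChartedSpace (Eu d) X]

/-- The differential of a function with values in a normed space, as a linear map on the model
space. -/
def diffAt {F : Type*} [NormedAddCommGroup F] [NormedSpace ℝ F] (f : X → F) (x : X) :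
    Eu d →L[ℝ] F :=
  mfderiv (𝓡 d) 𝓘(ℝ, F) f x

/-- The coordinate expression of a vector field in the chart around `x₀`. -/
def chartField (x₀ : X) (v : (x : X) → TangentSpace (𝓡 d) x) (y : Eu d) : Eu d :=
  mfderiv (𝓡 d) (𝓡 d) (chartAt (Eu d) x₀) ((chartAt (Eu d) x₀).symm y)
    (v ((chartAt (Eu d) x₀).symm y))

variable [IsManifold (𝓡 d) ∞ X]

theorem contMDiffAt_chartAt_of_mem {x₀ x : X} (hx : x ∈ (chartAt (Eu d) x₀).source) :
    ContMDiffAt (𝓡 d) (𝓡 d) ∞ (chartAt (Eu d) x₀) x :=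
  (contMDiffOn_chart (I := 𝓡 d) (x := x₀)).contMDiffAt
    ((chartAt (Eu d) x₀).open_source.mem_nhds hx)

theorem contMDiffAt_chartAt_symm_of_mem {x₀ : X} {y : Eu d}
    (hy : y ∈ (chartAt (Eu d) x₀).target) :
    ContMDiffAt (𝓡 d) (𝓡 d) ∞ (chartAt (Eu d) x₀).symm y :=
  (contMDiffOn_chart_symm (I := 𝓡 d) (x := x₀)).contMDiffAt
    ((chartAt (Eu d) x₀).open_target.mem_nhds hy)

theorem mdifferentiableAt_chartAt {x₀ x : X} (hx : x ∈ (chartAt (Eu d) x₀).source) :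
    MDifferentiableAt (𝓡 d) (𝓡 d) (chartAt (Eu d) x₀) x :=
  (contMDiffAt_chartAt_of_mem hx).mdifferentiableAt (by simp)

theorem mdifferentiableAt_chartAt_symm {x₀ : X} {y : Eu d}
    (hy : y ∈ (chartAt (Eu d) x₀).target) :
    MDifferentiableAt (𝓡 d) (𝓡 d) (chartAt (Eu d) x₀).symm y :=
  (contMDiffAt_chartAt_symm_of_mem hy).mdifferentiableAt (by simp)

theorem mfderiv_symm_comp_mfderiv_chartAt {x₀ x : X} (hx : x ∈ (chartAt (Eu d) x₀).source)
    (ξ : TangentSpace (𝓡 d) x) :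
    (show Eu d from mfderiv (𝓡 d) (𝓡 d) (chartAt (Eu d) x₀).symm (chartAt (Eu d) x₀ x)
      (mfderiv (𝓡 d) (𝓡 d) (chartAt (Eu d) x₀) x ξ)) = ξ := by
  have h1 : mfderiv (𝓡 d) (𝓡 d) ((chartAt (Eu d) x₀).symm ∘ chartAt (Eu d) x₀) x =
      mfderiv (𝓡 d) (𝓡 d) id x := by
    apply Filter.EventuallyEq.mfderiv_eq
    filter_upwards [(chartAt (Eu d) x₀).open_source.mem_nhds hx] with z hz
    simp [(chartAt (Eu d) x₀).left_inv hz]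
  rw [mfderiv_comp x (mdifferentiableAt_chartAt_symm ((chartAt (Eu d) x₀).map_source hx))
    (mdifferentiableAt_chartAt hx), mfderiv_id] at h1
  exact congrArg (fun L : Eu d →L[ℝ] Eu d => L ξ) h1

theorem mfderiv_chartAt_comp_mfderiv_symm {x₀ : X} {y : Eu d}
    (hy : y ∈ (chartAt (Eu d) x₀).target) (ξ : Eu d) :
    (show Eu d from mfderiv (𝓡 d) (𝓡 d) (chartAt (Eu d) x₀) ((chartAt (Eu d) x₀).symm y)
      (mfderiv (𝓡 d) (𝓡 d) (chartAt (Eu d) x₀).symm y ξ)) = ξ := by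
  have h1 : mfderiv (𝓡 d) (𝓡 d) (chartAt (Eu d) x₀ ∘ (chartAt (Eu d) x₀).symm) y =
      mfderiv (𝓡 d) (𝓡 d) id y := by
    apply Filter.EventuallyEq.mfderiv_eq
    filter_upwards [(chartAt (Eu d) x₀).open_target.mem_nhds hy] with z hz
    simp [(chartAt (Eu d) x₀).right_inv hz]
  rw [mfderiv_comp y (mdifferentiableAt_chartAt ((chartAt (Eu d) x₀).map_target hy))
    (mdifferentiableAt_chartAt_symm hy), mfderiv_id] at h1
  exact congrArg (fun L : Eu d →L[ℝ] Eu d => L ξ) h1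

theorem mfderiv_symm_chartField {x₀ : X} {y : Eu d} (hy : y ∈ (chartAt (Eu d) x₀).target)
    (v : (x : X) → TangentSpace (𝓡 d) x) :
    mfderiv (𝓡 d) (𝓡 d) (chartAt (Eu d) x₀).symm y (chartField x₀ v y) =
      v ((chartAt (Eu d) x₀).symm y) := by
  have := mfderiv_symm_comp_mfderiv_chartAt ((chartAt (Eu d) x₀).map_target hy)
    (v ((chartAt (Eu d) x₀).symm y))
  rwa [(chartAt (Eu d) x₀).right_inv hy] at this

section

variable {F : Type*} [NormedAddCommGroup F] [NormedSpace ℝ F]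

/-- Directional derivatives in a chart. -/
theorem diffAt_apply_eq_fderiv {f : X → F} {x₀ : X} {y : Eu d}
    (hy : y ∈ (chartAt (Eu d) x₀).target)
    (hf : MDifferentiableAt (𝓡 d) 𝓘(ℝ, F) f ((chartAt (Eu d) x₀).symm y))
    (v : (x : X) → TangentSpace (𝓡 d) x) :
    diffAt f ((chartAt (Eu d) x₀).symm y) (v ((chartAt (Eu d) x₀).symm y)) =
      fderiv ℝ (f ∘ (chartAt (Eu d) x₀).symm) y (chartField x₀ v y) := by
  rw [← mfderiv_eq_fderiv, mfderiv_comp y hf (mdifferentiableAt_chartAt_symm hy)]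
  change _ = mfderiv (𝓡 d) 𝓘(ℝ, F) f _ (mfderiv (𝓡 d) (𝓡 d) (chartAt (Eu d) x₀).symm y
    (chartField x₀ v y))
  rw [mfderiv_symm_chartField hy]
  rfl

theorem contDiffOn_comp_chartAt_symm {n : ℕ∞} {f : X → F}
    (hf : ContMDiff (𝓡 d) 𝓘(ℝ, F) n f) (x₀ : X) :
    ContDiffOn ℝ n (f ∘ (chartAt (Eu d) x₀).symm) (chartAt (Eu d) x₀).target := by
  rw [← contMDiffOn_iff_contDiffOn]
  exact hf.comp_contMDiffOn ((contMDiffOn_chart_symm (I := 𝓡 d) (x := x₀)).of_le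
    (by norm_cast))

/-- Differentiability of a function on a manifold along a curve. -/
theorem hasDerivAt_comp_of_hasMFDerivAt {f : X → F} {γ : ℝ → X} {t : ℝ}
    {ξ : TangentSpace (𝓡 d) (γ t)}
    (hf : MDifferentiableAt (𝓡 d) 𝓘(ℝ, F) f (γ t))
    (hγ : HasMFDerivAt 𝓘(ℝ, ℝ) (𝓡 d) γ t ((1 : ℝ →L[ℝ] ℝ).smulRight ξ)) :
    HasDerivAt (fun s => f (γ s)) (diffAt f (γ t) ξ) t := by
  have h : HasFDerivAt (f ∘ γ)
      ((diffAt f (γ t)).comp ((1 : ℝ →L[ℝ] ℝ).smulRight (show Eu d from ξ))) t :=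
    (hf.hasMFDerivAt.comp t hγ).hasFDerivAt
  exact hasDerivAt_of_hasFDerivAt_comp_smulRight h

theorem hasMFDerivAt_of_chart {x₀ : X} {c : ℝ → Eu d} {t : ℝ} {η : Eu d}
    (hy : c t ∈ (chartAt (Eu d) x₀).target) (hc : HasDerivAt c η t) :
    HasMFDerivAt 𝓘(ℝ, ℝ) (𝓡 d) (fun s => (chartAt (Eu d) x₀).symm (c s)) t
      ((1 : ℝ →L[ℝ] ℝ).smulRight
        (mfderiv (𝓡 d) (𝓡 d) (chartAt (Eu d) x₀).symm (c t) η)) := by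
  have h := (mdifferentiableAt_chartAt_symm hy).hasMFDerivAt.comp t hc.hasFDerivAt.hasMFDerivAt
  have e : (1 : ℝ →L[ℝ] ℝ).smulRight
        (show Eu d from mfderiv (𝓡 d) (𝓡 d) (chartAt (Eu d) x₀).symm (c t) η) =
      (show Eu d →L[ℝ] Eu d from mfderiv (𝓡 d) (𝓡 d) (chartAt (Eu d) x₀).symm (c t)).comp
        (ContinuousLinearMap.toSpanSingleton ℝ η) :=
    smulRight_one_apply_eq_comp_toSpanSingleton _ _
  exact e ▸ h

/-- A curve which is an integral curve in a chart is an integral curve. -/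
theorem hasMFDerivAt_of_chartField {x₀ : X} {c : ℝ → Eu d} {t : ℝ}
    {v : (x : X) → TangentSpace (𝓡 d) x} (hy : c t ∈ (chartAt (Eu d) x₀).target)
    (hc : HasDerivAt c (chartField x₀ v (c t)) t) :
    HasMFDerivAt 𝓘(ℝ, ℝ) (𝓡 d) (fun s => (chartAt (Eu d) x₀).symm (c s)) t
      ((1 : ℝ →L[ℝ] ℝ).smulRight (v ((chartAt (Eu d) x₀).symm (c t)))) := by
  have := hasMFDerivAt_of_chart hy hc
  rwa [mfderiv_symm_chartField hy] at this

end

/-- The coordinate expression is the fibre component of the section followed by the tangent map of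
the chart; the chart being `C^∞`, no derivative is lost. -/
theorem contDiffOn_chartField {n : ℕ∞} {v : (x : X) → TangentSpace (𝓡 d) x}
    (hv : ContMDiff (𝓡 d) (𝓡 d).tangent n (fun x => (⟨x, v x⟩ : TangentBundle (𝓡 d) X)))
    (x₀ : X) : ContDiffOn ℝ n (chartField x₀ v) (chartAt (Eu d) x₀).target := by
  have h1 : ContMDiffOn (𝓡 d).tangent (𝓡 d).tangent n
      (tangentMapWithin (𝓡 d) (𝓡 d) (chartAt (Eu d) x₀) (chartAt (Eu d) x₀).source)
      (Bundle.TotalSpace.proj ⁻¹' (chartAt (Eu d) x₀).source) :=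
    (contMDiffOn_chart (I := 𝓡 d) (n := ∞) (x := x₀)).contMDiffOn_tangentMapWithin
      (by norm_cast; exact le_top) (chartAt (Eu d) x₀).open_source.uniqueMDiffOn
  have h2 : ContMDiffOn (𝓡 d) (𝓡 d).tangent n (fun y : Eu d =>
      (⟨(chartAt (Eu d) x₀).symm y, v ((chartAt (Eu d) x₀).symm y)⟩ : TangentBundle (𝓡 d) X))
      (chartAt (Eu d) x₀).target :=
    hv.comp_contMDiffOn ((contMDiffOn_chart_symm (I := 𝓡 d) (x := x₀)).of_le
      (by norm_cast))
  have h3 := (contMDiff_snd_tangentBundle_modelSpace (Eu d) (𝓡 d) (n := n)).comp_contMDiffOn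
    (h1.comp h2 fun y hy => (chartAt (Eu d) x₀).map_target hy)
  rw [← contMDiffOn_iff_contDiffOn]
  refine h3.congr fun y hy => ?_
  change chartField x₀ v y = mfderivWithin (𝓡 d) (𝓡 d) (chartAt (Eu d) x₀)
    (chartAt (Eu d) x₀).source ((chartAt (Eu d) x₀).symm y) (v _)
  rw [mfderivWithin_of_isOpen (chartAt (Eu d) x₀).open_source ((chartAt (Eu d) x₀).map_target hy)]
  rfl

/-- The differential of the chart inverts that of its inverse. In this form the naturality of the
Lie bracket under pullbacks applies to coordinates. -/
theorem mpullback_chartAt_symm {x₀ : X} {y : Eu d} (hy : y ∈ (chartAt (Eu d) x₀).target)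
    (v : (x : X) → TangentSpace (𝓡 d) x) :
    VectorField.mpullback (𝓡 d) (𝓡 d) (chartAt (Eu d) x₀).symm v y = chartField x₀ v y := by
  have hx := (chartAt (Eu d) x₀).map_target hy
  suffices h : (mfderiv (𝓡 d) (𝓡 d) (chartAt (Eu d) x₀).symm y).inverse =
      mfderiv (𝓡 d) (𝓡 d) (chartAt (Eu d) x₀) ((chartAt (Eu d) x₀).symm y) by
    change (mfderiv (𝓡 d) (𝓡 d) (chartAt (Eu d) x₀).symm y).inverse _ = _
    rw [h]
    rfl
  refine ContinuousLinearMap.inverse_eq ?_ ?_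
  · ext1 ξ
    have := mfderiv_symm_comp_mfderiv_chartAt hx ξ
    rw [(chartAt (Eu d) x₀).right_inv hy] at this
    exact this
  · ext1 ξ
    exact mfderiv_chartAt_comp_mfderiv_symm hy ξ

/-- The Lie bracket in a chart. -/
theorem chartField_mlieBracket {v w : (x : X) → TangentSpace (𝓡 d) x}
    (hv : ContMDiff (𝓡 d) (𝓡 d).tangent 1 (fun x => (⟨x, v x⟩ : TangentBundle (𝓡 d) X)))
    (hw : ContMDiff (𝓡 d) (𝓡 d).tangent 1 (fun x => (⟨x, w x⟩ : TangentBundle (𝓡 d) X)))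
    {x₀ : X} {y : Eu d} (hy : y ∈ (chartAt (Eu d) x₀).target) :
    chartField x₀ (VectorField.mlieBracket (𝓡 d) v w) y =
      fderiv ℝ (chartField x₀ w) y (chartField x₀ v y) -
        fderiv ℝ (chartField x₀ v) y (chartField x₀ w y) := by
  -- The bracket commutes with the pullback by the inverse chart, which leaves a bracket on the
  -- model space.
  rw [← mpullback_chartAt_symm hy, VectorField.mpullback_mlieBracket (n := ∞)
    (hv.mdifferentiable (by simp) _) (hw.mdifferentiable (by simp) _)
    (contMDiffAt_chartAt_symm_of_mem hy) (by simp; norm_cast)]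
  have e : ∀ u : (x : X) → TangentSpace (𝓡 d) x,
      VectorField.mpullback (𝓡 d) (𝓡 d) (chartAt (Eu d) x₀).symm u =ᶠ[𝓝 y] chartField x₀ u := by
    intro u
    filter_upwards [(chartAt (Eu d) x₀).open_target.mem_nhds hy] with z hz
    exact mpullback_chartAt_symm hz u
  rw [Filter.EventuallyEq.mlieBracket_vectorField_eq (e v) (e w)]
  have key : ∀ V W : (y : Eu d) → TangentSpace (𝓡 d) y, VectorField.mlieBracket (𝓡 d) V W =
      VectorField.lieBracketWithin ℝ V W univ := fun V W => by
    rw [← VectorField.mlieBracketWithin_univ]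
    exact VectorField.mlieBracketWithin_eq_lieBracketWithin
  refine (congrFun (key (chartField x₀ v) (chartField x₀ w)) y).trans ?_
  exact congrFun (VectorField.lieBracketWithin_univ (V := chartField x₀ v)
    (W := chartField x₀ w)) y

end ChartCalculus

/-! ### Integral curves and flows of compactly supported vector fields -/

section IntegralCurves

variable {d : ℕ} {X : Type*} [TopologicalSpace X] [ChartedSpace (Eu d) X]
  [IsManifold (𝓡 d) ∞ X]

theorem contDiffAt_chartField {n : ℕ∞} {v : (x : X) → TangentSpace (𝓡 d) x}
    (hv : ContMDiff (𝓡 d) (𝓡 d).tangent n (fun x => (⟨x, v x⟩ : TangentBundle (𝓡 d) X)))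
    {x₀ : X} {y : Eu d} (hy : y ∈ (chartAt (Eu d) x₀).target) :
    ContDiffAt ℝ n (chartField x₀ v) y :=
  (contDiffOn_chartField hv x₀).contDiffAt ((chartAt (Eu d) x₀).open_target.mem_nhds hy)

/-- Integral curves starting near `x₀` exist for a uniform time. -/
theorem exists_uniform_isMIntegralCurveOn {v : (x : X) → TangentSpace (𝓡 d) x}
    (hv : ContMDiff (𝓡 d) (𝓡 d).tangent 1 (fun x => (⟨x, v x⟩ : TangentBundle (𝓡 d) X)))
    (x₀ : X) : ∃ ε > 0, ∀ᶠ x in 𝓝 x₀, ∃ γ : ℝ → X, γ 0 = x ∧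
      IsMIntegralCurveOn γ v (Ioo (-ε) ε) := by
  set φ := chartAt (Eu d) x₀
  have hx₀ : x₀ ∈ φ.source := mem_chart_source _ x₀
  have hy₀ : φ x₀ ∈ φ.target := φ.map_source hx₀
  obtain ⟨ε, hε, a, r, L, K, hr, hpl⟩ :=
    IsPicardLindelof.of_contDiffAt_one (contDiffAt_chartField (n := 1) hv hy₀)
  obtain ⟨α, hα, hcont⟩ :=
    (hpl 0).exists_forall_mem_closedBall_eq_hasDerivWithinAt_continuousOn
  have hball : Metric.closedBall (φ x₀) r ∈ 𝓝 (φ x₀) := Metric.closedBall_mem_nhds _ (by exact_mod_cast hr)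
  have hnhd : Metric.closedBall (φ x₀) r ×ˢ Icc (0 - ε) (0 + ε) ∈ 𝓝 (φ x₀, (0 : ℝ)) :=
    prod_mem_nhds hball (Icc_mem_nhds (by linarith) (by linarith))
  -- Joint continuity of the local flow keeps the solutions in the chart target for a short time,
  -- uniformly in the starting point; only there does a solution in coordinates define a curve on
  -- `X`.
  have hc := (hcont.continuousAt hnhd).preimage_mem_nhds (by
    rw [show α (φ x₀, 0) = φ x₀ from (hα _ (mem_of_mem_nhds hball)).1]
    exact φ.open_target.mem_nhds hy₀)
  rw [nhds_prod_eq, Filter.mem_prod_iff] at hc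
  obtain ⟨s, hs, t, ht, hst⟩ := hc
  obtain ⟨δ, hδ, hδt⟩ := Metric.mem_nhds_iff.1 ht
  refine ⟨min δ ε, lt_min hδ hε, ?_⟩
  filter_upwards [φ.open_source.mem_nhds hx₀,
    (φ.continuousAt hx₀).preimage_mem_nhds (Filter.inter_mem hball hs)] with x hx hxs
  refine ⟨fun τ => φ.symm (α (φ x, τ)), ?_, fun τ hτ => ?_⟩
  · change φ.symm (α (φ x, 0)) = x
    rw [show α (φ x, 0) = φ x from (hα _ hxs.1).1, φ.left_inv hx]
  · have h1 : τ ∈ Ioo (0 - ε) (0 + ε) := by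
      rcases hτ with ⟨h, h'⟩
      have := min_le_right δ ε
      constructor <;> linarith
    have h2 : τ ∈ t := hδt (by
      rw [Metric.mem_ball, Real.dist_eq, sub_zero, abs_lt]
      have := min_le_left δ ε
      exact ⟨by linarith [hτ.1], by linarith [hτ.2]⟩)
    refine (hasMFDerivAt_of_chartField (x₀ := x₀) (c := fun τ => α (φ x, τ)) ?_ ?_).hasMFDerivWithinAt
    · exact hst (mk_mem_prod hxs.2 h2)
    · exact ((hα _ hxs.1).2 τ (Ioo_subset_Icc_self h1)).hasDerivAt (Icc_mem_nhds h1.1 h1.2)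

theorem isMIntegralCurve_unique [T2Space X] {v : (x : X) → TangentSpace (𝓡 d) x}
    (hv : ContMDiff (𝓡 d) (𝓡 d).tangent 1 (fun x => (⟨x, v x⟩ : TangentBundle (𝓡 d) X)))
    {γ γ' : ℝ → X} (hγ : IsMIntegralCurve γ v) (hγ' : IsMIntegralCurve γ' v) {t₀ : ℝ}
    (h : γ t₀ = γ' t₀) : γ = γ' :=
  isMIntegralCurve_Ioo_eq_of_contMDiff_boundaryless hv hγ hγ' h

/-- A compactly supported vector field is complete. -/
theorem exists_isMIntegralCurve_of_compact_support [T2Space X]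
    {v : (x : X) → TangentSpace (𝓡 d) x}
    (hv : ContMDiff (𝓡 d) (𝓡 d).tangent 1 (fun x => (⟨x, v x⟩ : TangentBundle (𝓡 d) X)))
    (hc : IsCompact (closure {x | v x ≠ 0})) (x : X) :
    ∃ γ : ℝ → X, γ 0 = x ∧ IsMIntegralCurve γ v := by
  choose ε hε h using exists_uniform_isMIntegralCurveOn hv
  obtain ⟨t, -, ht⟩ := hc.elim_nhds_subcover _ (fun x _ => h x)
  obtain ⟨δ, hδ, hδt⟩ : ∃ δ > 0, ∀ x ∈ t, δ ≤ ε x := by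
    rcases t.eq_empty_or_nonempty with rfl | hne
    · exact ⟨1, one_pos, by simp⟩
    · exact ⟨t.inf' hne ε, by simpa [Finset.lt_inf'_iff] using fun i _ => hε i,
        fun x hx => Finset.inf'_le _ hx⟩
  -- A uniform existence time gives global curves. On the support of `v` the finite subcover
  -- provides `δ`; elsewhere the constant curve serves.
  refine exists_isMIntegralCurve_of_isMIntegralCurveOn hv hδ (fun y => ?_) x
  by_cases hy : y ∈ closure {x | v x ≠ 0}
  · obtain ⟨i, hi, hyi⟩ := mem_iUnion₂.1 (ht hy)
    obtain ⟨γ, h0, hγ⟩ := hyi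
    exact ⟨γ, h0, hγ.mono (Ioo_subset_Ioo (neg_le_neg (hδt i hi)) (hδt i hi))⟩
  · have : v y = 0 := by
      by_contra h
      exact hy (subset_closure h)
    exact ⟨fun _ => y, rfl, (isMIntegralCurve_const this).isMIntegralCurveOn _⟩

section Flow

variable [T2Space X] {v : (x : X) → TangentSpace (𝓡 d) x}
  (hv : ContMDiff (𝓡 d) (𝓡 d).tangent 1 (fun x => (⟨x, v x⟩ : TangentBundle (𝓡 d) X)))
  (hc : IsCompact (closure {x | v x ≠ 0}))

include hv hc

/-- The choice in `flow` depends on the point but not on the time, so its values at all times lie on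
one and the same integral curve. -/
theorem flow_spec (x : X) :
    flow v 0 x = x ∧ IsMIntegralCurve (fun t => flow v t x) v := by
  have h := exists_isMIntegralCurve_of_compact_support hv hc x
  have e : (fun t => flow v t x) = h.choose := by
    funext t
    simp only [flow, dif_pos h]
  rw [e]
  refine ⟨?_, h.choose_spec.2⟩
  rw [show flow v 0 x = h.choose 0 from congrFun e 0]
  exact h.choose_spec.1

theorem flow_eq_of_integralCurve {γ : ℝ → X} (hγ : IsMIntegralCurve γ v) (t : ℝ) :
    flow v t (γ 0) = γ t :=
  congrFun (isMIntegralCurve_unique hv (flow_spec hv hc (γ 0)).2 hγ (t₀ := 0)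
    (flow_spec hv hc (γ 0)).1) t

/-- Two integral curves that meet at time `t` coincide, in particular at time `0`. This keeps the
positions of a transported configuration distinct. -/
theorem flow_injective (t : ℝ) : Function.Injective (flow v t) := by
  intro x x' h
  have := congrFun (isMIntegralCurve_unique hv (flow_spec hv hc x).2 (flow_spec hv hc x').2
    (t₀ := t) h) 0
  simpa only [(flow_spec hv hc _).1] using this

theorem flow_of_eq_zero {x : X} (hx : v x = 0) (t : ℝ) : flow v t x = x :=
  flow_eq_of_integralCurve hv hc (isMIntegralCurve_const hx) t

theorem hasMFDerivAt_flow (x : X) :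
    HasMFDerivAt 𝓘(ℝ, ℝ) (𝓡 d) (fun t => flow v t x) 0 ((1 : ℝ →L[ℝ] ℝ).smulRight (v x)) := by
  have := (flow_spec hv hc x).2 0
  beta_reduce at this
  rw [show flow v 0 x = x from (flow_spec hv hc x).1] at this
  exact this

end Flow

end IntegralCurves

/-! ### The exponential map of the Lie group and its differential at the origin -/

section Exponential

variable {l : ℕ} {G : Type*} [TopologicalSpace G] [T2Space G] [ChartedSpace (Eu l) G] [Group G]
  [LieGroup (𝓡 l) ∞ G]

theorem contMDiff_leftInvariantField (w : GroupLieAlgebra (𝓡 l) G) :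
    ContMDiff (𝓡 l) (𝓡 l).tangent 1
      (fun g => (⟨g, mulInvariantVectorField w g⟩ : TangentBundle (𝓡 l) G)) :=
  (contMDiff_mulInvariantVectorField w).of_le (by simp)

theorem mdifferentiableAt_mul_left (g h : G) :
    MDifferentiableAt (𝓡 l) (𝓡 l) (fun x => g * x) h :=
  (contMDiff_mul_left (I := 𝓡 l) (n := ∞) (a := g)).mdifferentiable (by simp) h

theorem mdifferentiableAt_mul_right (g h : G) :
    MDifferentiableAt (𝓡 l) (𝓡 l) (fun x => x * g) h :=
  (contMDiff_mul_right (I := 𝓡 l) (n := ∞) (a := g)).mdifferentiable (by simp) h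

theorem mfderiv_mul_left_leftInvariantField (w : GroupLieAlgebra (𝓡 l) G) (g h : G) :
    mfderiv (𝓡 l) (𝓡 l) (fun x => g * x) h (mulInvariantVectorField w h) =
      mulInvariantVectorField w (g * h) := by
  have e : (fun x => g * h * x) = (fun x => g * x) ∘ (fun x => h * x) := by
    ext x; simp [mul_assoc]
  simp only [mulInvariantVectorField]
  rw [e, mfderiv_comp (I' := 𝓡 l) _ (mdifferentiableAt_mul_left _ _)
    (mdifferentiableAt_mul_left _ _)]
  have key : ∀ h', h' = h → mfderiv (𝓡 l) (𝓡 l) (fun x => g * x) h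
      (show Eu l from mfderiv (𝓡 l) (𝓡 l) (fun x => h * x) 1 w) =
      (show Eu l from mfderiv (𝓡 l) (𝓡 l) (fun x => g * x) h'
        (show Eu l from mfderiv (𝓡 l) (𝓡 l) (fun x => h * x) 1 w)) := by
    rintro _ rfl; rfl
  exact key _ (mul_one h)

theorem isMIntegralCurveOn_mul_left {w : GroupLieAlgebra (𝓡 l) G} {γ : ℝ → G} {s : Set ℝ}
    (hγ : IsMIntegralCurveOn γ (mulInvariantVectorField w) s) (g : G) :
    IsMIntegralCurveOn (fun t => g * γ t) (mulInvariantVectorField w) s := by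
  intro t ht
  have h := (mdifferentiableAt_mul_left (l := l) g (γ t)).hasMFDerivAt.comp_hasMFDerivWithinAt t (hγ t ht)
  have e : (1 : ℝ →L[ℝ] ℝ).smulRight (show Eu l from mulInvariantVectorField w (g * γ t)) =
      (show Eu l →L[ℝ] Eu l from mfderiv (𝓡 l) (𝓡 l) (fun x => g * x) (γ t)).comp
        ((1 : ℝ →L[ℝ] ℝ).smulRight (show Eu l from mulInvariantVectorField w (γ t))) := by
    rw [← mfderiv_mul_left_leftInvariantField]
    exact smulRight_one_apply_eq_comp_smulRight (E := Eu l) (F := Eu l) _ _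
  exact e ▸ h

/-- Left translations carry the local curve through `1` to one through any `g` with the same
lifetime, so left-invariant fields are complete. -/
theorem exists_isMIntegralCurve_leftInvariantField (w : GroupLieAlgebra (𝓡 l) G) (g : G) :
    ∃ γ : ℝ → G, γ 0 = g ∧ IsMIntegralCurve γ (mulInvariantVectorField w) := by
  obtain ⟨ε, hε, h⟩ := exists_uniform_isMIntegralCurveOn (contMDiff_leftInvariantField w) (1 : G)
  obtain ⟨γ, h0, hγ⟩ := h.self_of_nhds
  exact exists_isMIntegralCurve_of_isMIntegralCurveOn (contMDiff_leftInvariantField w) hε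
    (fun g => ⟨fun t => g * γ t, by simp [h0], isMIntegralCurveOn_mul_left hγ g⟩) g

/-- The curve `s ↦ γ (s t)` is an integral curve of the field of `t • w`; uniqueness identifies its
value at time `1`. -/
theorem lieExp_smul_eq {w : GroupLieAlgebra (𝓡 l) G} {γ : ℝ → G} (h0 : γ 0 = 1)
    (hγ : IsMIntegralCurve γ (mulInvariantVectorField w)) (t : ℝ) : lieExp (t • w) = γ t := by
  have h := exists_isMIntegralCurve_leftInvariantField (t • w) (1 : G)
  rw [lieExp, dif_pos h]
  have h1 : IsMIntegralCurve (γ ∘ (· * t)) (mulInvariantVectorField (t • w)) := by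
    rw [mulInvariantVectorField_smul]
    exact hγ.comp_mul t
  have := congrFun (isMIntegralCurve_unique (contMDiff_leftInvariantField _) h.choose_spec.2 h1
    (t₀ := 0) (by simp [h.choose_spec.1, h0])) 1
  simpa using this

theorem lieExp_spec (w : GroupLieAlgebra (𝓡 l) G) :
    lieExp ((0 : ℝ) • w) = (1 : G) ∧
      IsMIntegralCurve (fun t : ℝ => (lieExp (t • w) : G)) (mulInvariantVectorField w) := by
  obtain ⟨γ, h0, hγ⟩ := exists_isMIntegralCurve_leftInvariantField w (1 : G)
  have e : (fun t : ℝ => (lieExp (t • w) : G)) = γ := funext fun t => lieExp_smul_eq h0 hγ t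
  rw [e, lieExp_smul_eq h0 hγ]
  exact ⟨h0, hγ⟩

theorem lieExp_zero : lieExp (0 : GroupLieAlgebra (𝓡 l) G) = 1 := by
  simpa using (lieExp_spec (0 : GroupLieAlgebra (𝓡 l) G)).1

/-- As functions of `t` both sides are integral curves of the same field, the right one by left
translation, and they agree at `t = 0`. -/
theorem lieExp_add_smul (w : GroupLieAlgebra (𝓡 l) G) (s t : ℝ) :
    (lieExp ((s + t) • w) : G) = lieExp (s • w) * lieExp (t • w) := by
  have h1 : IsMIntegralCurve (fun t : ℝ => (lieExp (s • w) * lieExp (t • w) : G))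
      (mulInvariantVectorField w) := by
    rw [isMIntegralCurve_iff_isMIntegralCurveOn]
    exact isMIntegralCurveOn_mul_left ((lieExp_spec w).2.isMIntegralCurveOn _) _
  have h2 := (lieExp_spec w).2.comp_add s
  have := congrFun (isMIntegralCurve_unique (contMDiff_leftInvariantField w) h2 h1
    (t₀ := 0) (by simp [lieExp_zero])) t
  simpa [add_comm] using this

theorem continuous_lieExp_smul (w : GroupLieAlgebra (𝓡 l) G) :
    Continuous (fun t : ℝ => (lieExp (t • w) : G)) := (lieExp_spec w).2.continuous

/-- The left-invariant vector field with value `w` at `1`, in the chart around `1`. It is linear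
in `w`. -/
def leftInvariantCoord (G : Type*) [TopologicalSpace G] [ChartedSpace (Eu l) G] [Group G]
    (y : Eu l) : Eu l →L[ℝ] Eu l :=
  (show Eu l →L[ℝ] Eu l from mfderiv (𝓡 l) (𝓡 l) (chartAt (Eu l) (1 : G))
    ((chartAt (Eu l) (1 : G)).symm y)).comp
  (show Eu l →L[ℝ] Eu l from mfderiv (𝓡 l) (𝓡 l)
    (fun h : G => (chartAt (Eu l) (1 : G)).symm y * h) 1)

/-- In finite dimensions it suffices to evaluate the operator at fixed `w`, which gives a
left-invariant field in coordinates. -/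
theorem contDiffOn_leftInvariantCoord :
    ContDiffOn ℝ 1 (leftInvariantCoord G) (chartAt (Eu l) (1 : G)).target := by
  rw [contDiffOn_clm_apply]
  intro w
  simp only [leftInvariantCoord]
  exact contDiffOn_chartField (n := 1) (contMDiff_leftInvariantField _) 1

/-- At a fixed time `τ`, the integral curve through `1` is affine in `w` up to a quadratic error.
The curve stays within `O(‖w‖)` of its starting point, so its velocity differs from the initial
velocity by `O(‖w‖²)`, and this is integrated over `[0, τ]`. -/
theorem lieExp_expansion :
    ∃ C > (0 : ℝ), ∃ ρ > (0 : ℝ), ∃ τ > (0 : ℝ), ∀ w : Eu l, ‖w‖ < ρ → ∃ c : Eu l,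
      c ∈ (chartAt (Eu l) (1 : G)).target ∧
      (lieExp (τ • (show GroupLieAlgebra (𝓡 l) G from w)) : G) =
        (chartAt (Eu l) (1 : G)).symm c ∧
      ‖c - chartAt (Eu l) (1 : G) 1 - τ • leftInvariantCoord G (chartAt (Eu l) (1 : G) 1) w‖ ≤
        C * ‖w‖ ^ 2 := by
  set φ := chartAt (Eu l) (1 : G)
  set y₀ := φ 1
  have hy₀ : y₀ ∈ φ.target := φ.map_source (mem_chart_source _ _)
  have hA : ContDiffAt ℝ 1 (leftInvariantCoord G) y₀ :=
    contDiffOn_leftInvariantCoord.contDiffAt (φ.open_target.mem_nhds hy₀)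
  obtain ⟨K, s, hs, hK⟩ := hA.exists_lipschitzOnWith
  obtain ⟨ρ, hρ, hρs⟩ := Metric.mem_nhds_iff.1 (Filter.inter_mem hs (φ.open_target.mem_nhds hy₀))
  -- The parameter `w` is adjoined as a component with zero velocity, so Lipschitz dependence on
  -- initial values becomes Lipschitz dependence on `w`.
  let F : Eu l × Eu l → Eu l × Eu l := fun z => (leftInvariantCoord G z.1 z.2, 0)
  have hF : ContDiffAt ℝ 1 F (y₀, 0) := by
    refine ContDiffAt.prodMk ?_ contDiffAt_const
    exact (ContDiffAt.comp (y₀, (0 : Eu l)) (g := leftInvariantCoord G) (f := Prod.fst)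
      hA contDiffAt_fst).clm_apply contDiffAt_snd
  obtain ⟨ε, hε, a, r, L, K', hr, hpl⟩ := IsPicardLindelof.of_contDiffAt_one hF
  obtain ⟨α, hα, L', hL⟩ :=
    (hpl 0).exists_forall_mem_closedBall_eq_hasDerivWithinAt_lipschitzOnWith
  simp only [zero_sub, zero_add] at hα hL
  have h0mem : (0 : ℝ) ∈ Icc (-ε) ε := ⟨by linarith, hε.le⟩
  have hconv : Convex ℝ (Icc (-ε) ε) := convex_Icc _ _
  have hmem : ∀ w : Eu l, ‖w‖ ≤ r → ((y₀, w) : Eu l × Eu l) ∈ Metric.closedBall (y₀, (0 : Eu l)) r := by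
    intro w hw
    simp [Prod.dist_eq, hw]
  have hsnd : ∀ w : Eu l, ‖w‖ ≤ r → ∀ t ∈ Icc (-ε) ε, (α (y₀, w) t).2 = w := by
    intro w hw t ht
    have := hconv.norm_image_sub_le_of_norm_hasDerivWithin_le (f := fun t => (α (y₀, w) t).2)
      (f' := fun _ => 0) (C := 0) (fun t ht => by
        exact ((ContinuousLinearMap.snd ℝ (Eu l) (Eu l)).hasFDerivAt.comp_hasDerivWithinAt t
          ((hα _ (hmem w hw)).2 t ht))) (by simp) h0mem ht
    simp only [zero_mul, norm_le_zero_iff, sub_eq_zero] at this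
    rw [this, (hα _ (hmem w hw)).1]
  have hder : ∀ w : Eu l, ‖w‖ ≤ r → ∀ t ∈ Icc (-ε) ε, HasDerivWithinAt (fun t => (α (y₀, w) t).1)
      (leftInvariantCoord G (α (y₀, w) t).1 w) (Icc (-ε) ε) t := by
    intro w hw t ht
    have := (ContinuousLinearMap.fst ℝ (Eu l) (Eu l)).hasFDerivAt.comp_hasDerivWithinAt t
          ((hα _ (hmem w hw)).2 t ht)
    simp only [F, hsnd w hw t ht] at this
    exact this
  have hfst0 : ∀ t ∈ Icc (-ε) ε, (α (y₀, 0) t).1 = y₀ := by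
    intro t ht
    have h0 : ‖(0 : Eu l)‖ ≤ r := by simp
    have := hconv.norm_image_sub_le_of_norm_hasDerivWithin_le (f := fun t => (α (y₀, 0) t).1)
      (f' := fun _ => 0) (C := 0) (fun t ht => by simpa using hder 0 h0 t ht) (by simp) h0mem ht
    simp only [zero_mul, norm_le_zero_iff, sub_eq_zero] at this
    rw [this, (hα _ (hmem 0 h0)).1]
  -- The solution is compared with the one for `w = 0`, which is constant.
  have hclose : ∀ w : Eu l, ‖w‖ ≤ r → ∀ t ∈ Icc (-ε) ε, ‖(α (y₀, w) t).1 - y₀‖ ≤ L' * ‖w‖ := by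
    intro w hw t ht
    have h1 := (hL t ht).dist_le_mul _ (hmem w hw) _ (hmem 0 (by simp))
    have h2 : dist (α (y₀, w) t).1 (α (y₀, 0) t).1 ≤ dist (α (y₀, w) t) (α (y₀, 0) t) := by
      rw [Prod.dist_eq]; exact le_max_left _ _
    rw [hfst0 t ht, dist_eq_norm] at h2
    have h3 : dist (y₀, w) (y₀, (0 : Eu l)) = ‖w‖ := by simp [Prod.dist_eq]
    rw [h3] at h1
    exact h2.trans h1
  -- The velocity error `K L' ‖w‖²` acts for the time `ε / 2`; the summand `1` makes the constant
  -- positive. The radius `ρ / (L' + 1)` keeps the solution in the ball where the chart and the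
  -- Lipschitz bound `K` are available.
  refine ⟨(K : ℝ) * L' * (ε / 2) + 1, by positivity, min (r : ℝ) (ρ / (L' + 1)),
    lt_min (by exact_mod_cast hr) (by positivity), ε / 2, by positivity, fun w hw => ?_⟩
  have hwr : ‖w‖ ≤ r := (hw.trans_le (min_le_left _ _)).le
  have hball : ∀ t ∈ Icc (-ε) ε, (α (y₀, w) t).1 ∈ Metric.ball y₀ ρ := by
    intro t ht
    rw [Metric.mem_ball, dist_eq_norm]
    refine (hclose w hwr t ht).trans_lt ?_
    have := hw.trans_le (min_le_right _ _)
    rw [lt_div_iff₀ (by positivity)] at this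
    nlinarith [norm_nonneg w]
  have hε2 : ε / 2 ∈ Icc (-ε) ε := ⟨by linarith, by linarith⟩
  refine ⟨(α (y₀, w) (ε / 2)).1, (hρs (hball _ hε2)).2, ?_, ?_⟩
  · have hγ : IsMIntegralCurveOn (fun t => φ.symm (α (y₀, w) t).1)
        (mulInvariantVectorField (show GroupLieAlgebra (𝓡 l) G from w)) (Ioo (-ε) ε) := by
      intro t ht
      refine (hasMFDerivAt_of_chartField (x₀ := (1 : G)) (c := fun t => (α (y₀, w) t).1)
        (hρs (hball _ (Ioo_subset_Icc_self ht))).2 ?_).hasMFDerivWithinAt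
      exact (hder w hwr t (Ioo_subset_Icc_self ht)).hasDerivAt (Icc_mem_nhds ht.1 ht.2)
    refine isMIntegralCurveOn_Ioo_eqOn_of_contMDiff_boundaryless (t₀ := 0) (a := -ε) (b := ε)
      ⟨by linarith, hε⟩
      (contMDiff_leftInvariantField _) ((lieExp_spec _).2.isMIntegralCurveOn _) hγ ?_
      ⟨by linarith, by linarith⟩
    rw [(lieExp_spec _).1, (hα _ (hmem w hwr)).1]
    exact (φ.left_inv (mem_chart_source _ _)).symm
  · have := hconv.norm_image_sub_le_of_norm_hasDerivWithin_le
      (f := fun t => (α (y₀, w) t).1 - t • leftInvariantCoord G y₀ w)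
      (f' := fun t => leftInvariantCoord G (α (y₀, w) t).1 w - leftInvariantCoord G y₀ w)
      (C := K * L' * ‖w‖ ^ 2) (fun t ht => by
        have := (hder w hwr t ht).fun_sub
          ((hasDerivWithinAt_id t (Icc (-ε) ε)).smul_const (leftInvariantCoord G y₀ w))
        simpa using this) (fun t ht => by
        rw [← sub_apply]
        refine (ContinuousLinearMap.le_opNorm _ _).trans ?_
        have h1 := hK.dist_le_mul _ (hρs (hball t ht)).1 _ (mem_of_mem_nhds hs)
        rw [dist_eq_norm, dist_eq_norm] at h1
        have h2 := hclose w hwr t ht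
        calc _ ≤ (K * (L' * ‖w‖)) * ‖w‖ := by gcongr; exact h1.trans (by gcongr)
          _ = _ := by ring) h0mem hε2
    simp only [zero_smul, sub_zero, (hα _ (hmem w hwr)).1] at this
    rw [sub_right_comm]
    refine this.trans ?_
    rw [Real.norm_of_nonneg (by positivity)]
    nlinarith [sq_nonneg ‖w‖]

theorem mulInvariantVectorField_one (w : GroupLieAlgebra (𝓡 l) G) :
    mulInvariantVectorField w (1 : G) = w := by
  have e : (fun h : G => 1 * h) = id := by ext; simp
  have : ∀ f : G → G, f = id → (show Eu l from mfderiv (𝓡 l) (𝓡 l) f 1 w) = w := by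
    rintro _ rfl
    rw [mfderiv_id]
    rfl
  exact this _ e

/-- The exponential map is differentiable at the origin, and its derivative is the identity. -/
theorem hasMFDerivAt_lieExp :
    HasMFDerivAt (𝓡 l) (𝓡 l) (fun w : Eu l => (lieExp (show GroupLieAlgebra (𝓡 l) G from w) : G)) 0
      (ContinuousLinearMap.id ℝ (Eu l)) := by
  obtain ⟨C, hC, ρ, hρ, τ, hτ, h⟩ := lieExp_expansion (l := l) (G := G)
  set φ := chartAt (Eu l) (1 : G)
  set B := leftInvariantCoord G (φ 1)
  -- The expansion at time `τ` is applied to `τ⁻¹ • w`; rescaling turns the error into `C / τ²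
  -- ‖w‖²`.
  have key : ∀ w : Eu l, ‖w‖ < τ * ρ →
      (lieExp (show GroupLieAlgebra (𝓡 l) G from w) : G) ∈ φ.source ∧
      ‖φ (lieExp (show GroupLieAlgebra (𝓡 l) G from w)) - φ 1 - B w‖ ≤ C / τ ^ 2 * ‖w‖ ^ 2 := by
    intro w hw
    have hw' : ‖τ⁻¹ • w‖ = τ⁻¹ * ‖w‖ := by
      rw [norm_smul, Real.norm_of_nonneg (by positivity)]
    obtain ⟨c, hc, hcw, hle⟩ := h (τ⁻¹ • w) (by
      rw [hw', inv_mul_lt_iff₀ hτ]; exact hw)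
    have e : (τ • (show GroupLieAlgebra (𝓡 l) G from τ⁻¹ • w)) =
        (show GroupLieAlgebra (𝓡 l) G from w) := by
      change τ • (τ⁻¹ • w) = w
      rw [smul_smul, mul_inv_cancel₀ hτ.ne', one_smul]
    rw [e] at hcw
    rw [hcw]
    refine ⟨φ.map_target hc, ?_⟩
    rw [φ.right_inv hc]
    rw [map_smul, smul_smul, mul_inv_cancel₀ hτ.ne', one_smul, hw'] at hle
    refine hle.trans (le_of_eq ?_)
    field_simp
  have h0 : φ (lieExp (show GroupLieAlgebra (𝓡 l) G from (0 : Eu l))) = φ 1 :=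
    congrArg φ lieExp_zero
  have hd : HasFDerivAt (fun w : Eu l => φ (lieExp (show GroupLieAlgebra (𝓡 l) G from w))) B 0 := by
    rw [hasFDerivAt_iff_isLittleO_nhds_zero]
    refine Asymptotics.IsBigO.trans_isLittleO (g := fun w : Eu l => ‖w‖ ^ 2) ?_ ?_
    · refine Asymptotics.IsBigO.of_bound (C / τ ^ 2) ?_
      filter_upwards [Metric.ball_mem_nhds (0 : Eu l) (mul_pos hτ hρ)] with w hw
      rw [zero_add, h0, Real.norm_of_nonneg (by positivity)]
      exact (key w (by simpa using hw)).2
    · have := Asymptotics.isLittleO_norm_pow_id (E' := Eu l) (n := 2) one_lt_two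
      exact this
  have hy₀ : φ 1 ∈ φ.target := φ.map_source (mem_chart_source _ _)
  have h1 := (mdifferentiableAt_chartAt_symm (x₀ := (1 : G))
    (by rw [h0]; exact hy₀)).hasMFDerivAt.comp (0 : Eu l) hd.hasMFDerivAt
  have e1 : (fun w : Eu l => (lieExp (show GroupLieAlgebra (𝓡 l) G from w) : G)) =ᶠ[𝓝 0]
      φ.symm ∘ fun w : Eu l => φ (lieExp (show GroupLieAlgebra (𝓡 l) G from w)) := by
    filter_upwards [Metric.ball_mem_nhds (0 : Eu l) (mul_pos hτ hρ)] with w hw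
    exact (φ.left_inv (key w (by simpa using hw)).1).symm
  have h2 := h1.congr_of_eventuallyEq e1
  have e2 : (show Eu l →L[ℝ] Eu l from mfderiv (𝓡 l) (𝓡 l) φ.symm
      (φ (lieExp (show GroupLieAlgebra (𝓡 l) G from (0 : Eu l))))).comp B =
      ContinuousLinearMap.id ℝ (Eu l) := by
    rw [h0]
    ext1 w
    have h3 := mfderiv_symm_chartField hy₀
      (mulInvariantVectorField (show GroupLieAlgebra (𝓡 l) G from w))
    rw [φ.left_inv (mem_chart_source _ _), mulInvariantVectorField_one] at h3
    exact h3
  exact e2 ▸ h2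

end Exponential

/-! ### Smoothness of directional derivatives with parameters -/

theorem smulRight_one_prod {E F : Type*} [NormedAddCommGroup E] [NormedSpace ℝ E]
    [NormedAddCommGroup F] [NormedSpace ℝ F] (ξ : E) (η : F) :
    (1 : ℝ →L[ℝ] ℝ).smulRight (ξ, η) =
      ((1 : ℝ →L[ℝ] ℝ).smulRight ξ).prod ((1 : ℝ →L[ℝ] ℝ).smulRight η) := by
  ext1; simp

/-- The term with `c'` carries the factor `t = 0`. Hence the motion of the base point does not
contribute to the velocity of `t u(ψₜ x)` at `t = 0`. -/
theorem hasDerivAt_smul_self_zero {E : Type*} [NormedAddCommGroup E] [NormedSpace ℝ E]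
    {c : ℝ → E} {c' : E} (h : HasDerivAt c c' 0) : HasDerivAt (fun t : ℝ => t • c t) (c 0) 0 := by
  simpa using! (hasDerivAt_id (0 : ℝ)).smul h

section ParametricDerivative

variable {d : ℕ} {X : Type*} [TopologicalSpace X] [ChartedSpace (Eu d) X]
  [IsManifold (𝓡 d) ∞ X]
  {E : Type*} [NormedAddCommGroup E] [NormedSpace ℝ E] {H : Type*} [TopologicalSpace H]
  {I : ModelWithCorners ℝ E H} {N : Type*} [TopologicalSpace N] [ChartedSpace H N]
  [IsManifold I ∞ N]
  {E' : Type*} [NormedAddCommGroup E'] [NormedSpace ℝ E'] {H' : Type*} [TopologicalSpace H']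
  {I' : ModelWithCorners ℝ E' H'} {N' : Type*} [TopologicalSpace N'] [ChartedSpace H' N']
  {F : Type*} [NormedAddCommGroup F] [NormedSpace ℝ F]

/-- Smoothness of directional derivatives of functions depending on a parameter. -/
theorem contMDiff_diffAt_param {n m : ℕ∞} (hnm : n + 1 ≤ m) {Φ : N × X → F}
    (hΦ : ContMDiff (I.prod (𝓡 d)) 𝓘(ℝ, F) m Φ) {s : N' → N} (hs : ContMDiff I' I n s)
    {η : N' → TangentBundle (𝓡 d) X} (hη : ContMDiff I' (𝓡 d).tangent n η) :
    ContMDiff I' 𝓘(ℝ, F) n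
      (fun p => diffAt (fun x => Φ (s p, x)) (η p).proj (η p).2) := by
  have : IsManifold I (n + 1) N := IsManifold.of_le (n := ∞) (by norm_cast; exact le_top)
  have : IsManifold (𝓡 d) (n + 1) X := IsManifold.of_le (n := ∞) (by norm_cast; exact le_top)
  have : IsManifold I 1 N := IsManifold.of_le (n := ∞) (by norm_cast)
  let F₁ : N' → TangentBundle I N × TangentBundle (𝓡 d) X :=
    fun p => (TotalSpace.mk' E (s p) 0, η p)
  have S₁ : ContMDiff I' (I.tangent.prod (𝓡 d).tangent) n F₁ :=
    ((contMDiff_zeroSection ℝ (TangentSpace I : N → Type _)).comp hs).prodMk hη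
  have S₂ : ContMDiff (I.tangent.prod (𝓡 d).tangent) (I.prod (𝓡 d)).tangent n
    (equivTangentBundleProd I N (𝓡 d) X).symm := contMDiff_equivTangentBundleProd_symm
  have S₃ : ContMDiff (I.prod (𝓡 d)).tangent 𝓘(ℝ, F).tangent n
      (tangentMap (I.prod (𝓡 d)) 𝓘(ℝ, F) Φ) :=
    hΦ.contMDiff_tangentMap (m := n) (by exact_mod_cast hnm)
  have S₄ := (contMDiff_snd_tangentBundle_modelSpace F 𝓘(ℝ, F) (n := n)).comp
    ((S₃.comp S₂).comp S₁)
  have e : (fun p => diffAt (fun x => Φ (s p, x)) (η p).proj (η p).2) =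
      (fun q : TangentBundle 𝓘(ℝ, F) F => (q.2 : F)) ∘ ((tangentMap (I.prod (𝓡 d)) 𝓘(ℝ, F) Φ ∘
        (equivTangentBundleProd I N (𝓡 d) X).symm) ∘ F₁) := by
    funext p
    have hd : MDifferentiableAt (I.prod (𝓡 d)) 𝓘(ℝ, F) Φ (s p, (η p).proj) :=
      hΦ.mdifferentiable (by
        have : (1 : ℕ∞) ≤ m := le_trans le_add_self hnm
        have h2 : m ≠ 0 := by rintro rfl; simp at this
        exact_mod_cast h2) _
    have h3 := mfderiv_prod_eq_add_apply (v := ((0 : E), (show Eu d from (η p).2))) hd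
    refine Eq.trans ?_ h3.symm
    have h4 : ∀ (L : E →L[ℝ] F) (y : F), y = L 0 + y := fun L y => by simp
    exact h4 _ _
  rw [e]
  exact S₄

theorem contMDiff_diffAt {n m : ℕ∞} (hnm : n + 1 ≤ m) {f : X → F}
    (hf : ContMDiff (𝓡 d) 𝓘(ℝ, F) m f) {v : (x : X) → TangentSpace (𝓡 d) x}
    (hv : ContMDiff (𝓡 d) (𝓡 d).tangent n (fun x => (⟨x, v x⟩ : TangentBundle (𝓡 d) X))) :
    ContMDiff (𝓡 d) 𝓘(ℝ, F) n (fun x => diffAt f x (v x)) :=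
  contMDiff_diffAt_param (I := 𝓡 d) (I' := 𝓡 d) (N := X) hnm (Φ := fun z : X × X => f z.2)
    (hf.comp contMDiff_snd) (s := id) contMDiff_id hv

end ParametricDerivative

/-! ### Derivatives along currents as sums of partial differentials -/

section Derivatives

variable {d k l : ℕ} {X : Type*} [TopologicalSpace X] [ChartedSpace (Eu d) X]
  [IsManifold (𝓡 d) ∞ X]
  {M : Type*} [TopologicalSpace M] [ChartedSpace (Eu k) M] [IsManifold (𝓡 k) ∞ M]
  {G : Type*} [TopologicalSpace G] [ChartedSpace (Eu l) G] [Group G]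
  [LieGroup (𝓡 l) ∞ G] [MulAction G M] [ContMDiffSMul (𝓡 l) (𝓡 k) ∞ G M]

theorem contMDiff_orbit {n m : ℕ∞} (hnm : n ≤ m) {f : X × M → ℝ}
    (hf : ContMDiff ((𝓡 d).prod (𝓡 k)) 𝓘(ℝ, ℝ) m f) :
    ContMDiff (((𝓡 d).prod (𝓡 k)).prod (𝓡 l)) 𝓘(ℝ, ℝ) n
      (fun p : (X × M) × G => f (p.1.1, p.2 • p.1.2)) := by
  refine (hf.of_le (by exact_mod_cast hnm)).comp ?_
  refine (contMDiff_fst.comp contMDiff_fst).prodMk ?_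
  exact (ContMDiff.smul (n := n) (I := 𝓡 l) (I' := 𝓡 k) contMDiff_snd
    (contMDiff_snd.comp contMDiff_fst))

theorem contMDiff_gradX {n m : ℕ∞} (hnm : n + 1 ≤ m) {f : X × M → ℝ}
    (hf : ContMDiff ((𝓡 d).prod (𝓡 k)) 𝓘(ℝ, ℝ) m f) {v : (x : X) → TangentSpace (𝓡 d) x}
    (hv : ContMDiff (𝓡 d) (𝓡 d).tangent n (fun x => (⟨x, v x⟩ : TangentBundle (𝓡 d) X))) :
    ContMDiff ((𝓡 d).prod (𝓡 k)) 𝓘(ℝ, ℝ) n (fun z => gradX d f z (v z.1)) :=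
  contMDiff_diffAt_param (I := 𝓡 k) (I' := (𝓡 d).prod (𝓡 k)) (N := M) (N' := X × M) hnm
    (Φ := fun z : M × X => f (z.2, z.1)) (hf.comp (contMDiff_snd.prodMk contMDiff_fst))
    (s := Prod.snd) contMDiff_snd (η := fun z => ⟨z.1, v z.1⟩) (hv.comp contMDiff_fst)

theorem contMDiff_gradM_const {n m : ℕ∞} (hnm : n + 1 ≤ m) {f : X × M → ℝ}
    (hf : ContMDiff ((𝓡 d).prod (𝓡 k)) 𝓘(ℝ, ℝ) m f) (w : Eu l) :
    ContMDiff ((𝓡 d).prod (𝓡 k)) 𝓘(ℝ, ℝ) n (fun z => gradM l G f z w) :=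
  contMDiff_diffAt_param (I := (𝓡 d).prod (𝓡 k)) (I' := (𝓡 d).prod (𝓡 k)) (N := X × M)
    (N' := X × M) (X := G) hnm (contMDiff_orbit le_rfl hf) (s := id) contMDiff_id
    (η := fun _ => ⟨1, w⟩) contMDiff_const

theorem clm_apply_eq_sum {F : Type*} [NormedAddCommGroup F] [NormedSpace ℝ F] (L : Eu l →L[ℝ] F)
    (w : Eu l) : L w = ∑ i, w i • L (EuclideanSpace.single i 1) := by
  conv_lhs => rw [← (EuclideanSpace.basisFun (Fin l) ℝ).sum_repr w]
  simp

/-- Expanding `u` in the standard basis of `𝔤` reduces to constant directions. -/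
theorem contMDiff_gradM {n m : ℕ∞} (hnm : n + 1 ≤ m) {f : X × M → ℝ}
    (hf : ContMDiff ((𝓡 d).prod (𝓡 k)) 𝓘(ℝ, ℝ) m f) {u : X → Eu l}
    (hu : ContMDiff (𝓡 d) 𝓘(ℝ, Eu l) n u) :
    ContMDiff ((𝓡 d).prod (𝓡 k)) 𝓘(ℝ, ℝ) n (fun z => gradM l G f z (u z.1)) := by
  have e : (fun z : X × M => gradM l G f z (u z.1)) =
      fun z => ∑ i, (u z.1) i * gradM l G f z (EuclideanSpace.single i 1) := by
    funext z
    rw [clm_apply_eq_sum]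
    simp
  rw [e]
  refine contMDiff_finsetSum fun i _ => ContMDiff.mul ?_ (contMDiff_gradM_const hnm hf _)
  exact ((EuclideanSpace.proj (𝕜 := ℝ) i).contMDiff.comp hu).comp contMDiff_fst

section PointDerivative

variable [T2Space X] [T2Space G]

/-- The differential of `exp` at `0` is the identity and `t u(ψₜ x)` has initial velocity `u(x)`. -/
theorem hasMFDerivAt_lieExp_flow {a : FieldPair d l X G} (ha : IsCurrent a) (x : X) :
    HasMFDerivAt 𝓘(ℝ, ℝ) (𝓡 l) (fun t : ℝ => (lieExp (t • a.2 (flow a.1 t x)) : G)) 0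
      ((1 : ℝ →L[ℝ] ℝ).smulRight (show Eu l from a.2 x)) := by
  have hv : ContMDiff (𝓡 d) (𝓡 d).tangent 1
      (fun x => (⟨x, a.1 x⟩ : TangentBundle (𝓡 d) X)) := ha.smooth_fst.of_le (by simp)
  have hu : HasDerivAt (fun t : ℝ => (show Eu l from a.2 (flow a.1 t x)))
      (diffAt (fun x => (show Eu l from a.2 x)) (flow a.1 0 x) (a.1 x)) 0 :=
    hasDerivAt_comp_of_hasMFDerivAt (f := fun x => (show Eu l from a.2 x))
      (ha.smooth_snd.mdifferentiable (by simp) _) (hasMFDerivAt_flow hv ha.compact_fst x)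
  have hw : HasDerivAt (fun t : ℝ => t • (show Eu l from a.2 (flow a.1 t x)))
      (show Eu l from a.2 x) 0 := by
    have := hasDerivAt_smul_self_zero hu
    rwa [(flow_spec hv ha.compact_fst x).1] at this
  have h0 : (fun t : ℝ => t • (show Eu l from a.2 (flow a.1 t x))) 0 = 0 := zero_smul _ _
  have h1 := (h0 ▸ hasMFDerivAt_lieExp (l := l) (G := G) : HasMFDerivAt (𝓡 l) (𝓡 l)
    (fun w : Eu l => (lieExp (show GroupLieAlgebra (𝓡 l) G from w) : G))
    ((fun t : ℝ => t • (show Eu l from a.2 (flow a.1 t x))) 0)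
      (ContinuousLinearMap.id ℝ (Eu l))).comp (0 : ℝ) hw.hasFDerivAt.hasMFDerivAt
  have e : (1 : ℝ →L[ℝ] ℝ).smulRight (show Eu l from a.2 x) =
      (ContinuousLinearMap.id ℝ (Eu l)).comp
        (ContinuousLinearMap.toSpanSingleton ℝ (show Eu l from a.2 x)) :=
    smulRight_one_apply_eq_comp_toSpanSingleton (ContinuousLinearMap.id ℝ (Eu l)) _
  exact e ▸ h1

theorem currentMap_zero {a : FieldPair d l X G} (ha : IsCurrent a) (z : X × M) :
    currentMap a 0 z = z := by
  have hv : ContMDiff (𝓡 d) (𝓡 d).tangent 1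
      (fun x => (⟨x, a.1 x⟩ : TangentBundle (𝓡 d) X)) := ha.smooth_fst.of_le (by simp)
  have h : (lieExp (0 : GroupLieAlgebra (𝓡 l) G) : G) = 1 := lieExp_zero
  simp only [currentMap, zero_smul, h, one_smul, (flow_spec hv ha.compact_fst _).1]

/-- The directional derivative along a current in terms of partial differentials. -/
theorem hasDerivAt_currentMap {a : FieldPair d l X G} (ha : IsCurrent a) {f : X × M → ℝ}
    (hf : ContMDiff ((𝓡 d).prod (𝓡 k)) 𝓘(ℝ, ℝ) 1 f) (z : X × M) :
    HasDerivAt (fun t : ℝ => f (currentMap a t z))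
      (gradX d f z (a.1 z.1) + gradM l G f z (a.2 z.1)) 0 := by
  have hv : ContMDiff (𝓡 d) (𝓡 d).tangent 1
      (fun x => (⟨x, a.1 x⟩ : TangentBundle (𝓡 d) X)) := ha.smooth_fst.of_le (by simp)
  have h1 := (hasMFDerivAt_flow hv ha.compact_fst z.1).prodMk
    (hasMFDerivAt_lieExp_flow ha z.1)
  -- Along the current, `f` is the function `Φ` along a curve in `X × G` through `(x, 1)`; its
  -- differential there splits into the two partial ones.
  let Φ : X × G → ℝ := fun q => f (q.1, q.2 • z.2)
  have hΦ : ContMDiff ((𝓡 d).prod (𝓡 l)) 𝓘(ℝ, ℝ) 1 Φ :=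
    (contMDiff_orbit (n := 1) (m := 1) le_rfl hf).comp
      ((contMDiff_fst.prodMk contMDiff_const).prodMk contMDiff_snd)
  have h0 : (flow a.1 0 z.1, (lieExp ((0 : ℝ) • a.2 (flow a.1 0 z.1)) : G)) = (z.1, 1) := by
    rw [zero_smul, lieExp_zero, (flow_spec hv ha.compact_fst _).1]
  have hd : MDifferentiableAt ((𝓡 d).prod (𝓡 l)) 𝓘(ℝ, ℝ) Φ (z.1, 1) :=
    hΦ.mdifferentiable (by simp) _
  have h2 := (h0 ▸ hd.hasMFDerivAt : HasMFDerivAt ((𝓡 d).prod (𝓡 l)) 𝓘(ℝ, ℝ) Φ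
    (flow a.1 0 z.1, (lieExp ((0 : ℝ) • a.2 (flow a.1 0 z.1)) : G))
    (show Eu d × Eu l →L[ℝ] ℝ from
      mfderiv ((𝓡 d).prod (𝓡 l)) 𝓘(ℝ, ℝ) Φ (z.1, 1))).comp (0 : ℝ) h1
  have h3 : HasFDerivAt (Φ ∘ fun t : ℝ => (flow a.1 t z.1, (lieExp (t • a.2 (flow a.1 t z.1)) : G)))
      ((show Eu d × Eu l →L[ℝ] ℝ from mfderiv ((𝓡 d).prod (𝓡 l)) 𝓘(ℝ, ℝ) Φ (z.1, 1)).comp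
        ((1 : ℝ →L[ℝ] ℝ).smulRight ((show Eu d from a.1 z.1), (show Eu l from a.2 z.1)))) 0 := by
    have e : (1 : ℝ →L[ℝ] ℝ).smulRight ((show Eu d from a.1 z.1), (show Eu l from a.2 z.1)) =
      ((1 : ℝ →L[ℝ] ℝ).smulRight (show Eu d from a.1 z.1)).prod
        ((1 : ℝ →L[ℝ] ℝ).smulRight (show Eu l from a.2 z.1)) :=
      smulRight_one_prod _ _
    rw [e]
    exact h2.hasFDerivAt
  have h4 := hasDerivAt_of_hasFDerivAt_comp_smulRight h3
  have h5 := mfderiv_prod_eq_add_apply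
    (v := ((show Eu d from a.1 z.1), (show Eu l from a.2 z.1))) hd
  have h6 : (show Eu d × Eu l →L[ℝ] ℝ from mfderiv ((𝓡 d).prod (𝓡 l)) 𝓘(ℝ, ℝ) Φ (z.1, 1))
      ((show Eu d from a.1 z.1), (show Eu l from a.2 z.1)) =
      gradX d f z (a.1 z.1) + gradM l G f z (a.2 z.1) := by
    refine h5.trans ?_
    have e1 : (fun x => Φ (x, (1 : G))) = fun x => f (x, z.2) := by
      funext x; simp [Φ]
    have : ∀ g : X → ℝ, g = (fun x => f (x, z.2)) →
        (show Eu d →L[ℝ] ℝ from mfderiv (𝓡 d) 𝓘(ℝ, ℝ) g z.1) (a.1 z.1) = gradX d f z (a.1 z.1) := by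
      rintro _ rfl; rfl
    exact congrArg₂ (· + ·) (this _ e1) rfl
  rw [h6] at h4
  exact h4

theorem pointDeriv_eq {a : FieldPair d l X G} (ha : IsCurrent a) {f : X × M → ℝ}
    (hf : ContMDiff ((𝓡 d).prod (𝓡 k)) 𝓘(ℝ, ℝ) 1 f) (z : X × M) :
    pointDeriv a f z = gradX d f z (a.1 z.1) + gradM l G f z (a.2 z.1) :=
  (hasDerivAt_currentMap ha hf z).deriv

theorem contMDiff_pointDeriv {n m : ℕ∞} (hnm : n + 1 ≤ m) {a : FieldPair d l X G}
    (ha : IsCurrent a) {f : X × M → ℝ} (hf : ContMDiff ((𝓡 d).prod (𝓡 k)) 𝓘(ℝ, ℝ) m f) :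
    ContMDiff ((𝓡 d).prod (𝓡 k)) 𝓘(ℝ, ℝ) n (pointDeriv a f) := by
  have h1 : (1 : ℕ∞) ≤ m := le_trans le_add_self hnm
  have e : pointDeriv a f = fun z => gradX d f z (a.1 z.1) + gradM l G f z (a.2 z.1) :=
    funext fun z => pointDeriv_eq ha (hf.of_le (by exact_mod_cast h1)) z
  rw [e]
  exact (contMDiff_gradX hnm hf (ha.smooth_fst.of_le (by norm_cast; exact le_top))).add
    (contMDiff_gradM hnm hf (ha.smooth_snd.of_le (by norm_cast; exact le_top)))

end PointDerivative

end Derivatives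

/-! ### Calculus rules for differentials on a manifold -/

section DiffAt

variable {d : ℕ} {X : Type*} [TopologicalSpace X] [ChartedSpace (Eu d) X]
  [IsManifold (𝓡 d) ∞ X] {F : Type*} [NormedAddCommGroup F] [NormedSpace ℝ F]

/-- The coordinates of a tangent vector in the preferred chart. -/
def chartVec (x : X) (ξ : Eu d) : Eu d :=
  (show Eu d →L[ℝ] Eu d from mfderiv (𝓡 d) (𝓡 d) (chartAt (Eu d) x) x) ξ

theorem differentiableAt_comp_chartAt_symm {f : X → F} {x : X}
    (hf : MDifferentiableAt (𝓡 d) 𝓘(ℝ, F) f x) :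
    DifferentiableAt ℝ (f ∘ (chartAt (Eu d) x).symm) (chartAt (Eu d) x x) := by
  have hx := mem_chart_source (Eu d) x
  rw [← mdifferentiableAt_iff_differentiableAt]
  refine MDifferentiableAt.comp _ ?_ (mdifferentiableAt_chartAt_symm ((chartAt (Eu d) x).map_source hx))
  rwa [(chartAt (Eu d) x).left_inv hx]

theorem diffAt_eq_fderiv {f : X → F} {x : X} (hf : MDifferentiableAt (𝓡 d) 𝓘(ℝ, F) f x)
    (ξ : Eu d) : diffAt f x ξ =
      fderiv ℝ (f ∘ (chartAt (Eu d) x).symm) (chartAt (Eu d) x x) (chartVec x ξ) := by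
  have hx := mem_chart_source (Eu d) x
  have hy := (chartAt (Eu d) x).map_source hx
  have h := diffAt_apply_eq_fderiv (v := fun _ => ξ) (f := f) hy
    (by rwa [(chartAt (Eu d) x).left_inv hx])
  rw [(chartAt (Eu d) x).left_inv hx] at h
  have e : ∀ x' : X, x' = x → (show Eu d →L[ℝ] Eu d from
      mfderiv (𝓡 d) (𝓡 d) (chartAt (Eu d) x) x') ξ = chartVec x ξ := by
    rintro _ rfl
    rfl
  exact h.trans (congrArg _ (e _ ((chartAt (Eu d) x).left_inv hx)))

theorem diffAt_congr {f g : X → F} {x : X} (h : f =ᶠ[𝓝 x] g) : (diffAt f x : Eu d →L[ℝ] F) = diffAt g x :=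
  h.mfderiv_eq

theorem diffAt_const (c : F) (x : X) : (diffAt (fun _ : X => c) x : Eu d →L[ℝ] F) = 0 := mfderiv_const

theorem diffAt_add {f g : X → F} {x : X} (hf : MDifferentiableAt (𝓡 d) 𝓘(ℝ, F) f x)
    (hg : MDifferentiableAt (𝓡 d) 𝓘(ℝ, F) g x) (ξ : Eu d) :
    diffAt (fun x => f x + g x) x ξ = diffAt f x ξ + diffAt g x ξ := by
  have h := mfderiv_add hf hg
  exact congrArg (fun L : Eu d →L[ℝ] F => L ξ) h

theorem diffAt_sub {f g : X → F} {x : X} (hf : MDifferentiableAt (𝓡 d) 𝓘(ℝ, F) f x)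
    (hg : MDifferentiableAt (𝓡 d) 𝓘(ℝ, F) g x) (ξ : Eu d) :
    diffAt (fun x => f x - g x) x ξ = diffAt f x ξ - diffAt g x ξ := by
  have h := mfderiv_sub hf hg
  exact congrArg (fun L : Eu d →L[ℝ] F => L ξ) h

theorem diffAt_bilinear {F₁ F₂ : Type*} [NormedAddCommGroup F₁] [NormedSpace ℝ F₁]
    [NormedAddCommGroup F₂] [NormedSpace ℝ F₂] (B : F₁ →L[ℝ] F₂ →L[ℝ] F) {f : X → F₁} {g : X → F₂}
    {x : X} (hf : MDifferentiableAt (𝓡 d) 𝓘(ℝ, F₁) f x)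
    (hg : MDifferentiableAt (𝓡 d) 𝓘(ℝ, F₂) g x) (ξ : Eu d) :
    diffAt (fun x => B (f x) (g x)) x ξ = B (diffAt f x ξ) (g x) + B (f x) (diffAt g x ξ) := by
  have hx := mem_chart_source (Eu d) x
  have h1 := differentiableAt_comp_chartAt_symm hf
  have h2 := differentiableAt_comp_chartAt_symm hg
  have hd : MDifferentiableAt (𝓡 d) 𝓘(ℝ, F) (fun x => B (f x) (g x)) x := by
    have hB : Differentiable ℝ (fun p : F₁ × F₂ => B p.1 p.2) :=
      B.isBoundedBilinearMap.differentiable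
    exact (hB.differentiableAt.mdifferentiableAt).comp x (hf.prodMk_space hg)
  have h3 := (B.hasFDerivAt_of_bilinear h1.hasFDerivAt h2.hasFDerivAt).fderiv
  rw [diffAt_eq_fderiv hd, diffAt_eq_fderiv hf, diffAt_eq_fderiv hg]
  have e : (fun x => B (f x) (g x)) ∘ (chartAt (Eu d) x).symm =
    fun y => B ((f ∘ (chartAt (Eu d) x).symm) y) ((g ∘ (chartAt (Eu d) x).symm) y) := rfl
  rw [e, h3]
  simp [(chartAt (Eu d) x).left_inv hx, add_comm]

/-- The bracket of vector fields is the commutator of derivations. -/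
theorem diffAt_mlieBracket {f : X → F} (hf : ContMDiff (𝓡 d) 𝓘(ℝ, F) 2 f)
    {v w : (x : X) → TangentSpace (𝓡 d) x}
    (hv : ContMDiff (𝓡 d) (𝓡 d).tangent 1 (fun x => (⟨x, v x⟩ : TangentBundle (𝓡 d) X)))
    (hw : ContMDiff (𝓡 d) (𝓡 d).tangent 1 (fun x => (⟨x, w x⟩ : TangentBundle (𝓡 d) X)))
    (x : X) : diffAt f x (VectorField.mlieBracket (𝓡 d) v w x) =
      diffAt (fun y => diffAt f y (w y)) x (v x) - diffAt (fun y => diffAt f y (v y)) x (w x) := by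
  set φ := chartAt (Eu d) x
  have hx : x ∈ φ.source := mem_chart_source (Eu d) x
  have hy : φ x ∈ φ.target := φ.map_source hx
  have hf1 : ∀ z, MDifferentiableAt (𝓡 d) 𝓘(ℝ, F) f z := hf.mdifferentiable (by simp)
  have main : ∀ u : (x : X) → TangentSpace (𝓡 d) x,
      diffAt f x (u x) = fderiv ℝ (f ∘ φ.symm) (φ x) (chartField x u (φ x)) := fun u => by
    have := diffAt_apply_eq_fderiv hy (hf1 _) u
    rwa [φ.left_inv hx] at this
  have hF : ContDiffAt ℝ 2 (f ∘ φ.symm) (φ x) :=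
    (contDiffOn_comp_chartAt_symm (n := 2) hf x).contDiffAt (φ.open_target.mem_nhds hy)
  have hdF : DifferentiableAt ℝ (fderiv ℝ (f ∘ φ.symm)) (φ x) :=
    (hF.fderiv_right (m := 1) (by norm_num)).differentiableAt (by simp)
  have snd : ∀ u s : (x : X) → TangentSpace (𝓡 d) x,
      ContMDiff (𝓡 d) (𝓡 d).tangent 1 (fun x => (⟨x, u x⟩ : TangentBundle (𝓡 d) X)) →
      diffAt (fun y => diffAt f y (u y)) x (s x) =
        fderiv ℝ (fderiv ℝ (f ∘ φ.symm)) (φ x) (chartField x s (φ x)) (chartField x u (φ x)) +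
        fderiv ℝ (f ∘ φ.symm) (φ x) (fderiv ℝ (chartField x u) (φ x) (chartField x s (φ x))) := by
    intro u s hu
    have h1 : MDifferentiable (𝓡 d) 𝓘(ℝ, F) (fun y => diffAt f y (u y)) :=
      (contMDiff_diffAt (n := 1) (m := 2) le_rfl hf hu).mdifferentiable (by simp)
    have h2 := diffAt_apply_eq_fderiv hy (h1 _) s
    rw [φ.left_inv hx] at h2
    rw [h2]
    have e : (fun y => diffAt f y (u y)) ∘ φ.symm =ᶠ[𝓝 (φ x)]
        fun y => fderiv ℝ (f ∘ φ.symm) y (chartField x u y) := by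
      filter_upwards [φ.open_target.mem_nhds hy] with z hz
      exact diffAt_apply_eq_fderiv hz (hf1 _) u
    have hcu : DifferentiableAt ℝ (chartField x u) (φ x) :=
      (contDiffAt_chartField (n := 1) hu hy).differentiableAt (by simp)
    rw [e.fderiv_eq, (hdF.hasFDerivAt.clm_apply hcu.hasFDerivAt).fderiv]
    simp [add_comm]
  -- The second-order terms cancel by symmetry; the first-order terms that remain are the coordinate
  -- formula of the bracket.
  have hsymm : IsSymmSndFDerivAt ℝ (f ∘ φ.symm) (φ x) := hF.isSymmSndFDerivAt (by simp)
  rw [main, snd w v hw, snd v w hv, chartField_mlieBracket hv hw hy, map_sub,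
    hsymm.eq (chartField x v (φ x)) (chartField x w (φ x))]
  abel

end DiffAt

/-! ### Symmetry of mixed partial derivatives on products -/

section MixedPartials

variable {d e : ℕ} {X : Type*} [TopologicalSpace X] [ChartedSpace (Eu d) X]
  [IsManifold (𝓡 d) ∞ X] {Y : Type*} [TopologicalSpace Y] [ChartedSpace (Eu e) Y]
  [IsManifold (𝓡 e) ∞ Y]

/-- Mixed partial derivatives on a product of manifolds commute. -/
theorem diffAt_diffAt_comm {Φ : X × Y → ℝ}
    (hΦ : ContMDiff ((𝓡 d).prod (𝓡 e)) 𝓘(ℝ, ℝ) 2 Φ) (x : X) (y : Y) (ξ : Eu d) (η : Eu e) :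
    diffAt (fun x' => diffAt (fun y' => Φ (x', y')) y η) x ξ =
      diffAt (fun y' => diffAt (fun x' => Φ (x', y')) x ξ) y η := by
  set φ := chartAt (Eu d) x
  set ψ := chartAt (Eu e) y
  have hx : x ∈ φ.source := mem_chart_source (Eu d) x
  have hy : y ∈ ψ.source := mem_chart_source (Eu e) y
  have hφ : φ x ∈ φ.target := φ.map_source hx
  have hψ : ψ y ∈ ψ.target := ψ.map_source hy
  let Ψ : Eu d × Eu e → ℝ := fun p => Φ (φ.symm p.1, ψ.symm p.2)
  have hsm : ContMDiffOn ((𝓡 d).prod (𝓡 e)) 𝓘(ℝ, ℝ) 2 Ψ (φ.target ×ˢ ψ.target) := by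
    refine hΦ.comp_contMDiffOn (ContMDiffOn.prodMk ?_ ?_)
    · exact ((contMDiffOn_chart_symm (I := 𝓡 d) (x := x)).of_le (by norm_cast)).comp
        contMDiffOn_fst fun p hp => hp.1
    · exact ((contMDiffOn_chart_symm (I := 𝓡 e) (x := y)).of_le (by norm_cast)).comp
        contMDiffOn_snd fun p hp => hp.2
  have hΨ : ∀ p ∈ φ.target ×ˢ ψ.target, ContDiffAt ℝ 2 Ψ p := by
    intro p hp
    have h := hsm.contMDiffAt ((φ.open_target.prod ψ.open_target).mem_nhds hp)
    rw [← contMDiffAt_iff_contDiffAt, modelWithCornersSelf_prod, ← chartedSpaceSelf_prod]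
    exact h
  have hdX : ∀ y', MDifferentiable (𝓡 d) 𝓘(ℝ, ℝ) (fun x' => Φ (x', y')) := fun y' =>
    (hΦ.comp (contMDiff_id.prodMk contMDiff_const)).mdifferentiable (by simp)
  have hdY : ∀ x', MDifferentiable (𝓡 e) 𝓘(ℝ, ℝ) (fun y' => Φ (x', y')) := fun x' =>
    (hΦ.comp (contMDiff_const.prodMk contMDiff_id)).mdifferentiable (by simp)
  have hp₀ : ((φ x, ψ y) : Eu d × Eu e) ∈ φ.target ×ˢ ψ.target := ⟨hφ, hψ⟩
  have hd2 : DifferentiableAt ℝ (fderiv ℝ Ψ) (φ x, ψ y) :=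
    ((hΨ _ hp₀).fderiv_right (m := 1) (by norm_num)).differentiableAt (by simp)
  have hX : MDifferentiable (𝓡 d) 𝓘(ℝ, ℝ) (fun x' => diffAt (fun y' => Φ (x', y')) y η) :=
    (contMDiff_diffAt_param (n := 1) (m := 2) (I := 𝓡 d) (I' := 𝓡 d) le_rfl hΦ (s := id)
      contMDiff_id (η := fun _ => (⟨y, η⟩ : TangentBundle (𝓡 e) Y)) contMDiff_const).mdifferentiable
      (by simp)
  have hY : MDifferentiable (𝓡 e) 𝓘(ℝ, ℝ) (fun y' => diffAt (fun x' => Φ (x', y')) x ξ) :=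
    (contMDiff_diffAt_param (n := 1) (m := 2) (I := 𝓡 e) (I' := 𝓡 e) le_rfl
      (Φ := fun p : Y × X => Φ (p.2, p.1)) (hΦ.comp (contMDiff_snd.prodMk contMDiff_fst)) (s := id)
      contMDiff_id (η := fun _ => (⟨x, ξ⟩ : TangentBundle (𝓡 d) X)) contMDiff_const).mdifferentiable
      (by simp)
  have hs : IsSymmSndFDerivAt ℝ Ψ (φ x, ψ y) := (hΨ _ hp₀).isSymmSndFDerivAt (by simp)
  have eL : fderiv ℝ ((fun x' => diffAt (fun y' => Φ (x', y')) y η) ∘ φ.symm) (φ x) (chartVec x ξ) =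
      fderiv ℝ (fderiv ℝ Ψ) (φ x, ψ y) (chartVec x ξ, 0) (0, chartVec y η) := by
    have e1 : (fun x' => diffAt (fun y' => Φ (x', y')) y η) ∘ φ.symm =ᶠ[𝓝 (φ x)]
        fun s => fderiv ℝ Ψ (s, ψ y) (0, chartVec y η) := by
      filter_upwards [φ.open_target.mem_nhds hφ] with s hs
      rw [Function.comp_apply, diffAt_eq_fderiv (hdY _ _)]
      have h1 : HasFDerivAt (fun t => Ψ (s, t)) ((fderiv ℝ Ψ (s, ψ y)).comp
          (ContinuousLinearMap.inr ℝ (Eu d) (Eu e))) (ψ y) :=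
        (((hΨ _ ⟨hs, hψ⟩).differentiableAt (by simp)).hasFDerivAt).comp (ψ y)
          (hasFDerivAt_prodMk_right s (ψ y))
      change fderiv ℝ (fun t => Ψ (s, t)) (ψ y) (chartVec y η) = _
      rw [h1.fderiv]
      simp
    have h2 : HasFDerivAt (fun s => fderiv ℝ Ψ (s, ψ y))
        ((fderiv ℝ (fderiv ℝ Ψ) (φ x, ψ y)).comp (ContinuousLinearMap.inl ℝ (Eu d) (Eu e))) (φ x) :=
      hd2.hasFDerivAt.comp (φ x) (hasFDerivAt_prodMk_left (φ x) (ψ y))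
    rw [e1.fderiv_eq, (h2.clm_apply (hasFDerivAt_const _ _)).fderiv]
    simp
  have eR : fderiv ℝ ((fun y' => diffAt (fun x' => Φ (x', y')) x ξ) ∘ ψ.symm) (ψ y) (chartVec y η) =
      fderiv ℝ (fderiv ℝ Ψ) (φ x, ψ y) (0, chartVec y η) (chartVec x ξ, 0) := by
    have e1 : (fun y' => diffAt (fun x' => Φ (x', y')) x ξ) ∘ ψ.symm =ᶠ[𝓝 (ψ y)]
        fun t => fderiv ℝ Ψ (φ x, t) (chartVec x ξ, 0) := by
      filter_upwards [ψ.open_target.mem_nhds hψ] with t ht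
      rw [Function.comp_apply, diffAt_eq_fderiv (hdX _ _)]
      have h1 : HasFDerivAt (fun s => Ψ (s, t)) ((fderiv ℝ Ψ (φ x, t)).comp
          (ContinuousLinearMap.inl ℝ (Eu d) (Eu e))) (φ x) :=
        (((hΨ _ ⟨hφ, ht⟩).differentiableAt (by simp)).hasFDerivAt).comp (φ x)
          (hasFDerivAt_prodMk_left (φ x) t)
      change fderiv ℝ (fun s => Ψ (s, t)) (φ x) (chartVec x ξ) = _
      rw [h1.fderiv]
      simp
    have h2 : HasFDerivAt (fun t => fderiv ℝ Ψ (φ x, t))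
        ((fderiv ℝ (fderiv ℝ Ψ) (φ x, ψ y)).comp (ContinuousLinearMap.inr ℝ (Eu d) (Eu e))) (ψ y) :=
      hd2.hasFDerivAt.comp (ψ y) (hasFDerivAt_prodMk_right (φ x) (ψ y))
    rw [e1.fderiv_eq, (h2.clm_apply (hasFDerivAt_const _ _)).fderiv]
    simp
  rw [diffAt_eq_fderiv (hX x), diffAt_eq_fderiv (hY y), eL, eR]
  exact hs.eq _ _

end MixedPartials

/-! ### Right-invariant vector fields and the bracket of the Lie algebra of `G` -/

section RightInvariant

open VectorField

variable {l : ℕ} {G : Type*} [TopologicalSpace G] [T2Space G] [ChartedSpace (Eu l) G] [Group G]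
  [LieGroup (𝓡 l) ∞ G]

/-- The value at `g` is the tangent map of the multiplication on the pair of `w` at `1` and `0` at
`g`. -/
theorem contMDiff_rightInvariantField (w : GroupLieAlgebra (𝓡 l) G) :
    ContMDiff (𝓡 l) (𝓡 l).tangent ∞
      (fun g => (⟨g, rightInvariantField w g⟩ : TangentBundle (𝓡 l) G)) := by
  let F₁ : G → TangentBundle (𝓡 l) G × TangentBundle (𝓡 l) G :=
    fun g => (TotalSpace.mk' (Eu l) 1 w, TotalSpace.mk' (Eu l) g 0)
  have S₁ : ContMDiff (𝓡 l) ((𝓡 l).tangent.prod (𝓡 l).tangent) ∞ F₁ :=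
    contMDiff_const.prodMk (contMDiff_zeroSection ℝ (TangentSpace (𝓡 l) : G → Type _))
  have S₂ : ContMDiff ((𝓡 l).tangent.prod (𝓡 l).tangent) ((𝓡 l).prod (𝓡 l)).tangent ∞
    (equivTangentBundleProd (𝓡 l) G (𝓡 l) G).symm := contMDiff_equivTangentBundleProd_symm
  have hm : ContMDiff ((𝓡 l).prod (𝓡 l)) (𝓡 l) ∞ (fun p : G × G => p.1 * p.2) := contMDiff_mul _ _
  have S₃ : ContMDiff ((𝓡 l).prod (𝓡 l)).tangent (𝓡 l).tangent ∞
      (tangentMap ((𝓡 l).prod (𝓡 l)) (𝓡 l) (fun p : G × G => p.1 * p.2)) :=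
    hm.contMDiff_tangentMap (m := ∞) (by simp)
  have e : (fun g => (⟨g, rightInvariantField w g⟩ : TangentBundle (𝓡 l) G)) =
      (tangentMap ((𝓡 l).prod (𝓡 l)) (𝓡 l) (fun p : G × G => p.1 * p.2) ∘
        (equivTangentBundleProd (𝓡 l) G (𝓡 l) G).symm) ∘ F₁ := by
    funext g
    have h3 := mfderiv_prod_eq_add_apply (v := ((show Eu l from w), (0 : Eu l)))
      (hm.mdifferentiable (by simp) (1, g))
    have h4 : ∀ (L : Eu l →L[ℝ] Eu l) (y : Eu l), y = y + L 0 := fun L y => by simp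
    have h5 : ∀ (g' : G) (ξ : TangentSpace (𝓡 l) g) (ξ' : TangentSpace (𝓡 l) g'), g = g' →
        (show Eu l from ξ) = (show Eu l from ξ') →
        (⟨g, ξ⟩ : TangentBundle (𝓡 l) G) = ⟨g', ξ'⟩ := by
      rintro _ ξ ξ' rfl h
      exact congrArg _ h
    refine h5 _ _ _ (one_mul g).symm (Eq.trans ?_ h3.symm)
    exact h4 _ _
  rw [e]
  exact (S₃.comp S₂).comp S₁

theorem mdifferentiableAt_rightInvariantField (w : GroupLieAlgebra (𝓡 l) G) (g : G) :
    MDifferentiableAt (𝓡 l) (𝓡 l).tangent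
      (fun g => (⟨g, rightInvariantField w g⟩ : TangentBundle (𝓡 l) G)) g :=
  (contMDiff_rightInvariantField w).mdifferentiable (by simp) g

theorem rightInvariantField_add (w₁ w₂ : GroupLieAlgebra (𝓡 l) G) :
    rightInvariantField (w₁ + w₂) = rightInvariantField w₁ + rightInvariantField w₂ :=
  funext fun _ => map_add (show Eu l →L[ℝ] Eu l from _) (show Eu l from w₁) (show Eu l from w₂)

theorem rightInvariantField_smul (c : ℝ) (w : GroupLieAlgebra (𝓡 l) G) :
    rightInvariantField (c • w) = c • rightInvariantField w :=
  funext fun _ => map_smul (show Eu l →L[ℝ] Eu l from _) c (show Eu l from w)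

theorem inverse_mfderiv_mul_right {g h : G} :
    (mfderiv (𝓡 l) (𝓡 l) (fun b => b * g) h).inverse =
      mfderiv (𝓡 l) (𝓡 l) (fun b => b * g⁻¹) (h * g) := by
  have A : mfderiv (𝓡 l) (𝓡 l) ((fun x => x * g⁻¹) ∘ (fun x => x * g)) h =
      ContinuousLinearMap.id _ _ := by
    have : (fun x => x * g⁻¹) ∘ (fun x => x * g) = id := by ext x; simp
    rw [this, id_eq, mfderiv_id]
  rw [mfderiv_comp (I' := 𝓡 l) _ (mdifferentiableAt_mul_right _ _)
    (mdifferentiableAt_mul_right _ _)] at A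
  have A' : mfderiv (𝓡 l) (𝓡 l) ((fun x => x * g) ∘ (fun x => x * g⁻¹)) (h * g) =
      ContinuousLinearMap.id _ _ := by
    have : (fun x => x * g) ∘ (fun x => x * g⁻¹) = id := by ext x; simp
    rw [this, id_eq, mfderiv_id]
  rw [mfderiv_comp (I' := 𝓡 l) _ (mdifferentiableAt_mul_right _ _)
    (mdifferentiableAt_mul_right _ _), mul_inv_cancel_right h g] at A'
  exact ContinuousLinearMap.inverse_eq A' A

theorem mpullback_rightInvariantField (g : G) (w : GroupLieAlgebra (𝓡 l) G) :
    mpullback (𝓡 l) (𝓡 l) (fun x => x * g) (rightInvariantField w) = rightInvariantField w := by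
  ext h
  simp only [mpullback, inverse_mfderiv_mul_right, rightInvariantField]
  have D : (fun x => x * h) = (fun b => b * g⁻¹) ∘ (fun x => x * (h * g)) := by
    ext x; simp [mul_assoc]
  rw [D, mfderiv_comp (I' := 𝓡 l)]
  · congr 2
    simp
  · exact mdifferentiableAt_mul_right _ _
  · exact mdifferentiableAt_mul_right _ _

theorem rightInvariantField_eq_mpullback (g : G) (V : (g : G) → TangentSpace (𝓡 l) g) :
    rightInvariantField (V 1) g = mpullback (𝓡 l) (𝓡 l) (fun x => x * g⁻¹) V g := by
  simp only [rightInvariantField, mpullback, inverse_mfderiv_mul_right]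
  have key : ∀ g₁ g₂, g₁ = (1 : G) → g₂ = g → mfderiv (𝓡 l) (𝓡 l) (fun x => x * g) 1 (V 1) =
      (show Eu l from mfderiv (𝓡 l) (𝓡 l) (fun x => x * g₂) g₁ (show Eu l from V g₁)) := by
    rintro _ _ rfl rfl; rfl
  exact key (g * g⁻¹) g⁻¹⁻¹ (mul_inv_cancel g) (inv_inv g)

/-- Right translations preserve both fields, hence also their bracket; a right-invariant field is
determined by its value at `1`. -/
theorem rightInvariantField_rightBracket (w₁ w₂ : GroupLieAlgebra (𝓡 l) G) :
    rightInvariantField (rightBracket w₁ w₂) =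
      mlieBracket (𝓡 l) (rightInvariantField w₁) (rightInvariantField w₂) := by
  ext g
  rw [rightBracket, rightInvariantField_eq_mpullback, mpullback_mlieBracket (n := ∞),
    mpullback_rightInvariantField, mpullback_rightInvariantField]
  · exact mdifferentiableAt_rightInvariantField _ _
  · exact mdifferentiableAt_rightInvariantField _ _
  · exact (contMDiff_mul_right (I := 𝓡 l) (n := ∞)).contMDiffAt
  · simp; norm_cast

theorem rightBracket_self (w : GroupLieAlgebra (𝓡 l) G) : rightBracket w w = 0 := by
  simp [rightBracket]

theorem rightBracket_swap (w₁ w₂ : GroupLieAlgebra (𝓡 l) G) :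
    rightBracket w₁ w₂ = - rightBracket w₂ w₁ := mlieBracket_swap_apply

theorem rightBracket_add_left (w₁ w₂ w : GroupLieAlgebra (𝓡 l) G) :
    rightBracket (w₁ + w₂) w = rightBracket w₁ w + rightBracket w₂ w := by
  rw [rightBracket, rightInvariantField_add]
  exact mlieBracket_add_left (mdifferentiableAt_rightInvariantField _ _)
    (mdifferentiableAt_rightInvariantField _ _)

theorem rightBracket_smul_left (c : ℝ) (w₁ w : GroupLieAlgebra (𝓡 l) G) :
    rightBracket (c • w₁) w = c • rightBracket w₁ w := by
  rw [rightBracket, rightInvariantField_smul]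
  exact mlieBracket_const_smul_left (mdifferentiableAt_rightInvariantField _ _)

theorem rightBracket_add_right (w w₁ w₂ : GroupLieAlgebra (𝓡 l) G) :
    rightBracket w (w₁ + w₂) = rightBracket w w₁ + rightBracket w w₂ := by
  rw [rightBracket_swap, rightBracket_add_left, neg_add, ← rightBracket_swap, ← rightBracket_swap]

theorem rightBracket_smul_right (c : ℝ) (w w₁ : GroupLieAlgebra (𝓡 l) G) :
    rightBracket w (c • w₁) = c • rightBracket w w₁ := by
  rw [rightBracket_swap, rightBracket_smul_left, rightBracket_swap w]
  exact (smul_neg c _).symm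

/-- The iterated brackets are values at `1` of iterated brackets of right-invariant fields, so this
is the Jacobi identity of vector fields. -/
theorem rightBracket_leibniz (w₁ w₂ w₃ : GroupLieAlgebra (𝓡 l) G) :
    rightBracket w₁ (rightBracket w₂ w₃) =
      rightBracket (rightBracket w₁ w₂) w₃ + rightBracket w₂ (rightBracket w₁ w₃) := by
  have h : ∀ w : GroupLieAlgebra (𝓡 l) G, ContMDiffAt (𝓡 l) (𝓡 l).tangent (minSmoothness ℝ 2)
      (fun g => (⟨g, rightInvariantField w g⟩ : TangentBundle (𝓡 l) G)) 1 := fun w =>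
    ((contMDiff_rightInvariantField w).of_le (by simp; norm_cast)).contMDiffAt
  have := leibniz_identity_mlieBracket_apply (h w₁) (h w₂) (h w₃)
  have e : ∀ w w' : GroupLieAlgebra (𝓡 l) G, rightBracket w w' =
    mlieBracket (𝓡 l) (rightInvariantField w) (rightInvariantField w') 1 := fun _ _ => rfl
  rw [e w₁, e (rightBracket w₁ w₂), e w₂ (rightBracket w₁ w₃)]
  simp only [rightInvariantField_rightBracket]
  exact this

/-- The bracket of right-invariant vector fields as a bounded bilinear map. -/
def rightBracketCLM (l : ℕ) (G : Type*) [TopologicalSpace G] [T2Space G] [ChartedSpace (Eu l) G] [Group G]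
    [LieGroup (𝓡 l) ∞ G] : Eu l →L[ℝ] Eu l →L[ℝ] Eu l :=
  LinearMap.toContinuousBilinearMap (LinearMap.mk₂ ℝ
    (fun w₁ w₂ : Eu l => (show Eu l from
      rightBracket (show GroupLieAlgebra (𝓡 l) G from w₁) (show GroupLieAlgebra (𝓡 l) G from w₂)))
    (fun _ _ _ => rightBracket_add_left _ _ _) (fun _ _ _ => rightBracket_smul_left _ _ _)
    (fun _ _ _ => rightBracket_add_right _ _ _) (fun _ _ _ => rightBracket_smul_right _ _ _))

end RightInvariant

/-! ### Commutators of derivatives along currents -/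

section PointDerivCommutator

open VectorField

variable {d k l : ℕ} {X : Type*} [TopologicalSpace X] [ChartedSpace (Eu d) X]
  [IsManifold (𝓡 d) ∞ X]
  {M : Type*} [TopologicalSpace M] [ChartedSpace (Eu k) M] [IsManifold (𝓡 k) ∞ M]
  {G : Type*} [TopologicalSpace G] [T2Space G] [ChartedSpace (Eu l) G] [Group G]
  [LieGroup (𝓡 l) ∞ G] [MulAction G M] [ContMDiffSMul (𝓡 l) (𝓡 k) ∞ G M]

theorem gradM_eq_sum (f : X × M → ℝ) (z : X × M) : gradM l G f z =
    ∑ i, gradM l G f z (EuclideanSpace.single i 1) • (EuclideanSpace.proj i : Eu l →L[ℝ] ℝ) := by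
  ext w
  rw [clm_apply_eq_sum]
  simp [mul_comm]

theorem contMDiff_gradM_clm {n m : ℕ∞} (hnm : n + 1 ≤ m) {f : X × M → ℝ}
    (hf : ContMDiff ((𝓡 d).prod (𝓡 k)) 𝓘(ℝ, ℝ) m f) :
    ContMDiff ((𝓡 d).prod (𝓡 k)) 𝓘(ℝ, Eu l →L[ℝ] ℝ) n (gradM l G f) := by
  rw [funext (gradM_eq_sum (G := G) f)]
  exact contMDiff_finsetSum fun i _ => (contMDiff_gradM_const hnm hf _).smul contMDiff_const

theorem contMDiff_slice_fst {n : ℕ∞} {E : Type*} [NormedAddCommGroup E] [NormedSpace ℝ E]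
    {f : X × M → E} (hf : ContMDiff ((𝓡 d).prod (𝓡 k)) 𝓘(ℝ, E) n f) (m : M) :
    ContMDiff (𝓡 d) 𝓘(ℝ, E) n (fun x => f (x, m)) :=
  hf.comp (contMDiff_id.prodMk contMDiff_const)

theorem contMDiff_slice_orbit {n : ℕ∞} {f : X × M → ℝ}
    (hf : ContMDiff ((𝓡 d).prod (𝓡 k)) 𝓘(ℝ, ℝ) n f) (z : X × M) :
    ContMDiff (𝓡 l) 𝓘(ℝ, ℝ) n (fun g : G => f (z.1, g • z.2)) :=
  (contMDiff_orbit (G := G) le_rfl hf).comp (contMDiff_const (c := z).prodMk contMDiff_id)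

/-- Acting by `h` near `1` on `g • m` moves `g` to `h * g`, that is, along a right-invariant field.
For this reason the bracket of `𝔤` has to be the right-invariant one. -/
theorem gradM_smul_eq {f : X × M → ℝ} (hf : ContMDiff ((𝓡 d).prod (𝓡 k)) 𝓘(ℝ, ℝ) 1 f)
    (z : X × M) (g : G) (w : GroupLieAlgebra (𝓡 l) G) :
    gradM l G f (z.1, g • z.2) (show Eu l from w) =
      diffAt (fun g : G => f (z.1, g • z.2)) g (rightInvariantField w g) := by
  have e : (fun h : G => f (z.1, h • g • z.2)) =
      (fun g : G => f (z.1, g • z.2)) ∘ (fun h => h * g) := by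
    funext h; simp [mul_smul]
  have hF : ∀ g', MDifferentiableAt (𝓡 l) 𝓘(ℝ, ℝ) (fun g : G => f (z.1, g • z.2)) g' :=
    (contMDiff_slice_orbit (n := 1) hf z).mdifferentiable (by simp)
  have h1 : gradM l G f (z.1, g • z.2) =
      diffAt ((fun g : G => f (z.1, g • z.2)) ∘ (fun h => h * g)) 1 := by rw [← e]; rfl
  have h2 := mfderiv_comp (I' := 𝓡 l) (1 : G) (hF _) (mdifferentiableAt_mul_right (l := l) g 1)
  rw [h1]
  have key : ∀ g', g' = g → (show Eu l →L[ℝ] ℝ from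
      mfderiv (𝓡 l) 𝓘(ℝ, ℝ) (fun g : G => f (z.1, g • z.2)) g')
        (show Eu l from rightInvariantField w g) =
      diffAt (fun g : G => f (z.1, g • z.2)) g (rightInvariantField w g) := by
    rintro _ rfl; rfl
  exact (congrArg (fun L : Eu l →L[ℝ] ℝ => L (show Eu l from w)) h2).trans (key _ (one_mul g))

/-- The product rule in `x`: the argument `u(x)` also varies, and this produces the terms `∇ᵥ u` of
the bracket. -/
theorem diffAt_gradM {f : X × M → ℝ} (hf : ContMDiff ((𝓡 d).prod (𝓡 k)) 𝓘(ℝ, ℝ) 2 f)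
    {u : X → Eu l} (hu : ContMDiff (𝓡 d) 𝓘(ℝ, Eu l) 1 u) (x : X) (m : M) (ξ : Eu d) :
    diffAt (fun x => gradM l G f (x, m) (u x)) x ξ =
      diffAt (fun x' => gradM l G f (x', m) (u x)) x ξ + gradM l G f (x, m) (diffAt u x ξ) := by
  have hL : MDifferentiableAt (𝓡 d) 𝓘(ℝ, Eu l →L[ℝ] ℝ) (fun x => gradM l G f (x, m)) x :=
    (contMDiff_slice_fst (contMDiff_gradM_clm (n := 1) (m := 2) (by norm_num) hf) m).mdifferentiable
      (by simp) x
  have h1 := diffAt_bilinear (ContinuousLinearMap.id ℝ (Eu l →L[ℝ] ℝ)) hL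
    (hu.mdifferentiable (by simp) x) ξ
  have h2 := diffAt_bilinear (ContinuousLinearMap.id ℝ (Eu l →L[ℝ] ℝ)) hL
    (mdifferentiableAt_const (c := u x)) ξ
  rw [diffAt_const] at h2
  simp only [ContinuousLinearMap.id_apply, zero_apply, map_zero,
    add_zero] at h1 h2
  rw [h1, h2]

/-- The field `v` does not depend on the mark, so only mixed partial derivatives on `X × G` are
interchanged. -/
theorem gradM_gradX_comm {f : X × M → ℝ} (hf : ContMDiff ((𝓡 d).prod (𝓡 k)) 𝓘(ℝ, ℝ) 2 f)
    (v : (x : X) → TangentSpace (𝓡 d) x) (w : Eu l) (z : X × M) :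
    gradM l G (fun z => gradX d f z (v z.1)) z w =
      diffAt (fun x => gradM l G f (x, z.2) w) z.1 (show Eu d from v z.1) := by
  have hΦ : ContMDiff ((𝓡 d).prod (𝓡 l)) 𝓘(ℝ, ℝ) 2 (fun p : X × G => f (p.1, p.2 • z.2)) :=
    (contMDiff_orbit (G := G) (n := 2) (m := 2) le_rfl hf).comp
      ((contMDiff_fst.prodMk contMDiff_const).prodMk contMDiff_snd)
  exact (diffAt_diffAt_comm hΦ z.1 1 (show Eu d from v z.1) w).symm

variable [T2Space X]

/-- The bracket of `𝔞` corresponds to the commutator of directional derivatives. -/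
theorem grad_bracket {a b : FieldPair d l X G} (ha : IsCurrent a) (hb : IsCurrent b)
    {f : X × M → ℝ} (hf : ContMDiff ((𝓡 d).prod (𝓡 k)) 𝓘(ℝ, ℝ) 2 f) (z : X × M) :
    gradX d f z ((bracket a b).1 z.1) + gradM l G f z ((bracket a b).2 z.1) =
      pointDeriv a (pointDeriv b f) z - pointDeriv b (pointDeriv a f) z := by
  have hf1 : ContMDiff ((𝓡 d).prod (𝓡 k)) 𝓘(ℝ, ℝ) 1 f := hf.of_le (by norm_num)
  have hv : ∀ {c : FieldPair d l X G}, IsCurrent c → ContMDiff (𝓡 d) (𝓡 d).tangent 1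
      (fun x => (⟨x, c.1 x⟩ : TangentBundle (𝓡 d) X)) := fun hc => hc.smooth_fst.of_le (by simp)
  have hu : ∀ {c : FieldPair d l X G}, IsCurrent c → ContMDiff (𝓡 d) 𝓘(ℝ, Eu l) 1
      (fun x => (show Eu l from c.2 x)) := fun hc => hc.smooth_snd.of_le (by simp)
  -- Second order on `X`, two mixed terms, the first-order term with `∇ᵥ u`, and second order along
  -- the orbit. The sum of the two mixed terms is symmetric in `a` and `b` and drops out of the
  -- commutator.
  have step : ∀ {a b : FieldPair d l X G}, IsCurrent a → IsCurrent b →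
      pointDeriv a (pointDeriv b f) z =
        diffAt (fun x => gradX d f (x, z.2) (b.1 x)) z.1 (show Eu d from a.1 z.1) +
        (diffAt (fun x => gradM l G f (x, z.2) (show Eu l from b.2 z.1)) z.1
            (show Eu d from a.1 z.1) +
          gradM l G f z (show Eu l from fieldDeriv a.1 b.2 z.1)) +
        (diffAt (fun x => gradM l G f (x, z.2) (show Eu l from a.2 z.1)) z.1
            (show Eu d from b.1 z.1) +
          diffAt (fun g : G => diffAt (fun g : G => f (z.1, g • z.2)) g
            (rightInvariantField (b.2 z.1) g)) 1 (show Eu l from a.2 z.1)) := by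
    intro a b ha hb
    have hA : ContMDiff ((𝓡 d).prod (𝓡 k)) 𝓘(ℝ, ℝ) 1 (fun z => gradX d f z (b.1 z.1)) :=
      contMDiff_gradX (n := 1) (m := 2) (by norm_num) hf (hv hb)
    have hM : ContMDiff ((𝓡 d).prod (𝓡 k)) 𝓘(ℝ, ℝ) 1 (fun z => gradM l G f z (b.2 z.1)) :=
      contMDiff_gradM (n := 1) (m := 2) (by norm_num) hf (hu hb)
    have e : pointDeriv b f = fun z => gradX d f z (b.1 z.1) + gradM l G f z (b.2 z.1) :=
      funext fun z => pointDeriv_eq hb hf1 z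
    rw [e]
    have e1 : gradX d (fun z => gradX d f z (b.1 z.1) + gradM l G f z (b.2 z.1)) z (a.1 z.1) =
        diffAt (fun x => gradX d f (x, z.2) (b.1 x)) z.1 (show Eu d from a.1 z.1) +
        (diffAt (fun x => gradM l G f (x, z.2) (show Eu l from b.2 z.1)) z.1
            (show Eu d from a.1 z.1) +
          gradM l G f z (show Eu l from fieldDeriv a.1 b.2 z.1)) := by
      refine (diffAt_add ((contMDiff_slice_fst (n := 1) hA z.2).mdifferentiable (by simp) _)
        ((contMDiff_slice_fst (n := 1) hM z.2).mdifferentiable (by simp) _) _).trans ?_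
      exact congrArg _ (diffAt_gradM hf (hu hb) z.1 z.2 _)
    have e2 : gradM l G (fun z => gradX d f z (b.1 z.1) + gradM l G f z (b.2 z.1)) z (a.2 z.1) =
        diffAt (fun x => gradM l G f (x, z.2) (show Eu l from a.2 z.1)) z.1
            (show Eu d from b.1 z.1) +
          diffAt (fun g : G => diffAt (fun g : G => f (z.1, g • z.2)) g
            (rightInvariantField (b.2 z.1) g)) 1 (show Eu l from a.2 z.1) := by
      refine (diffAt_add ((contMDiff_slice_orbit (n := 1) hA z).mdifferentiable (by simp) _)
        ((contMDiff_slice_orbit (n := 1) hM z).mdifferentiable (by simp) _) _).trans ?_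
      refine congrArg₂ _ (gradM_gradX_comm hf b.1 _ z) ?_
      have e3 : (fun g : G => gradM l G f (z.1, g • z.2) (show Eu l from b.2 z.1)) =
        fun g => diffAt (fun g : G => f (z.1, g • z.2)) g (rightInvariantField (b.2 z.1) g) :=
        funext fun g => gradM_smul_eq hf1 z g _
      exact congrArg (fun F : G → ℝ => diffAt F 1 (show Eu l from a.2 z.1)) e3
    exact (pointDeriv_eq ha (f := fun z => gradX d f z (b.1 z.1) + gradM l G f z (b.2 z.1))
      (hA.add hM) z).trans (congrArg₂ _ e1 e2)
  rw [step ha hb, step hb ha]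
  have h1 := diffAt_mlieBracket (contMDiff_slice_fst (n := 2) hf z.2) (hv ha) (hv hb) z.1
  have hR : ∀ w : GroupLieAlgebra (𝓡 l) G, ContMDiff (𝓡 l) (𝓡 l).tangent 1
      (fun g => (⟨g, rightInvariantField w g⟩ : TangentBundle (𝓡 l) G)) := fun w =>
    (contMDiff_rightInvariantField w).of_le (by simp)
  have h2 := diffAt_mlieBracket (contMDiff_slice_orbit (G := G) (n := 2) hf z) (hR (a.2 z.1))
    (hR (b.2 z.1)) 1
  have r1 : ∀ w : GroupLieAlgebra (𝓡 l) G, (show Eu l from rightInvariantField w 1) = w := by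
    intro w
    have : (fun h : G => h * 1) = id := by ext; simp
    simp only [rightInvariantField]
    rw [this, mfderiv_id]
    rfl
  have h3 : gradM l G f z (show Eu l from (bracket a b).2 z.1) =
      gradM l G f z (show Eu l from fieldDeriv a.1 b.2 z.1) -
      gradM l G f z (show Eu l from fieldDeriv b.1 a.2 z.1) +
      gradM l G f z (show Eu l from rightBracket (a.2 z.1) (b.2 z.1)) := by
    rw [← map_sub, ← map_add]
    rfl
  have h4 : gradM l G f z (show Eu l from rightBracket (a.2 z.1) (b.2 z.1)) = 
     diffAt (fun g : G => diffAt (fun g : G => f (z.1, g • z.2)) g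
            (rightInvariantField (b.2 z.1) g)) 1 (show Eu l from a.2 z.1) -
     diffAt (fun g : G => diffAt (fun g : G => f (z.1, g • z.2)) g
            (rightInvariantField (a.2 z.1) g)) 1 (show Eu l from b.2 z.1) := by
    rw [← r1 (a.2 z.1), ← r1 (b.2 z.1), r1 (a.2 z.1), r1 (b.2 z.1)]
    refine h2.trans (congrArg₂ _ (congrArg _ ?_) (congrArg _ ?_))
    exacts [r1 _, r1 _]
  have h5 : gradX d f z ((bracket a b).1 z.1) =
    diffAt (fun x => gradX d f (x, z.2) (b.1 x)) z.1 (show Eu d from a.1 z.1) -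
    diffAt (fun x => gradX d f (x, z.2) (a.1 x)) z.1 (show Eu d from b.1 z.1) := h1
  have h3' : gradM l G f z ((bracket a b).2 z.1) = _ := h3
  rw [h5, h3', h4]
  ring

end PointDerivCommutator

/-! ### The Lie algebra of currents -/

section LieAlgebra

open VectorField

variable {d l : ℕ} {X : Type*} [TopologicalSpace X] [ChartedSpace (Eu d) X]
  [IsManifold (𝓡 d) ∞ X]
  {G : Type*} [TopologicalSpace G] [T2Space G] [ChartedSpace (Eu l) G] [Group G]
  [LieGroup (𝓡 l) ∞ G]

theorem isCompact_closure_ne_zero_of_subset {E : X → Type*} [∀ x, Zero (E x)] {K : Set X}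
    (hK : IsCompact K) (hKc : IsClosed K) {s : ∀ x, E x} (h : ∀ x, x ∉ K → s x = 0) :
    IsCompact (closure {x | s x ≠ 0}) :=
  hK.of_isClosed_subset isClosed_closure
    (closure_minimal (fun x hx => by_contra fun hxK => hx (h x hxK)) hKc)

theorem eq_zero_of_notMem_closure {E : X → Type*} [∀ x, Zero (E x)] {s : ∀ x, E x} {x : X}
    (h : x ∉ closure {x | s x ≠ 0}) : s x = 0 :=
  by_contra fun hx => h (subset_closure hx)

theorem eventually_eq_zero_of_notMem_closure {E : X → Type*} [∀ x, Zero (E x)] {s : ∀ x, E x}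
    {x : X} (h : x ∉ closure {x | s x ≠ 0}) : ∀ᶠ y in 𝓝 x, s y = 0 := by
  filter_upwards [isClosed_closure.isOpen_compl.mem_nhds h] with y hy
  exact eq_zero_of_notMem_closure hy

theorem mlieBracket_eq_zero_of_notMem {v w : (x : X) → TangentSpace (𝓡 d) x} {x : X}
    (h : x ∉ closure {x | v x ≠ 0}) : mlieBracket (𝓡 d) v w x = 0 := by
  have h1 : v =ᶠ[𝓝 x] (0 : (x : X) → TangentSpace (𝓡 d) x) := eventually_eq_zero_of_notMem_closure h
  rw [h1.mlieBracket_vectorField_eq (W := w) (W₁ := w) (Filter.EventuallyEq.refl _ _)]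
  simp

theorem fieldDeriv_eq_diffAt (v : (x : X) → TangentSpace (𝓡 d) x)
    (u : X → GroupLieAlgebra (𝓡 l) G) (x : X) :
    fieldDeriv v u x = diffAt (fun x => (show Eu l from u x)) x (show Eu d from v x) := rfl

theorem fieldDeriv_eq_zero (v : (x : X) → TangentSpace (𝓡 d) x)
    (u : X → GroupLieAlgebra (𝓡 l) G) {x : X} (h : v x = 0) : fieldDeriv v u x = 0 := by
  rw [fieldDeriv_eq_diffAt, h]
  exact map_zero (diffAt (fun x => (show Eu l from u x)) x : Eu d →L[ℝ] Eu l)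

theorem fieldDeriv_zero_right (v : (x : X) → TangentSpace (𝓡 d) x) :
    fieldDeriv v (0 : X → GroupLieAlgebra (𝓡 l) G) = 0 := by
  funext x
  exact congrArg (fun L : Eu d →L[ℝ] Eu l => L (show Eu d from v x))
    (diffAt_const (0 : Eu l) x)

theorem fieldDeriv_add_left (v w : (x : X) → TangentSpace (𝓡 d) x)
    (u : X → GroupLieAlgebra (𝓡 l) G) (x : X) :
    fieldDeriv (v + w) u x = fieldDeriv v u x + fieldDeriv w u x :=
  map_add (diffAt (fun x => (show Eu l from u x)) x : Eu d →L[ℝ] Eu l) _ _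

theorem fieldDeriv_smul_left (r : ℝ) (v : (x : X) → TangentSpace (𝓡 d) x)
    (u : X → GroupLieAlgebra (𝓡 l) G) (x : X) :
    fieldDeriv (r • v) u x = r • fieldDeriv v u x :=
  map_smul (diffAt (fun x => (show Eu l from u x)) x : Eu d →L[ℝ] Eu l) r _

theorem contMDiff_const_smul {E : Type*} [NormedAddCommGroup E] [NormedSpace ℝ E] {n : ℕ∞ω}
    {f : X → E} (hf : ContMDiff (𝓡 d) 𝓘(ℝ, E) n f) (r : ℝ) :
    ContMDiff (𝓡 d) 𝓘(ℝ, E) n (fun x => r • f x) :=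
  (r • ContinuousLinearMap.id ℝ E).contMDiff.comp hf

theorem diffAt_const_smul {E : Type*} [NormedAddCommGroup E] [NormedSpace ℝ E]
    {f : X → E} {x : X} (hf : MDifferentiableAt (𝓡 d) 𝓘(ℝ, E) f x) (r : ℝ) (ξ : Eu d) :
    diffAt (fun x => r • f x) x ξ = r • diffAt f x ξ := by
  have h2 := diffAt_bilinear (ContinuousLinearMap.lsmul ℝ ℝ) (mdifferentiableAt_const (c := r)) hf ξ
  rw [diffAt_const] at h2
  simpa using h2

theorem contMDiff_rightBracket {u₁ u₂ : X → Eu l} (h₁ : ContMDiff (𝓡 d) 𝓘(ℝ, Eu l) ∞ u₁)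
    (h₂ : ContMDiff (𝓡 d) 𝓘(ℝ, Eu l) ∞ u₂) :
    ContMDiff (𝓡 d) 𝓘(ℝ, Eu l) ∞ (fun x => rightBracketCLM l G (u₁ x) (u₂ x)) :=
  ((rightBracketCLM l G).contMDiff.comp h₁).clm_apply h₂

theorem IsCurrent.smul_add {a b : FieldPair d l X G} (ha : IsCurrent a) (hb : IsCurrent b) (r : ℝ) :
    IsCurrent (r • a + b) where
  smooth_fst := ContMDiff.add_section (ha.smooth_fst.const_smul_section (a := r)) hb.smooth_fst
  compact_fst := isCompact_closure_ne_zero_of_subset (ha.compact_fst.union hb.compact_fst)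
    (isClosed_closure.union isClosed_closure) fun x hx => by
      have h1 : a.1 x = 0 := eq_zero_of_notMem_closure fun h => hx (Or.inl h)
      have h2 : b.1 x = 0 := eq_zero_of_notMem_closure fun h => hx (Or.inr h)
      simp [h1, h2]
  smooth_snd := (contMDiff_const_smul ha.smooth_snd r).add hb.smooth_snd
  compact_snd := isCompact_closure_ne_zero_of_subset (E := fun _ => GroupLieAlgebra (𝓡 l) G)
    (ha.compact_snd.union hb.compact_snd)
    (isClosed_closure.union isClosed_closure) fun x hx => by
      have h1 : a.2 x = 0 := eq_zero_of_notMem_closure (E := fun _ => GroupLieAlgebra (𝓡 l) G)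
        fun h => hx (Or.inl h)
      have h2 : b.2 x = 0 := eq_zero_of_notMem_closure (E := fun _ => GroupLieAlgebra (𝓡 l) G)
        fun h => hx (Or.inr h)
      simp [h1, h2]

theorem IsCurrent.fst {a : FieldPair d l X G} (ha : IsCurrent a) :
    IsCurrent ((a.1, 0) : FieldPair d l X G) where
  smooth_fst := ha.smooth_fst
  compact_fst := ha.compact_fst
  smooth_snd := contMDiff_const (c := (0 : Eu l))
  compact_snd := by simp

theorem IsCurrent.snd {a : FieldPair d l X G} (ha : IsCurrent a) :
    IsCurrent ((0, a.2) : FieldPair d l X G) where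
  smooth_fst := contMDiff_zeroSection ℝ (TangentSpace (𝓡 d) : X → Type _)
  compact_fst := by simp
  smooth_snd := ha.smooth_snd
  compact_snd := ha.compact_snd

theorem IsCurrent.smooth_fieldDeriv {a b : FieldPair d l X G} (ha : IsCurrent a)
    (hb : IsCurrent b) :
    ContMDiff (𝓡 d) 𝓘(ℝ, Eu l) ∞ (fun x => (show Eu l from fieldDeriv a.1 b.2 x)) :=
  contMDiff_diffAt (n := ⊤) (m := ⊤) le_top hb.smooth_snd ha.smooth_fst

theorem IsCurrent.bracket {a b : FieldPair d l X G} (ha : IsCurrent a) (hb : IsCurrent b) :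
    IsCurrent (bracket a b) where
  smooth_fst := by
    have : IsManifold (𝓡 d) (((⊤ : ℕ∞) : ℕ∞ω) + 1) X :=
      (show ((⊤ : ℕ∞) : ℕ∞ω) + 1 = ((⊤ : ℕ∞) : ℕ∞ω) from rfl) ▸ ‹IsManifold (𝓡 d) ∞ X›
    exact ContDiff.mlieBracket_vectorField (n := ⊤) (m := ⊤) ha.smooth_fst hb.smooth_fst (by simp)
  compact_fst := isCompact_closure_ne_zero_of_subset ha.compact_fst isClosed_closure fun x hx =>
    mlieBracket_eq_zero_of_notMem hx
  smooth_snd := by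
    refine ((ha.smooth_fieldDeriv hb).sub (hb.smooth_fieldDeriv ha)).add ?_
    exact contMDiff_rightBracket (G := G) ha.smooth_snd hb.smooth_snd
  -- Off the supports of `a.1`, `b.1` and `a.2` each of the three terms vanishes.
  compact_snd := isCompact_closure_ne_zero_of_subset (E := fun _ => GroupLieAlgebra (𝓡 l) G)
    ((ha.compact_fst.union hb.compact_fst).union ha.compact_snd)
    ((isClosed_closure.union isClosed_closure).union isClosed_closure) fun x hx => by
      have h1 : a.1 x = 0 := eq_zero_of_notMem_closure fun h => hx (Or.inl (Or.inl h))
      have h2 : b.1 x = 0 := eq_zero_of_notMem_closure fun h => hx (Or.inl (Or.inr h))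
      have h3 : a.2 x = 0 := eq_zero_of_notMem_closure (E := fun _ => GroupLieAlgebra (𝓡 l) G)
        fun h => hx (Or.inr h)
      have h4 : rightBracket (0 : GroupLieAlgebra (𝓡 l) G) (b.2 x) = 0 := by
        simpa using rightBracket_smul_left (0 : ℝ) (0 : GroupLieAlgebra (𝓡 l) G) (b.2 x)
      simp only [MarkedPoisson.bracket]
      rw [fieldDeriv_eq_zero _ _ h1, fieldDeriv_eq_zero _ _ h2, h3, h4]
      simp

theorem bracket_self (a : FieldPair d l X G) : bracket a a = 0 := by
  refine Prod.ext ?_ ?_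
  · simp [bracket]
  · funext x
    simp [bracket, rightBracket_self]

theorem mdifferentiable_current_snd {a : FieldPair d l X G} (ha : IsCurrent a) :
    MDifferentiable (𝓡 d) 𝓘(ℝ, Eu l) (fun x => (show Eu l from a.2 x)) :=
  ha.smooth_snd.mdifferentiable (by simp)

theorem mdifferentiable_current_fst {a : FieldPair d l X G} (ha : IsCurrent a) :
    MDifferentiable (𝓡 d) (𝓡 d).tangent
      (fun x => (⟨x, a.1 x⟩ : TangentBundle (𝓡 d) X)) :=
  ha.smooth_fst.mdifferentiable (by simp)

theorem fieldDeriv_smul_add_right {a b : FieldPair d l X G} (ha : IsCurrent a) (hb : IsCurrent b)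
    (r : ℝ) (v : (x : X) → TangentSpace (𝓡 d) x) (x : X) :
    fieldDeriv v (r • a + b).2 x = r • fieldDeriv v a.2 x + fieldDeriv v b.2 x := by
  have hs : MDifferentiableAt (𝓡 d) 𝓘(ℝ, Eu l) (fun x => r • (show Eu l from a.2 x)) x :=
    (contMDiff_const_smul ha.smooth_snd r).mdifferentiable (by simp) x
  have h1 := diffAt_add hs (mdifferentiable_current_snd hb x) (show Eu d from v x)
  have h2 := diffAt_const_smul (mdifferentiable_current_snd ha x) r (show Eu d from v x)
  exact h1.trans (congrArg (fun y : Eu l => y + _) h2)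

theorem bracket_smul_add_left {a b c : FieldPair d l X G} (ha : IsCurrent a) (hb : IsCurrent b)
    (r : ℝ) :
    bracket (r • a + b) c = r • bracket a c + bracket b c := by
  refine Prod.ext ?_ ?_
  · funext x
    have h1 : mlieBracket (𝓡 d) (r • a.1 + b.1) c.1 x =
        mlieBracket (𝓡 d) (r • a.1) c.1 x + mlieBracket (𝓡 d) b.1 c.1 x :=
      mlieBracket_add_left 
        ((ha.smooth_fst.const_smul_section (a := r)).mdifferentiable (by simp) x) (mdifferentiable_current_fst hb x)
    have h2 : mlieBracket (𝓡 d) (r • a.1) c.1 x = r • mlieBracket (𝓡 d) a.1 c.1 x :=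
      mlieBracket_const_smul_left (mdifferentiable_current_fst ha x)
    rw [h2] at h1
    exact h1
  · funext x
    have h1 := fieldDeriv_add_left (r • a.1) b.1 c.2 x
    rw [fieldDeriv_smul_left] at h1
    have h2 := fieldDeriv_smul_add_right ha hb r c.1 x
    have h3 := rightBracket_add_left (r • a.2 x) (b.2 x) (c.2 x)
    rw [rightBracket_smul_left] at h3
    have e : (bracket (r • a + b) c).2 x = fieldDeriv (r • a.1 + b.1) c.2 x -
      fieldDeriv c.1 (r • a + b).2 x + rightBracket (r • a.2 x + b.2 x) (c.2 x) := rfl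
    have e' : (r • bracket a c + bracket b c).2 x =
      r • (fieldDeriv a.1 c.2 x - fieldDeriv c.1 a.2 x + rightBracket (a.2 x) (c.2 x)) +
      (fieldDeriv b.1 c.2 x - fieldDeriv c.1 b.2 x + rightBracket (b.2 x) (c.2 x)) := rfl
    rw [e, e', h1, h2, h3]
    have key : ∀ A B C A' B' C' : Eu l, r • A + A' - (r • B + B') + (r • C + C') =
      r • (A - B + C) + (A' - B' + C') := fun A B C A' B' C' => by module
    exact key _ _ _ _ _ _

theorem bracket_swap (a b : FieldPair d l X G) : bracket a b = - bracket b a := by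
  refine Prod.ext ?_ ?_
  · exact mlieBracket_swap
  · funext x
    have e : ∀ a b : FieldPair d l X G, (bracket a b).2 x =
      fieldDeriv a.1 b.2 x - fieldDeriv b.1 a.2 x + rightBracket (a.2 x) (b.2 x) := fun _ _ => rfl
    have e' : (- bracket b a).2 x = - (bracket b a).2 x := rfl
    rw [e', e, e, rightBracket_swap (a.2 x)]
    have key : ∀ A B C : Eu l, A - B + -C = -(B - A + C) := fun A B C => by abel
    exact key _ _ _

theorem bracket_smul_add_right {a b c : FieldPair d l X G} (ha : IsCurrent a) (hb : IsCurrent b)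
    (r : ℝ) :
    bracket c (r • a + b) = r • bracket c a + bracket c b := by
  rw [bracket_swap, bracket_smul_add_left ha hb, bracket_swap c a, bracket_swap c b, smul_neg,
    neg_add]

/-- The bracket of `𝔤` is a bounded bilinear map, so the derivative obeys the Leibniz rule on it. -/
theorem fieldDeriv_bracket {a b c : FieldPair d l X G} (hb : IsCurrent b)
    (hc : IsCurrent c) (x : X) : fieldDeriv a.1 (bracket b c).2 x =
      fieldDeriv a.1 (fieldDeriv b.1 c.2) x - fieldDeriv a.1 (fieldDeriv c.1 b.2) x +
      (rightBracket (fieldDeriv a.1 b.2 x) (c.2 x) + rightBracket (b.2 x) (fieldDeriv a.1 c.2 x)) := by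
  have h1 : MDifferentiableAt (𝓡 d) 𝓘(ℝ, Eu l)
    (fun x => (show Eu l from fieldDeriv b.1 c.2 x)) x :=
    (hb.smooth_fieldDeriv hc).mdifferentiable (by simp) x
  have h2 : MDifferentiableAt (𝓡 d) 𝓘(ℝ, Eu l)
    (fun x => (show Eu l from fieldDeriv c.1 b.2 x)) x :=
    (hc.smooth_fieldDeriv hb).mdifferentiable (by simp) x
  have h3 : MDifferentiableAt (𝓡 d) 𝓘(ℝ, Eu l) (fun x => rightBracketCLM l G
      (show Eu l from b.2 x) (show Eu l from c.2 x)) x :=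
    (contMDiff_rightBracket hb.smooth_snd hc.smooth_snd).mdifferentiable (by simp) x
  have h4 := diffAt_add (h1.sub h2) h3 (show Eu d from a.1 x)
  have h5 := diffAt_sub h1 h2 (show Eu d from a.1 x)
  have h6 := diffAt_bilinear (rightBracketCLM l G) (mdifferentiable_current_snd hb x)
    (mdifferentiable_current_snd hc x) (show Eu d from a.1 x)
  exact h4.trans (congrArg₂ _ h5 h6)

theorem fieldDeriv_mlieBracket {a b c : FieldPair d l X G} (ha : IsCurrent a) (hb : IsCurrent b)
    (hc : IsCurrent c) (x : X) : fieldDeriv (bracket a b).1 c.2 x =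
      fieldDeriv a.1 (fieldDeriv b.1 c.2) x - fieldDeriv b.1 (fieldDeriv a.1 c.2) x :=
  diffAt_mlieBracket (hc.smooth_snd.of_le (by norm_cast)) (ha.smooth_fst.of_le (by simp))
    (hb.smooth_fst.of_le (by simp)) x

theorem rightBracket_sub_add_right (w A B C : GroupLieAlgebra (𝓡 l) G) :
    rightBracket w (A - B + C) = rightBracket w A - rightBracket w B + rightBracket w C := by
  have h : ∀ w A B C : Eu l, rightBracketCLM l G w (A - B + C) = rightBracketCLM l G w A -
    rightBracketCLM l G w B + rightBracketCLM l G w C := fun w A B C => by simp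
  exact h _ _ _ _

theorem rightBracket_sub_add_left (w A B C : GroupLieAlgebra (𝓡 l) G) :
    rightBracket (A - B + C) w = rightBracket A w - rightBracket B w + rightBracket C w := by
  have h : ∀ w A B C : Eu l, rightBracketCLM l G (A - B + C) w = rightBracketCLM l G A w -
    rightBracketCLM l G B w + rightBracketCLM l G C w := fun w A B C => by simp
  exact h _ _ _ _

/-- The first component is the Jacobi identity of vector fields. In the second, derivatives along
brackets are commutators of derivatives, derivatives act on the bracket of `𝔤` by the Leibniz rule,
and the purely algebraic part is the Jacobi identity of `𝔤`; the other terms cancel by antisymmetry.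
-/
theorem bracket_leibniz {a b c : FieldPair d l X G} (ha : IsCurrent a) (hb : IsCurrent b)
    (hc : IsCurrent c) :
    bracket a (bracket b c) = bracket (bracket a b) c + bracket b (bracket a c) := by
  refine Prod.ext ?_ ?_
  · have h : ∀ {c : FieldPair d l X G}, IsCurrent c → ContMDiff (𝓡 d) (𝓡 d).tangent
        (minSmoothness ℝ 2) (fun x => (⟨x, c.1 x⟩ : TangentBundle (𝓡 d) X)) := fun hc =>
      hc.smooth_fst.of_le (by simp; norm_cast)
    exact leibniz_identity_mlieBracket (h ha) (h hb) (h hc)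
  · funext x
    have e : ∀ a b : FieldPair d l X G, (bracket a b).2 x =
      fieldDeriv a.1 b.2 x - fieldDeriv b.1 a.2 x + rightBracket (a.2 x) (b.2 x) := fun _ _ => rfl
    have e' : (bracket (bracket a b) c + bracket b (bracket a c)).2 x =
      (bracket (bracket a b) c).2 x + (bracket b (bracket a c)).2 x := rfl
    rw [e', e a, e (bracket a b), e b (bracket a c), fieldDeriv_bracket hb hc,
      fieldDeriv_mlieBracket hb hc ha, e b c, fieldDeriv_mlieBracket ha hb hc,
      fieldDeriv_bracket ha hb, e a b, fieldDeriv_bracket ha hc,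
      fieldDeriv_mlieBracket ha hc hb, e a c, rightBracket_sub_add_right,
      rightBracket_sub_add_left, rightBracket_sub_add_right, rightBracket_leibniz,
      rightBracket_swap (b.2 x) (fieldDeriv c.1 a.2 x),
      rightBracket_swap (fieldDeriv b.1 a.2 x) (c.2 x)]
    abel

end LieAlgebra

/-! ### Test functions on the space of marked points -/

section TestFunctions

variable {d k l : ℕ} {X : Type*} [TopologicalSpace X] [T2Space X] [ChartedSpace (Eu d) X]
  [IsManifold (𝓡 d) ∞ X]
  {M : Type*} [TopologicalSpace M] [ChartedSpace (Eu k) M] [IsManifold (𝓡 k) ∞ M]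
  {G : Type*} [TopologicalSpace G] [T2Space G] [ChartedSpace (Eu l) G] [Group G]
  [LieGroup (𝓡 l) ∞ G] [MulAction G M] [ContMDiffSMul (𝓡 l) (𝓡 k) ∞ G M]

include k in
theorem continuous_smul_of_contMDiffSMul (l : ℕ) {G : Type*} [TopologicalSpace G]
    [ChartedSpace (Eu l) G] [Group G] [MulAction G M] [ContMDiffSMul (𝓡 l) (𝓡 k) ∞ G M] :
    ContinuousSMul G M :=
  ⟨(ContMDiff.smul (n := ∞) (I := 𝓡 l) (I' := 𝓡 k) (contMDiff_fst (M := G) (N := M))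
    contMDiff_snd).continuous⟩

theorem gradX_eq_zero {f : X × M → ℝ} {z : X × M} (h : ∀ᶠ z' in 𝓝 z, f z' = 0) (ξ : Eu d) :
    gradX d f z ξ = 0 := by
  have e : (fun x => f (x, z.2)) =ᶠ[𝓝 z.1] fun _ => 0 :=
    (Continuous.prodMk_left z.2).continuousAt.eventually (p := fun z' => f z' = 0) h
  exact congrArg (fun L : Eu d →L[ℝ] ℝ => L ξ) ((diffAt_congr e).trans (diffAt_const 0 z.1))

theorem gradM_eq_zero (k : ℕ) [ChartedSpace (Eu k) M] [IsManifold (𝓡 k) ∞ M]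
    [ContMDiffSMul (𝓡 l) (𝓡 k) ∞ G M] {f : X × M → ℝ} {z : X × M}
    (h : ∀ᶠ z' in 𝓝 z, f z' = 0) (w : Eu l) :
    gradM l G f z w = 0 := by
  have := continuous_smul_of_contMDiffSMul (k := k) (M := M) l (G := G)
  have hc : Continuous (fun g : G => (z.1, g • z.2)) := by fun_prop
  have e : (fun g : G => f (z.1, g • z.2)) =ᶠ[𝓝 1] fun _ => 0 :=
    hc.continuousAt.eventually (p := fun z' => f z' = 0) (by simpa using h)
  exact congrArg (fun L : Eu l →L[ℝ] ℝ => L w) ((diffAt_congr e).trans (diffAt_const 0 (1 : G)))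

theorem pointDeriv_eq_zero {a : FieldPair d l X G} (ha : IsCurrent a) {f : X × M → ℝ}
    (hf : ContMDiff ((𝓡 d).prod (𝓡 k)) 𝓘(ℝ, ℝ) 1 f) {z : X × M}
    (h : ∀ᶠ z' in 𝓝 z, f z' = 0) : pointDeriv a f z = 0 := by
  rw [pointDeriv_eq ha hf]
  have h1 : gradX d f z (a.1 z.1) = 0 := gradX_eq_zero h _
  have h2 : gradM l G f z (a.2 z.1) = 0 := gradM_eq_zero k h _
  rw [h1, h2, add_zero]

theorem IsTest.contMDiff_one {φ : X × M → ℝ} (hφ : IsTest d k l X M G φ) :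
    ContMDiff ((𝓡 d).prod (𝓡 k)) 𝓘(ℝ, ℝ) 1 φ := hφ.smooth.of_le (by simp)

theorem IsTest.pointDeriv {φ : X × M → ℝ} (hφ : IsTest d k l X M G φ) {a : FieldPair d l X G}
    (ha : IsCurrent a) : IsTest d k l X M G (pointDeriv a φ) where
  smooth := contMDiff_pointDeriv (n := ⊤) (m := ⊤) le_top ha hφ.smooth
  support := by
    obtain ⟨K, hK, h⟩ := hφ.support
    refine ⟨K, hK, fun z hz => by_contra fun hzK => hz ?_⟩
    refine pointDeriv_eq_zero ha hφ.contMDiff_one ?_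
    filter_upwards [continuous_fst.continuousAt.preimage_mem_nhds (hK.isClosed.isOpen_compl.mem_nhds hzK)]
      with z' hz'
    exact by_contra fun h' => hz' (h z' h')
  bounded := fun L hL => by
    -- Appended at the end of the list, `a` becomes the innermost derivative of the fold.
    simpa using hφ.bounded (L ++ [a]) (by
      intro b hb
      rcases List.mem_append.1 hb with h | h
      · exact hL b h
      · rw [List.mem_singleton.1 h]; exact ha)

theorem IsTest.exists_bound {φ : X × M → ℝ} (hφ : IsTest d k l X M G φ) : ∃ C, ∀ z, |φ z| ≤ C := by
  simpa using hφ.bounded [] (by simp)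

/-- Smooth functions with compact support belong to the class `𝔇`. -/
theorem isTest_of_hasCompactSupport {φ : X × M → ℝ} [T2Space M]
    (hφ : ContMDiff ((𝓡 d).prod (𝓡 k)) 𝓘(ℝ, ℝ) ∞ φ) (hc : HasCompactSupport φ) :
    IsTest d k l X M G φ where
  smooth := hφ
  support := ⟨Prod.fst '' tsupport φ, hc.isCompact.image continuous_fst, fun z hz =>
    ⟨z, subset_tsupport φ hz, rfl⟩⟩
  bounded := fun L hL => by
    have key : ∀ L : List (FieldPair d l X G), (∀ a ∈ L, IsCurrent a) →
        ContMDiff ((𝓡 d).prod (𝓡 k)) 𝓘(ℝ, ℝ) ∞ (L.foldr MarkedPoisson.pointDeriv φ) ∧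
        ∀ z ∉ tsupport φ, L.foldr MarkedPoisson.pointDeriv φ z = 0 := by
      intro L
      induction L with
      | nil => exact fun _ => ⟨hφ, fun z hz => image_eq_zero_of_notMem_tsupport hz⟩
      | cons a L ih =>
        intro h
        have ha := h a (by simp)
        obtain ⟨h1, h2⟩ := ih fun b hb => h b (by simp [hb])
        refine ⟨contMDiff_pointDeriv (n := ⊤) (m := ⊤) le_top ha h1, fun z hz => ?_⟩
        refine pointDeriv_eq_zero ha (h1.of_le (by simp)) ?_
        filter_upwards [(isClosed_tsupport φ).isOpen_compl.mem_nhds hz] with z' hz'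
        exact h2 z' hz'
    obtain ⟨h1, h2⟩ := key L hL
    have hcs : HasCompactSupport (L.foldr MarkedPoisson.pointDeriv φ) :=
      HasCompactSupport.intro hc.isCompact h2
    exact h1.continuous.bounded_above_of_compact_support hcs

/-- `𝔞` is a Lie algebra acting on `𝔇`. -/
theorem lieAlgebra_current {a b : FieldPair d l X G} (ha : IsCurrent a) (hb : IsCurrent b) :
    IsCurrent (bracket a b) ∧ bracket a a = 0 ∧
      (∀ φ, IsTest d k l X M G φ → ∀ z, pointDeriv (bracket a b) φ z =
        pointDeriv a (pointDeriv b φ) z - pointDeriv b (pointDeriv a φ) z) ∧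
      ∀ r : ℝ, IsCurrent (r • a + b) ∧ ∀ c : FieldPair d l X G, IsCurrent c →
        bracket (r • a + b) c = r • bracket a c + bracket b c ∧
        bracket c (r • a + b) = r • bracket c a + bracket c b ∧
        bracket a (bracket b c) = bracket (bracket a b) c + bracket b (bracket a c) :=
  ⟨ha.bracket hb, bracket_self a, fun φ hφ z => by
    rw [pointDeriv_eq (ha.bracket hb) hφ.contMDiff_one]
    exact grad_bracket ha hb (hφ.smooth.of_le (by norm_cast)) z,
    fun r => ⟨ha.smul_add hb r, fun c hc => ⟨bracket_smul_add_left ha hb r,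
      bracket_smul_add_right ha hb r, bracket_leibniz ha hb hc⟩⟩⟩

end TestFunctions

/-! ### The Riemannian density and its transformation law -/

section Density

variable {d : ℕ} {X : Type*} [TopologicalSpace X] [ChartedSpace (Eu d) X]
  [RiemannianBundle (fun x : X => TangentSpace (𝓡 d) x)]

/-- The density `√(det gᵢⱼ)` of the frame `L eᵢ` of the tangent space at `x`. -/
def gramDensity (x : X) (L : Eu d →L[ℝ] Eu d) : ℝ :=
  Real.sqrt (Matrix.det (Matrix.of fun i j : Fin d =>
    inner ℝ (show TangentSpace (𝓡 d) x from L (EuclideanSpace.single i (1 : ℝ)))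
      (show TangentSpace (𝓡 d) x from L (EuclideanSpace.single j (1 : ℝ)))))

theorem gramDensity_pos (x : X) {L : Eu d →L[ℝ] Eu d} (hL : Function.Injective L) :
    0 < gramDensity x L := by
  have hli : LinearIndependent ℝ (fun i : Fin d =>
      (show TangentSpace (𝓡 d) x from L (EuclideanSpace.single i (1 : ℝ)))) := by
    have h1 : LinearIndependent ℝ (fun i : Fin d => (EuclideanSpace.single i (1 : ℝ) : Eu d)) := by
      have e : (fun i : Fin d => (EuclideanSpace.single i (1 : ℝ) : Eu d)) =
        (EuclideanSpace.basisFun (Fin d) ℝ).toBasis := by ext1 i; simp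
      rw [e]
      exact (EuclideanSpace.basisFun (Fin d) ℝ).toBasis.linearIndependent
    exact h1.map' (L : Eu d →ₗ[ℝ] Eu d) (LinearMap.ker_eq_bot.2 hL)
  exact Real.sqrt_pos.2 (Matrix.posDef_gram_of_linearIndependent hli).det_pos

/-- With `A` the matrix of `T`, the Gram matrix of the new frame is `Aᵀ (Gram) A`, so its
determinant gains the factor `(det A)²`. -/
theorem gramDensity_comp (x : X) (L T : Eu d →L[ℝ] Eu d) :
    gramDensity x (L.comp T) = |T.det| * gramDensity x L := by
  set A : Matrix (Fin d) (Fin d) ℝ := LinearMap.toMatrix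
    (EuclideanSpace.basisFun (Fin d) ℝ).toBasis (EuclideanSpace.basisFun (Fin d) ℝ).toBasis
    (T : Eu d →ₗ[ℝ] Eu d)
  have hA : T.det = A.det := (LinearMap.det_toMatrix _ _).symm
  have hT : ∀ i, L (T (EuclideanSpace.single i 1)) =
      ∑ j, A j i • L (EuclideanSpace.single j 1) := by
    intro i
    rw [clm_apply_eq_sum L]
    refine Finset.sum_congr rfl fun j _ => ?_
    simp [A, LinearMap.toMatrix_apply]
  set w : Fin d → TangentSpace (𝓡 d) x :=
    fun i => (show TangentSpace (𝓡 d) x from L (EuclideanSpace.single i (1 : ℝ)))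
  have hv : ∀ i, (show TangentSpace (𝓡 d) x from L (T (EuclideanSpace.single i 1))) =
      ∑ j, A j i • w j := hT
  have hG : (Matrix.of fun i j : Fin d =>
      inner ℝ (show TangentSpace (𝓡 d) x from (L.comp T) (EuclideanSpace.single i (1 : ℝ)))
      (show TangentSpace (𝓡 d) x from (L.comp T) (EuclideanSpace.single j (1 : ℝ)))) =
      A.transpose * (Matrix.of fun i j => inner ℝ (w i) (w j)) * A := by
    ext i j
    have e : inner ℝ (show TangentSpace (𝓡 d) x from L (T (EuclideanSpace.single i (1 : ℝ))))
        (show TangentSpace (𝓡 d) x from L (T (EuclideanSpace.single j (1 : ℝ)))) =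
        inner ℝ (∑ a, A a i • w a) (∑ b, A b j • w b) := by rw [← hv, ← hv]
    refine e.trans ?_
    simp only [Matrix.mul_apply, Matrix.transpose_apply, Matrix.of_apply, sum_inner, inner_sum,
      real_inner_smul_left, real_inner_smul_right, Finset.sum_mul]
    refine Finset.sum_congr rfl fun a _ => Finset.sum_congr rfl fun b _ => ?_
    ring
  rw [gramDensity, hG, Matrix.det_mul, Matrix.det_mul, Matrix.det_transpose, hA, gramDensity,
    ← Real.sqrt_sq_eq_abs, ← Real.sqrt_mul (sq_nonneg _)]
  congr 1
  ring

variable [IsManifold (𝓡 d) ∞ X]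

/-- The differential of the inverse of the chart around `x₀`, at the point `x`. -/
def frameMap (x₀ x : X) : Eu d →L[ℝ] Eu d :=
  (show Eu d →L[ℝ] Eu d from
    mfderiv (𝓡 d) (𝓡 d) (chartAt (Eu d) x₀).symm (chartAt (Eu d) x₀ x))

theorem frameMap_injective {x₀ x : X} (hx : x ∈ (chartAt (Eu d) x₀).source) :
    Function.Injective (frameMap (d := d) x₀ x) := by
  have h := fun ξ => mfderiv_chartAt_comp_mfderiv_symm ((chartAt (Eu d) x₀).map_source hx) ξ
  exact Function.LeftInverse.injective (g := fun ξ : Eu d => (show Eu d from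
    mfderiv (𝓡 d) (𝓡 d) (chartAt (Eu d) x₀) ((chartAt (Eu d) x₀).symm (chartAt (Eu d) x₀ x)) ξ)) h

theorem volDensity_chartAt {x₀ x : X} (hx : x ∈ (chartAt (Eu d) x₀).source) :
    volDensity x₀ (chartAt (Eu d) x₀ x) = gramDensity (d := d) x (frameMap x₀ x) := by
  have key : ∀ x', x' = x → ∀ ξ η : Eu d,
      inner ℝ (show TangentSpace (𝓡 d) x' from ξ) (show TangentSpace (𝓡 d) x' from η) =
      inner ℝ (show TangentSpace (𝓡 d) x from ξ) (show TangentSpace (𝓡 d) x from η) := by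
    rintro _ rfl _ _; rfl
  rw [volDensity, gramDensity]
  congr 2
  ext i j
  exact key _ ((chartAt (Eu d) x₀).left_inv hx) _ _

theorem volDensity_pos {x₀ : X} {y : Eu d} (hy : y ∈ (chartAt (Eu d) x₀).target) :
    0 < volDensity x₀ y := by
  have hx := (chartAt (Eu d) x₀).map_target hy
  rw [← (chartAt (Eu d) x₀).right_inv hy, volDensity_chartAt hx]
  exact gramDensity_pos _ (frameMap_injective hx)

theorem frameMap_eq_comp {x₀ x₁ x : X} (h₀ : x ∈ (chartAt (Eu d) x₀).source)
    (h₁ : x ∈ (chartAt (Eu d) x₁).source) : frameMap x₀ x =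
      (frameMap x₁ x).comp (fderiv ℝ (chartAt (Eu d) x₁ ∘ (chartAt (Eu d) x₀).symm)
        (chartAt (Eu d) x₀ x)) := by
  have hy := (chartAt (Eu d) x₀).map_source h₀
  have hx' : (chartAt (Eu d) x₀).symm (chartAt (Eu d) x₀ x) ∈ (chartAt (Eu d) x₁).source := by
    rwa [(chartAt (Eu d) x₀).left_inv h₀]
  ext1 ξ
  rw [← mfderiv_eq_fderiv, mfderiv_comp _ (mdifferentiableAt_chartAt hx')
    (mdifferentiableAt_chartAt_symm hy)]
  have key : ∀ x', x' = x → ∀ ξ : Eu d, ξ = frameMap x₁ x (show Eu d from mfderiv (𝓡 d) (𝓡 d)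
      (chartAt (Eu d) x₁) x' ξ) := by
    rintro _ rfl ξ
    exact (mfderiv_symm_comp_mfderiv_chartAt h₁ ξ).symm
  exact key _ ((chartAt (Eu d) x₀).left_inv h₀) _

/-- This is exactly the Jacobian factor in the change of variables between two charts. -/
theorem volDensity_eq_abs_det_mul {x₀ x₁ x : X} (h₀ : x ∈ (chartAt (Eu d) x₀).source)
    (h₁ : x ∈ (chartAt (Eu d) x₁).source) : volDensity x₀ (chartAt (Eu d) x₀ x) =
      |(fderiv ℝ (chartAt (Eu d) x₁ ∘ (chartAt (Eu d) x₀).symm) (chartAt (Eu d) x₀ x)).det| *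
        volDensity x₁ (chartAt (Eu d) x₁ x) := by
  rw [volDensity_chartAt h₀, volDensity_chartAt h₁, frameMap_eq_comp h₀ h₁, gramDensity_comp]

variable [IsContMDiffRiemannianBundle (𝓡 d) ∞ (Eu d) (fun x : X => TangentSpace (𝓡 d) x)]

theorem contMDiffOn_coordVec (x₀ : X) (i : Fin d) :
    ContMDiffOn (𝓡 d) (𝓡 d).tangent ∞ (fun y => (⟨(chartAt (Eu d) x₀).symm y, coordVec x₀ y i⟩ :
      TangentBundle (𝓡 d) X)) (chartAt (Eu d) x₀).target := by
  have h1 : ContMDiffOn (𝓡 d).tangent (𝓡 d).tangent ∞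
      (tangentMapWithin (𝓡 d) (𝓡 d) (chartAt (Eu d) x₀).symm (chartAt (Eu d) x₀).target)
      (Bundle.TotalSpace.proj ⁻¹' (chartAt (Eu d) x₀).target) :=
    (contMDiffOn_chart_symm (I := 𝓡 d) (n := ∞) (x := x₀)).contMDiffOn_tangentMapWithin
      (by simp) (chartAt (Eu d) x₀).open_target.uniqueMDiffOn
  have h2 := (contMDiff_vectorSpace_iff_contDiff (𝕜 := ℝ) (E := Eu d) (n := ∞)
    (V := fun _ => (EuclideanSpace.single i (1 : ℝ) : Eu d))).2 contDiff_const
  refine (h1.comp h2.contMDiffOn fun y hy => hy).congr fun y hy => ?_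
  simp only [Function.comp_apply, tangentMapWithin]
  rw [mfderivWithin_of_isOpen (chartAt (Eu d) x₀).open_target hy]
  rfl

theorem contDiffOn_volDensity (x₀ : X) :
    ContDiffOn ℝ ∞ (volDensity x₀) (chartAt (Eu d) x₀).target := by
  have hg : ∀ i j, ContDiffOn ℝ ∞ (fun y : Eu d =>
      (inner ℝ (coordVec x₀ y i) (coordVec x₀ y j) : ℝ)) (chartAt (Eu d) x₀).target := fun i j => by
    rw [← contMDiffOn_iff_contDiffOn]
    exact ContMDiffOn.inner_bundle (contMDiffOn_coordVec x₀ i) (contMDiffOn_coordVec x₀ j)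
  have hdet : ContDiffOn ℝ ∞ (fun y : Eu d => Matrix.det (Matrix.of fun i j : Fin d =>
      (inner ℝ (coordVec x₀ y i) (coordVec x₀ y j) : ℝ))) (chartAt (Eu d) x₀).target := by
    simp only [Matrix.det_apply, Matrix.of_apply]
    exact ContDiffOn.sum fun s _ => (contDiffOn_prod fun i _ => hg _ _).const_smul _
  -- The root is smooth because the Gram determinant does not vanish.
  refine hdet.sqrt fun y hy h0 => ?_
  have := volDensity_pos hy
  rw [volDensity, h0, Real.sqrt_zero] at this
  exact lt_irrefl _ this

end Density

/-! ### The Riemannian volume measure -/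

theorem measurableSet_inter_preimage_of_continuousOn {A B : Type*} [TopologicalSpace A]
    [MeasurableSpace A] [BorelSpace A] [TopologicalSpace B] [MeasurableSpace B] [BorelSpace B]
    {f : A → B} {t : Set A} {s : Set B}
    (hf : ContinuousOn f t) (ht : MeasurableSet t) (hs : MeasurableSet s) :
    MeasurableSet (t ∩ f ⁻¹' s) := by
  have h := ht.subtype_image (hf.domRestrict.measurable hs)
  convert h using 1
  ext x
  simp [and_comm]

section Volume

variable {d : ℕ} {X : Type*} [TopologicalSpace X] [ChartedSpace (Eu d) X]
  [RiemannianBundle (fun x : X => TangentSpace (𝓡 d) x)] [IsManifold (𝓡 d) ∞ X]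
  [MeasurableSpace X] [BorelSpace X]

theorem aemeasurable_chartAt_symm (x₀ : X) : AEMeasurable (chartAt (Eu d) x₀).symm
    ((volume.restrict (chartAt (Eu d) x₀).target).withDensity
      (fun y => ENNReal.ofReal (volDensity x₀ y))) :=
  ((chartAt (Eu d) x₀).continuousOn_symm.aemeasurable
    (chartAt (Eu d) x₀).open_target.measurableSet).mono_ac (withDensity_absolutelyContinuous _ _)

theorem measurableSet_chart_preimage (x₀ : X) {s : Set X} (hs : MeasurableSet s) :
    MeasurableSet ((chartAt (Eu d) x₀).target ∩ (chartAt (Eu d) x₀).symm ⁻¹' s) :=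
  measurableSet_inter_preimage_of_continuousOn (chartAt (Eu d) x₀).continuousOn_symm
    (chartAt (Eu d) x₀).open_target.measurableSet hs

theorem chartVol_apply (x₀ : X) {s : Set X} (hs : MeasurableSet s) :
    chartVol (d := d) x₀ s = ∫⁻ y in (chartAt (Eu d) x₀).target ∩ (chartAt (Eu d) x₀).symm ⁻¹' s,
      ENNReal.ofReal (volDensity x₀ y) := by
  have h1 : NullMeasurableSet ((chartAt (Eu d) x₀).symm ⁻¹' s)
      (volume.restrict (chartAt (Eu d) x₀).target) :=
    ((chartAt (Eu d) x₀).continuousOn_symm.aemeasurable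
      (chartAt (Eu d) x₀).open_target.measurableSet).nullMeasurable hs
  rw [chartVol, Measure.map_apply_of_aemeasurable (aemeasurable_chartAt_symm x₀) hs,
    withDensity_apply₀ _ h1, Measure.restrict_restrict₀ h1, inter_comm]

theorem chartVol_compl_source (x₀ : X) :
    chartVol (d := d) x₀ (chartAt (Eu d) x₀).sourceᶜ = 0 := by
  rw [chartVol_apply x₀ (chartAt (Eu d) x₀).open_source.measurableSet.compl]
  have : (chartAt (Eu d) x₀).target ∩ (chartAt (Eu d) x₀).symm ⁻¹' (chartAt (Eu d) x₀).sourceᶜ = ∅ :=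
    eq_empty_of_forall_notMem fun y hy => hy.2 ((chartAt (Eu d) x₀).map_target hy.1)
  rw [this, setLIntegral_empty]

theorem contDiffAt_transition {x₀ x₁ x : X} (h₀ : x ∈ (chartAt (Eu d) x₀).source)
    (h₁ : x ∈ (chartAt (Eu d) x₁).source) : DifferentiableAt ℝ
      (chartAt (Eu d) x₁ ∘ (chartAt (Eu d) x₀).symm) (chartAt (Eu d) x₀ x) := by
  rw [← mdifferentiableAt_iff_differentiableAt]
  refine MDifferentiableAt.comp _ ?_
    (mdifferentiableAt_chartAt_symm ((chartAt (Eu d) x₀).map_source h₀))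
  rw [(chartAt (Eu d) x₀).left_inv h₀]
  exact mdifferentiableAt_chartAt h₁

/-- The Jacobian of the transition map is compensated by the transformation law of the density. -/
theorem chartVol_eq_chartVol {x₀ x₁ : X} {s : Set X} (hs : MeasurableSet s)
    (h₀ : s ⊆ (chartAt (Eu d) x₀).source) (h₁ : s ⊆ (chartAt (Eu d) x₁).source) :
    chartVol (d := d) x₀ s = chartVol (d := d) x₁ s := by
  rw [chartVol_apply x₀ hs, chartVol_apply x₁ hs]
  set φ₀ := chartAt (Eu d) x₀
  set φ₁ := chartAt (Eu d) x₁
  have hS : φ₁.target ∩ φ₁.symm ⁻¹' s = (φ₁ ∘ φ₀.symm) '' (φ₀.target ∩ φ₀.symm ⁻¹' s) := by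
    ext y
    constructor
    · rintro ⟨hy, hys⟩
      refine ⟨φ₀ (φ₁.symm y), ⟨φ₀.map_source (h₀ hys), ?_⟩, ?_⟩
      · simpa [φ₀.left_inv (h₀ hys)] using hys
      · simp [φ₀.left_inv (h₀ hys), φ₁.right_inv hy]
    · rintro ⟨z, ⟨hz, hzs⟩, rfl⟩
      refine ⟨φ₁.map_source (h₁ hzs), ?_⟩
      simpa [φ₁.left_inv (h₁ hzs)] using hzs
  have hm := measurableSet_chart_preimage (d := d) x₀ hs
  rw [hS, lintegral_image_eq_lintegral_abs_det_fderiv_mul volume hm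
    (f' := fun y => fderiv ℝ (φ₁ ∘ φ₀.symm) y)]
  · refine setLIntegral_congr_fun hm fun y hy => ?_
    have := volDensity_eq_abs_det_mul (h₀ hy.2) (h₁ hy.2)
    rw [φ₀.right_inv hy.1] at this
    simp only [Function.comp_apply]
    rw [this, ENNReal.ofReal_mul (abs_nonneg _)]
  · intro y hy
    have := contDiffAt_transition (h₀ hy.2) (h₁ hy.2)
    rw [φ₀.right_inv hy.1] at this
    exact this.hasFDerivAt.hasFDerivWithinAt
  · intro y hy z hz hyz
    have h := φ₁.injOn (h₁ hy.2) (h₁ hz.2) hyz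
    exact φ₀.symm.injOn hy.1 hz.1 h

/-- Measurability of `t` is not assumed, since the comparison with an outer measure runs over all
sets. On the overlap of the two domains the measures agree, and outside its own domain the left one
vanishes. -/
theorem chartVol_le_chartVol (x₀ : X) {x₁ : X} {t : Set X} (h₁ : t ⊆ (chartAt (Eu d) x₁).source) :
    chartVol (d := d) x₀ t ≤ chartVol (d := d) x₁ t := by
  set S := (chartAt (Eu d) x₀).source ∩ (chartAt (Eu d) x₁).source
  have hS : MeasurableSet S := ((chartAt (Eu d) x₀).open_source.inter
    (chartAt (Eu d) x₁).open_source).measurableSet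
  have e : (chartVol (d := d) x₀).restrict S = (chartVol (d := d) x₁).restrict S := by
    ext s hs
    rw [Measure.restrict_apply hs, Measure.restrict_apply hs]
    exact chartVol_eq_chartVol (hs.inter hS) (inter_subset_right.trans inter_subset_left)
      (inter_subset_right.trans inter_subset_right)
  calc chartVol (d := d) x₀ t ≤ chartVol (d := d) x₀ (t ∩ S ∪ (chartAt (Eu d) x₀).sourceᶜ) :=
        measure_mono fun x hx => by
          by_cases h : x ∈ (chartAt (Eu d) x₀).source
          · exact Or.inl ⟨hx, h, h₁ hx⟩
          · exact Or.inr h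
    _ ≤ chartVol (d := d) x₀ (t ∩ S) + chartVol (d := d) x₀ (chartAt (Eu d) x₀).sourceᶜ :=
        measure_union_le _ _
    _ = chartVol (d := d) x₁ (t ∩ S) := by
        rw [chartVol_compl_source, add_zero, ← Measure.restrict_apply' hS, e,
          Measure.restrict_apply' hS]
    _ ≤ chartVol (d := d) x₁ t := measure_mono inter_subset_left

/-- One inequality is the bound of the outer measure by its generating function. For the other, the
chart measure is a lower bound of `preVol`, and `boundedBy` yields the largest outer measure below
`preVol`. -/
theorem riemannianVolume_restrict_source (x₀ : X) :
    (riemannianVolume d X).restrict (chartAt (Eu d) x₀).source = chartVol (d := d) x₀ := by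
  have hS := (chartAt (Eu d) x₀).open_source.measurableSet
  ext s hs
  rw [Measure.restrict_apply hs, riemannianVolume, toMeasure_apply _ _ (hs.inter hS)]
  apply le_antisymm
  · refine (OuterMeasure.boundedBy_le _).trans ?_
    exact (iInf₂_le x₀ inter_subset_right).trans (measure_mono inter_subset_left)
  · have h : (chartVol (d := d) x₀).toOuterMeasure ≤
        OuterMeasure.boundedBy (preVol (d := d) (X := X)) :=
      OuterMeasure.le_boundedBy.2 fun t => le_iInf₂ fun x₁ h₁ => chartVol_le_chartVol x₀ h₁
    refine le_trans ?_ (h _)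
    change chartVol (d := d) x₀ s ≤ chartVol (d := d) x₀ (s ∩ (chartAt (Eu d) x₀).source)
    calc chartVol (d := d) x₀ s ≤ chartVol (d := d) x₀
          (s ∩ (chartAt (Eu d) x₀).source ∪ (chartAt (Eu d) x₀).sourceᶜ) :=
          measure_mono fun x hx => by
            by_cases h : x ∈ (chartAt (Eu d) x₀).source
            · exact Or.inl ⟨hx, h⟩
            · exact Or.inr h
      _ ≤ _ := measure_union_le _ _
      _ = _ := by rw [chartVol_compl_source, add_zero]

theorem riemannianVolume_apply {x₀ : X} {s : Set X} (hs : MeasurableSet s)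
    (h : s ⊆ (chartAt (Eu d) x₀).source) : riemannianVolume d X s =
      ∫⁻ y in (chartAt (Eu d) x₀).target ∩ (chartAt (Eu d) x₀).symm ⁻¹' s,
        ENNReal.ofReal (volDensity x₀ y) := by
  rw [← chartVol_apply x₀ hs, ← riemannianVolume_restrict_source, Measure.restrict_apply hs,
    inter_eq_left.2 h]

variable [IsContMDiffRiemannianBundle (𝓡 d) ∞ (Eu d) (fun x : X => TangentSpace (𝓡 d) x)]

theorem continuousOn_volDensity (x₀ : X) :
    ContinuousOn (volDensity x₀) (chartAt (Eu d) x₀).target :=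
  (contDiffOn_volDensity x₀).continuousOn

theorem setIntegral_riemannianVolume {x₀ : X} {f : X → ℝ}
    (hf : ContinuousOn f (chartAt (Eu d) x₀).source) :
    ∫ x in (chartAt (Eu d) x₀).source, f x ∂(riemannianVolume d X) =
      ∫ y in (chartAt (Eu d) x₀).target, volDensity x₀ y * f ((chartAt (Eu d) x₀).symm y) := by
  have hm := (chartAt (Eu d) x₀).open_target.measurableSet
  have h1 : AEStronglyMeasurable f (chartVol (d := d) x₀) := by
    rw [← riemannianVolume_restrict_source]
    exact (hf.aemeasurable (chartAt (Eu d) x₀).open_source.measurableSet).aestronglyMeasurable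
  rw [riemannianVolume_restrict_source, chartVol,
    integral_map (aemeasurable_chartAt_symm x₀) h1,
    integral_withDensity_eq_integral_toReal_smul₀]
  · refine setIntegral_congr_fun hm fun y hy => ?_
    simp [ENNReal.toReal_ofReal (volDensity_pos hy).le]
  · exact ((continuousOn_volDensity x₀).aemeasurable hm).ennreal_ofReal
  · simp

instance isLocallyFiniteMeasure_riemannianVolume :
    IsLocallyFiniteMeasure (riemannianVolume d X) := by
  refine ⟨fun x => ?_⟩
  set φ := chartAt (Eu d) x
  have hx := mem_chart_source (Eu d) x
  obtain ⟨r, hr, hball⟩ := Metric.nhds_basis_closedBall.mem_iff.1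
    (φ.open_target.mem_nhds (φ.map_source hx))
  have hO : IsOpen (φ.source ∩ φ ⁻¹' Metric.ball (φ x) r) := φ.isOpen_inter_preimage Metric.isOpen_ball
  refine ⟨φ.source ∩ φ ⁻¹' Metric.ball (φ x) r, hO.mem_nhds ⟨hx, Metric.mem_ball_self hr⟩, ?_⟩
  rw [riemannianVolume_apply hO.measurableSet inter_subset_left]
  have hsub : φ.target ∩ φ.symm ⁻¹' (φ.source ∩ φ ⁻¹' Metric.ball (φ x) r) ⊆
      Metric.closedBall (φ x) r := by
    rintro y ⟨hy, -, hy2⟩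
    simp only [mem_preimage, φ.right_inv hy] at hy2
    exact Metric.ball_subset_closedBall hy2
  have hint : IntegrableOn (volDensity x) (Metric.closedBall (φ x) r) :=
    ((continuousOn_volDensity x).mono hball).integrableOn_compact (isCompact_closedBall _ _)
  refine (lintegral_mono_set hsub).trans_lt ?_
  refine (lintegral_mono fun y => ?_).trans_lt hint.hasFiniteIntegral
  exact Real.ofReal_le_enorm _

/-- In dimension `0` points have positive volume. The absence of atoms makes the positions in almost
every tuple distinct. -/
theorem noAtoms_riemannianVolume [T2Space X] (hd : d ≠ 0) :
    NullSingletonClass (riemannianVolume d X) := by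
  refine ⟨fun x => ?_⟩
  have : Nonempty (Fin d) := ⟨⟨0, Nat.pos_of_ne_zero hd⟩⟩
  rw [riemannianVolume_apply (measurableSet_singleton x)
    (singleton_subset_iff.2 (mem_chart_source (Eu d) x))]
  refine setLIntegral_measure_zero _ _ (measure_mono_null (t := {chartAt (Eu d) x x}) ?_ ?_)
  · rintro y ⟨hy, hyx⟩
    rw [mem_preimage, mem_singleton_iff] at hyx
    rw [mem_singleton_iff, ← (chartAt (Eu d) x).right_inv hy]
    exact congrArg _ hyx
  · exact measure_singleton _

/-- The density is positive in every chart. Continuous functions that agree almost everywhere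
therefore agree. -/
instance isOpenPosMeasure_riemannianVolume :
    (riemannianVolume d X).IsOpenPosMeasure := by
  refine ⟨fun U hU ⟨x, hxU⟩ h0 => ?_⟩
  set φ := chartAt (Eu d) x
  have hx := mem_chart_source (Eu d) x
  have h1 : riemannianVolume d X (U ∩ φ.source) = 0 := measure_mono_null inter_subset_left h0
  have hO := hU.inter φ.open_source
  rw [riemannianVolume_apply hO.measurableSet inter_subset_right] at h1
  have hV : IsOpen (φ.target ∩ φ.symm ⁻¹' (U ∩ φ.source)) := φ.symm.isOpen_inter_preimage hO
  have h2 := hV.measure_pos volume ⟨φ x, φ.map_source hx, by rw [mem_preimage, φ.left_inv hx]; exact ⟨hxU, hx⟩⟩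
  have hm : AEMeasurable (fun y => ENNReal.ofReal (volDensity x y))
      (volume.restrict (φ.target ∩ φ.symm ⁻¹' (U ∩ φ.source))) :=
    (((continuousOn_volDensity x).mono inter_subset_left).aemeasurable
      hV.measurableSet).ennreal_ofReal
  rw [lintegral_eq_zero_iff' hm] at h1
  have h3 : ∀ᵐ y ∂(volume.restrict (φ.target ∩ φ.symm ⁻¹' (U ∩ φ.source))), False := by
    filter_upwards [h1, ae_restrict_mem hV.measurableSet] with y hy hyV
    exact (ENNReal.ofReal_pos.2 (volDensity_pos hyV.1)).ne' hy
  rw [Filter.eventually_false_iff_eq_bot, ae_eq_bot, Measure.restrict_eq_zero] at h3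
  exact h2.ne' h3

end Volume

/-! ### The divergence in charts and its independence of the chart -/

theorem continuous_of_continuousOn_of_eq_zero {A E : Type*} [TopologicalSpace A]
    [TopologicalSpace E] [Zero E] {f : A → E} {U K : Set A} (hU : IsOpen U) (hK : IsClosed K) (hKU : K ⊆ U)
    (hf : ContinuousOn f U) (h0 : ∀ x ∉ K, f x = 0) : Continuous f := by
  refine continuous_iff_continuousAt.2 fun x => ?_
  by_cases hx : x ∈ K
  · exact hf.continuousAt (hU.mem_nhds (hKU hx))
  · refine (continuousAt_const (y := (0 : E))).congr ?_
    filter_upwards [hK.isOpen_compl.mem_nhds hx] with y hy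
    exact (h0 y hy).symm

theorem integral_fderiv_eq_zero {d : ℕ} {W : Eu d → ℝ} (hW : ContDiff ℝ 1 W)
    (hc : HasCompactSupport W) (e : Eu d) : ∫ y, fderiv ℝ W y e = 0 := by
  have hi : Integrable (fun y => fderiv ℝ W y e) := by
    refine Continuous.integrable_of_hasCompactSupport
      ((hW.continuous_fderiv (by simp)).clm_apply continuous_const) ?_
    exact (hc.fderiv (𝕜 := ℝ)).comp_left (g := fun L : Eu d →L[ℝ] ℝ => L e) (by simp)
  have := integral_mul_fderiv_eq_neg_fderiv_mul_of_integrable (μ := volume) (f := fun _ : Eu d => (1 : ℝ))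
    (g := W) (v := e) (by simp) (by simpa using hi)
    (by simpa using hW.continuous.integrable_of_hasCompactSupport hc)
    (fun x _ => differentiableAt_const _) (fun x _ => (hW.differentiable (by simp)) x)
  simpa using this

section Divergence

variable {d : ℕ} {X : Type*} [TopologicalSpace X] [T2Space X] [ChartedSpace (Eu d) X]
  [RiemannianBundle (fun x : X => TangentSpace (𝓡 d) x)] [IsManifold (𝓡 d) ∞ X]

/-- The divergence of a vector field in the chart around `x₀`. -/
def chartDiv (x₀ : X) (v : (x : X) → TangentSpace (𝓡 d) x) (y : Eu d) : ℝ :=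
  (∑ i : Fin d, fderiv ℝ (fun y : Eu d => volDensity x₀ y * chartField x₀ v y i) y
    (EuclideanSpace.single i (1 : ℝ))) / volDensity x₀ y

theorem divergence_eq_chartDiv (v : (x : X) → TangentSpace (𝓡 d) x) (x : X) :
    divergence v x = chartDiv x v (chartAt (Eu d) x x) := rfl

variable [IsContMDiffRiemannianBundle (𝓡 d) ∞ (Eu d) (fun x : X => TangentSpace (𝓡 d) x)]

section

variable {v : (x : X) → TangentSpace (𝓡 d) x}
  (hv : ContMDiff (𝓡 d) (𝓡 d).tangent ∞ (fun x => (⟨x, v x⟩ : TangentBundle (𝓡 d) X)))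
include hv

theorem contDiffOn_volDensity_mul_chartField (x₀ : X) (i : Fin d) :
    ContDiffOn ℝ ∞ (fun y => volDensity x₀ y * chartField x₀ v y i) (chartAt (Eu d) x₀).target :=
  (contDiffOn_volDensity x₀).mul
    ((EuclideanSpace.proj (𝕜 := ℝ) i).contDiff.comp_contDiffOn (contDiffOn_chartField (n := ⊤) hv x₀))

theorem contDiffOn_chartDiv (x₀ : X) :
    ContDiffOn ℝ ∞ (chartDiv x₀ v) (chartAt (Eu d) x₀).target := by
  refine ContDiffOn.div ?_ (contDiffOn_volDensity x₀) fun y hy => (volDensity_pos hy).ne'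
  refine ContDiffOn.sum fun i _ => ?_
  exact ((contDiffOn_volDensity_mul_chartField hv x₀ i).fderiv_of_isOpen
    (chartAt (Eu d) x₀).open_target (m := ∞) (by simp)).clm_apply contDiffOn_const

theorem contMDiffOn_chartDiv_comp (x₀ : X) : ContMDiffOn (𝓡 d) 𝓘(ℝ, ℝ) ∞
    (fun x => chartDiv x₀ v (chartAt (Eu d) x₀ x)) (chartAt (Eu d) x₀).source :=
  (contDiffOn_chartDiv hv x₀).contMDiffOn.comp (contMDiffOn_chart (I := 𝓡 d) (x := x₀))
    fun _ hx => (chartAt (Eu d) x₀).map_source hx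

variable [MeasurableSpace X] [BorelSpace X]

/-- Integration by parts within the domain of one chart. -/
theorem setIntegral_diffAt_add_chartDiv {f : X → ℝ} (hf : ContMDiff (𝓡 d) 𝓘(ℝ, ℝ) 1 f) {x₀ : X}
    {K : Set X} (hK : IsCompact K) (hKs : K ⊆ (chartAt (Eu d) x₀).source)
    (h0 : ∀ x ∉ K, f x = 0 ∨ v x = 0) : ∫ x in (chartAt (Eu d) x₀).source,
      (diffAt f x (v x) + f x * chartDiv x₀ v (chartAt (Eu d) x₀ x)) ∂(riemannianVolume d X) = 0 := by
  set φ := chartAt (Eu d) x₀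
  have hv1 : ContMDiff (𝓡 d) (𝓡 d).tangent 1
    (fun x => (⟨x, v x⟩ : TangentBundle (𝓡 d) X)) := hv.of_le (by simp)
  have hcont : ContinuousOn (fun x => diffAt f x (v x) + f x * chartDiv x₀ v (φ x)) φ.source :=
    (contMDiff_diffAt (n := 0) (m := 1) (by simp) hf (hv.of_le (by simp))).continuous.continuousOn.add
      (hf.continuous.continuousOn.mul (contMDiffOn_chartDiv_comp hv x₀).continuousOn)
  rw [setIntegral_riemannianVolume hcont]
  -- The functions `f √g vⁱ`, extended by zero from the chart. They are `C¹` with compact support,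
  -- and `√g` times the integrand is `∑ ∂ᵢ Wᵢ`, which integrates to zero.
  let W : Fin d → Eu d → ℝ := fun i => φ.target.indicator
    (fun y => f (φ.symm y) * (volDensity x₀ y * chartField x₀ v y i))
  have hKc : IsCompact (φ '' K) := hK.image_of_continuousOn (φ.continuousOn.mono hKs)
  have hKt : φ '' K ⊆ φ.target := by rintro _ ⟨x, hx, rfl⟩; exact φ.map_source (hKs hx)
  have hW0 : ∀ i, ∀ y ∉ φ '' K, W i y = 0 := by
    intro i y hy
    by_cases hyt : y ∈ φ.target
    · have hxK : φ.symm y ∉ K := fun h => hy ⟨_, h, φ.right_inv hyt⟩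
      simp only [W, indicator_of_mem hyt]
      rcases h0 _ hxK with h | h
      · simp [h]
      · have : chartField x₀ v y = 0 := by
          rw [chartField, h]
          exact map_zero (show Eu d →L[ℝ] Eu d from _)
        simp [this]
    · simp [W, hyt]
  have hsm : ∀ i, ContDiffOn ℝ 1
      (fun y => f (φ.symm y) * (volDensity x₀ y * chartField x₀ v y i)) φ.target := fun i =>
    (contDiffOn_comp_chartAt_symm (n := 1) hf x₀).mul
      ((contDiffOn_volDensity_mul_chartField hv x₀ i).of_le (by simp))
  have hWs : ∀ i, ContDiff ℝ 1 (W i) := by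
    refine fun i => contDiff_iff_contDiffAt.2 fun y => ?_
    by_cases hy : y ∈ φ '' K
    · refine ((hsm i).contDiffAt (φ.open_target.mem_nhds (hKt hy))).congr_of_eventuallyEq ?_
      filter_upwards [φ.open_target.mem_nhds (hKt hy)] with z hz
      simp [W, hz]
    · refine (contDiffAt_const (c := (0 : ℝ))).congr_of_eventuallyEq ?_
      filter_upwards [hKc.isClosed.isOpen_compl.mem_nhds hy] with z hz
      exact hW0 i z hz
  have hWc : ∀ i, HasCompactSupport (W i) := fun i => HasCompactSupport.intro hKc (hW0 i)
  have hdW : ∀ i, ∀ y ∈ φ.target, fderiv ℝ (W i) y (EuclideanSpace.single i 1) =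
      f (φ.symm y) * fderiv ℝ (fun y => volDensity x₀ y * chartField x₀ v y i) y
        (EuclideanSpace.single i 1) + volDensity x₀ y * (chartField x₀ v y i *
          fderiv ℝ (f ∘ φ.symm) y (EuclideanSpace.single i 1)) := by
    intro i y hy
    have e : W i =ᶠ[𝓝 y] fun y => (f ∘ φ.symm) y * (volDensity x₀ y * chartField x₀ v y i) := by
      filter_upwards [φ.open_target.mem_nhds hy] with z hz
      simp [W, hz]
    have h1 : DifferentiableAt ℝ (f ∘ φ.symm) y :=
      ((contDiffOn_comp_chartAt_symm (n := 1) hf x₀).contDiffAt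
        (φ.open_target.mem_nhds hy)).differentiableAt (by simp)
    have h2 : DifferentiableAt ℝ (fun y => volDensity x₀ y * chartField x₀ v y i) y :=
      ((contDiffOn_volDensity_mul_chartField hv x₀ i).contDiffAt
        (φ.open_target.mem_nhds hy)).differentiableAt (by simp)
    rw [e.fderiv_eq, fderiv_fun_mul h1 h2]
    simp only [add_apply, smul_apply, smul_eq_mul,
      Function.comp_apply]
    ring
  have hI : ∀ y ∈ φ.target, volDensity x₀ y * (diffAt f (φ.symm y) (v (φ.symm y)) +
      f (φ.symm y) * chartDiv x₀ v (φ (φ.symm y))) =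
      ∑ i, fderiv ℝ (W i) y (EuclideanSpace.single i 1) := by
    intro y hy
    rw [Finset.sum_congr rfl fun i _ => hdW i y hy, Finset.sum_add_distrib, ← Finset.mul_sum,
      ← Finset.mul_sum, φ.right_inv hy, diffAt_apply_eq_fderiv hy (hf.mdifferentiable (by simp) _) v,
      clm_apply_eq_sum _ (chartField x₀ v y), chartDiv, mul_add, ← mul_assoc,
      mul_comm (volDensity x₀ y) (f _), mul_assoc, mul_div_cancel₀ _ (volDensity_pos hy).ne']
    simp only [smul_eq_mul]
    ring
  rw [setIntegral_congr_fun φ.open_target.measurableSet hI]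
  rw [setIntegral_eq_integral_of_forall_compl_eq_zero, integral_finsetSum]
  · exact Finset.sum_eq_zero fun i _ => integral_fderiv_eq_zero (hWs i) (hWc i) _
  · intro i _
    refine Continuous.integrable_of_hasCompactSupport
      (((hWs i).continuous_fderiv (by simp)).clm_apply continuous_const) ?_
    exact ((hWc i).fderiv (𝕜 := ℝ)).comp_left (g := fun L : Eu d →L[ℝ] ℝ => L _) (by simp)
  · intro y hy
    refine Finset.sum_eq_zero fun i _ => ?_
    have e : W i =ᶠ[𝓝 y] fun _ => 0 := by
      filter_upwards [hKc.isClosed.isOpen_compl.mem_nhds fun h => hy (hKt h)] with z hz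
      exact hW0 i z hz
    rw [e.fderiv_eq]
    simp

variable [SecondCountableTopology X]

/-- The divergence does not depend on the chart. -/
theorem divergence_eq_chartDiv_of_mem {x₀ x : X} (hx : x ∈ (chartAt (Eu d) x₀).source) :
    divergence v x = chartDiv x₀ v (chartAt (Eu d) x₀ x) := by
  have := ChartedSpace.locallyCompactSpace (Eu d) X
  set U := (chartAt (Eu d) x).source ∩ (chartAt (Eu d) x₀).source
  have hU : IsOpen U := (chartAt (Eu d) x).open_source.inter (chartAt (Eu d) x₀).open_source
  have hc : ∀ x₁ : X, U ⊆ (chartAt (Eu d) x₁).source →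
      ContinuousOn (fun x' => chartDiv x₁ v (chartAt (Eu d) x₁ x')) U := fun x₁ h =>
    (contMDiffOn_chartDiv_comp hv x₁).continuousOn.mono h
  have h1 := hc x inter_subset_left
  have h2 := hc x₀ inter_subset_right
  -- For `g` supported in the overlap, both chart expressions integrate against `g` to `-∫ dg(v)
  -- dν`, which involves no chart. So they agree almost everywhere on the overlap, and by continuity
  -- everywhere there.
  have hI : ∀ g : X → ℝ, ContMDiff (𝓡 d) 𝓘(ℝ, ℝ) ∞ g → HasCompactSupport g → tsupport g ⊆ U →
      ∀ x₁ : X, U ⊆ (chartAt (Eu d) x₁).source →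
      Integrable (fun x' => g x' * chartDiv x₁ v (chartAt (Eu d) x₁ x')) (riemannianVolume d X) ∧
      ∫ x', g x' * chartDiv x₁ v (chartAt (Eu d) x₁ x') ∂(riemannianVolume d X) =
        - ∫ x', diffAt g x' (v x') ∂(riemannianVolume d X) := by
    intro g hg hgc hgU x₁ hx₁
    have hg1 : ContMDiff (𝓡 d) 𝓘(ℝ, ℝ) 1 g := hg.of_le (by simp)
    have i1 : Integrable (fun x' => g x' * chartDiv x₁ v (chartAt (Eu d) x₁ x'))
        (riemannianVolume d X) :=
      (continuous_of_continuousOn_of_eq_zero hU (isClosed_tsupport g) hgU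
        (hg.continuous.continuousOn.mul (hc x₁ hx₁)) fun x' hx' => by
          simp [image_eq_zero_of_notMem_tsupport hx']).integrable_of_hasCompactSupport hgc.mul_right
    have hD0 : ∀ x' ∉ tsupport g, diffAt g x' (v x') = 0 := by
      intro x' hx'
      have e : g =ᶠ[𝓝 x'] fun _ => 0 := by
        filter_upwards [(isClosed_tsupport g).isOpen_compl.mem_nhds hx'] with z hz
        exact image_eq_zero_of_notMem_tsupport hz
      exact congrArg (fun L : Eu d →L[ℝ] ℝ => L (v x')) ((diffAt_congr e).trans (diffAt_const 0 x'))
    have i2 : Integrable (fun x' => diffAt g x' (v x')) (riemannianVolume d X) :=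
      (contMDiff_diffAt (n := 0) (m := 1) (by simp) hg1
        (hv.of_le (by simp))).continuous.integrable_of_hasCompactSupport
        (HasCompactSupport.intro hgc.isCompact hD0)
    have h3 := setIntegral_diffAt_add_chartDiv hv hg1 hgc.isCompact (hgU.trans hx₁)
      fun x' hx' => Or.inl (image_eq_zero_of_notMem_tsupport hx')
    rw [setIntegral_eq_integral_of_forall_compl_eq_zero, integral_add i2 i1] at h3
    · exact ⟨i1, by linarith⟩
    · intro x' hx'
      have hx'' : x' ∉ tsupport g := fun h => hx' (hx₁ (hgU h))
      rw [hD0 x' hx'', image_eq_zero_of_notMem_tsupport hx'']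
      simp
  have h3 := hU.ae_eq_zero_of_integral_contMDiff_smul_eq_zero (𝓡 d) (μ := riemannianVolume d X)
    ((h1.sub h2).locallyIntegrableOn hU.measurableSet) fun g hg hgc hgU => by
      obtain ⟨i1, e1⟩ := hI g hg hgc hgU x inter_subset_left
      obtain ⟨i2, e2⟩ := hI g hg hgc hgU x₀ inter_subset_right
      simp only [smul_eq_mul, Pi.sub_apply, mul_sub]
      rw [integral_sub i1 i2, e1, e2, sub_self]
  have h4 := Measure.eqOn_open_of_ae_eq (μ := riemannianVolume d X)
    ((ae_restrict_iff' hU.measurableSet).2 (h3.mono fun x' h hx' => sub_eq_zero.1 (h hx'))) hU h1 h2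
  exact h4 ⟨mem_chart_source (Eu d) x, hx⟩

theorem contMDiff_divergence : ContMDiff (𝓡 d) 𝓘(ℝ, ℝ) ∞ (divergence v) := by
  intro x
  refine ((contMDiffOn_chartDiv_comp hv x).contMDiffAt
    ((chartAt (Eu d) x).open_source.mem_nhds (mem_chart_source (Eu d) x))).congr_of_eventuallyEq ?_
  filter_upwards [(chartAt (Eu d) x).open_source.mem_nhds (mem_chart_source (Eu d) x)] with z hz
  exact divergence_eq_chartDiv_of_mem hv hz

end

theorem divergence_eq_zero {v : (x : X) → TangentSpace (𝓡 d) x} {x : X}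
    (hx : x ∉ closure {x | v x ≠ 0}) : divergence v x = 0 := by
  rw [divergence_eq_chartDiv, chartDiv]
  have h1 := eventually_eq_zero_of_notMem_closure hx
  have hc : ContinuousAt (chartAt (Eu d) x).symm (chartAt (Eu d) x x) :=
    (chartAt (Eu d) x).continuousAt_symm
      ((chartAt (Eu d) x).map_source (mem_chart_source (Eu d) x))
  have h2 : ∀ᶠ y in 𝓝 (chartAt (Eu d) x x), v ((chartAt (Eu d) x).symm y) = 0 := by
    refine hc.eventually (p := fun z => v z = 0) ?_
    rwa [(chartAt (Eu d) x).left_inv (mem_chart_source (Eu d) x)]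
  have h3 : ∀ i, (fun y => volDensity x y * chartField x v y i) =ᶠ[𝓝 (chartAt (Eu d) x x)]
      fun _ => 0 := by
    intro i
    filter_upwards [h2] with y hy
    have : chartField x v y = 0 := by
      rw [chartField, hy]
      exact map_zero (show Eu d →L[ℝ] Eu d from _)
    simp [this]
  rw [Finset.sum_eq_zero, zero_div]
  intro i _
  rw [(h3 i).fderiv_eq]
  simp

end Divergence

/-! ### The divergence theorem -/

section DivergenceTheorem

variable {d : ℕ} {X : Type*} [TopologicalSpace X] [T2Space X] [ChartedSpace (Eu d) X]
  [RiemannianBundle (fun x : X => TangentSpace (𝓡 d) x)] [IsManifold (𝓡 d) ∞ X]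
  [IsContMDiffRiemannianBundle (𝓡 d) ∞ (Eu d) (fun x : X => TangentSpace (𝓡 d) x)]
  [MeasurableSpace X] [BorelSpace X] [SecondCountableTopology X]

theorem diffAt_finsetSum {ι : Type*} (s : Finset ι) {f : ι → X → ℝ} {x : X}
    (hf : ∀ i, MDifferentiable (𝓡 d) 𝓘(ℝ, ℝ) (f i)) (ξ : Eu d) :
    MDifferentiableAt (𝓡 d) 𝓘(ℝ, ℝ) (fun x => ∑ i ∈ s, f i x) x ∧
    diffAt (fun x => ∑ i ∈ s, f i x) x ξ = ∑ i ∈ s, diffAt (f i) x ξ := by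
  classical
  induction s using Finset.induction_on with
  | empty =>
    refine ⟨by simpa using mdifferentiableAt_const, ?_⟩
    simp only [Finset.sum_empty]
    exact congrArg (fun L : Eu d →L[ℝ] ℝ => L ξ) (diffAt_const (0 : ℝ) x)
  | insert i s hi ih =>
    simp only [Finset.sum_insert hi]
    exact ⟨(hf i x).add ih.1, by rw [diffAt_add (hf i x) ih.1, ih.2]⟩

/-- The divergence theorem: `div v` is adjoint to the derivative along `v`. -/
theorem integral_diffAt_add_divergence {v : (x : X) → TangentSpace (𝓡 d) x}
    (hv : ContMDiff (𝓡 d) (𝓡 d).tangent ∞ (fun x => (⟨x, v x⟩ : TangentBundle (𝓡 d) X)))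
    (hc : IsCompact (closure {x | v x ≠ 0})) {f : X → ℝ} (hf : ContMDiff (𝓡 d) 𝓘(ℝ, ℝ) 1 f) :
    ∫ x, (diffAt f x (v x) + f x * divergence v x) ∂(riemannianVolume d X) = 0 := by
  have := ChartedSpace.locallyCompactSpace (Eu d) X
  set S := closure {x | v x ≠ 0} with hSdef
  -- A compact neighbourhood of the support of `v`: the identity `f = ∑ ρᵢ f` with finitely many
  -- terms must hold near each point of the support, so that it can be differentiated there.
  obtain ⟨S', hS', hSS'⟩ := exists_compact_superset hc
  obtain ⟨ρ, hρ⟩ := SmoothPartitionOfUnity.exists_isSubordinate_chartAt_source (𝓡 d) X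
  have hfin := ρ.locallyFinite.finite_nonempty_inter_compact hS'
  set F := hfin.toFinset
  have hρs : ∀ i, ContMDiff (𝓡 d) 𝓘(ℝ, ℝ) 1 (ρ i) := fun i => (ρ i).contMDiff.of_le (by simp)
  have hρf : ∀ i, ContMDiff (𝓡 d) 𝓘(ℝ, ℝ) 1 (fun x => ρ i x * f x) := fun i => (hρs i).mul hf
  have hsum : ∀ x ∈ S', ∑ i ∈ F, ρ i x = 1 := by
    intro x hx
    rw [← ρ.sum_eq_one (mem_univ x), finsum_eq_sum_of_support_subset]
    intro i hi
    exact (Set.Finite.mem_toFinset hfin).2 ⟨x, hi, hx⟩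
  have hv0 : ∀ x ∉ S, v x = 0 := fun x hx => eq_zero_of_notMem_closure hx
  have hpt : ∀ x, diffAt f x (v x) + f x * divergence v x =
      ∑ i ∈ F, (diffAt (fun x => ρ i x * f x) x (v x) + ρ i x * f x * divergence v x) := by
    intro x
    by_cases hx : x ∈ S
    · have e : f =ᶠ[𝓝 x] fun x => ∑ i ∈ F, ρ i x * f x := by
        filter_upwards [isOpen_interior.mem_nhds (hSS' hx)] with z hz
        rw [← Finset.sum_mul, hsum z (interior_subset hz), one_mul]
      have e1 : diffAt f x (show Eu d from v x) =
          ∑ i ∈ F, diffAt (fun x => ρ i x * f x) x (show Eu d from v x) :=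
        (congrArg (fun L : Eu d →L[ℝ] ℝ => L (show Eu d from v x)) (diffAt_congr e)).trans
          (diffAt_finsetSum F (fun i => (hρf i).mdifferentiable (by simp)) _).2
      rw [Finset.sum_add_distrib, ← Finset.sum_mul, ← Finset.sum_mul,
        hsum x (interior_subset (hSS' hx)), one_mul]
      exact congrArg (fun y => y + f x * divergence v x) e1
    · have h0 : ∀ g : X → ℝ, diffAt g x (v x) = 0 := fun g => by
        rw [hv0 x hx]
        exact map_zero (diffAt g x : Eu d →L[ℝ] ℝ)
      simp only [h0, divergence_eq_zero (hSdef ▸ hx)]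
      simp
  have hi : ∀ i, HasCompactSupport
      (fun x => diffAt (fun x => ρ i x * f x) x (v x) + ρ i x * f x * divergence v x) := fun i =>
    HasCompactSupport.intro hc fun x hx => by
      rw [hv0 x hx, divergence_eq_zero hx, mul_zero, add_zero]
      exact map_zero (diffAt (fun x => ρ i x * f x) x : Eu d →L[ℝ] ℝ)
  have hci : ∀ i, Continuous
      (fun x => diffAt (fun x => ρ i x * f x) x (v x) + ρ i x * f x * divergence v x) := fun i =>
    (contMDiff_diffAt (n := 0) (m := 1) (by simp) (hρf i) (hv.of_le (by simp))).continuous.add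
      ((hρf i).continuous.mul (contMDiff_divergence hv).continuous)
  simp only [hpt]
  rw [integral_finsetSum _ fun i _ => (hci i).integrable_of_hasCompactSupport (hi i)]
  refine Finset.sum_eq_zero fun i _ => ?_
  have hK : IsCompact (tsupport (ρ i) ∩ S) := hc.inter_left (isClosed_tsupport _)
  have h1 := setIntegral_diffAt_add_chartDiv hv (hρf i) hK
    (inter_subset_left.trans (hρ i)) fun x hx => by
      by_cases hx1 : x ∈ S
      · left
        rw [image_eq_zero_of_notMem_tsupport fun h => hx ⟨h, hx1⟩, zero_mul]
      · exact Or.inr (hv0 x hx1)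
  rw [← h1, ← setIntegral_eq_integral_of_forall_compl_eq_zero (s := (chartAt (Eu d) i).source)]
  · refine setIntegral_congr_fun (chartAt (Eu d) i).open_source.measurableSet fun x hx => ?_
    simp only [divergence_eq_chartDiv_of_mem hv hx]
  · intro x hx
    have hx1 : x ∉ tsupport (ρ i) := fun h => hx (hρ i h)
    have e : (fun x => ρ i x * f x) =ᶠ[𝓝 x] fun _ => 0 := by
      filter_upwards [(isClosed_tsupport (ρ i)).isOpen_compl.mem_nhds hx1] with z hz
      rw [image_eq_zero_of_notMem_tsupport hz, zero_mul]
    rw [image_eq_zero_of_notMem_tsupport hx1, zero_mul, zero_mul, add_zero]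
    exact congrArg (fun L : Eu d →L[ℝ] ℝ => L (v x)) ((diffAt_congr e).trans (diffAt_const 0 x))

end DivergenceTheorem

/-! ### Differentiation under the integral along one-parameter groups -/

section GroupAction

variable {l : ℕ} {G : Type*} [TopologicalSpace G] [T2Space G] [ChartedSpace (Eu l) G] [Group G]
  [LieGroup (𝓡 l) ∞ G]
  {M : Type*} [TopologicalSpace M] [T2Space M] [MulAction G M] [ContinuousSMul G M]

theorem lieExp_inv_smul_smul (w : GroupLieAlgebra (𝓡 l) G) (t : ℝ) (m : M) :
    (lieExp ((-t) • w) : G) • (lieExp (t • w) : G) • m = m := by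
  rw [smul_smul, ← lieExp_add_smul, neg_add_cancel, zero_smul, lieExp_zero, one_smul]

/-- By the group law, the derivative at time `t` is the derivative at time `0` started from the
point `exp(tw) m`. -/
theorem hasDerivAt_lieExp_smul {w : GroupLieAlgebra (𝓡 l) G} {h Rh : M → ℝ}
    (hd : ∀ m, HasDerivAt (fun t : ℝ => h ((lieExp (t • w) : G) • m)) (Rh m) 0) (m : M) (t : ℝ) :
    HasDerivAt (fun t : ℝ => h ((lieExp (t • w) : G) • m)) (Rh ((lieExp (t • w) : G) • m)) t := by
  have h1 := hd ((lieExp (t • w) : G) • m)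
  have h2 : HasDerivAt (fun s : ℝ => h ((lieExp ((s - t) • w) : G) • (lieExp (t • w) : G) • m))
      (Rh ((lieExp (t • w) : G) • m)) t := by
    have h1' : HasDerivAt (fun t' : ℝ => h ((lieExp (t' • w) : G) • (lieExp (t • w) : G) • m))
      (Rh ((lieExp (t • w) : G) • m)) (t - t) := by rwa [sub_self]
    simpa using h1'.comp_sub_const t t
  refine h2.congr_of_eventuallyEq (Filter.Eventually.of_forall fun s => ?_)
  simp only
  rw [smul_smul, ← lieExp_add_smul, sub_add_cancel]

/-- The compact set swept out by a compact set under the one-parameter group generated by `w`. -/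
theorem isCompact_sweep (w : GroupLieAlgebra (𝓡 l) G) {K : Set M} (hK : IsCompact K) :
    IsCompact ((fun p : ℝ × M => (lieExp (p.1 • w) : G) • p.2) '' (Icc (-1) 1 ×ˢ K)) := by
  refine (isCompact_Icc.prod hK).image ?_
  exact ((continuous_lieExp_smul w).comp continuous_fst).smul continuous_snd

theorem mem_sweep {w : GroupLieAlgebra (𝓡 l) G} {K : Set M} {t : ℝ} (ht : t ∈ Icc (-1 : ℝ) 1)
    {m : M} (hm : (lieExp (t • w) : G) • m ∈ K) :
    m ∈ (fun p : ℝ × M => (lieExp (p.1 • w) : G) • p.2) '' (Icc (-1) 1 ×ˢ K) :=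
  ⟨(-t, (lieExp (t • w) : G) • m), ⟨⟨by linarith [ht.2], by linarith [ht.1]⟩, hm⟩,
    lieExp_inv_smul_smul w t m⟩

theorem eq_zero_of_hasDerivAt_lieExp {w : GroupLieAlgebra (𝓡 l) G} {h Rh : M → ℝ}
    (hd : ∀ m, HasDerivAt (fun t : ℝ => h ((lieExp (t • w) : G) • m)) (Rh m) 0) {m : M}
    (hm : m ∉ tsupport h) : Rh m = 0 := by
  have hc : Continuous (fun t : ℝ => (lieExp (t • w) : G) • m) :=
    (continuous_lieExp_smul w).smul continuous_const
  have e : (fun t : ℝ => h ((lieExp (t • w) : G) • m)) =ᶠ[𝓝 0] fun _ => 0 := by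
    refine hc.continuousAt.eventually (p := fun m => h m = 0) ?_
    simp only [zero_smul, lieExp_zero, one_smul]
    filter_upwards [(isClosed_tsupport h).isOpen_compl.mem_nhds hm] with z hz
    exact image_eq_zero_of_notMem_tsupport hz
  exact (hd m).unique ((hasDerivAt_const _ _).congr_of_eventuallyEq e)

variable [MeasurableSpace M] [BorelSpace M]

/-- Differentiation of the integral of a compactly supported function along a one-parameter
group. -/
theorem hasDerivAt_integral_lieExp_smul {μ : Measure M} [IsFiniteMeasureOnCompacts μ]
    {w : GroupLieAlgebra (𝓡 l) G} {h Rh ψ : M → ℝ} (hh : Continuous h) (hRh : Continuous Rh)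
    (hc : HasCompactSupport h)
    (hd : ∀ m, HasDerivAt (fun t : ℝ => h ((lieExp (t • w) : G) • m)) (Rh m) 0)
    (hψ : Continuous ψ) {C : ℝ} (hψC : ∀ m, |ψ m| ≤ C) :
    HasDerivAt (fun t : ℝ => ∫ m, h ((lieExp (t • w) : G) • m) * ψ m ∂μ)
      (∫ m, Rh m * ψ m ∂μ) 0 := by
  have hRc : HasCompactSupport Rh := HasCompactSupport.intro hc.isCompact
    fun m hm => eq_zero_of_hasDerivAt_lieExp hd hm
  obtain ⟨C', hC'⟩ := hRh.bounded_above_of_compact_support hRc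
  have hK := isCompact_sweep w hc.isCompact
  -- For `|t| ≤ 1` all translates of `h` vanish off the sweep of its support, a compact set, on
  -- which a constant is an integrable majorant.
  set K := (fun p : ℝ × M => (lieExp (p.1 • w) : G) • p.2) '' (Icc (-1) 1 ×ˢ tsupport h)
  have hcont : ∀ t : ℝ, Continuous (fun m : M => (lieExp (t • w) : G) • m) := fun t =>
    continuous_const_smul _
  have key := hasDerivAt_integral_of_dominated_loc_of_deriv_le (μ := μ) (x₀ := (0 : ℝ))
    (s := Ioo (-1 : ℝ) 1)
    (F := fun t m => h ((lieExp (t • w) : G) • m) * ψ m)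
    (F' := fun t m => Rh ((lieExp (t • w) : G) • m) * ψ m)
    (bound := K.indicator fun _ => C' * C) (Ioo_mem_nhds (by norm_num) (by norm_num))
    (Filter.Eventually.of_forall fun t => ((hh.comp (hcont t)).mul hψ).aestronglyMeasurable)
    ?_ ((hRh.comp (hcont 0)).mul hψ).aestronglyMeasurable ?_ ?_ ?_
  · simpa [lieExp_zero] using key.2
  · simp only [zero_smul, lieExp_zero, one_smul]
    exact (hh.mul hψ).integrable_of_hasCompactSupport hc.mul_right
  · refine Filter.Eventually.of_forall fun m t ht => ?_
    by_cases hm : m ∈ K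
    · rw [indicator_of_mem hm, norm_mul]
      have h1 := hC' ((lieExp (t • w) : G) • m)
      exact mul_le_mul h1 (hψC m) (norm_nonneg _) ((norm_nonneg _).trans h1)
    · rw [indicator_of_notMem hm, eq_zero_of_hasDerivAt_lieExp hd fun h' =>
        hm (mem_sweep (Ioo_subset_Icc_self ht) h')]
      simp
  · exact (integrable_indicator_iff hK.measurableSet).2 (integrableOn_const hK.measure_lt_top.ne)
  · exact Filter.Eventually.of_forall fun m t _ => (hasDerivAt_lieExp_smul hd m t).mul_const _

end GroupAction

/-! ### Integration by parts for the quasi-invariant measure -/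

section QuasiInvariance

variable {k l : ℕ} {G : Type*} [TopologicalSpace G] [T2Space G] [ChartedSpace (Eu l) G] [Group G]
  [LieGroup (𝓡 l) ∞ G]
  {M : Type*} [TopologicalSpace M] [T2Space M] [SecondCountableTopology M]
  [ChartedSpace (Eu k) M] [IsManifold (𝓡 k) ∞ M] [MeasurableSpace M] [BorelSpace M]
  [MulAction G M] [ContMDiffSMul (𝓡 l) (𝓡 k) ∞ G M]
  {lam : Measure M} [IsLocallyFiniteMeasure lam] {p : G → M → ℝ}
  (hp : ∀ g : G, lam.map (fun m => g • m) = lam.withDensity (fun m => ENNReal.ofReal (p g m)))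
  (hp_diff : ContMDiff ((𝓡 l).prod (𝓡 k)) 𝓘(ℝ, ℝ) 1 (fun z : G × M => p z.1 z.2))
include hp hp_diff

/-- The image of `λ` under the unit is `λ`, and densities are unique almost everywhere. -/
theorem density_one_ae : ∀ᵐ m ∂lam, p 1 m = 1 := by
  have hc : Continuous (fun m => p 1 m) := hp_diff.continuous.comp (Continuous.prodMk_right 1)
  have h1 := hp 1
  simp only [one_smul] at h1
  rw [show (fun m : M => m) = id from rfl, Measure.map_id] at h1
  have h2 : lam.withDensity (fun m => ENNReal.ofReal (p 1 m)) = lam.withDensity (fun _ => 1) := by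
    rw [withDensity_const, one_smul, ← h1]
  filter_upwards [(withDensity_eq_iff_of_sigmaFinite (g := fun _ => (1 : ℝ≥0∞))
    hc.measurable.ennreal_ofReal.aemeasurable aemeasurable_const).1 h2] with m hm
  simpa using hm

/-- The density acts through `ENNReal.ofReal`, hence the truncation at `0`. It is inactive near `t =
0` along a one-parameter group, because `p(1,·) = 1` almost everywhere. -/
theorem integral_comp_smul [ContinuousSMul G M] (g : G) {h : M → ℝ} (hh : Continuous h) :
    ∫ m, h (g • m) ∂lam = ∫ m, h m * max (p g m) 0 ∂lam := by
  have hc : Continuous (fun m => p g m) := hp_diff.continuous.comp (Continuous.prodMk_right g)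
  have h1 : ∫ m, h m ∂(lam.map (fun m => g • m)) = ∫ m, h (g • m) ∂lam :=
    integral_map (continuous_const_smul g).measurable.aemeasurable hh.aestronglyMeasurable
  rw [← h1, hp g, integral_withDensity_eq_integral_toReal_smul hc.measurable.ennreal_ofReal
    (by simp)]
  refine integral_congr_ae (Filter.Eventually.of_forall fun m => ?_)
  simp [ENNReal.toReal_ofReal', mul_comm]

/-- Integration by parts on `M` along a one-parameter subgroup. -/
theorem integral_lieExp_deriv {w : GroupLieAlgebra (𝓡 l) G} {h Rh : M → ℝ} (hh : Continuous h)
    (hRh : Continuous Rh) (hc : HasCompactSupport h)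
    (hd : ∀ m, HasDerivAt (fun t : ℝ => h ((lieExp (t • w) : G) • m)) (Rh m) 0) :
    ∫ m, Rh m ∂lam = ∫ m, h m * diffAtOne l (fun g => p g m) (show Eu l from w) ∂lam := by
  have := continuous_smul_of_contMDiffSMul (k := k) (M := M) l (G := G)
  have h1 : HasDerivAt (fun t : ℝ => ∫ m, h ((lieExp (t • w) : G) • m) ∂lam)
      (∫ m, Rh m ∂lam) 0 := by
    have := hasDerivAt_integral_lieExp_smul (μ := lam) hh hRh hc hd (ψ := fun _ => 1)
      continuous_const (C := 1) (by simp)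
    simpa using this
  -- The derivative of `p(·, m)` along `exp(tw)` at all times: the curve follows the left-invariant
  -- field. Continuity of `Q` bounds it on compact sets.
  let Q : G × M → ℝ := fun z => diffAt (fun g => p g z.2) z.1 (mulInvariantVectorField w z.1)
  have hQ : Continuous Q :=
    (contMDiff_diffAt_param (n := 0) (m := 1) (I := 𝓡 k) (I' := (𝓡 l).prod (𝓡 k)) (by simp)
      (Φ := fun z : M × G => p z.2 z.1) (hp_diff.comp (contMDiff_snd.prodMk contMDiff_fst))
      (s := Prod.snd) contMDiff_snd
      (η := fun z : G × M => ⟨z.1, mulInvariantVectorField w z.1⟩)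
      (((contMDiff_leftInvariantField w).of_le (by simp)).comp contMDiff_fst)).continuous
  have hpd : ∀ m, MDifferentiable (𝓡 l) 𝓘(ℝ, ℝ) (fun g => p g m) := fun m =>
    (hp_diff.comp (contMDiff_id.prodMk contMDiff_const)).mdifferentiable (by simp)
  have hpt : ∀ m (t : ℝ), HasDerivAt (fun t : ℝ => p (lieExp (t • w)) m)
      (Q (lieExp (t • w), m)) t := fun m t =>
    hasDerivAt_comp_of_hasMFDerivAt (f := fun g => p g m) (hpd m _) ((lieExp_spec w).2 t)
  have hQ1 : ∀ m, Q (1, m) = diffAtOne l (fun g => p g m) (show Eu l from w) := fun m =>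
    congrArg (fun ξ => (diffAt (fun g => p g m) (1 : G)) ξ) (mulInvariantVectorField_one w)
  have hK : IsCompact ((fun q : ℝ × M => Q (lieExp (q.1 • w), q.2)) ''
      (Icc (-1) 1 ×ˢ tsupport h)) := by
    refine (isCompact_Icc.prod hc.isCompact).image (hQ.comp ?_)
    exact ((continuous_lieExp_smul w).comp continuous_fst).prodMk continuous_snd
  obtain ⟨C, hC⟩ := hK.isBounded.exists_norm_le
  have hpc : ∀ g, Continuous (fun m => p g m) := fun g =>
    hp_diff.continuous.comp (Continuous.prodMk_right g)
  -- Truncation does not increase differences, so the mean value bound for `p` on the support of `h`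
  -- gives a Lipschitz majorant; at almost every `m` one has `p = 1` at `t = 0`, and for small `t`
  -- the truncation disappears.
  have h2 : HasDerivAt (fun t : ℝ => ∫ m, h m * max (p (lieExp (t • w)) m) 0 ∂lam)
      (∫ m, h m * diffAtOne l (fun g => p g m) (show Eu l from w) ∂lam) 0 := by
    refine (hasDerivAt_integral_of_dominated_loc_of_lip (μ := lam) (x₀ := (0 : ℝ))
      (s := Ioo (-1 : ℝ) 1) (bound := fun m => |h m| * C)
      (F := fun t m => h m * max (p (lieExp (t • w)) m) 0)
      (Ioo_mem_nhds (by norm_num) (by norm_num)) (Filter.Eventually.of_forall fun t =>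
        (hh.mul ((hpc _).max continuous_const)).aestronglyMeasurable) ?_ ?_ ?_ ?_ ?_).2
    · exact (hh.mul ((hpc _).max continuous_const)).integrable_of_hasCompactSupport hc.mul_right
    · simp only [← hQ1]
      exact (hh.mul (hQ.comp (Continuous.prodMk_right 1))).aestronglyMeasurable
    · refine Filter.Eventually.of_forall fun m => ?_
      refine LipschitzOnWith.of_dist_le_mul fun t ht s hs => ?_
      by_cases hm : m ∈ tsupport h
      · have hCb : ∀ r ∈ Ioo (-1 : ℝ) 1, ‖Q (lieExp (r • w), m)‖ ≤ C := fun r hr =>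
          hC _ ⟨(r, m), ⟨Ioo_subset_Icc_self hr, hm⟩, rfl⟩
        have hC0 : 0 ≤ C := (norm_nonneg _).trans (hCb t ht)
        have hmv := (convex_Ioo (-1 : ℝ) 1).norm_image_sub_le_of_norm_hasDerivWithin_le
          (fun r _ => (hpt m r).hasDerivWithinAt) hCb hs ht
        have e : (Real.nnabs (|h m| * C) : ℝ) = |h m| * C := by
          simp [abs_of_nonneg hC0]
        rw [e, Real.dist_eq, ← mul_sub, abs_mul, mul_assoc, Real.dist_eq]
        refine mul_le_mul_of_nonneg_left ?_ (abs_nonneg _)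
        refine (abs_max_sub_max_le_abs _ _ _).trans ?_
        simpa using hmv
      · simp [image_eq_zero_of_notMem_tsupport hm]
    · exact (hh.abs.mul continuous_const).integrable_of_hasCompactSupport
        (hc.abs.mul_right)
    · filter_upwards [density_one_ae hp hp_diff] with m hm
      have h3 := hpt m 0
      simp only [zero_smul, lieExp_zero, hQ1] at h3
      refine HasDerivAt.const_mul _ (h3.congr_of_eventuallyEq ?_)
      have hpos : 0 < p (lieExp ((0 : ℝ) • w) : G) m := by
        rw [zero_smul, lieExp_zero, hm]; norm_num
      filter_upwards [(hpt m 0).continuousAt.eventually (lt_mem_nhds hpos)] with t ht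
      exact max_eq_left ht.le
  have e : (fun t : ℝ => ∫ m, h ((lieExp (t • w) : G) • m) ∂lam) =
      fun t : ℝ => ∫ m, h m * max (p (lieExp (t • w)) m) 0 ∂lam :=
    funext fun t => integral_comp_smul hp hp_diff _ hh
  rw [e] at h1
  exact h1.unique h2

end QuasiInvariance

/-! ### Cutoff functions of the mark -/

section Cutoff

theorem exists_exhausting_cutoffs {M : Type*} [TopologicalSpace M] [T2Space M]
    [SigmaCompactSpace M] [LocallyCompactSpace M] :
    ∃ ψ : ℕ → M → ℝ, (∀ j, Continuous (ψ j)) ∧ (∀ j, HasCompactSupport (ψ j)) ∧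
      (∀ j m, |ψ j m| ≤ 1) ∧ ∀ m, ∀ᶠ j in Filter.atTop, ψ j m = 1 := by
  let E : CompactExhaustion M := CompactExhaustion.choice M
  have h := fun j => exists_continuous_one_zero_of_isCompact (E.isCompact j)
    (isClosed_empty (X := M)) (disjoint_empty _)
  choose f hf1 _ hfc hfr using h
  refine ⟨fun j => f j, fun j => (f j).continuous, hfc, fun j m => ?_, fun m => ?_⟩
  · exact abs_le.2 ⟨by linarith [(hfr j m).1], (hfr j m).2⟩
  · obtain ⟨n, hn⟩ := E.exists_mem m
    filter_upwards [Filter.eventually_ge_atTop n] with j hj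
    exact hf1 j (E.subset hj hn)

variable {l : ℕ} {G : Type*} [TopologicalSpace G] [T2Space G] [ChartedSpace (Eu l) G] [Group G]
  [LieGroup (𝓡 l) ∞ G]

theorem hasDerivAt_lieExp {f : G → ℝ} (hf : ContMDiff (𝓡 l) 𝓘(ℝ, ℝ) 1 f)
    (w : GroupLieAlgebra (𝓡 l) G) :
    HasDerivAt (fun t : ℝ => f (lieExp (t • w) : G)) (diffAtOne l f (show Eu l from w)) 0 := by
  have h1 := hasDerivAt_comp_of_hasMFDerivAt (f := f) (t := 0) (hf.mdifferentiable (by simp) _)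
    ((lieExp_spec w).2 0)
  refine h1.congr_deriv ?_
  have key : ∀ g₀ : G, g₀ = 1 → diffAt f g₀ (mulInvariantVectorField w g₀) =
      diffAtOne l f (show Eu l from w) := by
    rintro _ rfl
    exact congrArg (fun ξ => (diffAt f (1 : G)) ξ) (mulInvariantVectorField_one w)
  exact key _ (by rw [zero_smul, lieExp_zero])

theorem hasDerivAt_lieExp_mul {κ : G → ℝ} (hκ : ContMDiff (𝓡 l) 𝓘(ℝ, ℝ) ∞ κ)
    (w : GroupLieAlgebra (𝓡 l) G) (g : G) :
    HasDerivAt (fun t : ℝ => κ ((lieExp (t • w) : G) * g))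
      (diffAtOne l (fun g' => κ (g' * g)) (show Eu l from w)) 0 :=
  hasDerivAt_lieExp (f := fun g' => κ (g' * g))
    ((hκ.comp (contMDiff_mul_right (a := g))).of_le (by simp)) w

theorem continuous_diffAtOne_mul {κ : G → ℝ} (hκ : ContMDiff (𝓡 l) 𝓘(ℝ, ℝ) ∞ κ) :
    Continuous (fun z : Eu l × G => diffAtOne l (fun g' => κ (g' * z.2)) z.1) := by
  have h1 : ∀ w : Eu l, Continuous (fun g : G => diffAtOne l (fun g' => κ (g' * g)) w) := fun w =>
    (contMDiff_diffAt_param (n := 0) (m := 1) (I := 𝓡 l) (I' := 𝓡 l) (by simp)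
      (Φ := fun z : G × G => κ (z.2 * z.1))
      ((hκ.comp (contMDiff_snd.mul contMDiff_fst)).of_le (by simp))
      (s := id) contMDiff_id (η := fun _ : G => (⟨1, w⟩ : TangentBundle (𝓡 l) G))
      contMDiff_const).continuous
  have h2 : (fun z : Eu l × G => diffAtOne l (fun g' => κ (g' * z.2)) z.1) = fun z =>
      ∑ i, z.1 i * diffAtOne l (fun g' => κ (g' * z.2)) (EuclideanSpace.single i 1) := by
    funext z
    rw [clm_apply_eq_sum]
    simp
  rw [h2]
  refine continuous_finsetSum _ fun i _ => Continuous.mul ?_ ((h1 _).comp continuous_snd)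
  fun_prop

variable {M : Type*} [TopologicalSpace M] [T2Space M] [SigmaCompactSpace M]
  [LocallyCompactSpace M] [FirstCountableTopology M]
  [MulAction G M] [ContinuousSMul G M] [SecondCountableTopology G]

/-- Compactly supported cutoff functions on `M` that converge to `1`, whose derivatives along the
action of `G` are uniformly bounded and converge to `0`. -/
theorem exists_mark_cutoffs :
    ∃ (χ : ℕ → M → ℝ) (L : ℕ → M → Eu l → ℝ) (C : ℝ) (C' : Eu l → ℝ),
      (∀ j, Continuous (χ j)) ∧ (∀ j, HasCompactSupport (χ j)) ∧
      (∀ j, Continuous (fun z : M × Eu l => L j z.1 z.2)) ∧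
      (∀ j m (w : GroupLieAlgebra (𝓡 l) G), HasDerivAt
        (fun t : ℝ => χ j ((lieExp (t • w) : G) • m)) (L j m (show Eu l from w)) 0) ∧
      (∀ j m, |χ j m| ≤ C) ∧ Continuous C' ∧ (∀ j m w, |L j m w| ≤ C' w) ∧
      (∀ m, Filter.Tendsto (fun j => χ j m) Filter.atTop (𝓝 1)) ∧
      (∀ m w, Filter.Tendsto (fun j => L j m w) Filter.atTop (𝓝 0)) := by
  have : IsTopologicalGroup G := topologicalGroup_of_lieGroup (𝓡 l) ∞
  have : LocallyCompactSpace G := ChartedSpace.locallyCompactSpace (Eu l) G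
  let _ : MeasurableSpace G := borel G
  have : BorelSpace G := ⟨rfl⟩
  obtain ⟨ψ, hψ, hψc, hψ1, hψt⟩ := exists_exhausting_cutoffs (M := M)
  let b : SmoothBumpFunction (𝓡 l) (1 : G) := Classical.arbitrary _
  let μ : Measure G := Measure.haar
  have hb : Continuous b := b.continuous
  have hbi : 0 < ∫ g, b g ∂μ :=
    (hb.integral_pos_of_hasCompactSupport_nonneg_nonzero b.hasCompactSupport
      (fun g => b.nonneg) (x := 1) (by simp))
  set c := ∫ g, b g ∂μ
  -- A smooth kernel of Haar integral `1`. The cutoffs are the averages `∫ κ(g) ψⱼ(g⁻¹ m) dg` of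
  -- merely continuous cutoffs `ψⱼ`.
  let κ : G → ℝ := fun g => c⁻¹ * b g
  have hκ : ContMDiff (𝓡 l) 𝓘(ℝ, ℝ) ∞ κ := contMDiff_const.mul b.contMDiff
  have hκc : HasCompactSupport κ := b.hasCompactSupport.mul_left
  have hκ0 : Continuous κ := hκ.continuous
  have hκ1 : ∫ g, κ g ∂μ = 1 := by
    rw [integral_const_mul]; exact inv_mul_cancel₀ hbi.ne'
  let K : Eu l → G → ℝ := fun w g => diffAtOne l (fun g' => κ (g' * g)) w
  have hK : Continuous (fun z : Eu l × G => K z.1 z.2) := continuous_diffAtOne_mul hκ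
  have hKw : ∀ w, Continuous (K w) := fun w => hK.comp (Continuous.prodMk_right w)
  have hKd : ∀ (w : GroupLieAlgebra (𝓡 l) G) (g : G),
      HasDerivAt (fun t : ℝ => κ ((lieExp (t • w) : G) • g)) (K w g) 0 := fun w g =>
    hasDerivAt_lieExp_mul hκ w g
  set S := tsupport κ
  have hS : IsCompact S := hκc.isCompact
  have hK0 : ∀ w g, g ∉ S → K w g = 0 := fun w g hg =>
    eq_zero_of_hasDerivAt_lieExp (hKd w) hg
  have hκS : ∀ g, g ∉ S → κ g = 0 := fun g hg => image_eq_zero_of_notMem_tsupport hg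
  have hKc : ∀ w, HasCompactSupport (K w) := fun w => HasCompactSupport.intro hS (hK0 w)
  have hψg : ∀ j m, Continuous (fun g : G => ψ j (g⁻¹ • m)) := fun j m =>
    (hψ j).comp (continuous_inv.smul continuous_const)
  -- By left invariance of the Haar measure, `∫ κ(exp(tw) g) dg` does not depend on `t`. Hence the
  -- derivatives of the cutoffs tend to `0` as `ψⱼ → 1`.
  have hKint : ∀ w, ∫ g, K w g ∂μ = 0 := by
    intro w
    have h1 := hasDerivAt_integral_lieExp_smul (μ := μ) hκ0 (hKw w) hκc (hKd w)
      (ψ := fun _ => 1) continuous_const (C := 1) (by simp)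
    simp only [mul_one] at h1
    have e : (fun t : ℝ => ∫ g, κ ((lieExp (t • (show GroupLieAlgebra (𝓡 l) G from w)) : G) • g)
        ∂μ) = fun _ => ∫ g, κ g ∂μ :=
      funext fun t => integral_mul_left_eq_self (μ := μ) κ _
    exact h1.unique (e ▸ hasDerivAt_const _ _)
  have hset : ∀ (f h : G → ℝ), (∀ g, g ∉ S → f g = 0) →
      ∫ g, f g * h g ∂μ = ∫ g in S, f g * h g ∂μ := fun f h hf =>
    (setIntegral_eq_integral_of_forall_compl_eq_zero fun g hg => by simp [hf g hg]).symm
  have hlim : ∀ (f : G → ℝ), Continuous f → HasCompactSupport f → ∀ m,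
      Filter.Tendsto (fun j => ∫ g, f g * ψ j (g⁻¹ • m) ∂μ) Filter.atTop (𝓝 (∫ g, f g ∂μ)) := by
    intro f hf hfc m
    refine tendsto_integral_of_dominated_convergence (fun g => |f g|)
      (fun j => (hf.mul (hψg j m)).aestronglyMeasurable)
      (hf.integrable_of_hasCompactSupport hfc).abs
      (fun j => Filter.Eventually.of_forall fun g => ?_) (Filter.Eventually.of_forall fun g => ?_)
    · rw [Real.norm_eq_abs, abs_mul]
      exact mul_le_of_le_one_right (abs_nonneg _) (hψ1 _ _)
    · refine tendsto_const_nhds.congr' ?_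
      filter_upwards [hψt (g⁻¹ • m)] with j hj
      rw [hj, mul_one]
  have hbound : ∀ (f : G → ℝ), Continuous f → HasCompactSupport f → ∀ j m,
      |∫ g, f g * ψ j (g⁻¹ • m) ∂μ| ≤ ∫ g, |f g| ∂μ := by
    intro f hf hfc j m
    rw [← Real.norm_eq_abs]
    refine norm_integral_le_of_norm_le (μ := μ) (hf.integrable_of_hasCompactSupport hfc).abs
      (Filter.Eventually.of_forall fun g => ?_)
    rw [Real.norm_eq_abs, abs_mul]
    exact mul_le_of_le_one_right (abs_nonneg _) (hψ1 _ _)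
  refine ⟨fun j m => ∫ g, κ g * ψ j (g⁻¹ • m) ∂μ, fun j m w => ∫ g, K w g * ψ j (g⁻¹ • m) ∂μ,
    ∫ g, |κ g| ∂μ, fun w => ∫ g, |K w g| ∂μ, fun j => ?_, fun j => ?_, fun j => ?_,
    fun j m w => ?_, fun j m => hbound κ hκ0 hκc j m, ?_,
    fun j m w => hbound _ (hKw w) (hKc w) j m, fun m => ?_, fun m w => ?_⟩
  · simp_rw [hset κ _ hκS]
    exact continuous_parametric_integral_of_continuous
      (f := fun (m : M) (g : G) => κ g * ψ j (g⁻¹ • m))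
      ((hκ0.comp continuous_snd).mul ((hψ j).comp (continuous_snd.inv.smul continuous_fst))) hS
  · refine HasCompactSupport.intro (K := (fun z : G × M => z.1 • z.2) '' (S ×ˢ tsupport (ψ j)))
      ((hS.prod (hψc j).isCompact).image (continuous_fst.smul continuous_snd)) fun m hm => ?_
    have : (fun g => κ g * ψ j (g⁻¹ • m)) = fun _ => 0 := by
      funext g
      by_cases hg : g ∈ S
      · rw [image_eq_zero_of_notMem_tsupport (f := ψ j), mul_zero]
        exact fun h' => hm ⟨(g, g⁻¹ • m), ⟨hg, h'⟩, by simp⟩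
      · rw [hκS g hg, zero_mul]
    simp [this]
  · have e : (fun z : M × Eu l => ∫ g, K z.2 g * ψ j (g⁻¹ • z.1) ∂μ) =
        fun z => ∫ g in S, K z.2 g * ψ j (g⁻¹ • z.1) ∂μ := funext fun z => hset _ _ (hK0 z.2)
    simp only [e]
    exact continuous_parametric_integral_of_continuous
      (f := fun (z : M × Eu l) (g : G) => K z.2 g * ψ j (g⁻¹ • z.1))
      ((hK.comp ((continuous_snd.comp continuous_fst).prodMk continuous_snd)).mul
        ((hψ j).comp (continuous_snd.inv.smul (continuous_fst.comp continuous_fst)))) hS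
  · have h1 := hasDerivAt_integral_lieExp_smul (μ := μ) hκ0 (hKw w) hκc (hKd w)
      (hψg j m) (C := 1) fun g => hψ1 _ _
    refine h1.congr_of_eventuallyEq (Filter.Eventually.of_forall fun t => ?_)
    -- Substituting `g ↦ exp(tw) g` moves the translation from `ψⱼ` to the smooth kernel, which
    -- alone is differentiated.
    have h2 := integral_mul_left_eq_self (μ := μ)
      (fun g => κ g * ψ j (g⁻¹ • (lieExp (t • w) : G) • m)) (lieExp (t • w))
    refine h2.symm.trans ?_
    refine integral_congr_ae (Filter.Eventually.of_forall fun g => ?_)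
    simp [mul_smul]
  · have e : (fun w => ∫ g, |K w g| ∂μ) = fun w => ∫ g in S, |K w g| ∂μ := by
      funext w
      refine (setIntegral_eq_integral_of_forall_compl_eq_zero fun g hg => ?_).symm
      rw [hK0 w g hg, abs_zero]
    rw [e]
    exact continuous_parametric_integral_of_continuous (f := fun w g => |K w g|) hK.abs hS
  · rw [← hκ1]
    exact hlim κ hκ0 hκc m
  · rw [← hKint w]
    exact hlim _ (hKw w) (hKc w) m

end Cutoff

/-! ### Convergence of products of square-integrable functions -/

section SquareIntegrable

variable {α : Type*} [MeasurableSpace α] {μ : Measure α}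

theorem tendsto_eLpNorm_two_of_sq_le {g : ℕ → α → ℝ} {e : ℕ → α → ℝ≥0∞} {C : ℝ≥0∞} (hC : C ≠ ⊤)
    (h : ∀ n, ∀ᵐ z ∂μ, ‖g n z‖ₑ ^ 2 ≤ C * e n z)
    (he : Filter.Tendsto (fun n => ∫⁻ z, e n z ∂μ) Filter.atTop (𝓝 0)) :
    Filter.Tendsto (fun n => eLpNorm (g n) 2 μ) Filter.atTop (𝓝 0) := by
  have h1 : ∀ n, eLpNorm (g n) 2 μ ≤ (C * ∫⁻ z, e n z ∂μ) ^ (1 / 2 : ℝ) := fun n => by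
    rw [eLpNorm_eq_lintegral_rpow_enorm_toReal (by norm_num) (by norm_num),
      ← lintegral_const_mul' _ _ hC]
    refine ENNReal.rpow_le_rpow (lintegral_mono_ae ?_) (by norm_num)
    filter_upwards [h n] with z hz
    simpa using hz
  have h2 : Filter.Tendsto (fun n => (C * ∫⁻ z, e n z ∂μ) ^ (1 / 2 : ℝ)) Filter.atTop (𝓝 0) := by
    have h3 := (ENNReal.continuous_rpow_const (y := (1 / 2 : ℝ))).tendsto 0
    rw [ENNReal.zero_rpow_of_pos (by norm_num)] at h3
    refine h3.comp ?_
    simpa using ENNReal.Tendsto.const_mul he (Or.inr hC)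
  exact tendsto_of_tendsto_of_tendsto_of_le_of_le tendsto_const_nhds h2 (fun _ => zero_le) h1

theorem memLp_two_of_sq_le {g : α → ℝ} {e : α → ℝ≥0∞} {C : ℝ≥0∞} (hC : C ≠ ⊤)
    (hg : AEStronglyMeasurable g μ) (h : ∀ᵐ z ∂μ, ‖g z‖ₑ ^ 2 ≤ C * e z)
    (he : ∫⁻ z, e z ∂μ < ⊤) : MemLp g 2 μ := by
  refine ⟨hg, ?_⟩
  rw [eLpNorm_lt_top_iff_lintegral_rpow_enorm_lt_top (by norm_num) (by norm_num)]
  refine lt_of_le_of_lt (lintegral_mono_ae (g := fun z => C * e z) ?_) ?_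
  · filter_upwards [h] with z hz
    simpa using hz
  · rw [lintegral_const_mul' _ _ hC]
    exact ENNReal.mul_lt_top hC.lt_top he

theorem memLp_of_tendsto_eLpNorm_sub {g : ℕ → α → ℝ} {f : α → ℝ} (hg : ∀ n, MemLp (g n) 2 μ)
    (hf : AEStronglyMeasurable f μ)
    (h : Filter.Tendsto (fun n => eLpNorm (g n - f) 2 μ) Filter.atTop (𝓝 0)) : MemLp f 2 μ := by
  obtain ⟨n, hn⟩ := (h.eventually (gt_mem_nhds (show (0 : ℝ≥0∞) < 1 by norm_num))).exists
  have h1 : MemLp (g n - f) 2 μ := ⟨(hg n).1.sub hf, hn.trans (by norm_num)⟩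
  simpa using (hg n).sub h1

/-- Continuity of the inner product of `L²`. -/
theorem tendsto_integral_mul_of_tendsto_eLpNorm {f₁ f₂ : ℕ → α → ℝ} {g₁ g₂ : α → ℝ}
    (hf₁ : ∀ n, MemLp (f₁ n) 2 μ) (hf₂ : ∀ n, MemLp (f₂ n) 2 μ) (hg₁ : MemLp g₁ 2 μ)
    (hg₂ : MemLp g₂ 2 μ)
    (h₁ : Filter.Tendsto (fun n => eLpNorm (f₁ n - g₁) 2 μ) Filter.atTop (𝓝 0))
    (h₂ : Filter.Tendsto (fun n => eLpNorm (f₂ n - g₂) 2 μ) Filter.atTop (𝓝 0)) :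
    Filter.Tendsto (fun n => ∫ z, f₁ n z * f₂ n z ∂μ) Filter.atTop (𝓝 (∫ z, g₁ z * g₂ z ∂μ)) := by
  have key : ∀ {a b : α → ℝ} (ha : MemLp a 2 μ) (hb : MemLp b 2 μ),
      inner ℝ (ha.toLp a) (hb.toLp b) = ∫ z, a z * b z ∂μ := by
    intro a b ha hb
    rw [L2.inner_def]
    refine integral_congr_ae ?_
    filter_upwards [ha.coeFn_toLp, hb.coeFn_toLp] with z h1 h2
    rw [h1, h2]
    simp [mul_comm]
  have t1 := (Lp.tendsto_Lp_iff_tendsto_eLpNorm'' f₁ hf₁ g₁ hg₁).2 h₁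
  have t2 := (Lp.tendsto_Lp_iff_tendsto_eLpNorm'' f₂ hf₂ g₂ hg₂).2 h₂
  have := t1.inner (𝕜 := ℝ) t2
  simpa only [key] using this

/-- Convergence of integrals of products, with a bounded weight. -/
theorem tendsto_integral_weight_mul {c : α → ℝ} {C : ℝ} (hc : AEStronglyMeasurable c μ)
    (hC : ∀ z, |c z| ≤ C) {f₁ f₂ : ℕ → α → ℝ} {g₁ g₂ : α → ℝ}
    (hf₁ : ∀ n, MemLp (f₁ n) 2 μ) (hf₂ : ∀ n, MemLp (f₂ n) 2 μ) (hg₁ : MemLp g₁ 2 μ)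
    (hg₂ : MemLp g₂ 2 μ)
    (h₁ : Filter.Tendsto (fun n => eLpNorm (f₁ n - g₁) 2 μ) Filter.atTop (𝓝 0))
    (h₂ : Filter.Tendsto (fun n => eLpNorm (f₂ n - g₂) 2 μ) Filter.atTop (𝓝 0)) :
    Filter.Tendsto (fun n => ∫ z, c z * (f₁ n z * f₂ n z) ∂μ) Filter.atTop
      (𝓝 (∫ z, c z * (g₁ z * g₂ z) ∂μ)) := by
  have hm : ∀ {g : α → ℝ}, MemLp g 2 μ → MemLp (fun z => c z * g z) 2 μ := fun hg =>
    MemLp.of_le_mul (c := C) hg (hc.mul hg.1) (Filter.Eventually.of_forall fun z => by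
      rw [norm_mul]
      exact mul_le_mul_of_nonneg_right (hC z) (norm_nonneg _))
  have ht : Filter.Tendsto (fun n => eLpNorm ((fun z => c z * f₁ n z) - fun z => c z * g₁ z) 2 μ)
      Filter.atTop (𝓝 0) := by
    have h3 : ∀ n, eLpNorm ((fun z => c z * f₁ n z) - fun z => c z * g₁ z) 2 μ ≤
        ENNReal.ofReal C * eLpNorm (f₁ n - g₁) 2 μ := fun n => by
      refine eLpNorm_le_mul_eLpNorm_of_ae_le_mul (Filter.Eventually.of_forall fun z => ?_) _
      simp only [Pi.sub_apply, ← mul_sub, norm_mul]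
      exact mul_le_mul_of_nonneg_right (hC z) (norm_nonneg _)
    refine tendsto_of_tendsto_of_tendsto_of_le_of_le tendsto_const_nhds ?_ (fun _ => zero_le) h3
    simpa using ENNReal.Tendsto.const_mul h₁ (Or.inr ENNReal.ofReal_ne_top)
  simpa only [mul_assoc] using tendsto_integral_mul_of_tendsto_eLpNorm (fun n => hm (hf₁ n)) hf₂
    (hm hg₁) hg₂ ht h₂

end SquareIntegrable

/-! ### Smoothness of the derivative of the density of the mark measure -/

section Density

variable {k l : ℕ} {G : Type*} [TopologicalSpace G] [ChartedSpace (Eu l) G] [Group G]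
  [LieGroup (𝓡 l) ∞ G]
  {M : Type*} [TopologicalSpace M] [ChartedSpace (Eu k) M] [IsManifold (𝓡 k) ∞ M]

theorem contMDiff_diffAtOne {n m : ℕ∞} (hnm : n + 1 ≤ m) {p : G → M → ℝ}
    (hp : ContMDiff ((𝓡 l).prod (𝓡 k)) 𝓘(ℝ, ℝ) m (fun z : G × M => p z.1 z.2)) :
    ContMDiff (𝓡 k) 𝓘(ℝ, Eu l →L[ℝ] ℝ) n (fun m => diffAtOne l (fun g => p g m)) := by
  have e : (fun m => diffAtOne l (fun g => p g m)) = fun m =>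
      ∑ i, diffAtOne l (fun g => p g m) (EuclideanSpace.single i 1) •
        (EuclideanSpace.proj i : Eu l →L[ℝ] ℝ) := by
    funext m
    ext w
    rw [clm_apply_eq_sum]
    simp [mul_comm]
  rw [e]
  have h : ∀ w : Eu l, ContMDiff (𝓡 k) 𝓘(ℝ, ℝ) n (fun m => diffAtOne l (fun g => p g m) w) :=
    fun w => contMDiff_diffAt_param (I := 𝓡 k) (I' := 𝓡 k) hnm (Φ := fun z : M × G => p z.2 z.1)
      (hp.comp (contMDiff_snd.prodMk contMDiff_fst)) (s := id) contMDiff_id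
      (η := fun _ : M => (⟨1, w⟩ : TangentBundle (𝓡 l) G)) contMDiff_const
  exact contMDiff_finsetSum fun i _ => (h _).smul contMDiff_const

end Density

/-! ### Integration by parts for the product measure, with a cutoff -/

section CutoffIntegration

variable {d k l : ℕ} {X : Type*} [TopologicalSpace X] [T2Space X] [SecondCountableTopology X]
  [ChartedSpace (Eu d) X] [IsManifold (𝓡 d) ∞ X]
  [RiemannianBundle (fun x : X => TangentSpace (𝓡 d) x)]
  [IsContMDiffRiemannianBundle (𝓡 d) ∞ (Eu d) (fun x : X => TangentSpace (𝓡 d) x)]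
  [MeasurableSpace X] [BorelSpace X]
  {M : Type*} [TopologicalSpace M] [T2Space M] [SecondCountableTopology M]
  [ChartedSpace (Eu k) M] [IsManifold (𝓡 k) ∞ M] [MeasurableSpace M] [BorelSpace M]
  {G : Type*} [TopologicalSpace G] [T2Space G]
  [ChartedSpace (Eu l) G] [Group G] [LieGroup (𝓡 l) ∞ G]
  [MulAction G M] [ContMDiffSMul (𝓡 l) (𝓡 k) ∞ G M]
  {lam : Measure M} [IsLocallyFiniteMeasure lam] {p : G → M → ℝ}

theorem continuous_densityDeriv
    (hp_diff : ContMDiff ((𝓡 l).prod (𝓡 k)) 𝓘(ℝ, ℝ) 1 (fun z : G × M => p z.1 z.2))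
    {u : X → Eu l} (hu : Continuous u) :
    Continuous (fun z : X × M => diffAtOne l (fun g : G => p g z.2) (u z.1)) :=
  ((contMDiff_diffAtOne (n := 0) (m := 1) (by simp) hp_diff).continuous.comp
    continuous_snd).clm_apply (hu.comp continuous_fst)

/-- Integration by parts on `X × M` against a cutoff function of the mark. -/
theorem integral_cutoff_deriv
    (hp : ∀ g : G, lam.map (fun m => g • m) = lam.withDensity (fun m => ENNReal.ofReal (p g m)))
    (hp_diff : ContMDiff ((𝓡 l).prod (𝓡 k)) 𝓘(ℝ, ℝ) 1 (fun z : G × M => p z.1 z.2))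
    {a : FieldPair d l X G} (ha : IsCurrent a) {F : X × M → ℝ}
    (hF : ContMDiff ((𝓡 d).prod (𝓡 k)) 𝓘(ℝ, ℝ) 1 F)
    {χ : M → ℝ} {L : M → Eu l → ℝ} (hχ : Continuous χ) (hχc : HasCompactSupport χ)
    (hL : Continuous (fun z : M × Eu l => L z.1 z.2))
    (hχL : ∀ m (w : GroupLieAlgebra (𝓡 l) G), HasDerivAt
        (fun t : ℝ => χ ((lieExp (t • w) : G) • m)) (L m (show Eu l from w)) 0) :
    ∫ z, (χ z.2 * (gradX d F z (a.1 z.1) + gradM l G F z (a.2 z.1) + F z *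
      (divergence a.1 z.1 - diffAtOne l (fun g : G => p g z.2) (a.2 z.1))) +
      L z.2 (a.2 z.1) * F z) ∂((riemannianVolume d X).prod lam) = 0 := by
  have := continuous_smul_of_contMDiffSMul (k := k) (M := M) l (G := G)
  have hu : Continuous (fun x => (show Eu l from a.2 x)) := ha.smooth_snd.continuous
  have hχ2 : Continuous (fun z : X × M => χ z.2) := hχ.comp continuous_snd
  have hA : Continuous (fun z => gradX d F z (a.1 z.1)) :=
    (contMDiff_gradX (n := 0) (m := 1) (by simp) hF (ha.smooth_fst.of_le (by simp))).continuous
  have hB : Continuous (fun z => gradM l G F z (a.2 z.1)) :=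
    (contMDiff_gradM (n := 0) (m := 1) (by simp) hF (ha.smooth_snd.of_le (by simp))).continuous
  have hD : Continuous (fun z : X × M => divergence a.1 z.1) :=
    (contMDiff_divergence ha.smooth_fst).continuous.comp continuous_fst
  have hγ : Continuous (fun z : X × M => diffAtOne l (fun g : G => p g z.2) (a.2 z.1)) :=
    continuous_densityDeriv hp_diff hu
  have hLu : Continuous (fun z : X × M => L z.2 (a.2 z.1)) :=
    hL.comp (continuous_snd.prodMk (hu.comp continuous_fst))
  have hL0 : ∀ m ∉ tsupport χ, ∀ w : Eu l, L m w = 0 := fun m hm w =>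
    eq_zero_of_hasDerivAt_lieExp (G := G) (w := w) (h := χ) (Rh := fun m => L m w)
      (fun m => hχL m w) hm
  have hL00 : ∀ m, L m 0 = 0 := fun m =>
    (hχL m 0).unique (by simpa using hasDerivAt_const (0 : ℝ) (χ ((lieExp 0 : G) • m)))
  -- The integrand splits into two compactly supported functions. `T₁` integrates to zero over each
  -- slice of fixed mark by the divergence theorem, and `T₂` over each slice of fixed position by
  -- the quasi-invariance of `λ`, applied to `χ F`.
  let T₁ : X × M → ℝ := fun z => χ z.2 * (gradX d F z (a.1 z.1) + F z * divergence a.1 z.1)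
  let T₂ : X × M → ℝ := fun z => L z.2 (a.2 z.1) * F z + χ z.2 * gradM l G F z (a.2 z.1) -
    χ z.2 * F z * diffAtOne l (fun g : G => p g z.2) (a.2 z.1)
  have hT₁ : Continuous T₁ := hχ2.mul (hA.add (hF.continuous.mul hD))
  have hT₂ : Continuous T₂ := ((hLu.mul hF.continuous).add (hχ2.mul hB)).sub
    ((hχ2.mul hF.continuous).mul hγ)
  have hc₁ : HasCompactSupport T₁ := by
    refine HasCompactSupport.intro (ha.compact_fst.prod hχc.isCompact) fun z hz => ?_
    by_cases h : z.1 ∈ closure {x | a.1 x ≠ 0}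
    · simp only [T₁, image_eq_zero_of_notMem_tsupport fun h' => hz ⟨h, h'⟩, zero_mul]
    · have e : gradX d F z (a.1 z.1) = 0 := by
        rw [eq_zero_of_notMem_closure h, map_zero]
      simp only [T₁, e, divergence_eq_zero h, mul_zero, add_zero]
  have hc₂ : HasCompactSupport T₂ := by
    refine HasCompactSupport.intro (ha.compact_snd.prod hχc.isCompact) fun z hz => ?_
    by_cases h : z.1 ∈ closure {x | a.2 x ≠ 0}
    · have h' : z.2 ∉ tsupport χ := fun h' => hz ⟨h, h'⟩
      have e1 : L z.2 (a.2 z.1) = 0 := hL0 _ h' _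
      simp only [T₂, e1, image_eq_zero_of_notMem_tsupport h', zero_mul, add_zero, sub_zero]
    · have h0 : (show Eu l from a.2 z.1) = 0 := by
        by_contra h0; exact h (subset_closure h0)
      have e1 : L z.2 (a.2 z.1) = 0 := (congrArg (L z.2) h0).trans (hL00 _)
      have e2 : gradM l G F z (a.2 z.1) = 0 := (congrArg (gradM l G F z) h0).trans (map_zero _)
      have e3 : diffAtOne l (fun g : G => p g z.2) (a.2 z.1) = 0 :=
        (congrArg (diffAtOne l (fun g : G => p g z.2)) h0).trans (map_zero _)
      simp only [T₂, e1, e2, e3]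
      simp
  have hi₁ : Integrable T₁ ((riemannianVolume d X).prod lam) :=
    hT₁.integrable_of_hasCompactSupport hc₁
  have hi₂ : Integrable T₂ ((riemannianVolume d X).prod lam) :=
    hT₂.integrable_of_hasCompactSupport hc₂
  have hI₁ : ∫ z, T₁ z ∂((riemannianVolume d X).prod lam) = 0 := by
    rw [integral_prod_symm _ hi₁]
    refine integral_eq_zero_of_ae (Filter.Eventually.of_forall fun m => ?_)
    simp only [T₁, integral_const_mul]
    have h1 := integral_diffAt_add_divergence ha.smooth_fst ha.compact_fst
      (contMDiff_slice_fst (n := 1) hF m)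
    exact (congrArg (fun y => χ m * y) h1).trans (mul_zero _)
  have hI₂ : ∫ z, T₂ z ∂((riemannianVolume d X).prod lam) = 0 := by
    rw [integral_prod _ hi₂]
    refine integral_eq_zero_of_ae (Filter.Eventually.of_forall fun x => ?_)
    have hcx : ∀ {f : X × M → ℝ}, Continuous f → Continuous (fun m => f (x, m)) := fun hf =>
      hf.comp (Continuous.prodMk_right x)
    have hs : HasCompactSupport (fun m => χ m * F (x, m)) := hχc.mul_right
    have h1 := integral_lieExp_deriv hp hp_diff (w := a.2 x) (h := fun m => χ m * F (x, m))
      (Rh := fun m => L m (a.2 x) * F (x, m) + χ m * gradM l G F (x, m) (a.2 x))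
      (hχ.mul (hcx hF.continuous))
      (((hcx hLu).mul (hcx hF.continuous)).add (hχ.mul (hcx hB))) hs
      (fun m => by
        have h2 := hasDerivAt_lieExp (l := l) (contMDiff_slice_orbit (G := G) (n := 1) hF (x, m))
          (a.2 x)
        have h3 := (hχL m (a.2 x)).mul h2
        simp only [zero_smul, lieExp_zero, one_smul] at h3
        exact h3)
    have hj₁ : Integrable (fun m => L m (a.2 x) * F (x, m) + χ m * gradM l G F (x, m) (a.2 x))
        lam := by
      refine Continuous.integrable_of_hasCompactSupport
        (((hcx hLu).mul (hcx hF.continuous)).add (hχ.mul (hcx hB)))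
        (HasCompactSupport.intro hχc.isCompact fun m hm => ?_)
      have e1 : L m (a.2 x) = 0 := hL0 m hm _
      rw [e1, image_eq_zero_of_notMem_tsupport hm, zero_mul, zero_mul, add_zero]
    have hj₂ : Integrable
        (fun m => χ m * F (x, m) * diffAtOne l (fun g : G => p g m) (a.2 x)) lam :=
      Continuous.integrable_of_hasCompactSupport ((hχ.mul (hcx hF.continuous)).mul (hcx hγ))
        hs.mul_right
    change ∫ m, (L m (a.2 x) * F (x, m) + χ m * gradM l G F (x, m) (a.2 x) -
      χ m * F (x, m) * diffAtOne l (fun g : G => p g m) (a.2 x)) ∂lam = 0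
    rw [integral_sub hj₁ hj₂]
    exact sub_eq_zero.2 h1
  have hsum := integral_add hi₁ hi₂
  rw [hI₁, hI₂, add_zero] at hsum
  rw [← hsum]
  refine integral_congr_ae (Filter.Eventually.of_forall fun z => ?_)
  simp only [T₁, T₂]
  ring

end CutoffIntegration

/-! ### Approximation of local Sobolev functions -/

section SobolevApproximation

/-- The factor `2` comes from `(x + y)² ≤ 2x² + 2y²`. The term with `s` only completes the integrand
of `sobolevEnergy`. -/
theorem enorm_sq_apply_add_le {V W : Type*} [NormedAddCommGroup V] [NormedSpace ℝ V]
    [NormedAddCommGroup W] [NormedSpace ℝ W] (L : V →L[ℝ] ℝ) (L' : W →L[ℝ] ℝ) {v : V} {w : W}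
    (s : ℝ) {C : ℝ} (hv : ‖v‖ ≤ C) (hw : ‖w‖ ≤ C) :
    ‖L v + L' w‖ₑ ^ 2 ≤ ENNReal.ofReal (2 * C ^ 2) * (‖L‖ₑ ^ 2 + ‖L'‖ₑ ^ 2 + ‖s‖ₑ ^ 2) := by
  simp only [← ofReal_norm]
  rw [← ENNReal.ofReal_pow (norm_nonneg _), ← ENNReal.ofReal_pow (norm_nonneg _),
    ← ENNReal.ofReal_pow (norm_nonneg _), ← ENNReal.ofReal_pow (norm_nonneg _),
    ← ENNReal.ofReal_add (by positivity) (by positivity),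
    ← ENNReal.ofReal_add (by positivity) (by positivity), ← ENNReal.ofReal_mul (by positivity)]
  refine ENNReal.ofReal_le_ofReal ?_
  have h1 : ‖L v‖ ≤ ‖L‖ * C := (L.le_opNorm v).trans (by gcongr)
  have h2 : ‖L' w‖ ≤ ‖L'‖ * C := (L'.le_opNorm w).trans (by gcongr)
  have h3 : ‖L v + L' w‖ ≤ ‖L‖ * C + ‖L'‖ * C := (norm_add_le _ _).trans (add_le_add h1 h2)
  have h4 : ‖L v + L' w‖ ^ 2 ≤ (‖L‖ * C + ‖L'‖ * C) ^ 2 := by gcongr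
  refine h4.trans ?_
  nlinarith [sq_nonneg (‖L‖ * C - ‖L'‖ * C), mul_nonneg (sq_nonneg C) (sq_nonneg ‖s‖)]

theorem enorm_sq_le_energy {V W : Type*} [NormedAddCommGroup V] [NormedSpace ℝ V]
    [NormedAddCommGroup W] [NormedSpace ℝ W] (L : V →L[ℝ] ℝ) (L' : W →L[ℝ] ℝ) (s : ℝ) :
    ‖s‖ₑ ^ 2 ≤ 1 * (‖L‖ₑ ^ 2 + ‖L'‖ₑ ^ 2 + ‖s‖ₑ ^ 2) := by
  rw [one_mul]
  exact le_add_self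

variable {d k l : ℕ} {X : Type*} [TopologicalSpace X] [T2Space X] [SecondCountableTopology X]
  [ChartedSpace (Eu d) X] [IsManifold (𝓡 d) ∞ X]
  [RiemannianBundle (fun x : X => TangentSpace (𝓡 d) x)]
  [IsContMDiffRiemannianBundle (𝓡 d) ∞ (Eu d) (fun x : X => TangentSpace (𝓡 d) x)]
  [MeasurableSpace X] [BorelSpace X]
  {M : Type*} [TopologicalSpace M] [T2Space M] [SecondCountableTopology M]
  [ChartedSpace (Eu k) M] [IsManifold (𝓡 k) ∞ M] [MeasurableSpace M] [BorelSpace M]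
  {G : Type*} [TopologicalSpace G] [T2Space G]
  [ChartedSpace (Eu l) G] [Group G] [LieGroup (𝓡 l) ∞ G]
  [MulAction G M] [ContMDiffSMul (𝓡 l) (𝓡 k) ∞ G M]

/-- Both norms are continuous with compact support, the Riemannian one through the inner product of
the section with itself. -/
theorem IsCurrent.exists_norm_le {a : FieldPair d l X G} (ha : IsCurrent a) :
    ∃ C : ℝ, ∀ x, ‖a.1 x‖ ≤ C ∧ ‖(show Eu l from a.2 x)‖ ≤ C := by
  have h1 : Continuous (fun x => inner ℝ (a.1 x) (a.1 x)) :=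
    (ContMDiff.inner_bundle (n := ∞) (IB := 𝓡 d) (F := Eu d) ha.smooth_fst ha.smooth_fst).continuous
  have h1c : HasCompactSupport (fun x => inner ℝ (a.1 x) (a.1 x)) :=
    HasCompactSupport.intro ha.compact_fst fun x hx => by
      rw [eq_zero_of_notMem_closure hx, inner_zero_left]
  obtain ⟨C₁, hC₁⟩ := h1.bounded_above_of_compact_support h1c
  have h2 : Continuous (fun x => (show Eu l from a.2 x)) := ha.smooth_snd.continuous
  have h2c : HasCompactSupport (fun x => (show Eu l from a.2 x)) :=
    HasCompactSupport.intro ha.compact_snd fun x hx => by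
      by_contra h; exact hx (subset_closure h)
  obtain ⟨C₂, hC₂⟩ := h2.bounded_above_of_compact_support h2c
  refine ⟨max (Real.sqrt C₁) C₂, fun x => ⟨le_max_of_le_left ?_, le_max_of_le_right (hC₂ x)⟩⟩
  refine Real.le_sqrt_of_sq_le ?_
  have := hC₁ x
  rw [real_inner_self_eq_norm_sq] at this
  exact (le_abs_self _).trans this

/-- A local Sobolev function is approximated, together with its derivative along a current, by
functions of the class `𝔇` in `L²` over compact sets of positions. -/
theorem HasLocalSobolevGrad.exists_approx {lam : Measure M} [IsLocallyFiniteMeasure lam]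
    {f : X × M → ℝ} {DX : XField d X M} {DM : X × M → (Eu l →L[ℝ] ℝ)}
    (h : HasLocalSobolevGrad k G ((riemannianVolume d X).prod lam) f DX DM)
    {a : FieldPair d l X G} (ha : IsCurrent a) {K : Set X} (hK : IsCompact K) :
    ∃ φ : ℕ → X × M → ℝ, (∀ n, IsTest d k l X M G (φ n)) ∧
      (∀ n, MemLp (φ n) 2 (((riemannianVolume d X).prod lam).restrict (K ×ˢ univ))) ∧
      (∀ n, MemLp (fun z => gradX d (φ n) z (a.1 z.1) + gradM l G (φ n) z (a.2 z.1)) 2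
        (((riemannianVolume d X).prod lam).restrict (K ×ˢ univ))) ∧
      MemLp f 2 (((riemannianVolume d X).prod lam).restrict (K ×ˢ univ)) ∧
      MemLp (fun z => DX z (a.1 z.1) + DM z (a.2 z.1)) 2
        (((riemannianVolume d X).prod lam).restrict (K ×ˢ univ)) ∧
      Filter.Tendsto (fun n => eLpNorm (φ n - f) 2
        (((riemannianVolume d X).prod lam).restrict (K ×ˢ univ))) Filter.atTop (𝓝 0) ∧
      Filter.Tendsto (fun n => eLpNorm ((fun z => gradX d (φ n) z (a.1 z.1) +
          gradM l G (φ n) z (a.2 z.1)) - fun z => DX z (a.1 z.1) + DM z (a.2 z.1)) 2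
        (((riemannianVolume d X).prod lam).restrict (K ×ˢ univ))) Filter.atTop (𝓝 0) := by
  obtain ⟨f', DX', DM', ⟨hf', hDX', hDM', φ, hφ, hlim⟩, hae⟩ := h K hK
  set μ := (riemannianVolume d X).prod lam
  have hKm : MeasurableSet (K ×ˢ (univ : Set M)) := hK.measurableSet.prod MeasurableSet.univ
  obtain ⟨C, hC⟩ := ha.exists_norm_le
  set μK := μ.restrict (K ×ˢ univ)
  have haeK : ∀ᵐ z ∂μK, f z = f' z ∧ DX z = DX' z ∧ DM z = DM' z := by
    rw [ae_restrict_iff' hKm]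
    filter_upwards [hae] with z hz hzK
    exact hz hzK.1
  have hu : Measurable (fun z : X × M => (show Eu l from a.2 z.1)) :=
    (ha.smooth_snd.continuous.comp continuous_fst).measurable
  have hE' : AEMeasurable (fun z => DX' z (a.1 z.1) + DM' z (a.2 z.1)) μ := by
    refine (hDX' a ha).add ?_
    have e : (fun z => DM' z (a.2 z.1)) = fun z : X × M =>
        ∑ i, (show Eu l from a.2 z.1) i * DM' z (EuclideanSpace.single i 1) := by
      funext z
      exact (clm_apply_eq_sum (DM' z) (show Eu l from a.2 z.1)).trans (by simp)
    rw [e]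
    refine Finset.aemeasurable_fun_sum _ fun i _ => AEMeasurable.mul ?_
      (hDM'.apply_continuousLinearMap _)
    exact ((EuclideanSpace.proj (𝕜 := ℝ) i).continuous.measurable.comp hu).aemeasurable
  -- Measurability is known only for the global Sobolev function `f'` that coincides with `f` over
  -- `K`.
  have hfK : AEStronglyMeasurable f μK := by
    refine AEStronglyMeasurable.congr (hf'.mono_measure Measure.restrict_le_self).aestronglyMeasurable
      ?_
    filter_upwards [haeK] with z hz
    exact hz.1.symm
  have hEK : AEStronglyMeasurable (fun z => DX z (a.1 z.1) + DM z (a.2 z.1)) μK := by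
    refine AEStronglyMeasurable.congr (hE'.mono_measure Measure.restrict_le_self).aestronglyMeasurable
      ?_
    filter_upwards [haeK] with z hz
    rw [hz.2.1, hz.2.2]
  have hen : ∀ n, ∫⁻ z, (‖gradX d (φ n) z‖ₑ ^ 2 + ‖gradM l G (φ n) z‖ₑ ^ 2 + ‖φ n z‖ₑ ^ 2) ∂μK
      < ⊤ := fun n => (lintegral_mono' Measure.restrict_le_self le_rfl).trans_lt (hφ n).2
  have hlimK : Filter.Tendsto (fun n => ∫⁻ z, (‖gradX d (φ n) z - DX' z‖ₑ ^ 2 +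
      ‖gradM l G (φ n) z - DM' z‖ₑ ^ 2 + ‖(φ n - f') z‖ₑ ^ 2) ∂μK) Filter.atTop (𝓝 0) :=
    tendsto_of_tendsto_of_tendsto_of_le_of_le tendsto_const_nhds hlim (fun _ => zero_le)
      fun n => lintegral_mono' Measure.restrict_le_self le_rfl
  have hφm : ∀ n, MemLp (φ n) 2 μK := fun n => memLp_two_of_sq_le ENNReal.one_ne_top
    (hφ n).1.smooth.continuous.aestronglyMeasurable (Filter.Eventually.of_forall fun z =>
      enorm_sq_le_energy (gradX d (φ n) z) (gradM l G (φ n) z) _) (hen n)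
  have hEm : ∀ n, MemLp (fun z => gradX d (φ n) z (a.1 z.1) + gradM l G (φ n) z (a.2 z.1)) 2 μK :=
    fun n => memLp_two_of_sq_le ENNReal.ofReal_ne_top
      ((contMDiff_gradX (n := 0) (m := 1) (by simp) (hφ n).1.contMDiff_one
        (ha.smooth_fst.of_le (by simp))).continuous.add
        (contMDiff_gradM (n := 0) (m := 1) (by simp) (hφ n).1.contMDiff_one
          (ha.smooth_snd.of_le (by simp))).continuous).aestronglyMeasurable
      (Filter.Eventually.of_forall fun z => enorm_sq_apply_add_le (gradX d (φ n) z)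
        (gradM l G (φ n) z) _ (hC z.1).1 (hC z.1).2) (hen n)
  have t1 : Filter.Tendsto (fun n => eLpNorm (φ n - f) 2 μK) Filter.atTop (𝓝 0) := by
    refine tendsto_eLpNorm_two_of_sq_le ENNReal.one_ne_top (fun n => ?_) hlimK
    filter_upwards [haeK] with z hz
    rw [Pi.sub_apply, hz.1]
    exact enorm_sq_le_energy (gradX d (φ n) z - DX' z) (gradM l G (φ n) z - DM' z) _
  have t2 : Filter.Tendsto (fun n => eLpNorm ((fun z => gradX d (φ n) z (a.1 z.1) +
      gradM l G (φ n) z (a.2 z.1)) - fun z => DX z (a.1 z.1) + DM z (a.2 z.1)) 2 μK)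
      Filter.atTop (𝓝 0) := by
    refine tendsto_eLpNorm_two_of_sq_le (ENNReal.ofReal_ne_top (r := 2 * C ^ 2)) (fun n => ?_) hlimK
    filter_upwards [haeK] with z hz
    have e : ((fun z => gradX d (φ n) z (a.1 z.1) + gradM l G (φ n) z (a.2 z.1)) -
        fun z => DX z (a.1 z.1) + DM z (a.2 z.1)) z = (gradX d (φ n) z - DX' z) (a.1 z.1) +
        (gradM l G (φ n) z - DM' z) (show Eu l from a.2 z.1) := by
      rw [Pi.sub_apply, hz.2.1, hz.2.2]
      exact add_sub_add_comm _ _ _ _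
    rw [e]
    exact enorm_sq_apply_add_le (gradX d (φ n) z - DX' z) (gradM l G (φ n) z - DM' z) _
      (hC z.1).1 (hC z.1).2
  exact ⟨φ, fun n => (hφ n).1, hφm, hEm, memLp_of_tendsto_eLpNorm_sub hφm hfK t1,
    memLp_of_tendsto_eLpNorm_sub hEm hEK t2, t1, t2⟩

end SobolevApproximation

/-! ### Integration by parts for the Lévy measure -/

section OnePoint

variable {d k l : ℕ} {X : Type*} [TopologicalSpace X] [T2Space X] [SecondCountableTopology X]
  [ChartedSpace (Eu d) X] [IsManifold (𝓡 d) ∞ X]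
  [RiemannianBundle (fun x : X => TangentSpace (𝓡 d) x)]
  [IsContMDiffRiemannianBundle (𝓡 d) ∞ (Eu d) (fun x : X => TangentSpace (𝓡 d) x)]
  [MeasurableSpace X] [BorelSpace X]
  {M : Type*} [TopologicalSpace M] [T2Space M] [SecondCountableTopology M]
  [ChartedSpace (Eu k) M] [IsManifold (𝓡 k) ∞ M] [MeasurableSpace M] [BorelSpace M]
  {G : Type*} [TopologicalSpace G] [T2Space G] [SecondCountableTopology G]
  [ChartedSpace (Eu l) G] [Group G] [LieGroup (𝓡 l) ∞ G]
  [MulAction G M] [ContMDiffSMul (𝓡 l) (𝓡 k) ∞ G M]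

/-- The standing assumptions on the density `p` of the measure `lam` on the mark space and on the
density `q` of the Lévy measure `σ`. -/
structure LevyDensity (k : ℕ) [ChartedSpace (Eu k) M] [IsManifold (𝓡 k) ∞ M]
    (lam : Measure M) (p : G → M → ℝ) (q : X × M → ℝ) (σ : Measure (X × M))
    (DX : XField d X M) (DM : X × M → (Eu l →L[ℝ] ℝ)) : Prop where
  map_smul : ∀ g : G, lam.map (fun m => g • m) =
    lam.withDensity (fun m => ENNReal.ofReal (p g m))
  contMDiff_density : ContMDiff ((𝓡 l).prod (𝓡 k)) 𝓘(ℝ, ℝ) 1 (fun z : G × M => p z.1 z.2)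
  measurable_q : Measurable q
  q_pos : ∀ᵐ z ∂((riemannianVolume d X).prod lam), 0 < q z
  eq_withDensity : σ = ((riemannianVolume d X).prod lam).withDensity
    (fun z => ENNReal.ofReal (q z))
  finite : ∀ K : Set X, IsCompact K → σ (K ×ˢ univ) < ⊤
  sobolev : HasLocalSobolevGrad k G ((riemannianVolume d X).prod lam)
    (fun z => Real.sqrt (q z)) DX DM
  integrable_density : ∀ K : Set X, IsCompact K →
    IntegrableOn (fun z : X × M => ‖diffAtOne l (fun g : G => p g z.2)‖) (K ×ˢ univ) σ

/-- The support of a current in the position space. -/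
def currentSupport (a : FieldPair d l X G) : Set X :=
  closure {x | a.1 x ≠ 0} ∪ closure {x | a.2 x ≠ 0}

theorem IsCurrent.isCompact_currentSupport {a : FieldPair d l X G} (ha : IsCurrent a) :
    IsCompact (currentSupport a) := ha.compact_fst.union ha.compact_snd

theorem fst_eq_zero_of_notMem {a : FieldPair d l X G} {x : X} (hx : x ∉ currentSupport a) :
    a.1 x = 0 := eq_zero_of_notMem_closure fun h => hx (Or.inl h)

theorem snd_eq_zero_of_notMem {a : FieldPair d l X G} {x : X} (hx : x ∉ currentSupport a) :
    (show Eu l from a.2 x) = 0 := by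
  by_contra h
  exact hx (Or.inr (subset_closure h))

theorem apply_fst_eq_zero {a : FieldPair d l X G} {x : X} (hx : x ∉ currentSupport a)
    (L : TangentSpace (𝓡 d) x →L[ℝ] ℝ) : L (a.1 x) = 0 := by
  rw [fst_eq_zero_of_notMem hx, map_zero]

theorem apply_snd_eq_zero {a : FieldPair d l X G} {x : X} (hx : x ∉ currentSupport a)
    (L : Eu l →L[ℝ] ℝ) : L (a.2 x) = 0 :=
  (congrArg L (snd_eq_zero_of_notMem hx)).trans (map_zero L)

theorem divergence_eq_zero_of_notMem {a : FieldPair d l X G} {x : X}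
    (hx : x ∉ currentSupport a) : divergence a.1 x = 0 :=
  divergence_eq_zero fun h => hx (Or.inl h)

theorem pointDeriv_eq_zero_of_notMem {a : FieldPair d l X G} (ha : IsCurrent a) {f : X × M → ℝ}
    (hf : ContMDiff ((𝓡 d).prod (𝓡 k)) 𝓘(ℝ, ℝ) 1 f) {z : X × M} (hz : z.1 ∉ currentSupport a) :
    pointDeriv a f z = 0 := by
  rw [pointDeriv_eq ha hf, apply_fst_eq_zero hz, apply_snd_eq_zero hz, add_zero]

theorem pointDeriv_mul {a : FieldPair d l X G} (ha : IsCurrent a) {f g : X × M → ℝ}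
    (hf : ContMDiff ((𝓡 d).prod (𝓡 k)) 𝓘(ℝ, ℝ) 1 f)
    (hg : ContMDiff ((𝓡 d).prod (𝓡 k)) 𝓘(ℝ, ℝ) 1 g) (z : X × M) :
    pointDeriv a (fun z => f z * g z) z = pointDeriv a f z * g z + f z * pointDeriv a g z := by
  have hd := ((hasDerivAt_currentMap ha hf z).fun_mul (hasDerivAt_currentMap ha hg z)).deriv
  rw [currentMap_zero ha, ← pointDeriv_eq ha hf, ← pointDeriv_eq ha hg] at hd
  exact hd

theorem logDeriv_eq_zero_of_notMem {q : X × M → ℝ} {DX : XField d X M}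
    {DM : X × M → (Eu l →L[ℝ] ℝ)} {p : G → M → ℝ} {a : FieldPair d l X G} {z : X × M}
    (hz : z.1 ∉ currentSupport a) : logDeriv q DX DM p a z = 0 := by
  rw [logDeriv, apply_fst_eq_zero hz, apply_snd_eq_zero hz, apply_snd_eq_zero hz,
    divergence_eq_zero_of_notMem hz]
  simp

variable {lam : Measure M} [IsLocallyFiniteMeasure lam] {p : G → M → ℝ} {q : X × M → ℝ}
  {σ : Measure (X × M)} {DX : XField d X M} {DM : X × M → (Eu l →L[ℝ] ℝ)}

theorem LevyDensity.restrict_eq (h : LevyDensity k lam p q σ DX DM) {K : Set X}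
    (hK : IsCompact K) : σ.restrict (K ×ˢ univ) =
      (((riemannianVolume d X).prod lam).restrict (K ×ˢ univ)).withDensity
        (fun z => ENNReal.ofReal (q z)) := by
  rw [h.eq_withDensity, restrict_withDensity (hK.measurableSet.prod MeasurableSet.univ)]

theorem LevyDensity.sq_sqrt_ae (h : LevyDensity k lam p q σ DX DM) (K : Set X) :
    ∀ᵐ z ∂(((riemannianVolume d X).prod lam).restrict (K ×ˢ univ)),
      0 < Real.sqrt (q z) ∧ (ENNReal.ofReal (q z)).toReal = Real.sqrt (q z) * Real.sqrt (q z) := by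
  filter_upwards [ae_mono Measure.restrict_le_self h.q_pos] with z hz
  rw [Real.mul_self_sqrt hz.le, ENNReal.toReal_ofReal hz.le]
  exact ⟨Real.sqrt_pos.2 hz, rfl⟩

/-- The density is written as `√q √q`, so that square-integrability of `√q` and of its gradient can
be used. -/
theorem LevyDensity.setIntegral_eq (h : LevyDensity k lam p q σ DX DM) {K : Set X}
    (hK : IsCompact K) (f : X × M → ℝ) : ∫ z in K ×ˢ univ, f z ∂σ =
      ∫ z in K ×ˢ univ, Real.sqrt (q z) * Real.sqrt (q z) * f z
        ∂((riemannianVolume d X).prod lam) := by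
  rw [h.restrict_eq hK, integral_withDensity_eq_integral_toReal_smul
    h.measurable_q.ennreal_ofReal (by simp)]
  refine integral_congr_ae ?_
  filter_upwards [h.sq_sqrt_ae K] with z hz
  rw [hz.2, smul_eq_mul]

theorem LevyDensity.integrableOn_iff (h : LevyDensity k lam p q σ DX DM) {K : Set X}
    (hK : IsCompact K) (f : X × M → ℝ) : IntegrableOn f (K ×ˢ univ) σ ↔
      IntegrableOn (fun z => Real.sqrt (q z) * Real.sqrt (q z) * f z) (K ×ˢ univ)
        ((riemannianVolume d X).prod lam) := by
  rw [IntegrableOn, h.restrict_eq hK, integrable_withDensity_iff_integrable_smul'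
    h.measurable_q.ennreal_ofReal (by simp), IntegrableOn]
  refine integrable_congr ?_
  filter_upwards [h.sq_sqrt_ae K] with z hz
  rw [hz.2, smul_eq_mul]

/-- The part of the logarithmic derivative that does not depend on `q`. -/
def logDerivReg (p : G → M → ℝ) (a : FieldPair d l X G) (z : X × M) : ℝ :=
  divergence a.1 z.1 - diffAtOne l (fun g : G => p g z.2) (a.2 z.1)

theorem logDeriv_eq_reg (z : X × M) (a : FieldPair d l X G) : logDeriv q DX DM p a z =
    2 * (DX z (a.1 z.1) + DM z (a.2 z.1)) / Real.sqrt (q z) + logDerivReg p a z := by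
  rw [logDeriv, logDerivReg]
  ring

theorem LevyDensity.continuous_logDerivReg (h : LevyDensity k lam p q σ DX DM)
    {a : FieldPair d l X G} (ha : IsCurrent a) :
    Continuous (fun z : X × M => logDerivReg p a z) :=
  ((contMDiff_divergence ha.smooth_fst).continuous.comp continuous_fst).sub
    (continuous_densityDeriv h.contMDiff_density ha.smooth_snd.continuous)

theorem LevyDensity.integrableOn_logDerivReg (h : LevyDensity k lam p q σ DX DM)
    {a : FieldPair d l X G} (ha : IsCurrent a) {K : Set X} (hK : IsCompact K) :
    IntegrableOn (fun z : X × M => logDerivReg p a z) (K ×ˢ univ) σ := by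
  obtain ⟨C, hC⟩ := ha.exists_norm_le
  have : IsFiniteMeasure (σ.restrict (K ×ˢ univ)) :=
    ⟨by rw [Measure.restrict_apply_univ]; exact h.finite K hK⟩
  have hd : Continuous (divergence a.1) := (contMDiff_divergence ha.smooth_fst).continuous
  obtain ⟨C', hC'⟩ := hd.bounded_above_of_compact_support
    (HasCompactSupport.intro ha.compact_fst fun x hx => divergence_eq_zero hx)
  refine Integrable.mono' (g := fun z : X × M => C' + ‖diffAtOne l (fun g : G => p g z.2)‖ * C)
    ((integrable_const C').add ((h.integrable_density K hK).mul_const C))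
    (h.continuous_logDerivReg ha).aestronglyMeasurable (Filter.Eventually.of_forall fun z => ?_)
  refine (norm_sub_le _ _).trans (add_le_add (hC' z.1) ?_)
  exact ((diffAtOne l (fun g : G => p g z.2)).le_opNorm _).trans
    (mul_le_mul_of_nonneg_left (hC z.1).2 (norm_nonneg _))

/-- With respect to `ν ⊗ λ` the singular part becomes `2 √q ∇√q`, a product of two functions in `L²`
over the compact support of the current. The remaining part is controlled by the integrability of
`∇^G p(e,·)`. -/
theorem LevyDensity.integrable_logDeriv (h : LevyDensity k lam p q σ DX DM)
    {a : FieldPair d l X G} (ha : IsCurrent a) : Integrable (logDeriv q DX DM p a) σ := by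
  have hK := ha.isCompact_currentSupport
  obtain ⟨φ, -, -, -, hS, hE, -, -⟩ := h.sobolev.exists_approx ha hK
  have h1 : IntegrableOn (fun z => 2 * (DX z (a.1 z.1) + DM z (a.2 z.1)) / Real.sqrt (q z))
      (currentSupport a ×ˢ univ) σ := by
    rw [h.integrableOn_iff hK]
    refine Integrable.congr ((hS.integrable_mul hE).const_mul 2) ?_
    filter_upwards [h.sq_sqrt_ae (currentSupport a)] with z hz
    have := hz.1.ne'
    simp only [Pi.mul_apply]
    field_simp
  have h2 : IntegrableOn (logDeriv q DX DM p a) (currentSupport a ×ˢ univ) σ := by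
    refine (h1.add (h.integrableOn_logDerivReg ha hK)).congr
      (Filter.Eventually.of_forall fun z => ?_)
    exact (logDeriv_eq_reg z a).symm
  refine (integrableOn_iff_integrable_of_support_subset fun z hz => ?_).1 h2
  by_contra h'
  exact hz (logDeriv_eq_zero_of_notMem fun hm => h' ⟨hm, mem_univ _⟩)

/-- For smooth `φₙ` in place of `√q`, this is the integration by parts for `ν ⊗ λ` applied to `f
φₙ²`. The resulting integrals are quadratic in `φₙ` and its derivative with bounded weights, hence
continuous under the Sobolev convergence `φₙ → √q`. -/
theorem LevyDensity.integral_cutoff (h : LevyDensity k lam p q σ DX DM)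
    {a : FieldPair d l X G} (ha : IsCurrent a) {f : X × M → ℝ}
    (hf : ContMDiff ((𝓡 d).prod (𝓡 k)) 𝓘(ℝ, ℝ) 1 f) {C : ℝ} (hfC : ∀ z, |f z| ≤ C)
    {χ : M → ℝ} {L : M → Eu l → ℝ} {Cχ : ℝ} (hχC : ∀ m, |χ m| ≤ Cχ) (hχ : Continuous χ)
    (hχc : HasCompactSupport χ)
    (hL : Continuous (fun z : M × Eu l => L z.1 z.2))
    (hχL : ∀ m (w : GroupLieAlgebra (𝓡 l) G), HasDerivAt
        (fun t : ℝ => χ ((lieExp (t • w) : G) • m)) (L m (show Eu l from w)) 0) :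
    ∫ z in currentSupport a ×ˢ univ,
      (χ z.2 * (pointDeriv a f z + f z * logDeriv q DX DM p a z) + L z.2 (a.2 z.1) * f z) ∂σ
      = 0 := by
  have hK := ha.isCompact_currentSupport
  obtain ⟨φ, hφ, hφm, hEm, hS, hE, hφt, hEt⟩ := h.sobolev.exists_approx ha hK
  set K := currentSupport a
  have hu : Continuous (fun x => (show Eu l from a.2 x)) := ha.smooth_snd.continuous
  have hχ2 : Continuous (fun z : X × M => χ z.2) := hχ.comp continuous_snd
  have hLu : Continuous (fun z : X × M => L z.2 (a.2 z.1)) :=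
    hL.comp (continuous_snd.prodMk (hu.comp continuous_fst))
  have hL00 : ∀ m, L m 0 = 0 := fun m =>
    (hχL m 0).unique (by simpa using hasDerivAt_const (0 : ℝ) (χ ((lieExp 0 : G) • m)))
  have := continuous_smul_of_contMDiffSMul (k := k) (M := M) l (G := G)
  have hL0 : ∀ m ∉ tsupport χ, ∀ w : Eu l, L m w = 0 := fun m hm w =>
    eq_zero_of_hasDerivAt_lieExp (G := G) (w := w) (h := χ) (Rh := fun m => L m w)
      (fun m => hχL m w) hm
  have hLK : ∀ z : X × M, z.1 ∉ K → L z.2 (a.2 z.1) = 0 := fun z hz =>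
    (congrArg (L z.2) (snd_eq_zero_of_notMem hz)).trans (hL00 _)
  -- The weights of `φₙ²` and of `φₙ ∇φₙ`. The term `∇^G p(e,·)` in `c₁` need not be bounded on `K ×
  -- M`; the compact support of `χ` makes `c₁` bounded.
  let c₁ : X × M → ℝ := fun z =>
    χ z.2 * (pointDeriv a f z + f z * logDerivReg p a z) + L z.2 (a.2 z.1) * f z
  let c₂ : X × M → ℝ := fun z => 2 * χ z.2 * f z
  have hc₁ : Continuous c₁ := (hχ2.mul ((contMDiff_pointDeriv (n := 0) (m := 1) (by simp)
    ha hf).continuous.add (hf.continuous.mul (h.continuous_logDerivReg ha)))).add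
    (hLu.mul hf.continuous)
  have hc₂ : Continuous c₂ := (hχ2.const_mul 2).mul hf.continuous
  have hc₁K : ∀ z : X × M, z.1 ∉ K → c₁ z = 0 := fun z hz => by
    have e : logDerivReg p a z = 0 := by
      rw [logDerivReg, divergence_eq_zero_of_notMem hz, apply_snd_eq_zero hz, sub_zero]
    simp only [c₁]
    rw [hLK z hz, pointDeriv_eq_zero_of_notMem ha hf hz, e]
    ring
  have hc₁c : HasCompactSupport c₁ := HasCompactSupport.intro (hK.prod hχc.isCompact)
    fun z hz => by
      by_cases hzK : z.1 ∈ K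
      · have hm : z.2 ∉ tsupport χ := fun h' => hz ⟨hzK, h'⟩
        have e : L z.2 (a.2 z.1) = 0 := hL0 _ hm _
        simp only [c₁]
        rw [e, image_eq_zero_of_notMem_tsupport hm]
        ring
      · exact hc₁K z hzK
  obtain ⟨C₁, hC₁⟩ := hc₁.bounded_above_of_compact_support hc₁c
  have hC₂ : ∀ z, |c₂ z| ≤ 2 * Cχ * C := fun z => by
    simp only [c₂, abs_mul, abs_two]
    have := (abs_nonneg _).trans (hχC z.2)
    exact mul_le_mul (mul_le_mul_of_nonneg_left (hχC _) two_pos.le) (hfC z) (abs_nonneg _)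
      (by positivity)
  have t₁ := tendsto_integral_weight_mul hc₁.aestronglyMeasurable hC₁ hφm hφm hS hS hφt hφt
  have t₂ := tendsto_integral_weight_mul hc₂.aestronglyMeasurable hC₂ hφm hEm hS hE hφt hEt
  have hi : ∀ {c u v : X × M → ℝ} {C : ℝ}, Continuous c → (∀ z, |c z| ≤ C) →
      MemLp u 2 (((riemannianVolume d X).prod lam).restrict (K ×ˢ univ)) →
      MemLp v 2 (((riemannianVolume d X).prod lam).restrict (K ×ˢ univ)) →
      Integrable (fun z => c z * (u z * v z))
        (((riemannianVolume d X).prod lam).restrict (K ×ˢ univ)) := fun hc hC hu hv =>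
    (hu.integrable_mul hv).bdd_mul hc.aestronglyMeasurable (Filter.Eventually.of_forall hC)
  -- The smooth identity for `f φₙ²`, expanded by the product rule; its integrand vanishes off the
  -- support of the current.
  have hzero : ∀ n, ∫ z in K ×ˢ univ, c₁ z * (φ n z * φ n z) ∂((riemannianVolume d X).prod lam) +
      ∫ z in K ×ˢ univ, c₂ z * (φ n z * (gradX d (φ n) z (a.1 z.1) +
        gradM l G (φ n) z (a.2 z.1))) ∂((riemannianVolume d X).prod lam) = 0 := by
    intro n
    rw [← integral_add (hi hc₁ hC₁ (hφm n) (hφm n)) (hi hc₂ hC₂ (hφm n) (hEm n)),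
      setIntegral_eq_integral_of_forall_compl_eq_zero]
    · have hφ1 := (hφ n).contMDiff_one
      have hF := hf.mul (hφ1.mul hφ1)
      have key := integral_cutoff_deriv h.map_smul h.contMDiff_density ha hF hχ hχc hL hχL
      refine Eq.trans (integral_congr_ae (Filter.Eventually.of_forall fun z => ?_)) key
      have e : pointDeriv a (fun z => f z * (φ n z * φ n z)) z = pointDeriv a f z * (φ n z * φ n z) +
          f z * (pointDeriv a (φ n) z * φ n z + φ n z * pointDeriv a (φ n) z) := by
        refine (pointDeriv_mul ha hf (g := fun z => φ n z * φ n z) (hφ1.mul hφ1) z).trans ?_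
        exact congrArg (fun y => pointDeriv a f z * (φ n z * φ n z) + f z * y)
          (pointDeriv_mul ha hφ1 hφ1 z)
      have fin : ∀ A B : ℝ, pointDeriv a (φ n) z = A →
          pointDeriv a (fun z => f z * (φ n z * φ n z)) z = B →
          c₁ z * (φ n z * φ n z) + c₂ z * (φ n z * A) = χ z.2 * (B +
            (f z * (φ n z * φ n z)) * logDerivReg p a z) +
            L z.2 (a.2 z.1) * (f z * (φ n z * φ n z)) := by
        rintro A B rfl rfl
        rw [e]
        simp only [c₁, c₂]
        ring
      exact fin _ _ (pointDeriv_eq ha hφ1 z) (pointDeriv_eq ha hF z)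
    · intro z hz
      have hzK : z.1 ∉ K := fun h' => hz ⟨h', mem_univ _⟩
      rw [hc₁K z hzK, apply_fst_eq_zero hzK, apply_snd_eq_zero hzK]
      ring
  have hlim := t₁.add t₂
  simp only [hzero] at hlim
  have h0 := tendsto_nhds_unique hlim tendsto_const_nhds
  rw [h.setIntegral_eq hK]
  rw [← integral_add (hi hc₁ hC₁ hS hS) (hi hc₂ hC₂ hS hE)] at h0
  refine Eq.trans (integral_congr_ae ?_) h0
  filter_upwards [h.sq_sqrt_ae K] with z hz
  have := hz.1.ne'
  simp only [c₁, c₂]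
  rw [logDeriv_eq_reg]
  field_simp
  ring

/-- Integration by parts for the Lévy measure. -/
theorem LevyDensity.integral_pointDeriv_add (h : LevyDensity k lam p q σ DX DM)
    {a : FieldPair d l X G} (ha : IsCurrent a) {f : X × M → ℝ}
    (hf : ContMDiff ((𝓡 d).prod (𝓡 k)) 𝓘(ℝ, ℝ) 1 f) (hfC : ∃ C, ∀ z, |f z| ≤ C)
    (hfD : ∃ C, ∀ z, |pointDeriv a f z| ≤ C) :
    Integrable (pointDeriv a f) σ ∧ Integrable (fun z => f z * logDeriv q DX DM p a z) σ ∧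
    ∫ z, (pointDeriv a f z + f z * logDeriv q DX DM p a z) ∂σ = 0 := by
  obtain ⟨C, hC⟩ := hfC
  obtain ⟨C', hC'⟩ := hfD
  have hK := ha.isCompact_currentSupport
  have := continuous_smul_of_contMDiffSMul (k := k) (M := M) l (G := G)
  have : LocallyCompactSpace M := ChartedSpace.locallyCompactSpace (Eu k) M
  obtain ⟨χ, L, Cχ, CL, hχ, hχc, hL, hχL, hχC, hCL, hLC, hχt, hLt⟩ :=
    exists_mark_cutoffs (l := l) (G := G) (M := M)
  have hcut := fun j => h.integral_cutoff ha hf hC (hχC j) (hχ j) (hχc j) (hL j) (hχL j)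
  set K := currentSupport a
  have : IsFiniteMeasure (σ.restrict (K ×ˢ univ)) :=
    ⟨by rw [Measure.restrict_apply_univ]; exact h.finite K hK⟩
  have hu : Continuous (fun x => (show Eu l from a.2 x)) := ha.smooth_snd.continuous
  have hD : Continuous (pointDeriv a f) :=
    (contMDiff_pointDeriv (n := 0) (m := 1) (by simp) ha hf).continuous
  have hDi : IntegrableOn (pointDeriv a f) (K ×ˢ univ) σ :=
    Integrable.of_bound hD.aestronglyMeasurable C' (Filter.Eventually.of_forall hC')
  have hβi : Integrable (fun z => f z * logDeriv q DX DM p a z) σ :=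
    (h.integrable_logDeriv ha).bdd_mul hf.continuous.aestronglyMeasurable
      (Filter.Eventually.of_forall hC)
  have hD0 : ∀ z : X × M, z ∉ K ×ˢ (univ : Set M) → pointDeriv a f z = 0 := fun z hz =>
    pointDeriv_eq_zero_of_notMem ha hf fun h' => hz ⟨h', mem_univ _⟩
  refine ⟨(integrableOn_iff_integrable_of_support_subset fun z hz =>
    by_contra fun h' => hz (hD0 z h')).1 hDi, hβi, ?_⟩
  rw [← setIntegral_eq_integral_of_forall_compl_eq_zero (s := K ×ˢ univ) fun z hz => by
    rw [hD0 z hz, logDeriv_eq_zero_of_notMem fun h' => hz ⟨h', mem_univ _⟩, mul_zero, add_zero]]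
  -- The bound `CL(u(x))` on the derivatives of the cutoffs is uniform for positions in the compact
  -- set `K`.
  obtain ⟨B, hB⟩ := (hK.image (hCL.comp hu)).isBounded.exists_norm_le
  -- The cutoffs are removed by dominated convergence: `β` is `σ`-integrable, and constants are
  -- integrable because `σ(K × M) < ∞`.
  have hlim : Filter.Tendsto (fun j => ∫ z in K ×ˢ univ,
      (χ j z.2 * (pointDeriv a f z + f z * logDeriv q DX DM p a z) + L j z.2 (a.2 z.1) * f z) ∂σ)
      Filter.atTop (𝓝 (∫ z in K ×ˢ univ, (1 * (pointDeriv a f z +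
        f z * logDeriv q DX DM p a z) + 0 * f z) ∂σ)) := by
    refine tendsto_integral_of_dominated_convergence
      (fun z => Cχ * |pointDeriv a f z + f z * logDeriv q DX DM p a z| + B * C)
      (fun j => ?_) ?_ (fun j => ?_) (Filter.Eventually.of_forall fun z => ?_)
    · refine AEStronglyMeasurable.add (AEStronglyMeasurable.mul
        ((hχ j).comp continuous_snd).aestronglyMeasurable
        (hD.aestronglyMeasurable.add hβi.integrableOn.1)) ?_
      exact (((hL j).comp (continuous_snd.prodMk (hu.comp continuous_fst))).mul
        hf.continuous).aestronglyMeasurable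
    · exact ((hDi.add hβi.integrableOn).abs.const_mul Cχ).add (integrable_const _)
    · rw [ae_restrict_iff' (hK.measurableSet.prod MeasurableSet.univ)]
      refine Filter.Eventually.of_forall fun z hz => ?_
      have hb : CL (show Eu l from a.2 z.1) ≤ B :=
        (le_abs_self _).trans (hB _ ⟨z.1, hz.1, rfl⟩)
      have hl : |L j z.2 (show Eu l from a.2 z.1)| ≤ B := (hLC j z.2 _).trans hb
      refine (norm_add_le _ _).trans (add_le_add ?_ ?_)
      · rw [norm_mul]
        exact mul_le_mul_of_nonneg_right (hχC j z.2) (norm_nonneg _)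
      · rw [norm_mul]
        exact mul_le_mul hl (hC z) (abs_nonneg _) ((abs_nonneg _).trans hl)
    · exact ((hχt z.2).mul_const _).add ((hLt z.2 (a.2 z.1)).mul_const _)
  simp only [hcut, one_mul, zero_mul, add_zero] at hlim
  exact (tendsto_nhds_unique hlim tendsto_const_nhds)

end OnePoint

/-! ### Pairings of functions with configurations -/

section Pairing

variable {X M : Type*} [TopologicalSpace X]

theorem Conf.finite_inter (ζ : Conf X M) {K : Set X} (hK : IsCompact K) :
    (ζ.1 ∩ K ×ˢ univ).Finite := by
  refine Set.Finite.of_finite_image ((ζ.2.2 K hK).subset ?_) (ζ.2.1.mono inter_subset_left)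
  rintro _ ⟨z, hz, rfl⟩
  exact ⟨⟨z, hz.1, rfl⟩, hz.2.1⟩

/-- The points of a configuration with position in a compact set. -/
def Conf.points (ζ : Conf X M) {K : Set X} (hK : IsCompact K) : Finset (X × M) :=
  (ζ.finite_inter hK).toFinset

theorem Conf.mem_points {ζ : Conf X M} {K : Set X} {hK : IsCompact K} {z : X × M} :
    z ∈ ζ.points hK ↔ z ∈ ζ.1 ∧ z.1 ∈ K := by
  simp [Conf.points]

/-- The finite index set depends only on the compact set, so pairings of several functions can be
compared and added termwise. -/
theorem pairing_eq_sum {f : X × M → ℝ} {K : Set X} (hK : IsCompact K)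
    (hf : ∀ z, f z ≠ 0 → z.1 ∈ K) (ζ : Conf X M) : pairing f ζ = ∑ z ∈ ζ.points hK, f z := by
  refine finsum_mem_eq_sum_of_inter_support_eq f ?_
  ext z
  simp only [mem_inter_iff, Function.mem_support, Finset.mem_coe, Conf.mem_points]
  exact ⟨fun h => ⟨⟨h.1, hf z h.2⟩, h.2⟩, fun h => ⟨h.1.1, h.2⟩⟩

/-- `f` vanishes outside `K × M` for a compact set `K`. -/
def CompactPos (f : X × M → ℝ) : Prop := ∃ K : Set X, IsCompact K ∧ ∀ z, f z ≠ 0 → z.1 ∈ K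

theorem CompactPos.exists_common {ι : Type*} [Finite ι] {f : ι → X × M → ℝ}
    (hf : ∀ i, CompactPos (f i)) :
    ∃ K : Set X, IsCompact K ∧ ∀ i z, f i z ≠ 0 → z.1 ∈ K := by
  choose K hK h using hf
  exact ⟨⋃ i, K i, isCompact_iUnion hK, fun i z hz => mem_iUnion.2 ⟨i, h i z hz⟩⟩

theorem pairing_smul_add {f g : X × M → ℝ} (hf : CompactPos f) (hg : CompactPos g) (r : ℝ)
    (ζ : Conf X M) :
    pairing (fun z => r * f z + g z) ζ = r * pairing f ζ + pairing g ζ := by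
  obtain ⟨K₁, hK₁, h₁⟩ := hf
  obtain ⟨K₂, hK₂, h₂⟩ := hg
  have hK := hK₁.union hK₂
  rw [pairing_eq_sum hK (fun z hz => Or.inl (h₁ z hz)),
    pairing_eq_sum hK (fun z hz => Or.inr (h₂ z hz)), pairing_eq_sum hK, Finset.sum_add_distrib,
    Finset.mul_sum]
  intro z hz
  by_contra h
  refine hz ?_
  have e1 : f z = 0 := by_contra fun h' => h (Or.inl (h₁ z h'))
  have e2 : g z = 0 := by_contra fun h' => h (Or.inr (h₂ z h'))
  simp [e1, e2]

theorem pairing_restrict {f : X × M → ℝ} {Λ : Set X} (hf : ∀ z, f z ≠ 0 → z.1 ∈ Λ)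
    (ζ : Conf X M) : pairing f (ζ.restrict Λ) = pairing f ζ := by
  refine finsum_mem_inter_support_eq f _ _ ?_
  ext z
  simp only [Conf.restrict, mem_inter_iff, Function.mem_support]
  exact ⟨fun h => ⟨h.1.1, h.2⟩, fun h => ⟨⟨h.1, hf z h.2, mem_univ _⟩, h.2⟩⟩

theorem Conf.ofTuple_val {n : ℕ} {z : Fin n → X × M}
    (hz : Function.Injective fun i => (z i).1) : (Conf.ofTuple z).1 = range z :=
  congrArg Subtype.val (dif_pos hz)

theorem Conf.ofTuple_val_of_not_injective {n : ℕ} {z : Fin n → X × M}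
    (hz : ¬Function.Injective fun i => (z i).1) : (Conf.ofTuple z).1 = ∅ :=
  congrArg Subtype.val (dif_neg hz)

theorem Conf.image_val {f : X × M → X × M} {ζ : Conf X M} (h : IsConf (f '' ζ.1)) :
    (ζ.image f).1 = f '' ζ.1 :=
  congrArg Subtype.val (dif_pos h)

theorem pairing_ofTuple {n : ℕ} {z : Fin n → X × M}
    (hz : Function.Injective fun i => (z i).1) (f : X × M → ℝ) :
    pairing f (Conf.ofTuple z) = ∑ i, f (z i) := by
  rw [pairing, Conf.ofTuple_val hz, finsum_mem_range (fun i j hij => hz (congrArg _ hij)),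
    finsum_eq_sum_of_fintype]

end Pairing

/-! ### Transport of configurations along currents -/

section Transport

variable {d k l : ℕ} {X : Type*} [TopologicalSpace X] [T2Space X]
  [ChartedSpace (Eu d) X] [IsManifold (𝓡 d) ∞ X]
  {M : Type*} [TopologicalSpace M]
  {G : Type*} [TopologicalSpace G] [T2Space G]
  [ChartedSpace (Eu l) G] [Group G] [LieGroup (𝓡 l) ∞ G]
  [MulAction G M]

/-- Positions where `v` vanishes are fixed by the flow, so only the support of `v` can feed points
into `K`. -/
theorem currentMap_fst_mem {a : FieldPair d l X G} (ha : IsCurrent a) {K : Set X} {t : ℝ}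
    {z : X × M} (h : (currentMap a t z).1 ∈ K) : z.1 ∈ closure {x | a.1 x ≠ 0} ∪ K := by
  by_contra h'
  have hz : a.1 z.1 = 0 := eq_zero_of_notMem_closure fun h'' => h' (Or.inl h'')
  refine h' (Or.inr ?_)
  have e := flow_of_eq_zero (ha.smooth_fst.of_le (by simp)) ha.compact_fst hz t
  rw [← e]
  exact h

/-- The flow is injective on positions and moves only points over a compact set. Hence `Conf.image`
always takes its first alternative here. -/
theorem isConf_image_currentMap {a : FieldPair d l X G} (ha : IsCurrent a) (t : ℝ)
    (ζ : Conf X M) : IsConf (currentMap a t '' ζ.1) := by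
  have hinj := flow_injective (ha.smooth_fst.of_le (by simp)) ha.compact_fst t
  refine ⟨?_, fun K hK => ?_⟩
  · rintro _ ⟨z, hz, rfl⟩ _ ⟨z', hz', rfl⟩ h
    exact congrArg _ (ζ.2.1 hz hz' (hinj h))
  · refine ((ζ.finite_inter (ha.compact_fst.union hK)).image
      fun z => (currentMap a t z).1).subset ?_
    rintro _ ⟨⟨_, ⟨z, hz, rfl⟩, rfl⟩, hzK⟩
    exact ⟨z, ⟨hz, currentMap_fst_mem ha hzK, mem_univ _⟩, rfl⟩

theorem pairing_image {a : FieldPair d l X G} (ha : IsCurrent a) (t : ℝ)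
    (ζ : Conf X M) (f : X × M → ℝ) :
    pairing f (ζ.image (currentMap a t)) = pairing (fun z => f (currentMap a t z)) ζ := by
  have hinj := flow_injective (ha.smooth_fst.of_le (by simp)) ha.compact_fst t
  rw [pairing, Conf.image_val (isConf_image_currentMap ha t ζ), finsum_mem_image]
  · rfl
  · intro z hz z' hz' h
    exact ζ.2.1 hz hz' (hinj (congrArg Prod.fst h))

theorem Conf.image_zero {a : FieldPair d l X G} (ha : IsCurrent a) (ζ : Conf X M) :
    ζ.image (currentMap a 0) = ζ := by
  refine Subtype.ext ?_
  rw [Conf.image_val (isConf_image_currentMap ha 0 ζ), show currentMap a 0 = (id : X × M → X × M) from funext fun z => currentMap_zero ha z,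
    image_id]

variable [ChartedSpace (Eu k) M] [IsManifold (𝓡 k) ∞ M] [ContMDiffSMul (𝓡 l) (𝓡 k) ∞ G M]

theorem CompactPos.pointDeriv {a : FieldPair d l X G} (ha : IsCurrent a) {f : X × M → ℝ}
    (hf : ContMDiff ((𝓡 d).prod (𝓡 k)) 𝓘(ℝ, ℝ) 1 f) (hfc : CompactPos f) :
    CompactPos (pointDeriv a f) := by
  obtain ⟨K, hK, h⟩ := hfc
  refine ⟨K, hK, fun z hz => by_contra fun hzK => hz (pointDeriv_eq_zero ha hf ?_)⟩
  filter_upwards [continuous_fst.continuousAt.preimage_mem_nhds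
    (hK.isClosed.isOpen_compl.mem_nhds hzK)] with z' hz'
  exact by_contra fun h' => hz' (h z' h')

/-- The points over the support of `v`, the support of `f` and that of its derivative form one
finite set that serves for all `t`, so a finite sum is differentiated. -/
theorem hasDerivAt_pairing_image {a : FieldPair d l X G} (ha : IsCurrent a) {f : X × M → ℝ}
    (hf : ContMDiff ((𝓡 d).prod (𝓡 k)) 𝓘(ℝ, ℝ) 1 f) (hfc : CompactPos f) (ζ : Conf X M) :
    HasDerivAt (fun t : ℝ => pairing f (ζ.image (currentMap a t)))
      (pairing (pointDeriv a f) ζ) 0 := by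
  have hfc' := hfc.pointDeriv ha hf
  obtain ⟨K, hK, h⟩ := hfc
  obtain ⟨K', hK', h'⟩ := hfc'
  have hC := (ha.compact_fst.union hK).union hK'
  rw [pairing_eq_sum hC fun z hz => Or.inr (h' z hz)]
  have e : (fun t : ℝ => pairing f (ζ.image (currentMap a t))) =
      fun t => ∑ z ∈ ζ.points hC, f (currentMap a t z) := by
    funext t
    rw [pairing_image ha, pairing_eq_sum hC]
    exact fun z hz => Or.inl (currentMap_fst_mem ha (h _ hz))
  rw [e]
  refine HasDerivAt.fun_sum fun z _ => ?_
  exact (hasDerivAt_currentMap ha hf z).differentiableAt.hasDerivAt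

theorem IsTest.compactPos {φ : X × M → ℝ} (hφ : IsTest d k l X M G φ) : CompactPos φ := hφ.support

variable {E : Type*} [NormedAddCommGroup E] [NormedSpace ℝ E]

/-- The derivative of a smooth function of finitely many pairings along a current. -/
theorem hasDerivAt_comp_pairing {ι : Type*} [Fintype ι] {a : FieldPair d l X G} (ha : IsCurrent a)
    {g : (ι → ℝ) → E} {φ : ι → X × M → ℝ}
    (hφ : ∀ j, ContMDiff ((𝓡 d).prod (𝓡 k)) 𝓘(ℝ, ℝ) 1 (φ j)) (hφc : ∀ j, CompactPos (φ j))
    (ζ : Conf X M) (hg : DifferentiableAt ℝ g fun j => pairing (φ j) ζ) :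
    HasDerivAt (fun t : ℝ => g fun j => pairing (φ j) (ζ.image (currentMap a t)))
      (fderiv ℝ g (fun j => pairing (φ j) ζ) fun j => pairing (pointDeriv a (φ j)) ζ) 0 := by
  have h1 : HasDerivAt (fun (t : ℝ) j => pairing (φ j) (ζ.image (currentMap a t)))
      (fun j => pairing (pointDeriv a (φ j)) ζ) 0 :=
    hasDerivAt_pi.2 fun j => hasDerivAt_pairing_image ha (hφ j) (hφc j) ζ
  refine HasFDerivAt.comp_hasDerivAt (0 : ℝ) ?_ h1
  rw [Conf.image_zero ha]
  exact hg.hasFDerivAt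

end Transport

/-! ### Measurability on the configuration space -/

section ConfMeasurability

variable {X M : Type*} [TopologicalSpace X] [T2Space X] [SecondCountableTopology X]
  [MeasurableSpace X] [BorelSpace X] [MeasurableSpace M]

theorem pairing_indicator {B : Set (X × M)} {K : Set X} (hK : IsCompact K)
    (hB : B ⊆ K ×ˢ univ) (ζ : Conf X M) :
    pairing (B.indicator 1) ζ = (ζ.1 ∩ B).ncard := by
  classical
  have h0 : ∀ z, B.indicator (1 : X × M → ℝ) z ≠ 0 → z.1 ∈ K := fun z hz =>
    (hB (mem_of_indicator_ne_zero hz)).1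
  rw [pairing_eq_sum hK h0]
  have e : ζ.1 ∩ B = ((ζ.points hK).filter fun z => z ∈ B : Finset (X × M)) := by
    ext z
    simp only [mem_inter_iff, Finset.coe_filter, mem_ofPred_eq, Conf.mem_points]
    exact ⟨fun h => ⟨⟨h.1, (hB h.2).1⟩, h.2⟩, fun h => ⟨h.1.1, h.2⟩⟩
  rw [e, ncard_coe_finset, Finset.card_filter]
  push_cast
  exact Finset.sum_congr rfl fun z _ => by simp [indicator_apply]

theorem measurable_pairing_indicator {B : Set (X × M)} (hB : MeasurableSet B) {K : Set X}
    (hK : IsCompact K) (hBK : B ⊆ K ×ˢ univ) :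
    Measurable (pairing (B.indicator 1) : Conf X M → ℝ) := by
  have h1 : Measurable (fun ζ : Conf X M => (ζ.1 ∩ B).ncard) :=
    measurable_to_countable' fun n =>
      MeasurableSpace.measurableSet_generateFrom ⟨B, n, hB, ⟨K, hK, hBK⟩, rfl⟩
  rw [funext (pairing_indicator hK hBK)]
  exact measurable_from_nat.comp h1

/-- For simple functions supported over `K` the pairing is a combination of counting functions; the
general case is a pointwise limit, each configuration having finitely many points over `K`. -/
theorem measurable_pairing {f : X × M → ℝ} (hf : Measurable f) (hc : CompactPos f) :
    Measurable (pairing f : Conf X M → ℝ) := by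
  obtain ⟨K, hK, h⟩ := hc
  have hKm : MeasurableSet (K ×ˢ (univ : Set M)) := hK.measurableSet.prod MeasurableSet.univ
  let s : ℕ → SimpleFunc (X × M) ℝ := fun n => hf.stronglyMeasurable.approx n
  have hs : ∀ z, Filter.Tendsto (fun n => s n z) Filter.atTop (𝓝 (f z)) :=
    hf.stronglyMeasurable.tendsto_approx
  refine measurable_of_tendsto_metrizable (f := fun n ζ => ∑ y ∈ (s n).range,
    y * pairing ((s n ⁻¹' {y} ∩ K ×ˢ univ).indicator 1) ζ) (fun n => ?_)
    (tendsto_pi_nhds.2 fun ζ => ?_)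
  · exact Finset.measurable_sum _ fun y _ => (measurable_pairing_indicator
      (((s n).measurableSet_fiber y).inter hKm) hK inter_subset_right).const_mul y
  · rw [pairing_eq_sum hK h]
    have e : ∀ n, ∑ y ∈ (s n).range, y * pairing ((s n ⁻¹' {y} ∩ K ×ˢ univ).indicator 1) ζ =
        ∑ z ∈ ζ.points hK, s n z := by
      intro n
      have e1 : ∀ y, pairing ((s n ⁻¹' {y} ∩ K ×ˢ univ).indicator 1) ζ =
          ∑ z ∈ ζ.points hK, (s n ⁻¹' {y} ∩ K ×ˢ univ).indicator (1 : X × M → ℝ) z := fun y =>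
        pairing_eq_sum hK (fun z hz => (mem_of_indicator_ne_zero hz).2.1) ζ
      simp only [e1, Finset.mul_sum]
      rw [Finset.sum_comm]
      refine Finset.sum_congr rfl fun z hz => ?_
      rw [Finset.sum_eq_single (s n z)]
      · rw [indicator_of_mem (show z ∈ s n ⁻¹' {s n z} ∩ K ×ˢ univ from
          ⟨rfl, (Conf.mem_points.1 hz).2, mem_univ _⟩)]
        simp
      · intro y _ hy
        rw [indicator_of_notMem fun h' => hy h'.1.symm, mul_zero]
      · intro h'
        exact absurd ((s n).mem_range_self z) h'
    simp only [e]
    exact tendsto_finsetSum _ fun z _ => hs z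

theorem measurable_restrict {Λ : Set X} (hΛ : IsOpen Λ) :
    Measurable (Conf.restrict Λ : Conf X M → Conf X M) := by
  refine measurable_generateFrom ?_
  rintro _ ⟨B, n, hB, ⟨K, hK, hBK⟩, rfl⟩
  refine MeasurableSpace.measurableSet_generateFrom ⟨Λ ×ˢ univ ∩ B, n,
    (hΛ.measurableSet.prod MeasurableSet.univ).inter hB, ⟨K, hK, inter_subset_right.trans hBK⟩, ?_⟩
  ext ζ
  change (ζ.1 ∩ Λ ×ˢ univ ∩ B).ncard = n ↔ (ζ.1 ∩ (Λ ×ˢ univ ∩ B)).ncard = n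
  rw [inter_assoc]

theorem measurableSet_injective_fst (n : ℕ) :
    MeasurableSet {z : Fin n → X × M | Function.Injective fun i => (z i).1} := by
  have e : {z : Fin n → X × M | Function.Injective fun i => (z i).1} =
      ⋂ (i) (j) (_ : i ≠ j), {z : Fin n → X × M | (z i).1 ≠ (z j).1} := by
    ext z
    simp only [mem_ofPred_eq, mem_iInter]
    exact ⟨fun h i j hij h' => hij (h h'), fun h i j h' => by_contra fun hij => h i j hij h'⟩
  rw [e]
  refine MeasurableSet.iInter fun i => MeasurableSet.iInter fun j => MeasurableSet.iInter fun _ => ?_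
  have h1 : Measurable (fun z : Fin n → X × M => ((z i).1, (z j).1)) :=
    (measurable_fst.comp (measurable_pi_apply i)).prodMk
      (measurable_fst.comp (measurable_pi_apply j))
  exact (h1 isClosed_diagonal.measurableSet).compl

theorem measurable_ofTuple (n : ℕ) :
    Measurable (Conf.ofTuple : (Fin n → X × M) → Conf X M) := by
  classical
  refine measurable_generateFrom ?_
  rintro _ ⟨B, m, hB, ⟨K, hK, hBK⟩, rfl⟩
  have h1 : Measurable (fun z : Fin n → X × M => if Function.Injective (fun i => (z i).1) then
      ∑ i, B.indicator (1 : X × M → ℝ) (z i) else 0) := by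
    refine Measurable.ite (measurableSet_injective_fst n) ?_ measurable_const
    exact Finset.measurable_sum _ fun i _ =>
      (measurable_one.indicator hB).comp (measurable_pi_apply i)
  have e : Conf.ofTuple ⁻¹' {ζ : Conf X M | (ζ.1 ∩ B).ncard = m} = {z : Fin n → X × M |
      (if Function.Injective (fun i => (z i).1) then
        ∑ i, B.indicator (1 : X × M → ℝ) (z i) else 0) = (m : ℝ)} := by
    ext z
    change ((Conf.ofTuple z).1 ∩ B).ncard = m ↔ _ = (m : ℝ)
    rw [← Nat.cast_inj (R := ℝ), ← pairing_indicator hK hBK]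
    by_cases hz : Function.Injective fun i => (z i).1
    · rw [if_pos hz, pairing_ofTuple hz]
    · rw [if_neg hz, pairing, Conf.ofTuple_val_of_not_injective hz, finsum_mem_empty]
  rw [e]
  exact h1 (measurableSet_singleton _)

/-- Almost all tuples have pairwise distinct positions. -/
theorem ae_injective_fst {ρ : Measure (X × M)} [SigmaFinite ρ] (h0 : ∀ x, ρ ({x} ×ˢ univ) = 0)
    (n : ℕ) : ∀ᵐ z ∂(Measure.pi fun _ : Fin n => ρ), Function.Injective fun i => (z i).1 := by
  have key : ∀ i j : Fin n, i ≠ j →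
      ∀ᵐ z ∂(Measure.pi fun _ : Fin n => ρ), (z i).1 ≠ (z j).1 := by
    intro i j hij
    cases n with
    | zero => exact i.elim0
    | succ n =>
      obtain ⟨j', rfl⟩ := Fin.exists_succAbove_eq (Ne.symm hij)
      have hm := measurePreserving_piFinSuccAbove (fun _ : Fin (n + 1) => ρ) i
      -- The `i`-th variable is split off; with the others fixed, coincidence with position `j`
      -- confines it to one fibre over `X`, a null set.
      have h2 : ∀ᵐ w ∂(ρ.prod (Measure.pi fun _ : Fin n => ρ)), w.1.1 ≠ (w.2 j').1 := by
        have hmeas : MeasurableSet {w : (X × M) × (Fin n → X × M) | w.1.1 ≠ (w.2 j').1} := by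
          have h1 : Measurable (fun w : (X × M) × (Fin n → X × M) => (w.1.1, (w.2 j').1)) :=
            (measurable_fst.comp measurable_fst).prodMk
              (measurable_fst.comp ((measurable_pi_apply j').comp measurable_snd))
          exact (h1 isClosed_diagonal.measurableSet).compl
        rw [ae_iff, show {w : (X × M) × (Fin n → X × M) | ¬w.1.1 ≠ (w.2 j').1} =
          {w | w.1.1 ≠ (w.2 j').1}ᶜ from rfl, Measure.prod_apply_symm hmeas.compl]
        refine lintegral_eq_zero_of_ae_eq_zero (Filter.Eventually.of_forall fun y => ?_)
        refine measure_mono_null (fun w hw => ?_) (h0 (y j').1)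
        have : w.1 = (y j').1 := by simpa using hw
        exact ⟨this, mem_univ _⟩
      exact hm.quasiMeasurePreserving.ae h2
  have h2 : ∀ᵐ z ∂(Measure.pi fun _ : Fin n => ρ), ∀ i j, i ≠ j → (z i).1 ≠ (z j).1 :=
    ae_all_iff.2 fun i => ae_all_iff.2 fun j => by
      by_cases hij : i = j
      · exact Filter.Eventually.of_forall fun z h => absurd hij h
      · filter_upwards [key i j hij] with z hz _ using hz
  filter_upwards [h2] with z hz i j hij
  by_contra h
  exact hz i j h hij

end ConfMeasurability

/-! ### Integrals with respect to the marked Poisson measure -/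

section PoissonMeasure

variable {X M : Type*} [TopologicalSpace X] [T2Space X] [SecondCountableTopology X]
  [MeasurableSpace X] [BorelSpace X] [MeasurableSpace M]
  {σ : Measure (X × M)} {P : Measure (Conf X M)}

theorem IsMarkedPoisson.ae_restrict (hP : IsMarkedPoisson σ P) {Λ : Set X} (hΛ : IsOpen Λ)
    (hΛc : IsCompact (closure Λ)) {s : Set (Conf X M)} (hs : MeasurableSet s)
    (h : ∀ n : ℕ, ∀ᵐ z ∂(Measure.pi fun _ : Fin n => σ.restrict (Λ ×ˢ univ)), Conf.ofTuple z ∈ s) :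
    ∀ᵐ ζ ∂P, ζ.restrict Λ ∈ s := by
  refine ae_of_ae_map (measurable_restrict hΛ).aemeasurable ?_
  rw [hP.2 Λ hΛ hΛc]
  refine Measure.ae_smul_measure ?_ _
  refine Measure.ae_sum_iff.2 fun n => Measure.ae_smul_measure ?_ _
  exact (ae_map_iff (measurable_ofTuple n).aemeasurable hs).2 (h n)

variable {E : Type*} [NormedAddCommGroup E] [MeasurableSpace E] [BorelSpace E]

theorem IsMarkedPoisson.integrable_iff_sum [SecondCountableTopology E] (hP : IsMarkedPoisson σ P)
    {Λ : Set X} (hΛ : IsOpen Λ)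
    (hΛc : IsCompact (closure Λ)) {T : Conf X M → E} (hT : Measurable T)
    (hTΛ : ∀ ζ : Conf X M, T (ζ.restrict Λ) = T ζ) :
    Integrable T P ↔ Integrable T (Measure.sum (fun n : ℕ => ((n.factorial : ℝ≥0∞)⁻¹) •
          (Measure.pi (fun _ : Fin n => σ.restrict (Λ ×ˢ univ))).map Conf.ofTuple)) := by
  have h1 := integrable_map_measure (μ := P) (f := Conf.restrict Λ)
    (hT.stronglyMeasurable.aestronglyMeasurable (μ := P.map (Conf.restrict Λ)))
    (measurable_restrict hΛ).aemeasurable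
  rw [show T ∘ Conf.restrict Λ = T from funext hTΛ, hP.2 Λ hΛ hΛc] at h1
  rw [← h1]
  exact integrable_smul_measure (by simpa using Real.exp_pos _) ENNReal.ofReal_ne_top

/-- The `n`-point contributions are dominated by the terms `cⁿ / n!` of the exponential series. -/
theorem IsMarkedPoisson.integrable_of_bound [SecondCountableTopology E] (hP : IsMarkedPoisson σ P)
    {Λ : Set X} (hΛ : IsOpen Λ)
    (hΛc : IsCompact (closure Λ)) {T : Conf X M → E} (hT : Measurable T)
    (hTΛ : ∀ ζ : Conf X M, T (ζ.restrict Λ) = T ζ) {c : ℝ} (hc : 0 ≤ c)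
    (hb : ∀ n : ℕ, ∫⁻ z, ‖T (Conf.ofTuple z)‖ₑ
      ∂(Measure.pi fun _ : Fin n => σ.restrict (Λ ×ˢ univ)) ≤ ENNReal.ofReal (c ^ n)) :
    Integrable T P := by
  rw [hP.integrable_iff_sum hΛ hΛc hT hTΛ]
  refine ⟨hT.stronglyMeasurable.aestronglyMeasurable, ?_⟩
  rw [HasFiniteIntegral, lintegral_sum_measure]
  have h1 : ∀ n : ℕ, ∫⁻ ζ, ‖T ζ‖ₑ ∂(((n.factorial : ℝ≥0∞)⁻¹) •
      (Measure.pi (fun _ : Fin n => σ.restrict (Λ ×ˢ univ))).map Conf.ofTuple) ≤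
      ENNReal.ofReal (c ^ n / n.factorial) := by
    intro n
    rw [lintegral_smul_measure, lintegral_map hT.enorm (measurable_ofTuple n), smul_eq_mul,
      div_eq_inv_mul, ENNReal.ofReal_mul (by positivity), ENNReal.ofReal_inv_of_pos (by positivity),
      ENNReal.ofReal_natCast]
    gcongr
    exact hb n
  refine (ENNReal.tsum_le_tsum h1).trans_lt ?_
  rw [← ENNReal.ofReal_tsum_of_nonneg (fun n => by positivity) (Real.summable_pow_div_factorial c)]
  exact ENNReal.ofReal_lt_top

/-- A function of the configuration in `Λ × M` is integrated by summing its `n`-point integrals;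
integrability allows the summation term by term. -/
theorem IsMarkedPoisson.integral_eq_zero [NormedSpace ℝ E] [SecondCountableTopology E]
    (hP : IsMarkedPoisson σ P) {Λ : Set X} (hΛ : IsOpen Λ)
    (hΛc : IsCompact (closure Λ)) {T : Conf X M → E} (hT : Measurable T)
    (hTΛ : ∀ ζ : Conf X M, T (ζ.restrict Λ) = T ζ) (hi : Integrable T P)
    (h0 : ∀ n : ℕ, ∫ z, T (Conf.ofTuple z)
      ∂(Measure.pi fun _ : Fin n => σ.restrict (Λ ×ˢ univ)) = 0) :
    ∫ ζ, T ζ ∂P = 0 := by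
  have h1 := integral_map (μ := P) (φ := Conf.restrict Λ) (measurable_restrict hΛ).aemeasurable
    (hT.stronglyMeasurable.aestronglyMeasurable (μ := P.map (Conf.restrict Λ)))
  simp only [hTΛ] at h1
  rw [← h1, hP.2 Λ hΛ hΛc, integral_smul_measure]
  have h2 := hasSum_integral_measure ((hP.integrable_iff_sum hΛ hΛc hT hTΛ).1 hi)
  have h3 : ∀ n : ℕ, ∫ ζ, T ζ ∂(((n.factorial : ℝ≥0∞)⁻¹) •
      (Measure.pi (fun _ : Fin n => σ.restrict (Λ ×ˢ univ))).map Conf.ofTuple) = 0 := by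
    intro n
    rw [integral_smul_measure, integral_map (measurable_ofTuple n).aemeasurable
      hT.stronglyMeasurable.aestronglyMeasurable, h0, smul_zero]
  simp only [h3] at h2
  rw [h2.unique hasSum_zero, smul_zero]

/-- The measure `ρ` is not normalised: the `i`-th marginal of the product carries the factor
`ρ(univ)^(n-1)`, and `c` bounds all `n` factors. -/
theorem lintegral_pi_eval {n : ℕ} {ρ : Measure (X × M)} [IsFiniteMeasure ρ] (i : Fin n)
    {f : X × M → ℝ≥0∞} (hf : Measurable f) {c : ℝ≥0∞} (hρ : ρ univ ≤ c)
    (hfc : ∫⁻ w, f w ∂ρ ≤ c) :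
    ∫⁻ z, f (z i) ∂(Measure.pi fun _ : Fin n => ρ) ≤ c ^ n := by
  classical
  have e := lintegral_map (μ := Measure.pi fun _ : Fin n => ρ) hf (measurable_pi_apply i)
  rw [Measure.pi_map_eval, lintegral_smul_measure, Finset.prod_const,
    Finset.card_erase_of_mem (Finset.mem_univ i), Finset.card_univ, Fintype.card_fin] at e
  rw [← e, smul_eq_mul]
  have hn : n - 1 + 1 = n := Nat.sub_add_cancel i.pos
  calc ρ univ ^ (n - 1) * ∫⁻ w, f w ∂ρ ≤ c ^ (n - 1) * c := by gcongr
    _ = c ^ n := by rw [← pow_succ, hn]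

theorem one_add_le_two_pow (n : ℕ) : (1 + n : ℝ) ≤ 2 ^ n := by
  exact_mod_cast (add_comm 1 n ▸ Nat.lt_two_pow_self : 1 + n ≤ 2 ^ n)

/-- Integrability of functions of polynomial growth in the number of points. -/
theorem IsMarkedPoisson.integrable_growth [LocallyCompactSpace X] (hP : IsMarkedPoisson σ P)
    (hfin : ∀ K : Set X, IsCompact K → σ (K ×ˢ univ) < ⊤) {K : Set X} (hK : IsCompact K)
    {b : X × M → ℝ} (hb : Measurable b) (hb0 : ∀ z, 0 ≤ b z) (hbK : ∀ z, b z ≠ 0 → z.1 ∈ K)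
    (hbi : Integrable b σ) (p : ℕ) :
    Integrable (fun ζ : Conf X M =>
      (1 + pairing ((K ×ˢ univ : Set (X × M)).indicator 1) ζ) ^ p * (1 + pairing b ζ)) P := by
  obtain ⟨L, hL, hKL⟩ := exists_compact_superset hK
  set Λ := interior L
  have hΛ : IsOpen Λ := isOpen_interior
  have hΛc : IsCompact (closure Λ) :=
    hL.of_isClosed_subset isClosed_closure (closure_minimal interior_subset hL.isClosed)
  have hKm : MeasurableSet (K ×ˢ (univ : Set M)) := hK.measurableSet.prod MeasurableSet.univ
  have h1K : ∀ z, (K ×ˢ univ : Set (X × M)).indicator (1 : X × M → ℝ) z ≠ 0 → z.1 ∈ K :=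
    fun z hz => (mem_of_indicator_ne_zero hz).1
  have h1m : Measurable ((K ×ˢ univ : Set (X × M)).indicator (1 : X × M → ℝ)) :=
    measurable_one.indicator hKm
  set ρ := σ.restrict (Λ ×ˢ univ)
  have hρ : IsFiniteMeasure ρ := ⟨by
    rw [Measure.restrict_apply_univ]
    exact (measure_mono (prod_mono_left interior_subset)).trans_lt (hfin L hL)⟩
  let c : ℝ≥0∞ := max 1 (max (ρ univ) (∫⁻ w, ENNReal.ofReal (b w) ∂ρ))
  have hct : c ≠ ⊤ := by
    refine max_ne_top ENNReal.one_ne_top (max_ne_top (measure_ne_top _ _) ?_)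
    exact (hbi.restrict (s := Λ ×ˢ univ)).lintegral_lt_top.ne
  -- The `n`-point integral is at most `(1 + n)^(p+1) cⁿ`, with one factor `1 + n` from the sum over
  -- the points in `⟨b, ω⟩`; and `1 + n ≤ 2ⁿ`.
  refine hP.integrable_of_bound hΛ hΛc (c := 2 ^ (p + 1) * c.toReal) ?_ ?_ (by positivity) ?_
  · exact (((measurable_pairing h1m ⟨K, hK, h1K⟩).const_add 1).pow_const p).mul
      ((measurable_pairing hb ⟨K, hK, hbK⟩).const_add 1)
  · intro ζ
    rw [pairing_restrict fun z hz => hKL (h1K z hz), pairing_restrict fun z hz => hKL (hbK z hz)]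
  · intro n
    have hpt : ∀ z : Fin n → X × M,
        ‖(1 + pairing ((K ×ˢ univ : Set (X × M)).indicator 1) (Conf.ofTuple z)) ^ p *
          (1 + pairing b (Conf.ofTuple z))‖ₑ ≤
        ENNReal.ofReal ((1 + n) ^ p) * (1 + ∑ i, ENNReal.ofReal (b (z i))) := by
      intro z
      have hs : 0 ≤ ∑ i, b (z i) := Finset.sum_nonneg fun i _ => hb0 _
      rw [← ENNReal.ofReal_sum_of_nonneg fun i _ => hb0 _, ← ENNReal.ofReal_one,
        ← ENNReal.ofReal_add zero_le_one hs, ← ENNReal.ofReal_mul (by positivity)]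
      by_cases hz : Function.Injective fun i => (z i).1
      · rw [pairing_ofTuple hz, pairing_ofTuple hz]
        have h2 : 0 ≤ ∑ i, (K ×ˢ univ : Set (X × M)).indicator (1 : X × M → ℝ) (z i) :=
          Finset.sum_nonneg fun i _ => indicator_nonneg (fun _ _ => zero_le_one) _
        have h3 : ∑ i, (K ×ˢ univ : Set (X × M)).indicator (1 : X × M → ℝ) (z i) ≤ n := by
          refine (Finset.sum_le_card_nsmul _ _ 1 fun i _ => ?_).trans (by simp)
          exact indicator_le_self' (fun _ _ => zero_le_one) _
        rw [Real.enorm_eq_ofReal (by positivity)]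
        gcongr
      · have e : ∀ f : X × M → ℝ, pairing f (Conf.ofTuple z) = 0 := fun f => by
          rw [pairing, Conf.ofTuple_val_of_not_injective hz, finsum_mem_empty]
        rw [e, e, Real.enorm_eq_ofReal (by positivity)]
        refine ENNReal.ofReal_le_ofReal ?_
        rw [add_zero, one_pow, one_mul]
        nlinarith [one_le_pow₀ (n := p) (show (1 : ℝ) ≤ 1 + n by simp)]
    refine (lintegral_mono hpt).trans ?_
    have hbe : Measurable (fun w => ENNReal.ofReal (b w)) := hb.ennreal_ofReal
    have hbe' : ∀ i : Fin n, Measurable fun z : Fin n → X × M => ENNReal.ofReal (b (z i)) :=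
      fun i => hbe.comp (measurable_pi_apply i)
    rw [lintegral_const_mul' _ _ ENNReal.ofReal_ne_top, lintegral_add_left measurable_const,
      lintegral_finsetSum _ fun i _ => hbe' i, lintegral_one,
      Measure.pi_univ, Finset.prod_const, Finset.card_univ, Fintype.card_fin]
    have h4 : ρ univ ^ n + ∑ i : Fin n, ∫⁻ z, ENNReal.ofReal (b (z i))
        ∂(Measure.pi fun _ : Fin n => ρ) ≤ ENNReal.ofReal (1 + n) * c ^ n := by
      have h5 : ∀ i : Fin n, ∫⁻ z, ENNReal.ofReal (b (z i)) ∂(Measure.pi fun _ : Fin n => ρ) ≤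
          c ^ n := fun i => lintegral_pi_eval i hbe
            ((le_max_left _ _).trans (le_max_right _ _))
            ((le_max_right _ _).trans (le_max_right _ _))
      have h6 : ρ univ ^ n ≤ c ^ n :=
        pow_le_pow_left₀ zero_le ((le_max_left _ _).trans (le_max_right _ _)) n
      rw [ENNReal.ofReal_add zero_le_one (by positivity), ENNReal.ofReal_one, add_mul, one_mul]
      refine add_le_add h6 ((Finset.sum_le_card_nsmul _ _ _ fun i _ => h5 i).trans ?_)
      simp
    refine (mul_le_mul_right h4 _).trans ?_
    rw [← mul_assoc, ← ENNReal.ofReal_mul (by positivity), mul_pow,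
      ENNReal.ofReal_mul (p := (2 ^ (p + 1)) ^ n) (by positivity),
      ENNReal.ofReal_pow ENNReal.toReal_nonneg, ENNReal.ofReal_toReal hct]
    refine mul_le_mul_left (ENNReal.ofReal_le_ofReal ?_) _
    rw [← pow_succ, ← pow_mul, mul_comm (p + 1) n, pow_mul]
    exact pow_le_pow_left₀ (by positivity) (one_add_le_two_pow n) _

end PoissonMeasure

/-! ### Functions of temperate growth -/

section TemperateGrowth

variable {E F : Type*} [NormedAddCommGroup E] [NormedSpace ℝ E] [NormedAddCommGroup F]
  [NormedSpace ℝ F] {g : E → F}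

theorem temperateGrowth_fderiv (hg : g.HasTemperateGrowth) : (fderiv ℝ g).HasTemperateGrowth := by
  refine ⟨hg.1.fderiv_right (by simp), fun n => ?_⟩
  obtain ⟨k, C, h⟩ := hg.2 (n + 1)
  exact ⟨k, C, fun x => by rw [norm_iteratedFDeriv_fderiv]; exact h x⟩

theorem temperateGrowth_bound (hg : g.HasTemperateGrowth) :
    ∃ (p : ℕ) (C : ℝ), 0 ≤ C ∧ ∀ x, ‖g x‖ ≤ C * (1 + ‖x‖) ^ p := by
  obtain ⟨p, C, h⟩ := hg.2 0
  simp only [norm_iteratedFDeriv_zero] at h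
  exact ⟨p, C, by simpa using (norm_nonneg _).trans (h 0), h⟩

theorem temperateGrowth_bound_of_le (hg : g.HasTemperateGrowth) (r : ℝ) :
    ∃ C : ℝ, ∀ x, ‖x‖ ≤ r → ‖g x‖ ≤ C := by
  obtain ⟨p, C, hC, h⟩ := temperateGrowth_bound hg
  refine ⟨C * (1 + r) ^ p, fun x hx => (h x).trans ?_⟩
  gcongr

end TemperateGrowth

/-! ### Integrability of polynomially growing functions of pairings -/

section Integrability

variable {X M : Type*} [TopologicalSpace X] [T2Space X] [SecondCountableTopology X]
  [LocallyCompactSpace X] [MeasurableSpace X] [BorelSpace X] [MeasurableSpace M]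
  {σ : Measure (X × M)} {P : Measure (Conf X M)}
  {E : Type*} [NormedAddCommGroup E] [NormedSpace ℝ E] [MeasurableSpace E] [BorelSpace E]
  [SecondCountableTopology E]

theorem abs_pairing_le {f g : X × M → ℝ} (hf : CompactPos f) (hg : CompactPos g)
    (h : ∀ z, |f z| ≤ g z) (ζ : Conf X M) : |pairing f ζ| ≤ pairing g ζ := by
  obtain ⟨K₁, hK₁, h₁⟩ := hf
  obtain ⟨K₂, hK₂, h₂⟩ := hg
  have hK := hK₁.union hK₂
  rw [pairing_eq_sum hK (fun z hz => Or.inl (h₁ z hz)),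
    pairing_eq_sum hK (fun z hz => Or.inr (h₂ z hz))]
  exact (Finset.abs_sum_le_sum_abs _ _).trans (Finset.sum_le_sum fun z _ => h z)

theorem measurable_comp_pairing {ι : Type*} [Fintype ι] {g : (ι → ℝ) → E} (hg : Continuous g)
    {φ : ι → X × M → ℝ} (hφ : ∀ j, Measurable (φ j)) (hφc : ∀ j, CompactPos (φ j)) :
    Measurable fun ζ : Conf X M => g fun j => pairing (φ j) ζ :=
  hg.measurable.comp (measurable_pi_lambda _ fun j => measurable_pairing (hφ j) (hφc j))

/-- Bounded functions supported over `K` have pairings at most `B'` times the number `N` of points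
over `K`. So everything is dominated by a multiple of `(1 + N)^p (1 + ⟨|b|, ω⟩)`. -/
theorem IsMarkedPoisson.integrable_comp_pairing (hP : IsMarkedPoisson σ P)
    (hfin : ∀ K : Set X, IsCompact K → σ (K ×ˢ univ) < ⊤) {ι : Type*} [Fintype ι]
    {g : (ι → ℝ) → E} (hg : g.HasTemperateGrowth) {φ : ι → X × M → ℝ}
    (hφ : ∀ j, Measurable (φ j)) (hφc : ∀ j, CompactPos (φ j)) (hφb : ∀ j, ∃ C, ∀ z, |φ j z| ≤ C)
    {b : X × M → ℝ} (hb : Measurable b) (hbc : CompactPos b) (hbi : Integrable b σ) :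
    Integrable (fun ζ : Conf X M => g fun j => pairing (φ j) ζ) P ∧
    Integrable (fun ζ : Conf X M => pairing b ζ • g fun j => pairing (φ j) ζ) P := by
  obtain ⟨p, C, hC, hgp⟩ := temperateGrowth_bound hg
  obtain ⟨K₁, hK₁, h₁⟩ := CompactPos.exists_common hφc
  obtain ⟨K₂, hK₂, h₂⟩ := hbc
  choose B hB using hφb
  set B' := ∑ j, |B j|
  have hB0 : 0 ≤ B' := Finset.sum_nonneg fun j _ => abs_nonneg _
  have hBB : ∀ j z, |φ j z| ≤ B' := fun j z => ((hB j z).trans (le_abs_self _)).trans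
    (Finset.single_le_sum (f := fun j => |B j|) (fun j _ => abs_nonneg _) (Finset.mem_univ j))
  set K := K₁ ∪ K₂
  have hK : IsCompact K := hK₁.union hK₂
  set e : X × M → ℝ := (K ×ˢ univ : Set (X × M)).indicator 1
  have he : ∀ z, e z ≠ 0 → z.1 ∈ K := fun z hz => (mem_of_indicator_ne_zero hz).1
  have habs : ∀ z, |b z| ≠ 0 → z.1 ∈ K := fun z hz => Or.inr (h₂ z (abs_ne_zero.1 hz))
  have hG := hP.integrable_growth hfin hK (b := fun z => |b z|) hb.abs (fun z => abs_nonneg _)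
    habs hbi.abs p
  have hN0 : ∀ ζ : Conf X M, 0 ≤ pairing e ζ := fun ζ => by
    rw [pairing_eq_sum hK he]
    exact Finset.sum_nonneg fun z _ => indicator_nonneg (fun _ _ => zero_le_one) z
  have hb0 : ∀ ζ : Conf X M, |pairing b ζ| ≤ pairing (fun z => |b z|) ζ := fun ζ =>
    abs_pairing_le ⟨K₂, hK₂, h₂⟩ ⟨K, hK, habs⟩ (fun z => le_rfl) ζ
  have hφN : ∀ (ζ : Conf X M) j, |pairing (φ j) ζ| ≤ B' * pairing e ζ := fun ζ j => by
    have e1 := pairing_smul_add (f := e) (g := 0) ⟨K, hK, he⟩ ⟨∅, isCompact_empty, by simp⟩ B' ζ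
    have e2 : pairing (0 : X × M → ℝ) ζ = 0 := by simp [pairing]
    rw [e2, add_zero] at e1
    rw [← e1]
    refine abs_pairing_le (hφc j) ⟨K, hK, fun z hz => he z fun h => hz ?_⟩ (fun z => ?_) ζ
    · simp [h]
    · by_cases hz : z.1 ∈ K
      · simpa [e, hz] using hBB j z
      · have : φ j z = 0 := by_contra fun h => hz (Or.inl (h₁ j z h))
        simp [e, hz, this]
  have hgN : ∀ ζ : Conf X M, ‖g fun j => pairing (φ j) ζ‖ ≤
      C * (1 + B') ^ p * (1 + pairing e ζ) ^ p := fun ζ => by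
    refine (hgp _).trans ?_
    rw [mul_assoc, ← mul_pow]
    have h1 : ‖fun j => pairing (φ j) ζ‖ ≤ B' * pairing e ζ :=
      (pi_norm_le_iff_of_nonneg (mul_nonneg hB0 (hN0 ζ))).2 fun j => hφN ζ j
    gcongr
    nlinarith [hN0 ζ]
  have hm := measurable_comp_pairing hg.1.continuous hφ hφc
  have hmb : Measurable fun ζ : Conf X M => pairing b ζ • g fun j => pairing (φ j) ζ :=
    (measurable_pairing hb ⟨K₂, hK₂, h₂⟩).smul hm
  have hG' := hG.const_mul (C * (1 + B') ^ p)
  have hA : ∀ ζ : Conf X M, 0 ≤ C * (1 + B') ^ p * (1 + pairing e ζ) ^ p := fun ζ => by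
    have := hN0 ζ
    positivity
  refine ⟨hG'.mono' hm.stronglyMeasurable.aestronglyMeasurable (.of_forall fun ζ => ?_),
    hG'.mono' hmb.stronglyMeasurable.aestronglyMeasurable (.of_forall fun ζ => ?_)⟩
  · rw [← mul_assoc]
    exact (hgN ζ).trans (le_mul_of_one_le_right (hA ζ)
      (by linarith [(abs_nonneg _).trans (hb0 ζ)]))
  · rw [norm_smul, ← mul_assoc, mul_comm, Real.norm_eq_abs]
    exact mul_le_mul (hgN ζ) (by linarith [hb0 ζ]) (abs_nonneg _) (hA ζ)

end Integrability

/-! ### Integration by parts on the configuration space -/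

section ConfIntegration

variable {d k l : ℕ} {X : Type*} [TopologicalSpace X] [T2Space X] [SecondCountableTopology X]
  [ChartedSpace (Eu d) X] [IsManifold (𝓡 d) ∞ X]
  [RiemannianBundle (fun x : X => TangentSpace (𝓡 d) x)]
  [IsContMDiffRiemannianBundle (𝓡 d) ∞ (Eu d) (fun x : X => TangentSpace (𝓡 d) x)]
  [MeasurableSpace X] [BorelSpace X]
  {M : Type*} [TopologicalSpace M] [T2Space M] [SecondCountableTopology M]
  [ChartedSpace (Eu k) M] [IsManifold (𝓡 k) ∞ M] [MeasurableSpace M] [BorelSpace M]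
  {G : Type*} [TopologicalSpace G] [T2Space G] [SecondCountableTopology G]
  [ChartedSpace (Eu l) G] [Group G] [LieGroup (𝓡 l) ∞ G]
  [MulAction G M] [ContMDiffSMul (𝓡 l) (𝓡 k) ∞ G M]
  {lam : Measure M} [IsLocallyFiniteMeasure lam] {p : G → M → ℝ} {q : X × M → ℝ}
  {σ : Measure (X × M)} {DX : XField d X M} {DM : X × M → (Eu l →L[ℝ] ℝ)}
  {P : Measure (Conf X M)}

theorem IsTest.measurable {φ : X × M → ℝ} (hφ : IsTest d k l X M G φ) : Measurable φ :=
  hφ.contMDiff_one.continuous.measurable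

theorem pointDeriv_comp {ι : Type*} [Fintype ι] {a : FieldPair d l X G} (ha : IsCurrent a)
    {f : (ι → ℝ) → ℝ} (hf : Differentiable ℝ f) {φ : ι → X × M → ℝ}
    (hφ : ∀ j, ContMDiff ((𝓡 d).prod (𝓡 k)) 𝓘(ℝ, ℝ) 1 (φ j)) (s : ι → ℝ) (z : X × M) :
    pointDeriv a (fun z => f fun j => φ j z + s j) z =
      fderiv ℝ f (fun j => φ j z + s j) fun j => pointDeriv a (φ j) z := by
  have h1 : HasDerivAt (fun (t : ℝ) j => φ j (currentMap a t z) + s j)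
      (fun j => pointDeriv a (φ j) z) 0 := hasDerivAt_pi.2 fun j => by
    rw [pointDeriv_eq ha (hφ j)]
    exact (hasDerivAt_currentMap ha (hφ j) z).add_const _
  have h2 := (hf fun j => φ j (currentMap a 0 z) + s j).hasFDerivAt.comp_hasDerivAt 0 h1
  rw [currentMap_zero ha] at h2
  exact h2.deriv

/-- Integration by parts in one of the variables of `σ`, the others being frozen. -/
theorem LevyDensity.integral_fderiv_add (h : LevyDensity k lam p q σ DX DM) {ι : Type*} [Fintype ι]
    {a : FieldPair d l X G} (ha : IsCurrent a) {g : (ι → ℝ) → ℝ} (hg : g.HasTemperateGrowth)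
    {φ : ι → X × M → ℝ} (hφ : ∀ j, IsTest d k l X M G (φ j)) {b : X × M → ℝ}
    (hbσ : b =ᵐ[σ] logDeriv q DX DM p a) (s : ι → ℝ) :
    ∫ z, (fderiv ℝ g (fun j => φ j z + s j) (fun j => pointDeriv a (φ j) z) +
      b z * g (fun j => φ j z + s j)) ∂σ = 0 := by
  choose B hB using fun j => (hφ j).exists_bound
  choose B' hB' using fun j => ((hφ j).pointDeriv ha).exists_bound
  set r := ∑ j, (|B j| + |s j|)
  have hr : ∀ z, ‖fun j => φ j z + s j‖ ≤ r := fun z => by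
    refine (pi_norm_le_iff_of_nonneg (Finset.sum_nonneg fun j _ => by positivity)).2 fun j => ?_
    refine le_trans ?_ (Finset.single_le_sum (f := fun j => |B j| + |s j|)
      (fun j _ => by positivity) (Finset.mem_univ j))
    exact (abs_add_le _ _).trans (add_le_add_left ((hB j z).trans (le_abs_self _)) _)
  have hr' : ∀ z, ‖fun j => pointDeriv a (φ j) z‖ ≤ ∑ j, |B' j| := fun z => by
    refine (pi_norm_le_iff_of_nonneg (Finset.sum_nonneg fun j _ => by positivity)).2 fun j => ?_
    exact ((hB' j z).trans (le_abs_self _)).trans (Finset.single_le_sum (f := fun j => |B' j|)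
      (fun j _ => by positivity) (Finset.mem_univ j))
  obtain ⟨C, hC⟩ := temperateGrowth_bound_of_le hg r
  obtain ⟨C', hC'⟩ := temperateGrowth_bound_of_le (temperateGrowth_fderiv hg) r
  have hdg : Differentiable ℝ g := hg.1.differentiable (by simp)
  have hD := fun z => pointDeriv_comp (k := k) (M := M) ha hdg (fun j => (hφ j).contMDiff_one) s z
  have hf : ContMDiff ((𝓡 d).prod (𝓡 k)) 𝓘(ℝ, ℝ) 1 fun z => g fun j => φ j z + s j :=
    (hg.1.of_le (by simp)).contMDiff.comp
      (contMDiff_pi_space.2 fun j => (hφ j).contMDiff_one.add contMDiff_const)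
  obtain ⟨-, -, h0⟩ := h.integral_pointDeriv_add ha hf ⟨C, fun z => hC _ (hr z)⟩
    ⟨C' * ∑ j, |B' j|, fun z => by
      rw [hD]
      exact (ContinuousLinearMap.le_opNorm _ _).trans (mul_le_mul (hC' _ (hr z)) (hr' z)
        (norm_nonneg _) ((norm_nonneg _).trans (hC' _ (hr z))))⟩
  rw [← h0]
  refine integral_congr_ae ?_
  filter_upwards [hbσ] with z hz
  rw [hD, hz, mul_comm]

/-- Fubini with the `i`-th variable innermost. Without integrability the integral is zero by
convention. -/
theorem integral_pi_eq_zero {Z : Type*} [MeasurableSpace Z] {ρ : Measure Z} [SigmaFinite ρ] {n : ℕ}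
    (i : Fin (n + 1)) {f : (Fin (n + 1) → Z) → ℝ}
    (h : ∀ z' : Fin n → Z, ∫ w, f (i.insertNth w z') ∂ρ = 0) :
    ∫ z, f z ∂(Measure.pi fun _ : Fin (n + 1) => ρ) = 0 := by
  have hm := (measurePreserving_piFinSuccAbove (fun _ : Fin (n + 1) => ρ) i).symm
  have e := hm.integral_comp' f
  rw [← e]
  by_cases hi : Integrable (fun y : Z × (Fin n → Z) =>
    f ((MeasurableEquiv.piFinSuccAbove (fun _ => Z) i).symm y))
    (ρ.prod (Measure.pi fun _ : Fin n => ρ))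
  · rw [integral_prod_symm _ hi]
    exact (integral_congr_ae (.of_forall fun z' => h z')).trans (integral_zero _ _)
  · exact integral_undef hi

/-- Each summand is the one-point identity in the variable `zᵢ`, the other points entering only as a
constant shift of the arguments of `g`. -/
theorem LevyDensity.integral_pi_eq_zero (h : LevyDensity k lam p q σ DX DM) {ι : Type*} [Fintype ι]
    {a : FieldPair d l X G} (ha : IsCurrent a) {g : (ι → ℝ) → ℝ} (hg : g.HasTemperateGrowth)
    {φ : ι → X × M → ℝ} (hφ : ∀ j, IsTest d k l X M G (φ j)) {b : X × M → ℝ}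
    (hbσ : b =ᵐ[σ] logDeriv q DX DM p a) {Λ : Set X} [IsFiniteMeasure (σ.restrict (Λ ×ˢ univ))]
    (haΛ : currentSupport a ⊆ Λ) (hbΛ : ∀ z, b z ≠ 0 → z.1 ∈ Λ) (n : ℕ) :
    ∫ z, ∑ i : Fin n, (fderiv ℝ g (fun j => ∑ i, φ j (z i)) (fun j => pointDeriv a (φ j) (z i)) +
      b (z i) * g fun j => ∑ i, φ j (z i)) ∂(Measure.pi fun _ : Fin n => σ.restrict (Λ ×ˢ univ))
      = 0 := by
  set ρ := σ.restrict (Λ ×ˢ univ)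
  obtain _ | n := n
  · simp
  choose B hB using fun j => (hφ j).exists_bound
  choose B' hB' using fun j => ((hφ j).pointDeriv ha).exists_bound
  set r := ∑ j, (n + 1) * |B j|
  have hr : ∀ z : Fin (n + 1) → X × M, ‖fun j => ∑ i, φ j (z i)‖ ≤ r := fun z => by
    refine (pi_norm_le_iff_of_nonneg (Finset.sum_nonneg fun j _ => by positivity)).2 fun j => ?_
    refine le_trans ?_ (Finset.single_le_sum (f := fun j => (n + 1) * |B j|)
      (fun j _ => by positivity) (Finset.mem_univ j))
    refine (Finset.abs_sum_le_sum_abs _ _).trans ((Finset.sum_le_card_nsmul _ _ |B j|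
      fun i _ => (hB j _).trans (le_abs_self _)).trans ?_)
    simp
  have hr' : ∀ z, ‖fun j => pointDeriv a (φ j) z‖ ≤ ∑ j, |B' j| := fun z => by
    refine (pi_norm_le_iff_of_nonneg (Finset.sum_nonneg fun j _ => by positivity)).2 fun j => ?_
    exact ((hB' j z).trans (le_abs_self _)).trans (Finset.single_le_sum (f := fun j => |B' j|)
      (fun j _ => by positivity) (Finset.mem_univ j))
  obtain ⟨C, hC⟩ := temperateGrowth_bound_of_le hg r
  obtain ⟨C', hC'⟩ := temperateGrowth_bound_of_le (temperateGrowth_fderiv hg) r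
  have hφm : ∀ j (i : Fin (n + 1)), Measurable fun z : Fin (n + 1) → X × M => φ j (z i) :=
    fun j i => (hφ j).measurable.comp (measurable_pi_apply i)
  have hw : Measurable fun (z : Fin (n + 1) → X × M) j => ∑ i, φ j (z i) :=
    measurable_pi_lambda _ fun j => Finset.measurable_sum _ fun i _ => hφm j i
  have hbi : Integrable b ρ :=
    ((h.integrable_logDeriv ha).congr hbσ.symm).mono_measure Measure.restrict_le_self
  rw [integral_finsetSum]
  · refine Finset.sum_eq_zero fun i _ => MarkedPoisson.integral_pi_eq_zero i fun z' => ?_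
    simp only [Fin.sum_univ_succAbove _ i, Fin.insertNth_apply_same, Fin.insertNth_apply_succAbove]
    -- The integrand vanishes off `Λ × M`, so the one-point identity for `σ` itself applies.
    rw [setIntegral_eq_integral_of_forall_compl_eq_zero]
    · exact h.integral_fderiv_add ha hg hφ hbσ fun j => ∑ i, φ j (z' i)
    · intro z hz
      have hz' : z.1 ∉ Λ := fun h' => hz ⟨h', mem_univ _⟩
      have e1 : (fun j => pointDeriv a (φ j) z) = 0 := funext fun j =>
        pointDeriv_eq_zero_of_notMem ha (hφ j).contMDiff_one fun h' => hz' (haΛ h')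
      have e2 : b z = 0 := by_contra fun h' => hz' (hbΛ z h')
      rw [e1, e2, map_zero, zero_mul, add_zero]
  · intro i _
    refine Integrable.add (Integrable.of_bound (C := C' * ∑ j, |B' j|) ?_ (.of_forall fun z => ?_))
      (Integrable.mul_bdd (c := C) (integrable_comp_eval (μ := fun _ => ρ) (i := i) hbi)
        ?_ (.of_forall fun z => ?_))
    · have h1 : Continuous fun y : (ι → ℝ) × (ι → ℝ) => fderiv ℝ g y.1 y.2 :=
        ((temperateGrowth_fderiv hg).1.continuous.comp continuous_fst).clm_apply continuous_snd
      refine (h1.measurable.comp (hw.prodMk (measurable_pi_lambda _ fun j => ?_))).aestronglyMeasurable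
      exact ((hφ j).pointDeriv ha).measurable.comp (measurable_pi_apply i)
    · exact (ContinuousLinearMap.le_opNorm _ _).trans (mul_le_mul (hC' _ (hr z)) (hr' _)
        (norm_nonneg _) ((norm_nonneg _).trans (hC' _ (hr z))))
    · exact (hg.1.continuous.measurable.comp hw).aestronglyMeasurable
    · exact hC _ (hr z)

/-- Integration by parts on the configuration space, for real functions. -/
theorem LevyDensity.integral_conf_real (h : LevyDensity k lam p q σ DX DM)
    (hP : IsMarkedPoisson σ P) (h0 : ∀ x : X, σ ({x} ×ˢ univ) = 0) {ι : Type*} [Fintype ι]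
    {a : FieldPair d l X G} (ha : IsCurrent a) {g : (ι → ℝ) → ℝ} (hg : g.HasTemperateGrowth)
    {φ : ι → X × M → ℝ} (hφ : ∀ j, IsTest d k l X M G (φ j)) {b : X × M → ℝ} (hb : Measurable b)
    (hbσ : b =ᵐ[σ] logDeriv q DX DM p a) (hbc : CompactPos b)
    (hi : Integrable (fun ζ : Conf X M => fderiv ℝ g (fun j => pairing (φ j) ζ)
      (fun j => pairing (pointDeriv a (φ j)) ζ) + pairing b ζ * g fun j => pairing (φ j) ζ) P) :
    ∫ ζ : Conf X M, (fderiv ℝ g (fun j => pairing (φ j) ζ)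
      (fun j => pairing (pointDeriv a (φ j)) ζ) + pairing b ζ * g fun j => pairing (φ j) ζ) ∂P
      = 0 := by
  have : LocallyCompactSpace X := ChartedSpace.locallyCompactSpace (Eu d) X
  have hφ' := fun j => (hφ j).pointDeriv ha
  obtain ⟨K₁, hK₁, h₁⟩ := CompactPos.exists_common fun j => (hφ j).compactPos
  obtain ⟨K₂, hK₂, h₂⟩ := hbc
  have hK := (hK₁.union hK₂).union ha.isCompact_currentSupport
  set K := K₁ ∪ K₂ ∪ currentSupport a
  obtain ⟨L, hL, hKL⟩ := exists_compact_superset hK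
  set Λ := interior L
  have hΛc : IsCompact (closure Λ) := hL.of_isClosed_subset isClosed_closure
    (closure_minimal interior_subset hL.isClosed)
  have hρ : IsFiniteMeasure (σ.restrict (Λ ×ˢ univ)) := ⟨by
    rw [Measure.restrict_apply_univ]
    exact (measure_mono (prod_mono interior_subset subset_rfl)).trans_lt (h.finite L hL)⟩
  have haΛ : currentSupport a ⊆ Λ := fun x hx => hKL (Or.inr hx)
  have hbΛ : ∀ z, b z ≠ 0 → z.1 ∈ Λ := fun z hz => hKL (Or.inl (Or.inr (h₂ z hz)))
  have hφΛ : ∀ j z, φ j z ≠ 0 → z.1 ∈ Λ := fun j z hz => hKL (Or.inl (Or.inl (h₁ j z hz)))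
  have hφΛ' : ∀ j z, pointDeriv a (φ j) z ≠ 0 → z.1 ∈ Λ := fun j z hz => haΛ <|
    by_contra fun h' => hz (pointDeriv_eq_zero_of_notMem ha (hφ j).contMDiff_one h')
  have h1 : Continuous fun y : (ι → ℝ) × (ι → ℝ) => fderiv ℝ g y.1 y.2 :=
    ((temperateGrowth_fderiv hg).1.continuous.comp continuous_fst).clm_apply continuous_snd
  have hw : ∀ {ψ : ι → X × M → ℝ}, (∀ j, IsTest d k l X M G (ψ j)) →
      Measurable fun (ζ : Conf X M) j => pairing (ψ j) ζ := fun hψ =>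
    measurable_pi_lambda _ fun j => measurable_pairing (hψ j).measurable (hψ j).compactPos
  have hT : Measurable fun ζ : Conf X M => fderiv ℝ g (fun j => pairing (φ j) ζ)
      (fun j => pairing (pointDeriv a (φ j)) ζ) + pairing b ζ * g fun j => pairing (φ j) ζ :=
    (h1.measurable.comp ((hw hφ).prodMk (hw hφ'))).add
      ((measurable_pairing hb ⟨K₂, hK₂, h₂⟩).mul (hg.1.continuous.measurable.comp (hw hφ)))
  refine hP.integral_eq_zero (Λ := Λ) isOpen_interior hΛc hT (fun ζ => ?_) hi fun n => ?_
  · have e1 : ∀ j, pairing (φ j) (ζ.restrict Λ) = pairing (φ j) ζ := fun j =>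
      pairing_restrict (hφΛ j) ζ
    have e2 : ∀ j, pairing (pointDeriv a (φ j)) (ζ.restrict Λ) = pairing (pointDeriv a (φ j)) ζ :=
      fun j => pairing_restrict (hφΛ' j) ζ
    simp only [e1, e2, pairing_restrict hbΛ ζ]
  -- Off a null set the positions in the tuple are distinct, and the pairings are sums over its
  -- points.
  · refine (integral_congr_ae ?_).trans (h.integral_pi_eq_zero ha hg hφ hbσ haΛ hbΛ n)
    filter_upwards [ae_injective_fst (ρ := σ.restrict (Λ ×ˢ univ))
      (fun x => Measure.absolutelyContinuous_of_le Measure.restrict_le_self (h0 x)) n] with z hz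
    have e : (fun j => ∑ i, pointDeriv a (φ j) (z i)) = ∑ i, fun j => pointDeriv a (φ j) (z i) :=
      funext fun j => by simp
    simp only [pairing_ofTuple hz, Finset.sum_add_distrib, ← Finset.sum_mul, e, map_sum]

end ConfIntegration

/-! ### Pairings of functions that agree almost everywhere -/

section AlmostEverywhere

variable {X M : Type*} [TopologicalSpace X] [T2Space X] [SecondCountableTopology X]
  [LocallyCompactSpace X] [MeasurableSpace X] [BorelSpace X] [MeasurableSpace M]
  {σ : Measure (X × M)} {P : Measure (Conf X M)}

/-- A pairing sees single points, but `π`-almost every configuration avoids a given `σ`-null set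
over a compact set of positions. -/
theorem IsMarkedPoisson.pairing_congr (hP : IsMarkedPoisson σ P)
    (hfin : ∀ K : Set X, IsCompact K → σ (K ×ˢ univ) < ⊤) {f g : X × M → ℝ} (hf : CompactPos f)
    (hg : CompactPos g) (h : f =ᵐ[σ] g) : pairing f =ᵐ[P] pairing g := by
  obtain ⟨K₁, hK₁, h₁⟩ := hf
  obtain ⟨K₂, hK₂, h₂⟩ := hg
  have hK := hK₁.union hK₂
  obtain ⟨L, hL, hKL⟩ := exists_compact_superset hK
  have hΛc : IsCompact (closure (interior L)) := hL.of_isClosed_subset isClosed_closure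
    (closure_minimal interior_subset hL.isClosed)
  have hρ : IsFiniteMeasure (σ.restrict (interior L ×ˢ univ)) := ⟨by
    rw [Measure.restrict_apply_univ]
    exact (measure_mono (prod_mono interior_subset subset_rfl)).trans_lt (hfin L hL)⟩
  obtain ⟨N, hN, hNm, hN0⟩ := exists_measurable_superset_of_null h
  set N' := N ∩ (K₁ ∪ K₂) ×ˢ univ
  have hN'm : MeasurableSet N' := hNm.inter (hK.measurableSet.prod MeasurableSet.univ)
  have hms : MeasurableSet {ζ : Conf X M | pairing (N'.indicator 1) ζ = 0} :=
    measurable_pairing_indicator hN'm hK inter_subset_right (measurableSet_singleton 0)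
  have hae := hP.ae_restrict isOpen_interior hΛc hms fun n => by
    have h3 : ∀ᵐ w ∂(σ.restrict (interior L ×ˢ univ)), w ∉ N' :=
      measure_eq_zero_iff_ae_notMem.1 (measure_mono_null inter_subset_left
        (Measure.absolutelyContinuous_of_le Measure.restrict_le_self hN0))
    have h4 : ∀ᵐ z ∂(Measure.pi fun _ : Fin n => σ.restrict (interior L ×ˢ univ)),
        ∀ i, z i ∉ N' := ae_all_iff.2 fun i =>
      (Measure.quasiMeasurePreserving_eval (μ := fun _ => σ.restrict (interior L ×ˢ univ)) i).ae h3
    filter_upwards [h4] with z hz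
    by_cases hi : Function.Injective fun i => (z i).1
    · rw [pairing_ofTuple hi]
      exact Finset.sum_eq_zero fun i _ => indicator_of_notMem (hz i) _
    · rw [pairing, Conf.ofTuple_val_of_not_injective hi]
      simp
  filter_upwards [hae] with ζ hζ
  rw [pairing_restrict (fun z hz => hKL (mem_of_indicator_ne_zero hz).2.1),
    pairing_indicator hK inter_subset_right, Nat.cast_eq_zero, ncard_eq_zero
    ((ζ.finite_inter hK).subset (inter_subset_inter_right _ inter_subset_right))] at hζ
  refine finsum_mem_congr rfl fun z hz => ?_
  by_contra hfg
  have hzK : z.1 ∈ K₁ ∪ K₂ := by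
    by_cases hf0 : f z = 0
    · exact Or.inr (h₂ z fun h' => hfg (hf0.trans h'.symm))
    · exact Or.inl (h₁ z hf0)
  exact (eq_empty_iff_forall_notMem.1 hζ z) ⟨hz, hN hfg, hzK, mem_univ _⟩

end AlmostEverywhere

/-! ### Temperate cylinder functions and their derivatives -/

section Polynomial

variable {d k l : ℕ} {X : Type*} [TopologicalSpace X] [T2Space X]
  [ChartedSpace (Eu d) X] [IsManifold (𝓡 d) ∞ X]
  {M : Type*} [TopologicalSpace M] [ChartedSpace (Eu k) M] [IsManifold (𝓡 k) ∞ M]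
  {G : Type*} [TopologicalSpace G] [T2Space G]
  [ChartedSpace (Eu l) G] [Group G] [LieGroup (𝓡 l) ∞ G]
  [MulAction G M] [ContMDiffSMul (𝓡 l) (𝓡 k) ∞ G M]

/-- Smooth functions of finitely many pairings with test functions, of polynomial growth together
with all derivatives. In contrast to the cylinder functions they are stable under `confDeriv`. -/
def IsTemperateCylinder (d k l : ℕ) (X M G : Type*) [TopologicalSpace X] [ChartedSpace (Eu d) X]
    [TopologicalSpace M] [ChartedSpace (Eu k) M]
    [TopologicalSpace G] [ChartedSpace (Eu l) G] [Group G] [MulAction G M]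
    [IsManifold (𝓡 d) ∞ X] (H : Conf X M → ℂ) : Prop :=
  ∃ (ι : Type) (_ : Fintype ι) (g : (ι → ℝ) → ℂ) (φ : ι → X × M → ℝ),
    g.HasTemperateGrowth ∧ (∀ j, IsTest d k l X M G (φ j)) ∧
      ∀ ζ, H ζ = g fun j => pairing (φ j) ζ

theorem IsCylinder.temperate {F : Conf X M → ℂ} (hF : IsCylinder d k l X M G F) :
    IsTemperateCylinder d k l X M G F := by
  obtain ⟨N, g, φ, hg, hgb, hφ, e⟩ := hF
  refine ⟨Fin N, inferInstance, g, φ, ⟨hg, fun n => ?_⟩, hφ, e⟩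
  obtain ⟨C, hC⟩ := hgb n
  exact ⟨0, C, fun r => by simpa using hC r⟩

theorem isCylinder_one : IsCylinder d k l X M G (fun _ : Conf X M => 1) :=
  ⟨0, fun _ => 1, fun j => j.elim0, contDiff_const, fun n => ⟨1, fun r => by
    obtain _ | n := n
    · simp
    · rw [iteratedFDeriv_succ_const]; simp⟩, fun j => j.elim0, fun _ => rfl⟩

namespace IsTemperateCylinder

variable {H H' : Conf X M → ℂ}

/-- The two families of test functions are joined into one family over the disjoint union of the
index sets. -/
theorem map₂ (hH : IsTemperateCylinder d k l X M G H) (hH' : IsTemperateCylinder d k l X M G H')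
    {f : ℂ → ℂ → ℂ} (hf : ∀ {D : Type} [NormedAddCommGroup D] [NormedSpace ℝ D] {g g' : D → ℂ},
      g.HasTemperateGrowth → g'.HasTemperateGrowth → (fun x => f (g x) (g' x)).HasTemperateGrowth) :
    IsTemperateCylinder d k l X M G fun ζ => f (H ζ) (H' ζ) := by
  obtain ⟨ι, _, g, φ, hg, hφ, e⟩ := hH
  obtain ⟨ι', _, g', φ', hg', hφ', e'⟩ := hH'
  have hl : Function.HasTemperateGrowth fun (w : ι ⊕ ι' → ℝ) j => w (Sum.inl j) :=
    (ContinuousLinearMap.pi (R := ℝ) fun j => ContinuousLinearMap.proj (φ := fun _ : ι ⊕ ι' => ℝ)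
      (Sum.inl j)).hasTemperateGrowth
  have hr : Function.HasTemperateGrowth fun (w : ι ⊕ ι' → ℝ) j => w (Sum.inr j) :=
    (ContinuousLinearMap.pi (R := ℝ) fun j => ContinuousLinearMap.proj (φ := fun _ : ι ⊕ ι' => ℝ)
      (Sum.inr j)).hasTemperateGrowth
  exact ⟨ι ⊕ ι', inferInstance, _, Sum.elim φ φ', hf (hg.comp hl) (hg'.comp hr),
    Sum.rec hφ hφ', fun ζ => by simp [e, e']⟩

theorem sub (hH : IsTemperateCylinder d k l X M G H) (hH' : IsTemperateCylinder d k l X M G H') :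
    IsTemperateCylinder d k l X M G fun ζ => H ζ - H' ζ :=
  hH.map₂ hH' fun h h' => h.sub h'

theorem mul (hH : IsTemperateCylinder d k l X M G H) (hH' : IsTemperateCylinder d k l X M G H') :
    IsTemperateCylinder d k l X M G fun ζ => H ζ * H' ζ :=
  hH.map₂ hH' fun h h' => h.mul h'

theorem map_conj (hH : IsTemperateCylinder d k l X M G H) :
    IsTemperateCylinder d k l X M G fun ζ => (starRingEnd ℂ) (H ζ) := by
  obtain ⟨ι, _, g, φ, hg, hφ, e⟩ := hH
  exact ⟨ι, inferInstance, _, φ, (Complex.conjCLE.toContinuousLinearMap.hasTemperateGrowth).comp hg,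
    hφ, fun ζ => by simp [e]⟩

variable {a : FieldPair d l X G}

theorem hasDerivAt (hH : IsTemperateCylinder d k l X M G H) (ha : IsCurrent a) (ζ : Conf X M) :
    HasDerivAt (fun t : ℝ => H (ζ.image (currentMap a t))) (confDeriv a H ζ) 0 := by
  obtain ⟨ι, _, g, φ, hg, hφ, e⟩ := hH
  have := hasDerivAt_comp_pairing ha (fun j => (hφ j).contMDiff_one) (fun j => (hφ j).compactPos) ζ
    ((hg.1.differentiable (by simp)) fun j => pairing (φ j) ζ)
  rw [funext e]
  exact this.differentiableAt.hasDerivAt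

theorem confDeriv_eq (ha : IsCurrent a) {ι : Type*} [Fintype ι] {g : (ι → ℝ) → ℂ}
    {φ : ι → X × M → ℝ} (hg : Differentiable ℝ g) (hφ : ∀ j, IsTest d k l X M G (φ j))
    (e : ∀ ζ, H ζ = g fun j => pairing (φ j) ζ) (ζ : Conf X M) : confDeriv a H ζ =
      fderiv ℝ g (fun j => pairing (φ j) ζ) fun j => pairing (pointDeriv a (φ j)) ζ := by
  rw [funext e]
  exact (hasDerivAt_comp_pairing ha (fun j => (hφ j).contMDiff_one)
    (fun j => (hφ j).compactPos) ζ (hg fun j => pairing (φ j) ζ)).deriv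

/-- The derivative is `g'(w) w'` with `w'` the pairings of the differentiated test functions. It
grows linearly in `w'`, so boundedness is lost while temperate growth is kept. -/
theorem confDeriv (hH : IsTemperateCylinder d k l X M G H) (ha : IsCurrent a) :
    IsTemperateCylinder d k l X M G (confDeriv a H) := by
  obtain ⟨ι, _, g, φ, hg, hφ, e⟩ := hH
  have hl : Function.HasTemperateGrowth fun (w : ι ⊕ ι → ℝ) j => w (Sum.inl j) :=
    (ContinuousLinearMap.pi (R := ℝ) fun j => ContinuousLinearMap.proj (φ := fun _ : ι ⊕ ι => ℝ)
      (Sum.inl j)).hasTemperateGrowth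
  have hr : Function.HasTemperateGrowth fun (w : ι ⊕ ι → ℝ) j => w (Sum.inr j) :=
    (ContinuousLinearMap.pi (R := ℝ) fun j => ContinuousLinearMap.proj (φ := fun _ : ι ⊕ ι => ℝ)
      (Sum.inr j)).hasTemperateGrowth
  exact ⟨ι ⊕ ι, inferInstance, _, Sum.elim φ fun j => pointDeriv a (φ j),
    (ContinuousLinearMap.id ℝ ((ι → ℝ) →L[ℝ] ℂ)).bilinear_hasTemperateGrowth
      ((temperateGrowth_fderiv hg).comp hl) hr,
    Sum.rec hφ fun j => (hφ j).pointDeriv ha, fun ζ => by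
      simpa using! confDeriv_eq ha (hg.1.differentiable (by simp)) hφ e ζ⟩

theorem confDeriv_mul (hH : IsTemperateCylinder d k l X M G H)
    (hH' : IsTemperateCylinder d k l X M G H') (ha : IsCurrent a) (ζ : Conf X M) :
    MarkedPoisson.confDeriv a (fun ζ => H ζ * H' ζ) ζ =
      MarkedPoisson.confDeriv a H ζ * H' ζ + H ζ * MarkedPoisson.confDeriv a H' ζ := by
  have h := ((hH.hasDerivAt ha ζ).fun_mul (hH'.hasDerivAt ha ζ)).deriv
  rw [Conf.image_zero ha] at h
  exact h

theorem confDeriv_sub (hH : IsTemperateCylinder d k l X M G H)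
    (hH' : IsTemperateCylinder d k l X M G H') (ha : IsCurrent a) (ζ : Conf X M) :
    MarkedPoisson.confDeriv a (fun ζ => H ζ - H' ζ) ζ =
      MarkedPoisson.confDeriv a H ζ - MarkedPoisson.confDeriv a H' ζ :=
  ((hH.hasDerivAt ha ζ).fun_sub (hH'.hasDerivAt ha ζ)).deriv

theorem confDeriv_conj (hH : IsTemperateCylinder d k l X M G H) (ha : IsCurrent a) (ζ : Conf X M) :
    MarkedPoisson.confDeriv a (fun ζ => (starRingEnd ℂ) (H ζ)) ζ =
      (starRingEnd ℂ) (MarkedPoisson.confDeriv a H ζ) :=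
  (Complex.conjCLE.toContinuousLinearMap.hasFDerivAt.comp_hasDerivAt 0 (hH.hasDerivAt ha ζ)).deriv

/-- The bracket of `𝔞` is the commutator of directional derivatives on the configuration space. -/
theorem confDeriv_bracket [T2Space M] (hH : IsTemperateCylinder d k l X M G H)
    {b : FieldPair d l X G} (ha : IsCurrent a) (hb : IsCurrent b) (ζ : Conf X M) :
    MarkedPoisson.confDeriv a (MarkedPoisson.confDeriv b H) ζ -
      MarkedPoisson.confDeriv b (MarkedPoisson.confDeriv a H) ζ =
      MarkedPoisson.confDeriv (bracket a b) H ζ := by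
  obtain ⟨ι, _, g, φ, hg, hφ, e⟩ := hH
  have hg1 : Differentiable ℝ g := hg.1.differentiable (by simp)
  have hg2 : Differentiable ℝ (fderiv ℝ g) :=
    (temperateGrowth_fderiv hg).1.differentiable (by simp)
  set w : ι → ℝ := fun j => pairing (φ j) ζ
  have key : ∀ {a b : FieldPair d l X G}, IsCurrent a → IsCurrent b →
      MarkedPoisson.confDeriv a (MarkedPoisson.confDeriv b H) ζ =
        fderiv ℝ (fderiv ℝ g) w (fun j => pairing (pointDeriv a (φ j)) ζ)
          (fun j => pairing (pointDeriv b (φ j)) ζ) +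
        fderiv ℝ g w fun j => pairing (pointDeriv a (pointDeriv b (φ j))) ζ := by
    intro a b ha hb
    have h1 : HasDerivAt (fun (t : ℝ) j => pairing (φ j) (ζ.image (currentMap a t)))
        (fun j => pairing (pointDeriv a (φ j)) ζ) 0 := hasDerivAt_pi.2 fun j =>
      hasDerivAt_pairing_image ha (hφ j).contMDiff_one (hφ j).compactPos ζ
    have h2 : HasDerivAt (fun (t : ℝ) j => pairing (pointDeriv b (φ j)) (ζ.image (currentMap a t)))
        (fun j => pairing (pointDeriv a (pointDeriv b (φ j))) ζ) 0 := hasDerivAt_pi.2 fun j =>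
      hasDerivAt_pairing_image ha ((hφ j).pointDeriv hb).contMDiff_one
        ((hφ j).pointDeriv hb).compactPos ζ
    have h3 := ((hg2 _).hasFDerivAt.comp_hasDerivAt 0 h1).clm_apply h2
    simp only [Function.comp_apply, Conf.image_zero ha] at h3
    rw [funext (confDeriv_eq hb hg1 hφ e)]
    exact h3.deriv
  -- The second derivative of `g` is symmetric and cancels in the commutator; what remains is the
  -- bracket identity for each test function.
  have hsym : IsSymmSndFDerivAt ℝ g w :=
    (hg.1.contDiffAt.of_le (by norm_cast)).isSymmSndFDerivAt (n := 2) (by simp)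
  have hb' : ∀ j, pairing (pointDeriv (bracket a b) (φ j)) ζ =
      pairing (pointDeriv a (pointDeriv b (φ j))) ζ -
        pairing (pointDeriv b (pointDeriv a (φ j))) ζ := fun j => by
    have e1 := pairing_smul_add (((hφ j).pointDeriv ha).pointDeriv hb).compactPos
      (((hφ j).pointDeriv hb).pointDeriv ha).compactPos (-1) ζ
    rw [show pointDeriv (bracket a b) (φ j) = _ from
      funext ((lieAlgebra_current (k := k) (M := M) ha hb).2.2.1 _ (hφ j))]
    simp only [neg_one_mul, neg_add_eq_sub] at e1
    exact e1
  rw [key ha hb, key hb ha, confDeriv_eq (ha.bracket hb) hg1 hφ e, hsym.eq,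
    add_sub_add_left_eq_sub, ← map_sub]
  exact congrArg _ (funext fun j => (hb' j).symm)

end IsTemperateCylinder

end Polynomial

/-! ### Symmetry and commutation of the operators as quadratic forms -/

section Operators

variable {d k l : ℕ} {X : Type*} [TopologicalSpace X] [T2Space X] [SecondCountableTopology X]
  [ChartedSpace (Eu d) X] [IsManifold (𝓡 d) ∞ X]
  [RiemannianBundle (fun x : X => TangentSpace (𝓡 d) x)]
  [IsContMDiffRiemannianBundle (𝓡 d) ∞ (Eu d) (fun x : X => TangentSpace (𝓡 d) x)]
  [MeasurableSpace X] [BorelSpace X]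
  {M : Type*} [TopologicalSpace M] [T2Space M] [SecondCountableTopology M]
  [ChartedSpace (Eu k) M] [IsManifold (𝓡 k) ∞ M] [MeasurableSpace M] [BorelSpace M]
  {G : Type*} [TopologicalSpace G] [T2Space G] [SecondCountableTopology G]
  [ChartedSpace (Eu l) G] [Group G] [LieGroup (𝓡 l) ∞ G]
  [MulAction G M] [ContMDiffSMul (𝓡 l) (𝓡 k) ∞ G M]
  {lam : Measure M} [IsLocallyFiniteMeasure lam] {p : G → M → ℝ} {q : X × M → ℝ}
  {σ : Measure (X × M)} {DX : XField d X M} {DM : X × M → (Eu l →L[ℝ] ℝ)}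
  {P : Measure (Conf X M)} {a b : FieldPair d l X G}

theorem LevyDensity.fiber_null (h : LevyDensity k lam p q σ DX DM) (hd : d ≠ 0) (x : X) :
    σ ({x} ×ˢ univ) = 0 := by
  have := noAtoms_riemannianVolume (X := X) hd
  have h1 : ((riemannianVolume d X).prod lam) ({x} ×ˢ univ) = 0 := by
    rw [Measure.prod_prod, measure_singleton, zero_mul]
  rw [h.eq_withDensity]
  exact withDensity_absolutelyContinuous _ _ h1

/-- A manifold of dimension `0` is discrete; being connected it would be a point, hence compact. -/
theorem dim_ne_zero [ConnectedSpace X] [NoncompactSpace X] : d ≠ 0 := by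
  rintro rfl
  have hdisc : DiscreteTopology X := discreteTopology_iff_isOpen_singleton.2 fun x => by
    have e : (chartAt (Eu 0) x).source = {x} := by
      refine subset_antisymm (fun y hy => ?_) (singleton_subset_iff.2 (mem_chart_source _ x))
      exact (chartAt (Eu 0) x).injOn hy (mem_chart_source _ x) (Subsingleton.elim _ _)
    exact e ▸ (chartAt (Eu 0) x).open_source
  have : Subsingleton X := PreconnectedSpace.trivial_of_discrete
  exact not_compactSpace_iff.2 ‹NoncompactSpace X› inferInstance

theorem compactPos_logDeriv (ha : IsCurrent a) : CompactPos (logDeriv q DX DM p a) :=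
  ⟨_, ha.isCompact_currentSupport, fun _ hz => by_contra fun h' => hz (logDeriv_eq_zero_of_notMem h')⟩

/-- Since `DX` and `DM` are only almost everywhere measurable, so is `β`; measurability of its
pairing calls for a Borel version, kept supported over the support of the current. -/
theorem LevyDensity.exists_measurable_logDeriv (h : LevyDensity k lam p q σ DX DM)
    (ha : IsCurrent a) : ∃ b : X × M → ℝ, Measurable b ∧ CompactPos b ∧ Integrable b σ ∧
      b =ᵐ[σ] logDeriv q DX DM p a := by
  have hi := h.integrable_logDeriv ha
  have hS : MeasurableSet (currentSupport a ×ˢ univ : Set (X × M)) :=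
    ha.isCompact_currentSupport.measurableSet.prod MeasurableSet.univ
  have e : (currentSupport a ×ˢ univ : Set (X × M)).indicator (hi.1.mk _) =ᵐ[σ]
      logDeriv q DX DM p a := by
    filter_upwards [hi.1.ae_eq_mk] with z hz
    by_cases hzS : z.1 ∈ currentSupport a
    · rw [indicator_of_mem (mk_mem_prod hzS (mem_univ z.2)), hz]
    · rw [indicator_of_notMem fun h' => hzS h'.1, logDeriv_eq_zero_of_notMem hzS]
  refine ⟨_, hi.1.stronglyMeasurable_mk.measurable.indicator hS, ?_, hi.congr e.symm, e⟩
  exact ⟨_, ha.isCompact_currentSupport, fun z hz => (mem_of_indicator_ne_zero hz).1⟩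

variable {H : Conf X M → ℂ}

theorem LevyDensity.integrable_temperate (h : LevyDensity k lam p q σ DX DM)
    (hP : IsMarkedPoisson σ P) (hH : IsTemperateCylinder d k l X M G H) : Integrable H P := by
  have : LocallyCompactSpace X := ChartedSpace.locallyCompactSpace (Eu d) X
  obtain ⟨ι, _, g, φ, hg, hφ, e⟩ := hH
  rw [funext e]
  exact (hP.integrable_comp_pairing h.finite hg (fun j => (hφ j).measurable)
    (fun j => (hφ j).compactPos) (fun j => (hφ j).exists_bound) measurable_const
    (b := fun _ => 0) ⟨∅, isCompact_empty, by simp⟩ (integrable_zero _ _ _)).1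

theorem LevyDensity.integrable_logDeriv_mul (h : LevyDensity k lam p q σ DX DM)
    (hP : IsMarkedPoisson σ P) (hH : IsTemperateCylinder d k l X M G H) (ha : IsCurrent a) :
    Integrable (fun ζ => (pairing (logDeriv q DX DM p a) ζ : ℂ) * H ζ) P := by
  have : LocallyCompactSpace X := ChartedSpace.locallyCompactSpace (Eu d) X
  obtain ⟨b, hb, hbc, hbi, hbσ⟩ := h.exists_measurable_logDeriv ha
  obtain ⟨ι, _, g, φ, hg, hφ, e⟩ := hH
  refine (hP.integrable_comp_pairing h.finite hg (fun j => (hφ j).measurable)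
    (fun j => (hφ j).compactPos) (fun j => (hφ j).exists_bound) hb hbc hbi).2.congr ?_
  filter_upwards [hP.pairing_congr h.finite hbc (compactPos_logDeriv ha) hbσ] with ζ hζ
  rw [hζ, e, Complex.real_smul]

/-- Integration by parts on the configuration space. -/
theorem LevyDensity.integral_confDeriv_add (h : LevyDensity k lam p q σ DX DM) (hd : d ≠ 0)
    (hP : IsMarkedPoisson σ P) (hH : IsTemperateCylinder d k l X M G H) (ha : IsCurrent a) :
    ∫ ζ, (confDeriv a H ζ + (pairing (logDeriv q DX DM p a) ζ : ℂ) * H ζ) ∂P = 0 := by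
  have : LocallyCompactSpace X := ChartedSpace.locallyCompactSpace (Eu d) X
  have hi : Integrable (fun ζ => confDeriv a H ζ +
      (pairing (logDeriv q DX DM p a) ζ : ℂ) * H ζ) P :=
    (h.integrable_temperate hP (hH.confDeriv ha)).add (h.integrable_logDeriv_mul hP hH ha)
  obtain ⟨b, hb, hbc, hbi, hbσ⟩ := h.exists_measurable_logDeriv ha
  obtain ⟨ι, _, g, φ, hg, hφ, e⟩ := hH
  have hg1 : Differentiable ℝ g := hg.1.differentiable (by simp)
  -- Real and imaginary parts are treated alike by applying the real integration by parts to `L ∘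
  -- g`.
  have key : ∀ L : ℂ →L[ℝ] ℝ, L (∫ ζ, (confDeriv a H ζ +
      (pairing (logDeriv q DX DM p a) ζ : ℂ) * H ζ) ∂P) = 0 := by
    intro L
    have hLg : Function.HasTemperateGrowth fun w => L (g w) := L.hasTemperateGrowth.comp hg
    have hd' : ∀ ζ : Conf X M, fderiv ℝ (fun w => L (g w)) (fun j => pairing (φ j) ζ) =
        L.comp (fderiv ℝ g fun j => pairing (φ j) ζ) := fun ζ =>
      (L.hasFDerivAt.comp _ (hg1 _).hasFDerivAt).fderiv
    have hae : (fun ζ : Conf X M => fderiv ℝ (fun w => L (g w)) (fun j => pairing (φ j) ζ)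
        (fun j => pairing (pointDeriv a (φ j)) ζ) +
          pairing b ζ * L (g fun j => pairing (φ j) ζ)) =ᵐ[P]
        fun ζ => L (confDeriv a H ζ + (pairing (logDeriv q DX DM p a) ζ : ℂ) * H ζ) := by
      filter_upwards [hP.pairing_congr h.finite hbc (compactPos_logDeriv ha) hbσ] with ζ hζ
      rw [IsTemperateCylinder.confDeriv_eq ha hg1 hφ e, e, hζ, map_add,
        ← Complex.real_smul, _root_.map_smul, smul_eq_mul, hd' ζ]
      rfl
    rw [← L.integral_comp_comm hi]
    refine (integral_congr_ae hae).symm.trans (h.integral_conf_real hP (h.fiber_null hd) ha hLg hφ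
      hb hbσ hbc ((L.integrable_comp hi).congr hae.symm))
  exact Complex.ext (key Complex.reCLM) (key Complex.imCLM)

theorem opR_eq (β : FieldPair d l X G → X × M → ℝ) (a : FieldPair d l X G) (F : Conf X M → ℂ)
    (ζ : Conf X M) : opR β a F ζ =
      -Complex.I * (confDeriv a F ζ + 1 / 2 * (pairing (β a) ζ : ℂ) * F ζ) := by
  rw [opR, one_div, one_div, mul_inv, Complex.inv_I]
  ring

theorem conj_opR_eq (β : FieldPair d l X G → X × M → ℝ) (ha : IsCurrent a) {F : Conf X M → ℂ}
    (hF : IsTemperateCylinder d k l X M G F) (ζ : Conf X M) : conj (opR β a F ζ) =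
      Complex.I * (confDeriv a (fun ζ => conj (F ζ)) ζ +
        1 / 2 * (pairing (β a) ζ : ℂ) * conj (F ζ)) := by
  rw [opR_eq, hF.confDeriv_conj ha, map_mul, map_neg, Complex.conj_I, neg_neg, map_add, map_mul,
    map_mul, Complex.conj_ofReal, map_div₀, map_one, map_ofNat]

/-- `R(a)` is symmetric on the cylinder functions. -/
theorem LevyDensity.weakApply (h : LevyDensity k lam p q σ DX DM) (hd : d ≠ 0)
    (hP : IsMarkedPoisson σ P) (ha : IsCurrent a) {F : Conf X M → ℂ}
    (hF : IsCylinder d k l X M G F) : WeakApply d k l G P (opR (logDeriv q DX DM p) a) F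
      (opR (logDeriv q DX DM p) a F) := by
  intro F' hF'
  have hT := hF.temperate
  have hT' := hF'.temperate
  have hFF := hT.mul hT'.map_conj
  have i1 := h.integrable_temperate hP ((hT.confDeriv ha).mul hT'.map_conj)
  have i3 := h.integrable_logDeriv_mul hP hFF ha
  have i2 := h.integrable_temperate hP (hT.mul (hT'.map_conj.confDeriv ha))
  have e1 : ∀ ζ, opR (logDeriv q DX DM p) a F ζ * conj (F' ζ) =
      -Complex.I * (confDeriv a F ζ * conj (F' ζ)) +
      -Complex.I / 2 * (pairing (logDeriv q DX DM p a) ζ * (F ζ * conj (F' ζ))) := fun ζ => by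
    rw [opR_eq]
    ring
  have e2 : ∀ ζ, F ζ * conj (opR (logDeriv q DX DM p) a F' ζ) =
      Complex.I * (F ζ * confDeriv a (fun ζ => conj (F' ζ)) ζ) +
      Complex.I / 2 * (pairing (logDeriv q DX DM p a) ζ * (F ζ * conj (F' ζ))) := fun ζ => by
    rw [conj_opR_eq _ ha hT']
    ring
  have i4 := (i1.const_mul (-Complex.I)).add (i3.const_mul (-Complex.I / 2))
  have i5 := (i2.const_mul Complex.I).add (i3.const_mul (Complex.I / 2))
  have j4 := i4.congr (.of_forall fun ζ => (e1 ζ).symm)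
  have j5 := i5.congr (.of_forall fun ζ => (e2 ζ).symm)
  refine ⟨j4, j5, ?_⟩
  rw [← sub_eq_zero, ← integral_sub j4 j5]
  -- The two sides differ by `-i` times the integral of `∇_a(F F̄') + B_a F F̄'`.
  have h0 := h.integral_confDeriv_add hd hP hFF ha
  rw [← mul_zero (-Complex.I), ← h0, ← integral_const_mul]
  refine integral_congr_ae (.of_forall fun ζ => ?_)
  simp only [e1, e2, hT.confDeriv_mul hT'.map_conj ha]
  ring

/-- Symmetry is tested with the cylinder function `1`. -/
theorem LevyDensity.integrable_opR (h : LevyDensity k lam p q σ DX DM) (hd : d ≠ 0)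
    (hP : IsMarkedPoisson σ P) (ha : IsCurrent a) {F : Conf X M → ℂ}
    (hF : IsCylinder d k l X M G F) : Integrable (opR (logDeriv q DX DM p) a F) P := by
  simpa using (h.weakApply hd hP ha hF _ (isCylinder_one (k := k))).1

/-- The commutation relation in the sense of quadratic forms. -/
theorem LevyDensity.form_commutator (h : LevyDensity k lam p q σ DX DM) (hd : d ≠ 0)
    (hP : IsMarkedPoisson σ P) (ha : IsCurrent a) (hb : IsCurrent b) {F F' : Conf X M → ℂ}
    (hF : IsCylinder d k l X M G F) (hF' : IsCylinder d k l X M G F') :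
    Integrable (fun ζ => opR (logDeriv q DX DM p) b F ζ * conj (opR (logDeriv q DX DM p) a F' ζ) -
      opR (logDeriv q DX DM p) a F ζ * conj (opR (logDeriv q DX DM p) b F' ζ)) P ∧
    Integrable (fun ζ => -Complex.I * opR (logDeriv q DX DM p) (bracket a b) F ζ * conj (F' ζ)) P ∧
    ∫ ζ, (opR (logDeriv q DX DM p) b F ζ * conj (opR (logDeriv q DX DM p) a F' ζ) -
      opR (logDeriv q DX DM p) a F ζ * conj (opR (logDeriv q DX DM p) b F' ζ)) ∂P =
    ∫ ζ, -Complex.I * opR (logDeriv q DX DM p) (bracket a b) F ζ * conj (F' ζ) ∂P := by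
  have hc := ha.bracket hb
  have hT := hF.temperate
  have hT' := hF'.temperate.map_conj
  have haF := hT.confDeriv ha
  have hbF := hT.confDeriv hb
  have haF' := hT'.confDeriv ha
  have hbF' := hT'.confDeriv hb
  set F₁ : Conf X M → ℂ := fun ζ => conj (F' ζ) with hF₁
  -- The three functions to which the integration by parts is applied, along `a`, `b` and `[a,b]`.
  -- They are antisymmetrised so that all second derivatives combine into `∇_[a,b]`, while no
  -- derivative falls on `β`.
  have hH1 := (hbF.mul hT').sub (hT.mul hbF')
  have hH2 := (hT.mul haF').sub (haF.mul hT')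
  have hH3 := hT.mul hT'
  have hZ : ∀ {a : FieldPair d l X G} {H : Conf X M → ℂ}, IsCurrent a →
      IsTemperateCylinder d k l X M G H → Integrable (fun ζ => confDeriv a H ζ +
        (pairing (logDeriv q DX DM p a) ζ : ℂ) * H ζ) P := fun ha hH =>
    (h.integrable_temperate hP (hH.confDeriv ha)).add (h.integrable_logDeriv_mul hP hH ha)
  have iC : Integrable (fun ζ => -Complex.I * opR (logDeriv q DX DM p) (bracket a b) F ζ *
      conj (F' ζ)) P := by
    simp only [mul_assoc]
    exact (h.weakApply hd hP hc hF _ hF').1.const_mul _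
  have iR := (((hZ ha hH1).add (hZ hb hH2)).add (hZ hc hH3)).const_mul (1 / 2)
  -- Pointwise, the form equals the wanted commutator plus half of three integrands with vanishing
  -- integral. The products `B_a B_b F F̄'` cancel, so no square of `B` has to be integrable.
  have key : ∀ ζ, opR (logDeriv q DX DM p) b F ζ * conj (opR (logDeriv q DX DM p) a F' ζ) -
      opR (logDeriv q DX DM p) a F ζ * conj (opR (logDeriv q DX DM p) b F' ζ) =
      -Complex.I * opR (logDeriv q DX DM p) (bracket a b) F ζ * conj (F' ζ) + 1 / 2 *
      (confDeriv a (fun ζ => confDeriv b F ζ * F₁ ζ - F ζ * confDeriv b F₁ ζ) ζ +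
        (pairing (logDeriv q DX DM p a) ζ : ℂ) *
          (confDeriv b F ζ * F₁ ζ - F ζ * confDeriv b F₁ ζ) +
      (confDeriv b (fun ζ => F ζ * confDeriv a F₁ ζ - confDeriv a F ζ * F₁ ζ) ζ +
        (pairing (logDeriv q DX DM p b) ζ : ℂ) *
          (F ζ * confDeriv a F₁ ζ - confDeriv a F ζ * F₁ ζ)) +
      (confDeriv (bracket a b) (fun ζ => F ζ * F₁ ζ) ζ +
        (pairing (logDeriv q DX DM p (bracket a b)) ζ : ℂ) * (F ζ * F₁ ζ))) := by
    intro ζ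
    rw [conj_opR_eq _ ha hF'.temperate, conj_opR_eq _ hb hF'.temperate, opR_eq, opR_eq, opR_eq,
      (hbF.mul hT').confDeriv_sub (hT.mul hbF') ha, (hT.mul haF').confDeriv_sub (haF.mul hT') hb,
      hbF.confDeriv_mul hT' ha, hT.confDeriv_mul hbF' ha, hT.confDeriv_mul haF' hb,
      haF.confDeriv_mul hT' hb, hT.confDeriv_mul hT' hc, ← hT.confDeriv_bracket ha hb,
      ← hT'.confDeriv_bracket ha hb]
    -- The identity is linear over the ring of these functions up to `i² = -1`; the bracketed factor
    -- collects the terms where `i²` occurs.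
    linear_combination (
      (-confDeriv b F ζ - 1 / 2 * (pairing (logDeriv q DX DM p b) ζ : ℂ) * F ζ) *
        (confDeriv a F₁ ζ + 1 / 2 * (pairing (logDeriv q DX DM p a) ζ : ℂ) * F₁ ζ) +
      (confDeriv a F ζ + 1 / 2 * (pairing (logDeriv q DX DM p a) ζ : ℂ) * F ζ) *
        (confDeriv b F₁ ζ + 1 / 2 * (pairing (logDeriv q DX DM p b) ζ : ℂ) * F₁ ζ) -
      (confDeriv a (confDeriv b F) ζ - confDeriv b (confDeriv a F) ζ +
        1 / 2 * (pairing (logDeriv q DX DM p (bracket a b)) ζ : ℂ) * F ζ) * F₁ ζ) * Complex.I_mul_I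
  refine ⟨(iC.add iR).congr (.of_forall fun ζ => (key ζ).symm), iC, ?_⟩
  have h3 := (integral_add iC iR).trans (congrArg _ ((integral_const_mul _ _).trans
    (congrArg _ ((integral_add ((hZ ha hH1).add (hZ hb hH2)) (hZ hc hH3)).trans
      (congrArg₂ _ (integral_add (hZ ha hH1) (hZ hb hH2)) rfl)))))
  rw [h.integral_confDeriv_add hd hP hH1 ha, h.integral_confDeriv_add hd hP hH2 hb,
    h.integral_confDeriv_add hd hP hH3 hc] at h3
  rw [integral_congr_ae (.of_forall key)]
  simpa using h3

end Operators

/-! ### Cylinder functions determine integrable functions -/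

section Determining

theorem tendsto_pairing {X M : Type*} [TopologicalSpace X] {f : ℕ → X × M → ℝ} {g : X × M → ℝ}
    {K : Set X} (hK : IsCompact K) (hf : ∀ n z, f n z ≠ 0 → z.1 ∈ K)
    (h : ∀ z, Filter.Tendsto (fun n => f n z) Filter.atTop (𝓝 (g z))) (ζ : Conf X M) :
    Filter.Tendsto (fun n => pairing (f n) ζ) Filter.atTop (𝓝 (pairing g ζ)) := by
  have hg : ∀ z, g z ≠ 0 → z.1 ∈ K := fun z hz => by_contra fun hzK =>
    hz (tendsto_nhds_unique (h z) (tendsto_const_nhds.congr fun n =>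
      (by_contra fun h' => hzK (hf n z (Ne.symm h')) : (0 : ℝ) = f n z)))
  rw [pairing_eq_sum hK hg]
  simp only [fun n => pairing_eq_sum hK (hf n) ζ]
  exact tendsto_finsetSum _ fun z _ => h z

/-- Composed with a smooth function whose nonvanishing set is a given open set, this approximates
the indicator of that set by smooth functions. -/
theorem tendsto_smoothTransition {t : ℝ} (ht : 0 ≤ t) :
    Filter.Tendsto (fun n : ℕ => Real.smoothTransition (n * t)) Filter.atTop
      (𝓝 (if t = 0 then 0 else 1)) := by
  split_ifs with h0
  · simp [h0]
  · have ht' : 0 < t := lt_of_le_of_ne ht (Ne.symm h0)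
    obtain ⟨N, hN⟩ := exists_nat_ge (1 / t)
    refine tendsto_const_nhds.congr' ?_
    filter_upwards [Filter.eventually_ge_atTop N] with n hn
    refine (Real.smoothTransition.one_of_one_le ?_).symm
    have : (N : ℝ) ≤ n := by exact_mod_cast hn
    rw [div_le_iff₀ ht'] at hN
    nlinarith

variable {d k : ℕ} {X : Type*} [TopologicalSpace X] [T2Space X] [SecondCountableTopology X]
  [ChartedSpace (Eu d) X] [IsManifold (𝓡 d) ∞ X] [MeasurableSpace X] [BorelSpace X]
  {M : Type*} [TopologicalSpace M] [T2Space M] [SecondCountableTopology M]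
  [ChartedSpace (Eu k) M] [IsManifold (𝓡 k) ∞ M] [MeasurableSpace M] [BorelSpace M]

/-- The σ-algebra of the configuration space is generated by the pairings with smooth functions of
compact support. -/
theorem measurable_of_pairing {Ω : Type*} [MeasurableSpace Ω] {T : Ω → Conf X M}
    (h : ∀ φ : X × M → ℝ, ContMDiff ((𝓡 d).prod (𝓡 k)) 𝓘(ℝ, ℝ) ∞ φ → HasCompactSupport φ →
      Measurable fun y => pairing φ (T y)) : Measurable T := by
  have : LocallyCompactSpace X := ChartedSpace.locallyCompactSpace (Eu d) X
  have : LocallyCompactSpace M := ChartedSpace.locallyCompactSpace (Eu k) M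
  have hlim : ∀ {f : ℕ → X × M → ℝ} {g : X × M → ℝ} {K : Set X}, IsCompact K →
      (∀ n z, f n z ≠ 0 → z.1 ∈ K) →
      (∀ z, Filter.Tendsto (fun n => f n z) Filter.atTop (𝓝 (g z))) →
      (∀ n, Measurable fun y => pairing (f n) (T y)) → Measurable fun y => pairing g (T y) :=
    fun hK hf hfg hm => measurable_of_tendsto_metrizable hm
      (tendsto_pi_nhds.2 fun y => tendsto_pairing hK hf hfg (T y))
  -- The indicator of `V` is the limit of smooth functions supported in the compact closure of `V`.
  have hopen : ∀ V : Set (X × M), IsOpen V → IsCompact (closure V) →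
      Measurable fun y => pairing (V.indicator 1) (T y) := by
    intro V hV hVc
    obtain ⟨f, hfV, hf, hf0⟩ := hV.exists_contMDiff_support_eq (n := ⊤) ((𝓡 d).prod (𝓡 k))
    have hs : ∀ n : ℕ, ∀ z, Real.smoothTransition (n * f z) ≠ 0 → z ∈ V := fun n z hz => by
      rw [← hfV]
      exact fun h' => hz (by rw [h', mul_zero, Real.smoothTransition.zero])
    refine hlim (f := fun n z => Real.smoothTransition (n * f z)) (hVc.image continuous_fst)
      (fun n z hz => ⟨z, subset_closure (hs n z hz), rfl⟩) (fun z => ?_) fun n => h _ ?_ ?_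
    · have h1 := tendsto_smoothTransition (hf0 z)
      have e : V.indicator (1 : X × M → ℝ) z = if f z = 0 then 0 else 1 := by
        rw [← hfV]
        by_cases hz : f z = 0 <;> simp [indicator, hz]
      rwa [e]
    · exact (Real.smoothTransition.contDiff (n := ⊤)).contMDiff.comp (contMDiff_const.mul hf)
    · exact hVc.of_isClosed_subset isClosed_closure (closure_mono fun z hz => hs n z hz)
  have hind : ∀ (W : Set (X × M)), IsOpen W → IsCompact (closure W) → ∀ B : Set (X × M),
      MeasurableSet B → Measurable fun y => pairing ((B ∩ W).indicator 1) (T y) := by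
    intro W hW hWc B hB
    have hWK := hWc.image continuous_fst
    have hWK' : ∀ (s : Set (X × M)) z, (s ∩ W).indicator (1 : X × M → ℝ) z ≠ 0 →
      z.1 ∈ Prod.fst '' closure W := fun s z hz =>
        ⟨z, subset_closure (mem_of_indicator_ne_zero hz).2, rfl⟩
    -- From open to Borel sets by the `π`-`λ` theorem, inside a relatively compact `W` so that
    -- complements stay finitely counted.
    refine MeasurableSpace.induction_on_inter (C := fun B _ =>
      Measurable fun y => pairing ((B ∩ W).indicator 1) (T y)) (BorelSpace.measurable_eq (α := X × M))
      isPiSystem_isOpen ?_ (fun V hV => ?_) (fun B _ hB => ?_) (fun B hd _ hB => ?_) B hB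
    · simp [pairing]
    · exact hopen _ (IsOpen.inter hV hW) (hWc.of_isClosed_subset isClosed_closure
        (closure_mono inter_subset_right))
    · have e : ((Bᶜ ∩ W).indicator 1 : X × M → ℝ) =
          fun z => -1 * (B ∩ W).indicator 1 z + W.indicator 1 z := by
        funext z
        by_cases h1 : z ∈ B <;> by_cases h2 : z ∈ W <;> simp [h1, h2]
      have h1 : ∀ y, pairing ((Bᶜ ∩ W).indicator 1) (T y) =
          -1 * pairing ((B ∩ W).indicator 1) (T y) + pairing (W.indicator 1) (T y) := fun y => by
        rw [e]
        exact pairing_smul_add ⟨_, hWK, hWK' B⟩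
          ⟨_, hWK, fun z hz => ⟨z, subset_closure (mem_of_indicator_ne_zero hz), rfl⟩⟩ _ _
      simp only [h1]
      exact (hB.const_mul _).add (hopen W hW hWc)
    · have h1 : ∀ n y, pairing (fun z => ∑ i ∈ Finset.range n, (B i ∩ W).indicator 1 z) (T y) =
          ∑ i ∈ Finset.range n, pairing ((B i ∩ W).indicator 1) (T y) := fun n y => by
        rw [pairing_eq_sum hWK fun z hz => ?_, Finset.sum_comm]
        · exact Finset.sum_congr rfl fun i _ => (pairing_eq_sum hWK (hWK' (B i)) _).symm
        · obtain ⟨i, -, hi⟩ := Finset.exists_ne_zero_of_sum_ne_zero hz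
          exact hWK' (B i) z hi
      refine hlim (f := fun n z => ∑ i ∈ Finset.range n, (B i ∩ W).indicator 1 z) hWK
        (fun n z hz => ?_) (fun z => ?_) fun n => ?_
      · obtain ⟨i, -, hi⟩ := Finset.exists_ne_zero_of_sum_ne_zero hz
        exact hWK' (B i) z hi
      · by_cases hz : z ∈ (⋃ i, B i) ∩ W
        · obtain ⟨hz1, hz2⟩ := hz
          obtain ⟨i, hi⟩ := mem_iUnion.1 hz1
          rw [indicator_of_mem (mem_inter hz1 hz2)]
          refine tendsto_const_nhds.congr' ?_
          filter_upwards [Filter.eventually_gt_atTop i] with n hn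
          rw [Finset.sum_eq_single_of_mem i (Finset.mem_range.2 hn)]
          · rw [indicator_of_mem (mem_inter hi hz2)]
          · intro j _ hj
            exact indicator_of_notMem (fun h' => (disjoint_left.1 (hd hj) h'.1) hi) _
        · rw [indicator_of_notMem hz]
          refine tendsto_const_nhds.congr fun n => (Finset.sum_eq_zero fun i _ => ?_).symm
          exact indicator_of_notMem (fun h' => hz ⟨mem_iUnion.2 ⟨i, h'.1⟩, h'.2⟩) _
      · simp only [h1]
        exact Finset.measurable_sum _ fun i _ => hB i
  refine measurable_generateFrom ?_
  rintro _ ⟨B, n, hB, ⟨K, hK, hBK⟩, rfl⟩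
  -- A generating set `B` is relatively compact only in the position; the exhaustion bounds the
  -- marks as well.
  let E : CompactExhaustion (X × M) := CompactExhaustion.choice _
  have h1 : Measurable fun y => pairing (B.indicator 1) (T y) := by
    refine hlim (f := fun n => (B ∩ interior (E n)).indicator 1) hK
      (fun n z hz => (hBK (mem_of_indicator_ne_zero hz).1).1) (fun z => ?_) fun n => ?_
    · obtain ⟨n, hn⟩ := E.exists_mem z
      refine tendsto_const_nhds.congr' ?_
      filter_upwards [Filter.eventually_gt_atTop n] with j hj
      have hz : z ∈ interior (E j) :=
        interior_mono (E.subset (Nat.succ_le_of_lt hj)) (E.subset_interior_succ n hn)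
      by_cases hB : z ∈ B <;> simp [hB, hz]
    · exact hind _ isOpen_interior ((E.isCompact n).of_isClosed_subset isClosed_closure
        (closure_minimal interior_subset (E.isCompact n).isClosed)) _ hB
  have e : T ⁻¹' {ζ : Conf X M | (ζ.1 ∩ B).ncard = n} =
      (fun y => pairing (B.indicator 1) (T y)) ⁻¹' {(n : ℝ)} := by
    ext y
    simp only [mem_preimage, mem_singleton_iff, pairing_indicator hK hBK, Nat.cast_inj]
    rfl
  rw [e]
  exact h1 (measurableSet_singleton _)

variable {P : Measure (Conf X M)} {E : Type*} [NormedAddCommGroup E] [NormedSpace ℝ E]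
  [CompleteSpace E]

/-- The indicator of the open set `U` is a bounded pointwise limit of smooth compactly supported
functions: smooth transitions of a function positive exactly on `U`, times bumps equal to `1` on
growing balls. -/
theorem setIntegral_preimage_eq_zero {D : Conf X M → E} (hD : Integrable D P) {N : ℕ}
    {φ : Fin N → X × M → ℝ} (hφ : ∀ j, Continuous (φ j)) (hφc : ∀ j, CompactPos (φ j))
    (h : ∀ g : (Fin N → ℝ) → ℝ, ContDiff ℝ ∞ g → HasCompactSupport g →
      ∫ ζ, g (fun j => pairing (φ j) ζ) • D ζ ∂P = 0)
    {U : Set (Fin N → ℝ)} (hU : IsOpen U) :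
    ∫ ζ in {ζ | (fun j => pairing (φ j) ζ) ∈ U}, D ζ ∂P = 0 := by
  obtain ⟨f, hfU, hf, hf1⟩ := hU.exists_contDiff_support_eq (n := ⊤)
  have hm : Measurable fun (ζ : Conf X M) j => pairing (φ j) ζ :=
    measurable_pi_lambda _ fun j => measurable_pairing (hφ j).measurable (hφc j)
  let χ : ∀ n : ℕ, ContDiffBump (0 : Fin N → ℝ) := fun n =>
    ⟨n + 1, n + 2, by positivity, by linarith⟩
  let g : ℕ → (Fin N → ℝ) → ℝ := fun n w => χ n w * Real.smoothTransition (n * f w)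
  have hg : ∀ n, ContDiff ℝ ∞ (g n) := fun n => (χ n).contDiff.mul
    ((Real.smoothTransition.contDiff (n := ⊤)).comp (contDiff_const.mul hf))
  have hg1 : ∀ n w, |g n w| ≤ 1 := fun n w => by
    rw [abs_mul, abs_of_nonneg (χ n).nonneg, abs_of_nonneg (Real.smoothTransition.nonneg _)]
    exact mul_le_one₀ (χ n).le_one (Real.smoothTransition.nonneg _) (Real.smoothTransition.le_one _)
  have hlim : ∀ w, Filter.Tendsto (fun n => g n w) Filter.atTop (𝓝 (U.indicator 1 w)) := by
    intro w
    have e : U.indicator (1 : (Fin N → ℝ) → ℝ) w = if f w = 0 then 0 else 1 := by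
      rw [← hfU]
      by_cases hz : f w = 0 <;> simp [indicator, hz]
    rw [e]
    refine (tendsto_smoothTransition (hf1 (mem_range_self w)).1).congr' ?_
    obtain ⟨n, hn⟩ := exists_nat_ge ‖w‖
    filter_upwards [Filter.eventually_ge_atTop n] with j hj
    have : (n : ℝ) ≤ j := by exact_mod_cast hj
    have h1 : χ j w = 1 := (χ j).one_of_mem_closedBall (by
      rw [mem_closedBall_zero_iff]
      change ‖w‖ ≤ j + 1
      linarith)
    simp only [g, h1, one_mul]
  have h1 := tendsto_integral_of_dominated_convergence (μ := P)
    (F := fun n ζ => g n (fun j => pairing (φ j) ζ) • D ζ)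
    (f := fun ζ => U.indicator (1 : (Fin N → ℝ) → ℝ) (fun j => pairing (φ j) ζ) • D ζ)
    (fun ζ => ‖D ζ‖)
    (fun n => ((hg n).continuous.measurable.comp hm).aestronglyMeasurable.smul hD.1) hD.norm
    (fun n => .of_forall fun ζ => by
      rw [norm_smul]
      exact mul_le_of_le_one_left (norm_nonneg _) (hg1 n _))
    (.of_forall fun ζ => (hlim _).smul_const _)
  simp only [fun n => h (g n) (hg n) ((χ n).hasCompactSupport.mul_right)] at h1
  have hS : MeasurableSet {ζ : Conf X M | (fun j => pairing (φ j) ζ) ∈ U} := hm hU.measurableSet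
  rw [← integral_indicator hS, ← tendsto_nhds_unique h1 tendsto_const_nhds]
  refine integral_congr_ae (.of_forall fun ζ => ?_)
  by_cases hζ : (fun j => pairing (φ j) ζ) ∈ U
  · simp [indicator, hζ]
  · simp [indicator, hζ]

/-- Cylinder functions with smooth compactly supported data determine integrable functions. -/
theorem ae_eq_zero_of_integral_cylinder {D : Conf X M → E} (hD : Integrable D P)
    (h : ∀ (N : ℕ) (φ : Fin N → X × M → ℝ) (g : (Fin N → ℝ) → ℝ),
      (∀ j, ContMDiff ((𝓡 d).prod (𝓡 k)) 𝓘(ℝ, ℝ) ∞ (φ j)) → (∀ j, HasCompactSupport (φ j)) →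
      ContDiff ℝ ∞ g → HasCompactSupport g →
      ∫ ζ, g (fun j => pairing (φ j) ζ) • D ζ ∂P = 0) : D =ᵐ[P] 0 := by
  let C : Set (Set (Conf X M)) := {S | ∃ (N : ℕ) (φ : Fin N → X × M → ℝ) (U : Set (Fin N → ℝ)),
    (∀ j, ContMDiff ((𝓡 d).prod (𝓡 k)) 𝓘(ℝ, ℝ) ∞ (φ j)) ∧ (∀ j, HasCompactSupport (φ j)) ∧
      IsOpen U ∧ S = {ζ | (fun j => pairing (φ j) ζ) ∈ U}}
  have hcp : ∀ {φ : X × M → ℝ}, HasCompactSupport φ → CompactPos φ := fun hφ =>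
    ⟨_, hφ.image continuous_fst, fun z hz => ⟨z, subset_closure hz, rfl⟩⟩
  -- Two conditions on pairings are one condition on the concatenated family.
  have hC : IsPiSystem C := by
    rintro _ ⟨N, φ, U, hφ, hφc, hU, rfl⟩ _ ⟨N', φ', U', hφ', hφc', hU', rfl⟩ -
    refine ⟨N + N', Fin.append φ φ', {w | (fun j => w (Fin.castAdd N' j)) ∈ U} ∩
      {w | (fun j => w (Fin.natAdd N j)) ∈ U'}, fun j => ?_, fun j => ?_, ?_, ?_⟩
    · refine Fin.addCases (fun j => ?_) (fun j => ?_) j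
      · rw [Fin.append_left]; exact hφ j
      · rw [Fin.append_right]; exact hφ' j
    · refine Fin.addCases (fun j => ?_) (fun j => ?_) j
      · rw [Fin.append_left]; exact hφc j
      · rw [Fin.append_right]; exact hφc' j
    · exact (hU.preimage (by fun_prop)).inter (hU'.preimage (by fun_prop))
    · ext ζ
      simp [Fin.append_left, Fin.append_right]
  have hgen : (inferInstance : MeasurableSpace (Conf X M)) = MeasurableSpace.generateFrom C := by
    refine le_antisymm ?_ (MeasurableSpace.generateFrom_le ?_)
    · have h1 := @measurable_of_pairing d k X _ _ _ _ _ _ _ M _ _ _ _ _ _ _ (Conf X M)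
        (MeasurableSpace.generateFrom C) id (fun φ hφ hφc => ?_)
      · exact fun s hs => h1 hs
      · refine @measurable_of_isOpen _ _ _ _ _ (MeasurableSpace.generateFrom C) _ fun V hV => ?_
        exact MeasurableSpace.measurableSet_generateFrom ⟨1, fun _ => φ, {w | w 0 ∈ V},
          fun _ => hφ, fun _ => hφc, hV.preimage (continuous_apply 0), rfl⟩
    · rintro _ ⟨N, φ, U, hφ, hφc, hU, rfl⟩
      exact (measurable_pi_lambda _ fun j => measurable_pairing (hφ j).continuous.measurable
        (hcp (hφc j))) hU.measurableSet
  have hCz : ∀ S ∈ C, ∫ ζ in S, D ζ ∂P = 0 := by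
    rintro _ ⟨N, φ, U, hφ, hφc, hU, rfl⟩
    exact setIntegral_preimage_eq_zero hD (fun j => (hφ j).continuous) (fun j => hcp (hφc j))
      (fun g hg hgc => h N φ g hφ hφc hg hgc) hU
  -- The whole space is the cylinder set of an empty family; complements in the induction are taken
  -- relative to it.
  have huniv : ∫ ζ, D ζ ∂P = 0 := by
    rw [← setIntegral_univ]
    exact hCz univ ⟨0, fun j => j.elim0, univ, fun j => j.elim0, fun j => j.elim0, isOpen_univ,
      by simp⟩
  refine hD.ae_eq_zero_of_forall_setIntegral_eq_zero fun S hS _ => ?_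
  refine MeasurableSpace.induction_on_inter (C := fun S _ => ∫ ζ in S, D ζ ∂P = 0) hgen hC
    (by simp) hCz (fun S hS h0 => ?_) (fun S hd hS h0 => ?_) S hS
  · have e := integral_add_compl hS hD
    rwa [h0, zero_add, huniv] at e
  · rw [integral_iUnion hS hd hD.integrableOn]
    simp [h0]

end Determining

/-! ### Linearity of the divergence -/

section DivergenceLinear

variable {d : ℕ} {X : Type*} [TopologicalSpace X] [T2Space X] [ChartedSpace (Eu d) X]
  [RiemannianBundle (fun x : X => TangentSpace (𝓡 d) x)] [IsManifold (𝓡 d) ∞ X]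
  [IsContMDiffRiemannianBundle (𝓡 d) ∞ (Eu d) (fun x : X => TangentSpace (𝓡 d) x)]

theorem divergence_smul_add {v w : (x : X) → TangentSpace (𝓡 d) x}
    (hv : ContMDiff (𝓡 d) (𝓡 d).tangent ∞ (fun x => (⟨x, v x⟩ : TangentBundle (𝓡 d) X)))
    (hw : ContMDiff (𝓡 d) (𝓡 d).tangent ∞ (fun x => (⟨x, w x⟩ : TangentBundle (𝓡 d) X)))
    (r : ℝ) (x : X) : divergence (r • v + w) x = r * divergence v x + divergence w x := by
  have hx := (chartAt (Eu d) x).map_source (mem_chart_source (Eu d) x)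
  have hd : ∀ {v : (x : X) → TangentSpace (𝓡 d) x},
      ContMDiff (𝓡 d) (𝓡 d).tangent ∞ (fun x => (⟨x, v x⟩ : TangentBundle (𝓡 d) X)) → ∀ i,
      DifferentiableAt ℝ (fun y => volDensity x y * chartField x v y i) (chartAt (Eu d) x x) :=
    fun hv i => ((contDiffOn_volDensity_mul_chartField hv x i).contDiffAt
      ((chartAt (Eu d) x).open_target.mem_nhds hx)).differentiableAt (by simp)
  have hlin : ∀ y, chartField x (r • v + w) y = r • chartField x v y + chartField x w y :=
    fun y => by
      let L : Eu d →L[ℝ] Eu d := mfderiv (𝓡 d) (𝓡 d) (chartAt (Eu d) x) ((chartAt (Eu d) x).symm y)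
      exact (map_add L _ _).trans (congrArg (· + _) (map_smul L r _))
  have e : ∀ i, (fun y => volDensity x y * chartField x (r • v + w) y i) = fun y =>
      r * (volDensity x y * chartField x v y i) + volDensity x y * chartField x w y i := fun i => by
    funext y
    rw [hlin]
    simp
    ring
  simp only [divergence_eq_chartDiv, chartDiv, e]
  rw [← mul_div_assoc, ← add_div, Finset.mul_sum, ← Finset.sum_add_distrib]
  congr 1
  refine Finset.sum_congr rfl fun i _ => ?_
  rw [fderiv_fun_add ((hd hv i).const_mul r) (hd hw i), fderiv_const_mul (hd hv i)]
  rfl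

end DivergenceLinear

/-! ### Linearity in the current and the weak commutation relations -/

section Commutator

variable {d k l : ℕ} {X : Type*} [TopologicalSpace X] [T2Space X] [SecondCountableTopology X]
  [ChartedSpace (Eu d) X] [IsManifold (𝓡 d) ∞ X]
  [RiemannianBundle (fun x : X => TangentSpace (𝓡 d) x)]
  [IsContMDiffRiemannianBundle (𝓡 d) ∞ (Eu d) (fun x : X => TangentSpace (𝓡 d) x)]
  [MeasurableSpace X] [BorelSpace X]
  {M : Type*} [TopologicalSpace M] [T2Space M] [SecondCountableTopology M]
  [ChartedSpace (Eu k) M] [IsManifold (𝓡 k) ∞ M] [MeasurableSpace M] [BorelSpace M]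
  {G : Type*} [TopologicalSpace G] [T2Space G] [SecondCountableTopology G]
  [ChartedSpace (Eu l) G] [Group G] [LieGroup (𝓡 l) ∞ G]
  [MulAction G M] [ContMDiffSMul (𝓡 l) (𝓡 k) ∞ G M]
  {lam : Measure M} [IsLocallyFiniteMeasure lam] {p : G → M → ℝ} {q : X × M → ℝ}
  {σ : Measure (X × M)} {DX : XField d X M} {DM : X × M → (Eu l →L[ℝ] ℝ)}
  {P : Measure (Conf X M)} {a b : FieldPair d l X G}

theorem pointDeriv_smul_add (ha : IsCurrent a) (hb : IsCurrent b) {f : X × M → ℝ}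
    (hf : ContMDiff ((𝓡 d).prod (𝓡 k)) 𝓘(ℝ, ℝ) 1 f) (r : ℝ) (z : X × M) :
    pointDeriv (r • a + b) f z = r * pointDeriv a f z + pointDeriv b f z := by
  rw [pointDeriv_eq (ha.smul_add hb r) hf, pointDeriv_eq ha hf, pointDeriv_eq hb hf]
  have h1 : gradX d f z ((r • a + b).1 z.1) = r * gradX d f z (a.1 z.1) + gradX d f z (b.1 z.1) :=
    (map_add (gradX d f z) (r • a.1 z.1) (b.1 z.1)).trans
      (congrArg (· + _) (map_smul (gradX d f z) r (a.1 z.1)))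
  have h2 : gradM l G f z ((r • a + b).2 z.1) =
      r * gradM l G f z (a.2 z.1) + gradM l G f z (b.2 z.1) :=
    (map_add (gradM l G f z) (r • (show Eu l from a.2 z.1)) (show Eu l from b.2 z.1)).trans
      (congrArg (· + _) (map_smul (gradM l G f z) r (show Eu l from a.2 z.1)))
  rw [h1, h2]
  ring

theorem logDeriv_smul_add (ha : IsCurrent a) (hb : IsCurrent b) (r : ℝ) (z : X × M) :
    logDeriv q DX DM p (r • a + b) z =
      r * logDeriv q DX DM p a z + logDeriv q DX DM p b z := by
  have h1 : DX z ((r • a + b).1 z.1) = r * DX z (a.1 z.1) + DX z (b.1 z.1) :=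
    (map_add (DX z) (r • a.1 z.1) (b.1 z.1)).trans
      (congrArg (· + _) (map_smul (DX z) r (a.1 z.1)))
  have h2 : ∀ L : Eu l →L[ℝ] ℝ, L ((r • a + b).2 z.1) = r * L (a.2 z.1) + L (b.2 z.1) := fun L =>
    (map_add L (r • (show Eu l from a.2 z.1)) (show Eu l from b.2 z.1)).trans
      (congrArg (· + _) (map_smul L r (show Eu l from a.2 z.1)))
  rw [logDeriv, logDeriv, logDeriv, h1, h2, h2,
    show divergence (r • a + b).1 z.1 = r * divergence a.1 z.1 + divergence b.1 z.1 from
      divergence_smul_add ha.smooth_fst hb.smooth_fst r z.1]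
  ring

/-- `R(a)F` is linear in `a`. -/
theorem opR_smul_add (ha : IsCurrent a) (hb : IsCurrent b) {F : Conf X M → ℂ}
    (hF : IsTemperateCylinder d k l X M G F) (r : ℝ) (ζ : Conf X M) :
    opR (logDeriv q DX DM p) (r • a + b) F ζ =
      r * opR (logDeriv q DX DM p) a F ζ + opR (logDeriv q DX DM p) b F ζ := by
  have h1 : pairing (logDeriv q DX DM p (r • a + b)) ζ =
      r * pairing (logDeriv q DX DM p a) ζ + pairing (logDeriv q DX DM p b) ζ := by
    rw [funext (logDeriv_smul_add ha hb r)]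
    exact pairing_smul_add (compactPos_logDeriv ha) (compactPos_logDeriv hb) r ζ
  have h2 : confDeriv (r • a + b) F ζ = r * confDeriv a F ζ + confDeriv b F ζ := by
    obtain ⟨ι, _, g, φ, hg, hφ, e⟩ := hF
    have hg1 : Differentiable ℝ g := hg.1.differentiable (by simp)
    rw [IsTemperateCylinder.confDeriv_eq (ha.smul_add hb r) hg1 hφ e,
      IsTemperateCylinder.confDeriv_eq ha hg1 hφ e, IsTemperateCylinder.confDeriv_eq hb hg1 hφ e,
      ← Complex.real_smul, ← _root_.map_smul, ← map_add]
    congr 1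
    funext j
    rw [funext (pointDeriv_smul_add ha hb (hφ j).contMDiff_one r)]
    exact pairing_smul_add ((hφ j).pointDeriv ha).compactPos ((hφ j).pointDeriv hb).compactPos r ζ
  rw [opR_eq, opR_eq, opR_eq, h1, h2]
  push_cast
  ring

theorem isCylinder_of_hasCompactSupport {N : ℕ} {φ : Fin N → X × M → ℝ} {g : (Fin N → ℝ) → ℝ}
    (hφ : ∀ j, ContMDiff ((𝓡 d).prod (𝓡 k)) 𝓘(ℝ, ℝ) ∞ (φ j)) (hφc : ∀ j, HasCompactSupport (φ j))
    (hg : ContDiff ℝ ∞ g) (hgc : HasCompactSupport g) :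
    IsCylinder d k l X M G fun ζ => (g (fun j => pairing (φ j) ζ) : ℂ) := by
  have hg' : ContDiff ℝ ∞ fun w => (g w : ℂ) := Complex.ofRealCLM.contDiff.comp hg
  have hgc' : HasCompactSupport fun w => (g w : ℂ) := hgc.comp_left (g := Complex.ofReal) rfl
  exact ⟨N, fun w => (g w : ℂ), φ, hg', fun n =>
    (hg'.continuous_iteratedFDeriv (by exact_mod_cast le_top)).bounded_above_of_compact_support
      (hgc'.iteratedFDeriv n), fun j => isTest_of_hasCompactSupport (hφ j) (hφc j), fun ζ => rfl⟩

/-- The commutation relation, weakly on the cylinder functions. -/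
theorem LevyDensity.isCommutator (h : LevyDensity k lam p q σ DX DM) (hd : d ≠ 0)
    (hP : IsMarkedPoisson σ P) (ha : IsCurrent a) (hb : IsCurrent b) :
    IsCommutator d k l G P (opR (logDeriv q DX DM p) a) (opR (logDeriv q DX DM p) b)
      (fun F ζ => -Complex.I * opR (logDeriv q DX DM p) (bracket a b) F ζ) := by
  refine ⟨fun F F' hF hF' => h.form_commutator hd hP ha hb hF hF',
    fun F Ψ₁₂ Ψ₂₁ hF h₁ h₂ => ?_⟩
  set C : Conf X M → ℂ := fun ζ => -Complex.I * opR (logDeriv q DX DM p) (bracket a b) F ζ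
  -- By definition of the weak application, `Ψ₁₂ - Ψ₂₁` pairs with `F'` to the commutator form, so
  -- the difference from `C` is orthogonal to all cylinder functions.
  have key : ∀ F', IsCylinder d k l X M G F' →
      Integrable (fun ζ => (Ψ₁₂ ζ - Ψ₂₁ ζ - C ζ) * conj (F' ζ)) P ∧
      ∫ ζ, (Ψ₁₂ ζ - Ψ₂₁ ζ - C ζ) * conj (F' ζ) ∂P = 0 := fun F' hF' => by
    obtain ⟨i1, j1, e1⟩ := h₁ F' hF'
    obtain ⟨i2, j2, e2⟩ := h₂ F' hF'
    obtain ⟨-, i3, e3⟩ := h.form_commutator hd hP ha hb hF hF'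
    simp only [sub_mul]
    refine ⟨(i1.sub i2).sub i3, ?_⟩
    have e4 := integral_sub j1 j2
    rw [e3, ← e1, ← e2, ← integral_sub i1 i2] at e4
    exact (integral_sub (i1.sub i2) i3).trans (sub_eq_zero.2 e4.symm)
  -- The choice `F' = 1` shows that the difference is itself integrable.
  have hi : Integrable (fun ζ => Ψ₁₂ ζ - Ψ₂₁ ζ - C ζ) P := by
    simpa using (key _ isCylinder_one).1
  have h0 := ae_eq_zero_of_integral_cylinder (d := d) (k := k) hi fun N φ g hφ hφc hg hgc => by
    rw [← (key _ (isCylinder_of_hasCompactSupport hφ hφc hg hgc)).2]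
    refine integral_congr_ae (.of_forall fun ζ => ?_)
    simp only [Complex.conj_ofReal, Complex.real_smul]
    ring
  filter_upwards [h0] with ζ hζ
  exact sub_eq_zero.1 hζ

theorem rightBracket_zero_right (w : GroupLieAlgebra (𝓡 l) G) : rightBracket w 0 = 0 := by
  have e := rightBracket_smul_right 0 w (0 : GroupLieAlgebra (𝓡 l) G)
  exact (congrArg (rightBracket w) (zero_smul ℝ (0 : GroupLieAlgebra (𝓡 l) G)).symm).trans
    (e.trans (zero_smul ℝ _))

theorem rightBracket_zero_left (w : GroupLieAlgebra (𝓡 l) G) : rightBracket 0 w = 0 := by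
  rw [rightBracket_swap, rightBracket_zero_right]
  exact neg_zero

theorem bracket_fst_fst (v w : (x : X) → TangentSpace (𝓡 d) x) :
    bracket (v, 0) (w, 0) = ((VectorField.mlieBracket (𝓡 d) v w, 0) : FieldPair d l X G) := by
  refine Prod.ext rfl (funext fun x => ?_)
  change fieldDeriv v (0 : X → GroupLieAlgebra (𝓡 l) G) x - fieldDeriv w 0 x + rightBracket 0 0 = 0
  rw [fieldDeriv_zero_right, fieldDeriv_zero_right, rightBracket_zero_left]
  exact (add_zero _).trans (sub_self _)

theorem bracket_snd_snd (u u' : X → GroupLieAlgebra (𝓡 l) G) :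
    bracket (0, u) (0, u') = ((0, fun x => rightBracket (u x) (u' x)) : FieldPair d l X G) := by
  refine Prod.ext (VectorField.mlieBracket_self ..) (funext fun x => ?_)
  change fieldDeriv 0 u' x - fieldDeriv 0 u x + rightBracket (u x) (u' x) = _
  rw [fieldDeriv_eq_zero 0 u' rfl, fieldDeriv_eq_zero 0 u rfl]
  exact (congrArg (· + _) (sub_self _)).trans (zero_add _)

theorem bracket_fst_snd (v : (x : X) → TangentSpace (𝓡 d) x) (u : X → GroupLieAlgebra (𝓡 l) G) :
    bracket (v, 0) (0, u) = ((0, fieldDeriv v u) : FieldPair d l X G) := by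
  refine Prod.ext (VectorField.mlieBracket_zero_right ..) (funext fun x => ?_)
  change fieldDeriv v u x - fieldDeriv 0 0 x + rightBracket 0 (u x) = fieldDeriv v u x
  rw [fieldDeriv_zero_right, rightBracket_zero_left]
  exact (add_zero _).trans (sub_zero _)

/-- If one component of each current vanishes, the bracket reduces to a single term, which gives the
relations for `J` and `I`. -/
theorem LevyDensity.isCommutator_components (h : LevyDensity k lam p q σ DX DM) (hd : d ≠ 0)
    (hP : IsMarkedPoisson σ P) (ha : IsCurrent a) (hb : IsCurrent b) :
    IsCommutator d k l G P (opJ (logDeriv q DX DM p) a.1) (opJ (logDeriv q DX DM p) b.1)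
      (fun F ζ => -Complex.I *
        opJ (logDeriv q DX DM p) (VectorField.mlieBracket (𝓡 d) a.1 b.1) F ζ) ∧
    IsCommutator d k l G P (opI (logDeriv q DX DM p) a.2) (opI (logDeriv q DX DM p) b.2)
      (fun F ζ => -Complex.I *
        opI (logDeriv q DX DM p) (fun x => rightBracket (a.2 x) (b.2 x)) F ζ) ∧
    IsCommutator d k l G P (opJ (logDeriv q DX DM p) a.1) (opI (logDeriv q DX DM p) b.2)
      (fun F ζ => -Complex.I * opI (logDeriv q DX DM p) (fieldDeriv a.1 b.2) F ζ) := by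
  have h1 := h.isCommutator hd hP ha.fst hb.fst
  have h2 := h.isCommutator hd hP ha.snd hb.snd
  have h3 := h.isCommutator hd hP ha.fst hb.snd
  rw [bracket_fst_fst] at h1
  rw [bracket_snd_snd] at h2
  rw [bracket_fst_snd] at h3
  exact ⟨h1, h2, h3⟩

end Commutator

/-! ### Positivity of the mark measure on open sets -/

section OpenPositive

variable {M G : Type*} [TopologicalSpace M] [SecondCountableTopology M] [MeasurableSpace M]
  [BorelSpace M] [Group G] [MulAction G M] [ContinuousConstSMul G M] [MulAction.IsPretransitive G M]

/-- A nonzero quasi-invariant measure on a homogeneous space charges all open sets. -/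
theorem isOpenPosMeasure_of_map_smul {lam : Measure M} [NeZero lam] {p : G → M → ℝ}
    (hp : ∀ g : G, lam.map (fun m => g • m) =
      lam.withDensity (fun m => ENNReal.ofReal (p g m))) : lam.IsOpenPosMeasure := by
  refine ⟨fun U hU ⟨m₀, hm₀⟩ h0 => NeZero.ne lam ?_⟩
  -- If `U` is null, so are its preimages under all `g`, because the image measures have densities;
  -- by transitivity these cover `M`, so `λ` is locally null and hence zero.
  refine Measure.measure_univ_eq_zero.1 (measure_null_of_locally_null _ fun m _ => ?_)
  obtain ⟨g, hg⟩ := MulAction.exists_smul_eq G m m₀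
  have hcont : Continuous fun m : M => g • m := continuous_const_smul g
  refine ⟨(fun m => g • m) ⁻¹' U, mem_nhdsWithin_of_mem_nhds
    ((hU.preimage hcont).mem_nhds (by simpa [hg] using hm₀)), ?_⟩
  rw [← Measure.map_apply hcont.measurable hU.measurableSet, hp]
  exact withDensity_absolutelyContinuous _ _ h0

end OpenPositive

/-! ### The cocycle identity and the pointwise commutation relation -/

section PointwiseCommutator

variable {d k l : ℕ} {X : Type*} [TopologicalSpace X] [T2Space X] [SecondCountableTopology X]
  [ChartedSpace (Eu d) X] [IsManifold (𝓡 d) ∞ X]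
  [RiemannianBundle (fun x : X => TangentSpace (𝓡 d) x)]
  [IsContMDiffRiemannianBundle (𝓡 d) ∞ (Eu d) (fun x : X => TangentSpace (𝓡 d) x)]
  [MeasurableSpace X] [BorelSpace X]
  {M : Type*} [TopologicalSpace M] [T2Space M] [SecondCountableTopology M]
  [ChartedSpace (Eu k) M] [IsManifold (𝓡 k) ∞ M] [MeasurableSpace M] [BorelSpace M]
  {G : Type*} [TopologicalSpace G] [T2Space G] [SecondCountableTopology G]
  [ChartedSpace (Eu l) G] [Group G] [LieGroup (𝓡 l) ∞ G]
  [MulAction G M] [ContMDiffSMul (𝓡 l) (𝓡 k) ∞ G M]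
  {lam : Measure M} [IsLocallyFiniteMeasure lam] {p : G → M → ℝ} {q : X × M → ℝ}
  {σ : Measure (X × M)} {DX : XField d X M} {DM : X × M → (Eu l →L[ℝ] ℝ)}
  {a b : FieldPair d l X G}

/-- One derivative of `√q` and of `p` enters `β`, and `√q` is as smooth as `q` where `q > 0`; so
`C²` densities give a `C¹` function. -/
theorem contMDiff_logDeriv (hq : ∀ z, 0 < q z)
    (hq2 : ContMDiff ((𝓡 d).prod (𝓡 k)) 𝓘(ℝ, ℝ) 2 q)
    (hp2 : ContMDiff ((𝓡 l).prod (𝓡 k)) 𝓘(ℝ, ℝ) 2 (fun z : G × M => p z.1 z.2))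
    (ha : IsCurrent a) : ContMDiff ((𝓡 d).prod (𝓡 k)) 𝓘(ℝ, ℝ) 1
      (logDeriv q (gradX d fun z => Real.sqrt (q z)) (gradM l G fun z => Real.sqrt (q z)) p a) := by
  have hs : ContMDiff ((𝓡 d).prod (𝓡 k)) 𝓘(ℝ, ℝ) 2 fun z => Real.sqrt (q z) := fun z =>
    (Real.contDiffAt_sqrt (n := 2) (hq z).ne').contMDiffAt.comp z (hq2 z)
  have e : logDeriv q (gradX d fun z => Real.sqrt (q z)) (gradM l G fun z => Real.sqrt (q z)) p a =
      fun z => 2 * pointDeriv a (fun z => Real.sqrt (q z)) z * (Real.sqrt (q z))⁻¹ +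
        divergence a.1 z.1 - diffAtOne l (fun g => p g z.2) (show Eu l from a.2 z.1) := by
    funext z
    rw [pointDeriv_eq ha (hs.of_le (by norm_num)), logDeriv]
    have e3 : ∀ A B C D r : ℝ, 2 * A / r + D + 2 * B / r - C = 2 * (A + B) * r⁻¹ + D - C := by
      intros
      ring
    exact e3 _ _ _ _ _
  rw [e]
  have h1 := contMDiff_pointDeriv (n := 1) (m := 2) (by norm_num) ha hs
  have h2 : ContMDiff ((𝓡 d).prod (𝓡 k)) 𝓘(ℝ, ℝ) 1 fun z => (Real.sqrt (q z))⁻¹ := fun z =>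
    (contDiffAt_inv (n := 1) ℝ (Real.sqrt_pos.2 (hq z)).ne').contMDiffAt.comp z
      ((hs.of_le (by norm_num)) z)
  have h3 : ContMDiff ((𝓡 d).prod (𝓡 k)) 𝓘(ℝ, ℝ) 1 fun z : X × M => divergence a.1 z.1 :=
    ((contMDiff_divergence ha.smooth_fst).of_le (by simp)).comp contMDiff_fst
  have h4 : ContMDiff ((𝓡 d).prod (𝓡 k)) 𝓘(ℝ, ℝ) 1 fun z : X × M =>
      diffAtOne l (fun g => p g z.2) (show Eu l from a.2 z.1) :=
    ((contMDiff_diffAtOne (n := 1) (m := 2) (by norm_num) hp2).comp contMDiff_snd).clm_apply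
      ((ha.smooth_snd.of_le (by simp)).comp contMDiff_fst)
  exact (((contMDiff_const.mul h1).mul h2).add h3).sub h4

theorem exists_bound_of_hasCompactSupport {f : X × M → ℝ}
    (hf : ContMDiff ((𝓡 d).prod (𝓡 k)) 𝓘(ℝ, ℝ) 1 f) (hfc : HasCompactSupport f)
    (ha : IsCurrent a) : (∃ C, ∀ z, |f z| ≤ C) ∧ ∃ C, ∀ z, |pointDeriv a f z| ≤ C := by
  refine ⟨hf.continuous.bounded_above_of_compact_support hfc, Continuous.bounded_above_of_compact_support
    (contMDiff_pointDeriv (n := 0) (m := 1) (by simp) ha hf).continuous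
    (HasCompactSupport.intro hfc fun z hz => pointDeriv_eq_zero ha hf ?_)⟩
  filter_upwards [(isClosed_tsupport f).isOpen_compl.mem_nhds hz] with z' hz'
  exact image_eq_zero_of_notMem_tsupport hz'

/-- The logarithmic derivative is a cocycle on `𝔞`. -/
theorem LevyDensity.logDeriv_bracket [NeZero lam] [MulAction.IsPretransitive G M]
    (h : LevyDensity k lam p q σ DX DM) (hq : ∀ z, 0 < q z)
    (hβ : ∀ a, IsCurrent a →
      ContMDiff ((𝓡 d).prod (𝓡 k)) 𝓘(ℝ, ℝ) 1 (logDeriv q DX DM p a))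
    (ha : IsCurrent a) (hb : IsCurrent b) (z : X × M) :
    logDeriv q DX DM p (bracket a b) z = pointDeriv a (logDeriv q DX DM p b) z -
      pointDeriv b (logDeriv q DX DM p a) z := by
  have := continuous_smul_of_contMDiffSMul (k := k) (M := M) l (G := G)
  have : LocallyCompactSpace X := ChartedSpace.locallyCompactSpace (Eu d) X
  have : LocallyCompactSpace M := ChartedSpace.locallyCompactSpace (Eu k) M
  have : lam.IsOpenPosMeasure := isOpenPosMeasure_of_map_smul h.map_smul
  -- As `q > 0` everywhere, `ν ⊗ λ` is absolutely continuous with respect to `σ`, and it charges all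
  -- open sets.
  have hopen : σ.IsOpenPosMeasure := by
    have hac : (riemannianVolume d X).prod lam ≪ σ := by
      rw [h.eq_withDensity]
      exact withDensity_absolutelyContinuous' h.measurable_q.ennreal_ofReal.aemeasurable
        (.of_forall fun z => (ENNReal.ofReal_pos.2 (hq z)).ne')
    exact hac.isOpenPosMeasure
  have hloc : IsLocallyFiniteMeasure σ := ⟨fun z => by
    obtain ⟨K, hK, hKz⟩ := exists_compact_mem_nhds z.1
    exact ⟨K ×ˢ univ, prod_mem_nhds hKz Filter.univ_mem, h.finite K hK⟩⟩
  have hc := ha.bracket hb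
  set β : FieldPair d l X G → X × M → ℝ := logDeriv q DX DM p
  have hwc : Continuous fun z => pointDeriv a (β b) z - pointDeriv b (β a) z - β (bracket a b) z :=
    ((contMDiff_pointDeriv (n := 0) (m := 1) (by simp) ha (hβ b hb)).continuous.sub
      (contMDiff_pointDeriv (n := 0) (m := 1) (by simp) hb (hβ a ha)).continuous).sub
      (hβ _ hc).continuous
  have hae : ∀ᵐ z ∂σ, pointDeriv a (β b) z - pointDeriv b (β a) z - β (bracket a b) z = 0 := by
    refine ae_eq_zero_of_integral_contMDiff_smul_eq_zero ((𝓡 d).prod (𝓡 k))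
      hwc.locallyIntegrable fun f hf hfc => ?_
    have hT : IsTest d k l X M G f := isTest_of_hasCompactSupport hf hfc
    have hZ : ∀ {a : FieldPair d l X G} {f : X × M → ℝ}, IsCurrent a →
        ContMDiff ((𝓡 d).prod (𝓡 k)) 𝓘(ℝ, ℝ) 1 f → (∃ C, ∀ z, |f z| ≤ C) →
        (∃ C, ∀ z, |pointDeriv a f z| ≤ C) →
        Integrable (fun z => pointDeriv a f z + f z * β a z) σ ∧
          ∫ z, (pointDeriv a f z + f z * β a z) ∂σ = 0 := fun ha hf hC hC' => by
      obtain ⟨i1, i2, e⟩ := h.integral_pointDeriv_add ha hf hC hC'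
      exact ⟨i1.add i2, e⟩
    have hTZ : ∀ {a : FieldPair d l X G} {f : X × M → ℝ}, IsCurrent a → IsTest d k l X M G f → _ :=
      fun ha hT => hZ ha hT.contMDiff_one hT.exists_bound (hT.pointDeriv ha).exists_bound
    have hβf : ∀ {a b : FieldPair d l X G}, IsCurrent a → IsCurrent b → _ := fun {a b} ha hb =>
      have h1 : ContMDiff ((𝓡 d).prod (𝓡 k)) 𝓘(ℝ, ℝ) 1 fun z => f z * β b z :=
        hT.contMDiff_one.mul (hβ b hb)
      have h2 := exists_bound_of_hasCompactSupport h1 hfc.mul_right ha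
      hZ (f := fun z => f z * β b z) ha h1 h2.1 h2.2
    obtain ⟨i1, e1⟩ := hβf ha hb
    obtain ⟨i2, e2⟩ := hβf hb ha
    obtain ⟨i3, e3⟩ := hTZ ha (hT.pointDeriv hb)
    obtain ⟨i4, e4⟩ := hTZ hb (hT.pointDeriv ha)
    obtain ⟨i5, e5⟩ := hTZ hc hT
    -- Tested against `f`, the cocycle defect is a signed sum of five integrands of the one-point
    -- formula: `f β_b` and `∇_b f` along `a`, `f β_a` and `∇_a f` along `b`, and `f` along `[a,b]`.
    have key : ∀ z, f z • (pointDeriv a (β b) z - pointDeriv b (β a) z - β (bracket a b) z) =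
        (pointDeriv a (fun z => f z * β b z) z + f z * β b z * β a z) -
        (pointDeriv b (fun z => f z * β a z) z + f z * β a z * β b z) +
        (pointDeriv a (pointDeriv b f) z + pointDeriv b f z * β a z) -
        (pointDeriv b (pointDeriv a f) z + pointDeriv a f z * β b z) -
        (pointDeriv (bracket a b) f z + f z * β (bracket a b) z) := fun z => by
      rw [pointDeriv_mul ha hT.contMDiff_one (hβ b hb), pointDeriv_mul hb hT.contMDiff_one (hβ a ha),
        (lieAlgebra_current (k := k) (M := M) ha hb).2.2.1 f hT, smul_eq_mul]
      ring
    rw [integral_congr_ae (.of_forall key)]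
    refine (integral_sub (((i1.sub i2).add i3).sub i4) i5).trans ?_
    refine (congrArg₂ _ ((integral_sub ((i1.sub i2).add i3) i4).trans (congrArg₂ _
      ((integral_add (i1.sub i2) i3).trans (congrArg₂ _ (integral_sub i1 i2) rfl)) rfl)) rfl).trans ?_
    rw [e1, e2, e3, e4, e5]
    simp
  have h0 := (hwc.ae_eq_iff_eq σ continuous_const).1 hae
  have h1 := congrFun h0 z
  exact (sub_eq_zero.1 h1).symm

/-- The commutation relation at every configuration. -/
theorem isPointwiseCommutator_of_cocycle {β : FieldPair d l X G → X × M → ℝ}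
    (ha : IsCurrent a) (hb : IsCurrent b)
    (hβ : ∀ a, IsCurrent a → ContMDiff ((𝓡 d).prod (𝓡 k)) 𝓘(ℝ, ℝ) 1 (β a))
    (hβc : ∀ a, IsCurrent a → CompactPos (β a))
    (hcoc : ∀ z, β (bracket a b) z = pointDeriv a (β b) z - pointDeriv b (β a) z) :
    IsPointwiseCommutator (k := k) β a b (fun F ζ => -Complex.I * opR β (bracket a b) F ζ) := by
  intro F hF ζ
  have hT := hF.temperate
  have hder : ∀ {a b : FieldPair d l X G}, IsCurrent a → IsCurrent b →
      HasDerivAt (fun t : ℝ => opR β b F (ζ.image (currentMap a t)))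
        (-Complex.I * (confDeriv a (confDeriv b F) ζ + 1 / 2 *
          ((pairing (pointDeriv a (β b)) ζ : ℂ) * F ζ + (pairing (β b) ζ : ℂ) * confDeriv a F ζ)))
        0 := by
    intro a b ha hb
    have h1 := (hT.confDeriv hb).hasDerivAt ha ζ
    have h2 := (hasDerivAt_pairing_image ha (hβ b hb) (hβc b hb) ζ).ofReal_comp
    have h3 := ((h1.fun_add ((h2.fun_mul (hT.hasDerivAt ha ζ)).const_mul (1 / 2))).const_mul
      (-Complex.I))
    simp only [Conf.image_zero ha] at h3
    simp only [opR_eq]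
    refine h3.congr_of_eventuallyEq (.of_forall fun t => ?_)
    ring
  refine ⟨(hder ha hb).differentiableAt, (hder hb ha).differentiableAt, ?_⟩
  have e1 : confDeriv a (opR β b F) ζ = _ := (hder ha hb).deriv
  have e2 : confDeriv b (opR β a F) ζ = _ := (hder hb ha).deriv
  -- The cocycle identity, summed over the points of the configuration, matches the terms in which
  -- the derivative falls on `B`.
  have e3 : pairing (β (bracket a b)) ζ =
      -1 * pairing (pointDeriv b (β a)) ζ + pairing (pointDeriv a (β b)) ζ := by
    rw [← pairing_smul_add ((hβc a ha).pointDeriv hb (hβ a ha))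
      ((hβc b hb).pointDeriv ha (hβ b hb))]
    refine congrArg (fun f => pairing f ζ) (funext fun z => ?_)
    rw [hcoc]
    ring
  change _ = -Complex.I * opR β (bracket a b) F ζ
  rw [opR_eq β a (opR β b F), opR_eq β b (opR β a F), e1, e2, opR_eq β a F, opR_eq β b F,
    opR_eq, e3, ← hT.confDeriv_bracket ha hb]
  push_cast
  ring

end PointwiseCommutator

end MarkedPoisson

end

/-! ### The proposition -/

open MarkedPoisson in
theorem proposition4p2 {d k l : ℕ}
    -- the position space: a connected non-compact Riemannian manifold
    {X : Type*} [TopologicalSpace X] [T2Space X] [SecondCountableTopology X] [ConnectedSpace X]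
    [NoncompactSpace X] [ChartedSpace (Eu d) X] [IsManifold (𝓡 d) ∞ X]
    [RiemannianBundle (fun x : X => TangentSpace (𝓡 d) x)]
    [IsContMDiffRiemannianBundle (𝓡 d) ∞ (Eu d) (fun x : X => TangentSpace (𝓡 d) x)]
    [MeasurableSpace X] [BorelSpace X]
    -- the mark space: a connected manifold, homogeneous under the Lie group `G`
    {M : Type*} [TopologicalSpace M] [T2Space M] [SecondCountableTopology M] [ConnectedSpace M]
    [ChartedSpace (Eu k) M] [IsManifold (𝓡 k) ∞ M] [MeasurableSpace M] [BorelSpace M]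
    {G : Type*} [TopologicalSpace G] [T2Space G] [SecondCountableTopology G]
    [ChartedSpace (Eu l) G] [Group G] [LieGroup (𝓡 l) ∞ G]
    [MulAction G M] [ContMDiffSMul (𝓡 l) (𝓡 k) ∞ G M] [MulAction.IsPretransitive G M]
    -- the quasi-invariant measure `lam` on `M` and its density `p(g,m) = d(g^* lam)/d lam (m)`
    (lam : Measure M) [IsLocallyFiniteMeasure lam] [NeZero lam] (p : G → M → ℝ)
    (hp : ∀ g : G, lam.map (fun m => g • m) =
      lam.withDensity (fun m => ENNReal.ofReal (p g m)))
    (hp_diff : ContMDiff ((𝓡 l).prod (𝓡 k)) 𝓘(ℝ, ℝ) 1 (fun z : G × M => p z.1 z.2))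
    -- the Lévy measure `σ(dx,dm) = q(x,m) ν(dx) lam(dm)`
    (q : X × M → ℝ) (hq_meas : Measurable q)
    (hq_pos : ∀ᵐ z ∂((riemannianVolume d X).prod lam), 0 < q z)
    (σ : Measure (X × M))
    (hσ : σ = ((riemannianVolume d X).prod lam).withDensity (fun z => ENNReal.ofReal (q z)))
    (hσ_fin : ∀ K : Set X, IsCompact K → σ (K ×ˢ univ) < ⊤)
    -- `√q` is in the local Sobolev space, with gradient `(DX, DM)`
    (DX : XField d X M) (DM : X × M → (Eu l →L[ℝ] ℝ))
    (hq_sob : HasLocalSobolevGrad k G ((riemannianVolume d X).prod lam)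
      (fun z => Real.sqrt (q z)) DX DM)
    -- `|∇^G p(e,·)|` is integrable over `K × M` for compact `K`
    (hp_int : ∀ K : Set X, IsCompact K →
      IntegrableOn (fun z : X × M => ‖diffAtOne l (fun g : G => p g z.2)‖) (K ×ˢ univ) σ)
    -- the marked Poisson measure, and the logarithmic derivative of `σ`
    (P : Measure (Conf X M)) (hP : IsMarkedPoisson σ P)
    (β : FieldPair d l X G → X × M → ℝ) (hβ : β = logDeriv q DX DM p) :
    -- `𝔞` is a Lie algebra, and its bracket is the commutator of directional derivatives on `𝔇`
    (∀ a b : FieldPair d l X G, IsCurrent a → IsCurrent b →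
      IsCurrent (bracket a b) ∧ bracket a a = 0 ∧
      (∀ φ, IsTest d k l X M G φ → ∀ z, pointDeriv (bracket a b) φ z =
        pointDeriv a (pointDeriv b φ) z - pointDeriv b (pointDeriv a φ) z) ∧
      ∀ r : ℝ, IsCurrent (r • a + b) ∧ ∀ c : FieldPair d l X G, IsCurrent c →
        bracket (r • a + b) c = r • bracket a c + bracket b c ∧
        bracket c (r • a + b) = r • bracket c a + bracket c b ∧
        bracket a (bracket b c) = bracket (bracket a b) c + bracket b (bracket a c)) ∧
    -- `R(a)` is well defined and symmetric on the cylinder functions, and linear in `a`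
    (∀ a : FieldPair d l X G, IsCurrent a → ∀ F, IsCylinder d k l X M G F →
      (∀ ζ : Conf X M, DifferentiableAt ℝ (fun t : ℝ => F (ζ.image (currentMap a t))) 0) ∧
      Integrable (opR β a F) P ∧ WeakApply d k l G P (opR β a) F (opR β a F) ∧
      ∀ b : FieldPair d l X G, IsCurrent b → ∀ (r : ℝ) (ζ : Conf X M),
        opR β (r • a + b) F ζ = r * opR β a F ζ + opR β b F ζ) ∧
    -- the commutation relation for `R`
    (∀ a b : FieldPair d l X G, IsCurrent a → IsCurrent b →
      IsCommutator d k l G P (opR β a) (opR β b)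
        (fun F ζ => -Complex.I * opR β (bracket a b) F ζ)) ∧
    -- the commutation relations for `J` and `I`
    (∀ a b : FieldPair d l X G, IsCurrent a → IsCurrent b →
      IsCommutator d k l G P (opJ β a.1) (opJ β b.1)
        (fun F ζ => -Complex.I * opJ β (VectorField.mlieBracket (𝓡 d) a.1 b.1) F ζ) ∧
      IsCommutator d k l G P (opI β a.2) (opI β b.2)
        (fun F ζ => -Complex.I * opI β (fun x => rightBracket (a.2 x) (b.2 x)) F ζ) ∧
      IsCommutator d k l G P (opJ β a.1) (opI β b.2)
        (fun F ζ => -Complex.I * opI β (fieldDeriv a.1 b.2) F ζ)) ∧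
    -- the relation holds pointwise when the densities are regular
    ((∀ z, 0 < q z) → ContMDiff ((𝓡 d).prod (𝓡 k)) 𝓘(ℝ, ℝ) 2 q →
      ContMDiff ((𝓡 l).prod (𝓡 k)) 𝓘(ℝ, ℝ) 2 (fun z : G × M => p z.1 z.2) →
      DX = gradX d (fun z => Real.sqrt (q z)) → DM = gradM l G (fun z => Real.sqrt (q z)) →
      ∀ a b : FieldPair d l X G, IsCurrent a → IsCurrent b →
        IsPointwiseCommutator (k := k) β a b
          (fun F ζ => -Complex.I * opR β (bracket a b) F ζ)) := by
  subst hβ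
  have h : LevyDensity k lam p q σ DX DM :=
    ⟨hp, hp_diff, hq_meas, hq_pos, hσ, hσ_fin, hq_sob, hp_int⟩
  -- Connectedness and non-compactness enter only here: in positive dimension `ν` has no atoms, so
  -- almost all tuples have distinct positions.
  have hd : d ≠ 0 := dim_ne_zero (X := X)
  refine ⟨fun a b ha hb => lieAlgebra_current ha hb, fun a ha F hF => ⟨fun ζ =>
      (hF.temperate.hasDerivAt ha ζ).differentiableAt, h.integrable_opR hd hP ha hF,
      h.weakApply hd hP ha hF, fun b hb r ζ => opR_smul_add ha hb hF.temperate r ζ⟩,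
    fun a b ha hb => h.isCommutator hd hP ha hb,
    fun a b ha hb => h.isCommutator_components hd hP ha hb, ?_⟩
  rintro hq hq2 hp2 rfl rfl a b ha hb
  have hβ := fun (a : FieldPair d l X G) ha => contMDiff_logDeriv hq hq2 hp2 (a := a) ha
  exact isPointwiseCommutator_of_cocycle ha hb hβ (fun a ha => compactPos_logDeriv ha)
    (h.logDeriv_bracket hq hβ ha hb)
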